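/- Let $\ell\ge 0$, $m=2\ell+1$, with coordinates $x_1,\dots,x_\ell,y_1,\dots,y_\ell,z$ on $\mathbb R^m$ (collectively $u_1,\dots,u_m$, with $D_i=\partial/\partial u_i$), and let $\mathrm{Vec}\,\mathbb R^m$ be the Lie algebra of vector fields with complex polynomial coefficients. Let $\omega=dz+\frac12\sum_i(x_i\,dy_i-y_i\,dx_i)$, let $\mathrm{Tan}\,\mathbb R^m=\{X:\langle\omega,X\rangle=0\}$, let $\mathrm{Con}\,\mathbb R^m$ be the stabilizer of $\mathrm{Tan}\,\mathbb R^m$ in $\mathrm{Vec}\,\mathbb R^m$, let $\mathfrak s_m$ be the Lie algebra of those $X\in\mathrm{Con}\,\mathbb R^m$ for which the polynomial $\langle\omega,X\rangle$ has degree $\le2$ (a copy of $\mathfrak{sp}_{m+1}$), and let $\mathfrak a_m=\mathrm{Span}_{\mathbb C}\{D_i,\,u_jD_i,\,u_jE\}$, $E=\sum_iu_iD_i$, be the projective algebra (a copy of $\mathfrak{sl}_{m+1}$, containing $\mathfrak s_m$). For $\lambda\in\mathbb C$ let $F(\lambda)$ be the space of complex polynomials with the action $X\cdot f=X(f)+\lambda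 f\,\nabla\!\cdot\!X$ of $\mathrm{Vec}\,\mathbb R^m$. For $\lambda,p\in\mathbb C$ let $\mathrm{Diff}(\lambda,p)$ be the $\mathrm{Vec}\,\mathbb R^m$-module of polynomial differential operators $F(\lambda)\to F(\lambda+p)$, with the two-sided action, let $\mathrm{Diff}^k(\lambda,p)$ be its subspace of operators of order $\le k$ (zero for $k=-1$), and for $0\le l\le k$ let $$\mathrm{Diff}^{k,l}(\lambda,p)=\mathrm{Diff}^{k-1}(\lambda,p)+\sum_{i=0}^{l}\mathrm{Diff}^{i}(\lambda,p)\,(\mathrm{Tan}\,\mathbb R^m)^{k-i},\qquad \mathrm{Diff}^{k,-1}=\mathrm{Diff}^{k-1}.$$ Put $\mathrm{Symb}^k(p)=\mathrm{Diff}^k/\mathrm{Diff}^{k-1}$, $\mathrm{Symb}(p)=\bigoplus_k\mathrm{Symb}^k(p)$ (a $\mathrm{Vec}\,\mathbb R^m$-module), and $\mathrm{Symb}^{k,l}_{\mathrm{fine}}(p)=\mathrm{Diff}^{k,l}/\mathrm{Diff}^{k,l-1}$, $\mathrm{Symb}_{\mathrm{fine}}(p)=\bigoplus_{0\le l\le k}\mathrm{Symb}^{k,l}_{\mathrm{fine}}(p)$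 (a $\mathrm{Con}\,\mathbb R^m$-module). A *conformal quantization* of $\mathrm{Diff}(\lambda,p)$ is an isomorphism $Q:\mathrm{Symb}_{\mathrm{fine}}(p)\to\mathrm{Diff}(\lambda,p)$ of $\mathfrak s_m$-modules that preserves symbols: for $S\in\mathrm{Symb}^{k,l}_{\mathrm{fine}}(p)$, the operator $Q(S)$ lies in $\mathrm{Diff}^{k,l}(\lambda,p)$ and its class in $\mathrm{Symb}^{k,l}_{\mathrm{fine}}(p)$ is $S$. **Proposition.** Let $\lambda,p\in\mathbb C$ with $p\notin\frac1{m+1}\mathbb Z$. Then there is a unique conformal quantization $$\mathrm{CQ}_{\lambda,p}:\mathrm{Symb}_{\mathrm{fine}}(p)\to\mathrm{Diff}(\lambda,p).$$ Moreover $\mathrm{CQ}_{\lambda,p}=P\circ\Phi$, where $P:\mathrm{Symb}(p)\to\mathrm{Diff}(\lambda,p)$ is a projective quantization, i.e. an $\mathfrak a_m$-isomorphism sending each $S\in\mathrm{Symb}^k(p)$ to an element of $\mathrm{Diff}^k(\lambda,p)$ with symbol $S$, and $\Phi:\mathrm{Symb}_{\mathrm{fine}}(p)\to\mathrm{Symb}(p)$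 is a splitting of the fine filtrations of the $\mathrm{Symb}^k(p)$, i.e. an $\mathfrak s_m$-isomorphism sending each $S\in\mathrm{Symb}^{k,l}_{\mathrm{fine}}(p)$ to the class in $\mathrm{Symb}^k(p)$ of an element of $\mathrm{Diff}^{k,l}(\lambda,p)$ with fine symbol $S$. -/

import Mathlib

set_option linter.unusedSimpArgs false

open scoped DirectSum

noncomputable section

namespace ContactQuant

/-! ### Polynomial vector fields on `ℝ^m`, `m = 2ℓ+1` -/

/-- Index set of the coordinates `x_1,…,x_ℓ, y_1,…,y_ℓ, z` of `ℝ^(2ℓ+1)`. -/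
abbrev Coord (ℓ : ℕ) : Type := Fin ℓ ⊕ Fin ℓ ⊕ Unit

/-- Complex polynomials in the `2ℓ+1` coordinates. -/
abbrev Poly (ℓ : ℕ) : Type := MvPolynomial (Coord ℓ) ℂ

/-- The Lie algebra `Vec ℝ^m` of polynomial vector fields (with the commutator bracket). -/
abbrev Vec (ℓ : ℕ) : Type := Derivation ℂ (Poly ℓ) (Poly ℓ)

variable {ℓ : ℕ}

/-- The coordinate `x_i`. -/
def cx (i : Fin ℓ) : Coord ℓ := Sum.inl i
/-- The coordinate `y_i`. -/
def cy (i : Fin ℓ) : Coord ℓ := Sum.inr (Sum.inl i)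
/-- The coordinate `z`. -/
def cz : Coord ℓ := Sum.inr (Sum.inr ())

/-- The divergence `∇ · X = ∑_i D_i (X(x_i))`. -/
def div (X : Vec ℓ) : Poly ℓ :=
  ∑ i, MvPolynomial.pderiv i (X (MvPolynomial.X i))

/-- The Euler vector field `E = ∑_i x_i D_i`. -/
def euler (ℓ : ℕ) : Vec ℓ :=
  ∑ i, (MvPolynomial.X i : Poly ℓ) • (MvPolynomial.pderiv i : Vec ℓ)

/-- The generators `D_i`, `x_j D_i`, `x_j E` of the projective algebra. -/
def projGen (ℓ : ℕ) : Set (Vec ℓ) :=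
  {X | (∃ i, X = MvPolynomial.pderiv i) ∨
    (∃ i j, X = (MvPolynomial.X j : Poly ℓ) • (MvPolynomial.pderiv i : Vec ℓ)) ∨
    (∃ j, X = (MvPolynomial.X j : Poly ℓ) • euler ℓ)}

/-! ### The contact form, tangent fields, contact fields -/

/-- Contraction `X ↦ ⟨ω, X⟩` with the contact form
`ω = dz + ½ ∑_i (x_i dy_i - y_i dx_i)`. -/
def contactForm (X : Vec ℓ) : Poly ℓ :=
  X (MvPolynomial.X cz) + MvPolynomial.C (1 / 2 : ℂ) * ∑ i : Fin ℓ,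
    (MvPolynomial.X (cx i) * X (MvPolynomial.X (cy i))
      - MvPolynomial.X (cy i) * X (MvPolynomial.X (cx i)))

lemma contactForm_add (X Y : Vec ℓ) :
    contactForm (X + Y) = contactForm X + contactForm Y := by
  simp only [contactForm, Derivation.add_apply, mul_add, Finset.sum_add_distrib,
    Finset.sum_sub_distrib]
  ring

lemma contactForm_smul (f : Poly ℓ) (X : Vec ℓ) :
    contactForm (f • X) = f * contactForm X := by
  simp only [contactForm, Derivation.smul_apply, smul_eq_mul, mul_add, Finset.mul_sum]
  congr 1
  exact Finset.sum_congr rfl fun i _ => by ring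

lemma contactForm_csmul (c : ℂ) (X : Vec ℓ) :
    contactForm (c • X) = c • contactForm X := by
  have : c • X = (MvPolynomial.C c : Poly ℓ) • X := by
    ext i; simp [MvPolynomial.smul_eq_C_mul]
  rw [this, contactForm_smul, MvPolynomial.smul_eq_C_mul]

/-- `Tan ℝ^m`: the vector fields annihilated by the contact form. -/
def Tan (ℓ : ℕ) : Submodule ℂ (Vec ℓ) where
  carrier := {X | contactForm X = 0}
  add_mem' {X Y} hX hY := by
    change contactForm (X + Y) = 0
    rw [contactForm_add, show contactForm X = 0 from hX, show contactForm Y = 0 from hY, add_zero]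
  zero_mem' := by simp [contactForm]
  smul_mem' c X hX := by
    change contactForm (c • X) = 0
    rw [contactForm_csmul, show contactForm X = 0 from hX, smul_zero]

/-- `Con ℝ^m`: the stabilizer of `Tan ℝ^m` in `Vec ℝ^m`. -/
def Con (ℓ : ℕ) : LieSubalgebra ℂ (Vec ℓ) where
  carrier := {X | ∀ T ∈ Tan ℓ, ⁅X, T⁆ ∈ Tan ℓ}
  add_mem' {X Y} hX hY T hT := by
    rw [show ⁅X + Y, T⁆ = ⁅X, T⁆ + ⁅Y, T⁆ from add_lie X Y T]; exact add_mem (hX T hT) (hY T hT)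
  zero_mem' T _ := by rw [show ⁅(0 : Vec ℓ), T⁆ = 0 from zero_lie T]; exact zero_mem _
  smul_mem' c X hX T hT := by
    rw [show ⁅c • X, T⁆ = c • ⁅X, T⁆ from smul_lie c X T]; exact Submodule.smul_mem _ c (hX T hT)
  lie_mem' {X Y} hX hY T hT := by
    rw [show ⁅⁅X, Y⁆, T⁆ = ⁅X, ⁅Y, T⁆⁆ - ⁅Y, ⁅X, T⁆⁆ from lie_lie X Y T]; exact sub_mem (hX _ (hY T hT)) (hY _ (hX T hT))

/-! ### The projective algebra -/

lemma pderiv_lie_pderiv (i j : Coord ℓ) :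
    ⁅(MvPolynomial.pderiv i : Vec ℓ), (MvPolynomial.pderiv j : Vec ℓ)⁆ = 0 := by
  classical
  apply MvPolynomial.derivation_ext
  intro k
  simp only [Derivation.commutator_apply, MvPolynomial.pderiv_X, Derivation.zero_apply]
  rw [Pi.single_apply, Pi.single_apply]
  split_ifs <;> simp

lemma sum_apply {ι : Type*} (s : Finset ι) (D : ι → Vec ℓ) (f : Poly ℓ) :
    (∑ i ∈ s, D i) f = ∑ i ∈ s, D i f := by
  classical
  induction s using Finset.induction_on with
  | empty => simp
  | insert a s ha ih => simp [Finset.sum_insert ha, ih]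

lemma euler_X (k : Coord ℓ) : euler ℓ (MvPolynomial.X k) = MvPolynomial.X k := by
  classical
  rw [euler, sum_apply, Finset.sum_eq_single k]
  · simp
  · intro b _ hb
    simp [MvPolynomial.pderiv_X_of_ne hb.symm]
  · simp

lemma pd_X (i k : Coord ℓ) [Decidable (k = i)] :
    (MvPolynomial.pderiv i : Vec ℓ) (MvPolynomial.X k) = if k = i then 1 else 0 := by
  split_ifs with h
  · subst h; simp
  · exact MvPolynomial.pderiv_X_of_ne h

lemma smul_lie_smul (f g : Poly ℓ) (X Y : Vec ℓ) :
    ⁅f • X, g • Y⁆ = (f * X g) • Y - (g * Y f) • X + (f * g) • ⁅X, Y⁆ := by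
  apply MvPolynomial.derivation_ext
  intro k
  simp only [Derivation.commutator_apply, Derivation.smul_apply, Derivation.add_apply,
    Derivation.sub_apply, smul_eq_mul, Derivation.leibniz]
  ring

lemma pd_lie_euler (i : Coord ℓ) :
    ⁅(MvPolynomial.pderiv i : Vec ℓ), euler ℓ⁆ = MvPolynomial.pderiv i := by
  classical
  apply MvPolynomial.derivation_ext
  intro k
  rw [Derivation.commutator_apply, euler_X, pd_X]
  split_ifs <;> simp

lemma euler_lie_pd (i : Coord ℓ) :
    ⁅euler ℓ, (MvPolynomial.pderiv i : Vec ℓ)⁆ = -MvPolynomial.pderiv i := by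
  have h := (lie_skew (euler ℓ) (MvPolynomial.pderiv i : Vec ℓ)).symm
  rwa [pd_lie_euler] at h

lemma lie_fsmul (g : Poly ℓ) (X Y : Vec ℓ) : ⁅X, g • Y⁆ = X g • Y + g • ⁅X, Y⁆ := by
  apply MvPolynomial.derivation_ext
  intro k
  simp only [Derivation.commutator_apply, Derivation.smul_apply, Derivation.add_apply,
    smul_eq_mul, Derivation.leibniz]
  ring

lemma fsmul_lie (g : Poly ℓ) (X Y : Vec ℓ) : ⁅g • X, Y⁆ = g • ⁅X, Y⁆ - Y g • X := by
  apply MvPolynomial.derivation_ext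
  intro k
  simp only [Derivation.commutator_apply, Derivation.smul_apply, Derivation.sub_apply,
    smul_eq_mul, Derivation.leibniz]
  ring

lemma ite_smul_mem {S : Submodule ℂ (Vec ℓ)} (P : Prop) [Decidable P] (f : Poly ℓ) {Z : Vec ℓ}
    (h : f • Z ∈ S) : (f * (if P then (1 : Poly ℓ) else 0)) • Z ∈ S := by
  split_ifs
  · rwa [mul_one]
  · rw [mul_zero, zero_smul]; exact zero_mem _

lemma ite_smul_mem' {S : Submodule ℂ (Vec ℓ)} (P : Prop) [Decidable P] {Z : Vec ℓ}
    (h : Z ∈ S) : (if P then (1 : Poly ℓ) else 0) • Z ∈ S := by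
  split_ifs
  · rwa [one_smul]
  · rw [zero_smul]; exact zero_mem _

/-- The span of the generators is closed under the bracket. -/
lemma projGen_lie {X Y : Vec ℓ} (hX : X ∈ projGen ℓ) (hY : Y ∈ projGen ℓ) :
    ⁅X, Y⁆ ∈ Submodule.span ℂ (projGen ℓ) := by
  classical
  have h1 : ∀ i, (MvPolynomial.pderiv i : Vec ℓ) ∈ Submodule.span ℂ (projGen ℓ) :=
    fun i => Submodule.subset_span (Or.inl ⟨i, rfl⟩)
  have h2 : ∀ i j, (MvPolynomial.X j : Poly ℓ) • (MvPolynomial.pderiv i : Vec ℓ) ∈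
      Submodule.span ℂ (projGen ℓ) :=
    fun i j => Submodule.subset_span (Or.inr (Or.inl ⟨i, j, rfl⟩))
  have h3 : ∀ j, (MvPolynomial.X j : Poly ℓ) • euler ℓ ∈ Submodule.span ℂ (projGen ℓ) :=
    fun j => Submodule.subset_span (Or.inr (Or.inr ⟨j, rfl⟩))
  have h4 : euler ℓ ∈ Submodule.span ℂ (projGen ℓ) :=
    Submodule.sum_mem _ fun i _ => h2 i i
  rcases hX with ⟨i, rfl⟩ | ⟨i, j, rfl⟩ | ⟨j, rfl⟩ <;>
  rcases hY with ⟨a, rfl⟩ | ⟨a, b, rfl⟩ | ⟨b, rfl⟩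
  · rw [pderiv_lie_pderiv]; exact zero_mem _
  · rw [lie_fsmul, pd_X, pderiv_lie_pderiv, smul_zero, add_zero]
    exact ite_smul_mem' _ (h1 a)
  · rw [lie_fsmul, pd_X, pd_lie_euler]
    exact add_mem (ite_smul_mem' _ h4) (h2 i b)
  · rw [fsmul_lie, pd_X, pderiv_lie_pderiv, smul_zero, zero_sub]
    exact neg_mem (ite_smul_mem' _ (h1 i))
  · rw [smul_lie_smul, pd_X, pd_X, pderiv_lie_pderiv, smul_zero, add_zero]
    exact sub_mem (ite_smul_mem _ _ (h2 a j)) (ite_smul_mem _ _ (h2 i b))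
  · rw [smul_lie_smul, pd_X, euler_X, pd_lie_euler, mul_comm (MvPolynomial.X b), sub_add_cancel]
    exact ite_smul_mem _ _ (h3 j)
  · rw [fsmul_lie, pd_X, euler_lie_pd, smul_neg]
    exact sub_mem (neg_mem (h2 a j)) (ite_smul_mem' _ h4)
  · rw [smul_lie_smul, pd_X, euler_X, euler_lie_pd, smul_neg, sub_eq_add_neg, add_right_comm,
      add_neg_cancel, zero_add]
    exact neg_mem (ite_smul_mem _ _ (h3 b))
  · rw [smul_lie_smul, euler_X, euler_X, mul_comm (MvPolynomial.X b), sub_self, zero_add,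
      show ⁅euler ℓ, euler ℓ⁆ = 0 from lie_self (euler ℓ), smul_zero]
    exact zero_mem _

/-- The projective algebra `𝔞_m = Span {D_i, x_j D_i, x_j E} ≅ 𝔰𝔩_{m+1}`. -/
def projAlg (ℓ : ℕ) : LieSubalgebra ℂ (Vec ℓ) where
  toSubmodule := Submodule.span ℂ (projGen ℓ)
  lie_mem' {X Y} hX hY := by
    change X ∈ Submodule.span ℂ (projGen ℓ) at hX
    change Y ∈ Submodule.span ℂ (projGen ℓ) at hY
    change ⁅X, Y⁆ ∈ Submodule.span ℂ (projGen ℓ)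
    induction hX, hY using Submodule.span_induction₂ with
    | mem_mem X Y hX hY => exact projGen_lie hX hY
    | zero_left Y _ => rw [show ⁅(0 : Vec ℓ), Y⁆ = 0 from zero_lie Y]; exact zero_mem _
    | zero_right X _ => rw [show ⁅X, (0 : Vec ℓ)⁆ = 0 from lie_zero X]; exact zero_mem _
    | add_left X Y Z _ _ _ h1 h2 =>
      rw [show ⁅X + Y, Z⁆ = ⁅X, Z⁆ + ⁅Y, Z⁆ from add_lie X Y Z]; exact add_mem h1 h2
    | add_right X Y Z _ _ _ h1 h2 =>
      rw [show ⁅X, Y + Z⁆ = ⁅X, Y⁆ + ⁅X, Z⁆ from lie_add X Y Z]; exact add_mem h1 h2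
    | smul_left c X Y _ _ h =>
      rw [show ⁅c • X, Y⁆ = c • ⁅X, Y⁆ from smul_lie c X Y]; exact Submodule.smul_mem _ _ h
    | smul_right c X Y _ _ h =>
      rw [show ⁅X, c • Y⁆ = c • ⁅X, Y⁆ from lie_smul c X Y]; exact Submodule.smul_mem _ _ h

/-! ### The conformal algebra -/

/-- `⟨ω, [X,Y]⟩ = X⟨ω,Y⟩ - Y⟨ω,X⟩ - dω(X,Y)`. -/
lemma contactForm_lie (X Y : Vec ℓ) :
    contactForm ⁅X, Y⁆ = X (contactForm Y) - Y (contactForm X)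
      - ∑ i : Fin ℓ, (X (MvPolynomial.X (cx i)) * Y (MvPolynomial.X (cy i))
        - X (MvPolynomial.X (cy i)) * Y (MvPolynomial.X (cx i))) := by
  have hC : ∀ (Z : Vec ℓ) (c : ℂ), Z (MvPolynomial.C c) = 0 := fun Z c => Z.map_algebraMap c
  simp only [contactForm, Derivation.commutator_apply, map_add, Derivation.leibniz, hC, map_sum,
    map_sub, smul_eq_mul, mul_zero, add_zero, Finset.mul_sum, Finset.sum_add_distrib,
    Finset.sum_sub_distrib, mul_sub, mul_add]
  have h2 : ∀ a : Poly ℓ, a = MvPolynomial.C (1 / 2) * a + MvPolynomial.C (1 / 2) * a := by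
    intro a
    rw [← add_mul, ← map_add]
    norm_num
  rw [Finset.sum_congr rfl fun (i : Fin ℓ) _ =>
      h2 (X (MvPolynomial.X (cx i)) * Y (MvPolynomial.X (cy i))),
    Finset.sum_congr rfl fun (i : Fin ℓ) _ =>
      h2 (X (MvPolynomial.X (cy i)) * Y (MvPolynomial.X (cx i)))]
  simp only [Finset.sum_add_distrib, mul_comm (Y _) (X _)]
  ring

/-- The tangent field `A_i = ∂_{x_i} + ½ y_i ∂_z`. -/
def tanA (i : Fin ℓ) : Vec ℓ :=
  MvPolynomial.pderiv (cx i)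
    + (MvPolynomial.C (1 / 2) * MvPolynomial.X (cy i) : Poly ℓ) •
      (MvPolynomial.pderiv cz : Vec ℓ)

/-- The tangent field `B_i = ∂_{y_i} - ½ x_i ∂_z`. -/
def tanB (i : Fin ℓ) : Vec ℓ :=
  MvPolynomial.pderiv (cy i)
    - (MvPolynomial.C (1 / 2) * MvPolynomial.X (cx i) : Poly ℓ) •
      (MvPolynomial.pderiv cz : Vec ℓ)

lemma cx_eq (i j : Fin ℓ) : (cx i = cx j) = (i = j) := by simp [cx]
lemma cy_eq (i j : Fin ℓ) : (cy i = cy j) = (i = j) := by simp [cy]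
lemma cx_cy (i j : Fin ℓ) : (cx i = cy j) = False := by simp [cx, cy]
lemma cy_cx (i j : Fin ℓ) : (cy i = cx j) = False := by simp [cx, cy]
lemma cx_cz (i : Fin ℓ) : (cx i = cz) = False := by simp [cx, cz]
lemma cz_cx (i : Fin ℓ) : (cz = cx i) = False := by simp [cx, cz]
lemma cy_cz (i : Fin ℓ) : (cy i = cz) = False := by simp [cy, cz]
lemma cz_cy (i : Fin ℓ) : (cz = cy i) = False := by simp [cy, cz]

lemma tanA_x (i j : Fin ℓ) : tanA i (MvPolynomial.X (cx j)) = if j = i then 1 else 0 := by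
  classical
  simp only [tanA, Derivation.add_apply, Derivation.sub_apply, Derivation.smul_apply, pd_X, cx_eq, cx_cz,
    if_true, if_false, smul_eq_mul, mul_zero, mul_one, add_zero, sub_zero, zero_add, zero_sub]
lemma tanA_y (i j : Fin ℓ) : tanA i (MvPolynomial.X (cy j)) = 0 := by
  classical
  simp only [tanA, Derivation.add_apply, Derivation.sub_apply, Derivation.smul_apply, pd_X, cy_cx, cy_cz,
    if_true, if_false, smul_eq_mul, mul_zero, mul_one, add_zero, sub_zero, zero_add, zero_sub]
lemma tanA_z (i : Fin ℓ) :
    tanA i (MvPolynomial.X cz) = MvPolynomial.C (1 / 2) * MvPolynomial.X (cy i) := by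
  classical
  simp only [tanA, Derivation.add_apply, Derivation.sub_apply, Derivation.smul_apply, pd_X, cz_cx,
    if_true, if_false, smul_eq_mul, mul_zero, mul_one, add_zero, sub_zero, zero_add, zero_sub]
lemma tanB_x (i j : Fin ℓ) : tanB i (MvPolynomial.X (cx j)) = 0 := by
  classical
  simp only [tanB, Derivation.add_apply, Derivation.sub_apply, Derivation.smul_apply, pd_X, cx_cy, cx_cz,
    if_true, if_false, smul_eq_mul, mul_zero, mul_one, add_zero, sub_zero, zero_add, zero_sub]
lemma tanB_y (i j : Fin ℓ) : tanB i (MvPolynomial.X (cy j)) = if j = i then 1 else 0 := by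
  classical
  simp only [tanB, Derivation.add_apply, Derivation.sub_apply, Derivation.smul_apply, pd_X, cy_eq, cy_cz,
    if_true, if_false, smul_eq_mul, mul_zero, mul_one, add_zero, sub_zero, zero_add, zero_sub]
lemma tanB_z (i : Fin ℓ) :
    tanB i (MvPolynomial.X cz) = -(MvPolynomial.C (1 / 2) * MvPolynomial.X (cx i)) := by
  classical
  simp only [tanB, Derivation.add_apply, Derivation.sub_apply, Derivation.smul_apply, pd_X, cz_cy,
    if_true, if_false, smul_eq_mul, mul_zero, mul_one, add_zero, sub_zero, zero_add, zero_sub]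

lemma tanA_mem (i : Fin ℓ) : tanA i ∈ Tan ℓ := by
  change contactForm (tanA i) = 0
  simp only [contactForm, tanA_x, tanA_y, tanA_z]
  simp

lemma tanB_mem (i : Fin ℓ) : tanB i ∈ Tan ℓ := by
  change contactForm (tanB i) = 0
  simp only [contactForm, tanB_x, tanB_y, tanB_z]
  simp

lemma con_y {X : Vec ℓ} (hX : X ∈ Con ℓ) (i : Fin ℓ) :
    X (MvPolynomial.X (cy i)) = tanA i (contactForm X) := by
  have h : contactForm ⁅X, tanA i⁆ = 0 := hX _ (tanA_mem i)
  rw [contactForm_lie, show contactForm (tanA i) = 0 from tanA_mem i, map_zero] at h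
  simp only [tanA_x, tanA_y] at h
  simp at h
  linear_combination h

lemma con_x {X : Vec ℓ} (hX : X ∈ Con ℓ) (i : Fin ℓ) :
    X (MvPolynomial.X (cx i)) = -tanB i (contactForm X) := by
  have h : contactForm ⁅X, tanB i⁆ = 0 := hX _ (tanB_mem i)
  rw [contactForm_lie, show contactForm (tanB i) = 0 from tanB_mem i, map_zero] at h
  simp only [tanB_x, tanB_y] at h
  simp at h
  linear_combination -h

/-- The vector field with contact Hamiltonian `f`, i.e. the unique contact field `χ(f)` with
`⟨ω, χ(f)⟩ = f`. -/
def chi (ℓ : ℕ) : Poly ℓ →ₗ[ℂ] Vec ℓ where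
  toFun f := MvPolynomial.mkDerivation ℂ (Sum.elim (fun i => -tanB i f)
    (Sum.elim (fun i => tanA i f) (fun _ => f - MvPolynomial.C (1 / 2) *
      ∑ i : Fin ℓ, (MvPolynomial.X (cx i) * tanA i f + MvPolynomial.X (cy i) * tanB i f))))
  map_add' f g := by
    apply MvPolynomial.derivation_ext
    rintro (k | k | k)
    · simp [MvPolynomial.mkDerivation_X]; ring
    · simp [MvPolynomial.mkDerivation_X]
    · simp only [MvPolynomial.mkDerivation_X, Derivation.add_apply, Sum.elim_inr, map_add, mul_add,
        Finset.sum_add_distrib]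
      ring
  map_smul' c f := by
    apply MvPolynomial.derivation_ext
    rintro (k | k | k)
    · simp [MvPolynomial.mkDerivation_X]
    · simp [MvPolynomial.mkDerivation_X]
    · simp only [MvPolynomial.mkDerivation_X, Derivation.smul_apply, Sum.elim_inr, Derivation.map_smul,
        RingHom.id_apply]
      simp only [MvPolynomial.smul_eq_C_mul, mul_sub, Finset.mul_sum]
      congr 1
      exact Finset.sum_congr rfl fun i _ => by ring

lemma chi_x (f : Poly ℓ) (i : Fin ℓ) : chi ℓ f (MvPolynomial.X (cx i)) = -tanB i f :=
  MvPolynomial.mkDerivation_X ..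
lemma chi_y (f : Poly ℓ) (i : Fin ℓ) : chi ℓ f (MvPolynomial.X (cy i)) = tanA i f :=
  MvPolynomial.mkDerivation_X ..
lemma chi_z (f : Poly ℓ) : chi ℓ f (MvPolynomial.X cz) = f - MvPolynomial.C (1 / 2) *
    ∑ i : Fin ℓ, (MvPolynomial.X (cx i) * tanA i f + MvPolynomial.X (cy i) * tanB i f) :=
  MvPolynomial.mkDerivation_X ..

lemma vec_ext {X Y : Vec ℓ}
    (hx : ∀ i, X (MvPolynomial.X (cx i)) = Y (MvPolynomial.X (cx i)))
    (hy : ∀ i, X (MvPolynomial.X (cy i)) = Y (MvPolynomial.X (cy i)))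
    (hz : X (MvPolynomial.X cz) = Y (MvPolynomial.X cz)) : X = Y := by
  apply MvPolynomial.derivation_ext
  rintro (k | k | k)
  · exact hx k
  · exact hy k
  · exact hz

lemma chi_contactForm {X : Vec ℓ} (hX : X ∈ Con ℓ) : chi ℓ (contactForm X) = X := by
  apply vec_ext
  · intro i; rw [chi_x, con_x hX]
  · intro i; rw [chi_y, con_y hX]
  · rw [chi_z]
    simp only [← con_y hX, ← neg_eq_iff_eq_neg.mpr (con_x hX _)]
    rw [contactForm]
    simp only [mul_neg, ← sub_eq_add_neg]
    ring

lemma euler_mem : euler ℓ ∈ projAlg ℓ :=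
  Submodule.sum_mem _ fun i _ => Submodule.subset_span (Or.inr (Or.inl ⟨i, i, rfl⟩))

lemma pd_mem (i : Coord ℓ) : (MvPolynomial.pderiv i : Vec ℓ) ∈ projAlg ℓ :=
  Submodule.subset_span (Or.inl ⟨i, rfl⟩)

lemma X_pd_mem (i j : Coord ℓ) :
    (MvPolynomial.X j : Poly ℓ) • (MvPolynomial.pderiv i : Vec ℓ) ∈ projAlg ℓ :=
  Submodule.subset_span (Or.inr (Or.inl ⟨i, j, rfl⟩))

lemma X_euler_mem (j : Coord ℓ) : (MvPolynomial.X j : Poly ℓ) • euler ℓ ∈ projAlg ℓ :=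
  Submodule.subset_span (Or.inr (Or.inr ⟨j, rfl⟩))

lemma half_mem {Z : Vec ℓ} (h : Z ∈ projAlg ℓ) :
    (MvPolynomial.C (1 / 2) : Poly ℓ) • Z ∈ projAlg ℓ := by
  have : (MvPolynomial.C (1 / 2) : Poly ℓ) • Z = (1 / 2 : ℂ) • Z := by
    ext i; simp [MvPolynomial.smul_eq_C_mul]
  rw [this]
  exact (projAlg ℓ).smul_mem _ h

lemma Xhalf : (MvPolynomial.C (1 / 2) : Poly ℓ) + MvPolynomial.C (1 / 2) = 1 := by
  rw [← map_add]; norm_num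

/-- The three equations that identify `χ(f)`. -/
lemma chi_eq {f : Poly ℓ} {Y : Vec ℓ} (hx : ∀ i, -tanB i f = Y (MvPolynomial.X (cx i)))
    (hy : ∀ i, tanA i f = Y (MvPolynomial.X (cy i)))
    (hz : contactForm Y = f) : chi ℓ f = Y := by
  apply vec_ext
  · intro i; rw [chi_x, hx]
  · intro i; rw [chi_y, hy]
  · rw [chi_z]
    simp only [hy, ← neg_eq_iff_eq_neg.mpr (hx _).symm]
    rw [← hz, contactForm]
    simp only [mul_neg, ← sub_eq_add_neg]
    ring

lemma pd_cf_x (i : Fin ℓ) : contactForm (MvPolynomial.pderiv (cx i) : Vec ℓ)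
    = -(MvPolynomial.C (1 / 2) * MvPolynomial.X (cy i)) := by
  classical
  simp only [contactForm, pd_X, cx_eq, cy_eq, cx_cy, cy_cx, cx_cz, cz_cx, cy_cz, cz_cy]
  simp
lemma pd_cf_y (i : Fin ℓ) : contactForm (MvPolynomial.pderiv (cy i) : Vec ℓ)
    = MvPolynomial.C (1 / 2) * MvPolynomial.X (cx i) := by
  classical
  simp only [contactForm, pd_X, cx_eq, cy_eq, cx_cy, cy_cx, cx_cz, cz_cx, cy_cz, cz_cy]
  simp
lemma pd_cf_z : contactForm (MvPolynomial.pderiv cz : Vec ℓ) = 1 := by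
  classical
  simp only [contactForm, pd_X, cx_eq, cy_eq, cx_cy, cy_cx, cx_cz, cz_cx, cy_cz, cz_cy]
  simp
lemma euler_cf : contactForm (euler ℓ) = MvPolynomial.X cz := by
  simp only [contactForm, euler_X]
  simp [mul_comm]

lemma cf_sub (X Y : Vec ℓ) : contactForm (X - Y) = contactForm X - contactForm Y := by
  have h := contactForm_add (X - Y) Y
  rw [sub_add_cancel] at h
  rw [h, add_sub_cancel_right]

lemma cf_neg (X : Vec ℓ) : contactForm (-X) = -contactForm X := by
  have h := contactForm_add X (-X)
  rw [add_neg_cancel, show contactForm (0 : Vec ℓ) = 0 by simp [contactForm]] at h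
  linear_combination -h

lemma chi_one : chi ℓ 1 = MvPolynomial.pderiv cz := by
  classical
  apply chi_eq
  · intro i; simp [pd_X, cx_cz, -MvPolynomial.pderiv_X]
  · intro i; simp [pd_X, cy_cz, -MvPolynomial.pderiv_X]
  · exact pd_cf_z

lemma chi_X (a : Coord ℓ) : chi ℓ (MvPolynomial.X a) ∈ projAlg ℓ := by
  classical
  rcases a with j | j | j
  · have : chi ℓ (MvPolynomial.X (cx j)) = MvPolynomial.pderiv (cy j) +
        (MvPolynomial.C (1 / 2) : Poly ℓ) • (MvPolynomial.X (cx j) : Poly ℓ) •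
          (MvPolynomial.pderiv cz : Vec ℓ) := by
      apply chi_eq
      · intro i
        simp only [tanB_x, Derivation.add_apply, Derivation.smul_apply, pd_X, cx_cy, cx_cz]
        simp
      · intro i
        simp only [tanA_x, Derivation.add_apply, Derivation.smul_apply, pd_X, cy_cz, cy_eq]
        simp [eq_comm]
      · rw [contactForm_add, contactForm_smul, contactForm_smul, pd_cf_y, pd_cf_z]
        linear_combination (MvPolynomial.X (cx j)) * Xhalf (ℓ := ℓ)
    exact this ▸ add_mem (pd_mem _) (half_mem (X_pd_mem _ _))
  · have : chi ℓ (MvPolynomial.X (cy j)) =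
        (MvPolynomial.C (1 / 2) : Poly ℓ) • (MvPolynomial.X (cy j) : Poly ℓ) •
          (MvPolynomial.pderiv cz : Vec ℓ) - MvPolynomial.pderiv (cx j) := by
      apply chi_eq
      · intro i
        simp only [tanB_y, Derivation.sub_apply, Derivation.smul_apply, pd_X, cx_eq, cx_cz]
        simp [eq_comm]
      · intro i
        simp only [tanA_y, Derivation.sub_apply, Derivation.smul_apply, pd_X, cy_cz, cy_cx]
        simp
      · rw [cf_sub, contactForm_smul, contactForm_smul, pd_cf_x, pd_cf_z]
        linear_combination (MvPolynomial.X (cy j)) * Xhalf (ℓ := ℓ)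
    exact this ▸ sub_mem (half_mem (X_pd_mem _ _)) (pd_mem _)
  · have : chi ℓ (MvPolynomial.X cz) = (MvPolynomial.C (1 / 2) : Poly ℓ) • (euler ℓ +
        (MvPolynomial.X cz : Poly ℓ) • (MvPolynomial.pderiv cz : Vec ℓ)) := by
      apply chi_eq
      · intro i
        simp only [tanB_z, Derivation.add_apply, Derivation.smul_apply, pd_X, euler_X, cx_cz]
        simp
      · intro i
        simp only [tanA_z, Derivation.add_apply, Derivation.smul_apply, pd_X, euler_X, cy_cz]
        simp
      · rw [contactForm_smul, contactForm_add, contactForm_smul, euler_cf, pd_cf_z]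
        linear_combination (MvPolynomial.X cz) * Xhalf (ℓ := ℓ)
    exact this ▸ half_mem (add_mem euler_mem (X_pd_mem _ _))

lemma chi_xx (j k : Fin ℓ) : chi ℓ (MvPolynomial.X (cx j) * MvPolynomial.X (cx k)) ∈ projAlg ℓ := by
  classical
  have : chi ℓ (MvPolynomial.X (cx j) * MvPolynomial.X (cx k)) =
      (MvPolynomial.X (cx j) : Poly ℓ) • (MvPolynomial.pderiv (cy k) : Vec ℓ) +
        (MvPolynomial.X (cx k) : Poly ℓ) • (MvPolynomial.pderiv (cy j) : Vec ℓ) := by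
    apply chi_eq
    · intro i
      simp only [Derivation.leibniz, tanB_x, Derivation.add_apply, Derivation.smul_apply, pd_X,
        cx_cy]
      simp
    · intro i
      simp only [Derivation.leibniz, tanA_x, Derivation.add_apply, Derivation.smul_apply, pd_X,
        cy_eq]
      simp [eq_comm]
    · rw [contactForm_add, contactForm_smul, contactForm_smul, pd_cf_y, pd_cf_y]
      linear_combination (MvPolynomial.X (cx j) * MvPolynomial.X (cx k)) * Xhalf (ℓ := ℓ)
  exact this ▸ add_mem (X_pd_mem _ _) (X_pd_mem _ _)

lemma chi_yy (j k : Fin ℓ) : chi ℓ (MvPolynomial.X (cy j) * MvPolynomial.X (cy k)) ∈ projAlg ℓ := by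
  classical
  have : chi ℓ (MvPolynomial.X (cy j) * MvPolynomial.X (cy k)) =
      -((MvPolynomial.X (cy j) : Poly ℓ) • (MvPolynomial.pderiv (cx k) : Vec ℓ) +
        (MvPolynomial.X (cy k) : Poly ℓ) • (MvPolynomial.pderiv (cx j) : Vec ℓ)) := by
    apply chi_eq
    · intro i
      simp only [Derivation.leibniz, tanB_y, Derivation.add_apply, Derivation.neg_apply,
        Derivation.smul_apply, pd_X, cx_eq]
      simp [eq_comm]
    · intro i
      simp only [Derivation.leibniz, tanA_y, Derivation.add_apply, Derivation.neg_apply,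
        Derivation.smul_apply, pd_X, cy_cx]
      simp
    · rw [cf_neg, contactForm_add, contactForm_smul, contactForm_smul, pd_cf_x, pd_cf_x]
      linear_combination (MvPolynomial.X (cy j) * MvPolynomial.X (cy k)) * Xhalf (ℓ := ℓ)
  exact this ▸ neg_mem (add_mem (X_pd_mem _ _) (X_pd_mem _ _))

lemma chi_xy (j k : Fin ℓ) : chi ℓ (MvPolynomial.X (cx j) * MvPolynomial.X (cy k)) ∈ projAlg ℓ := by
  classical
  have : chi ℓ (MvPolynomial.X (cx j) * MvPolynomial.X (cy k)) =
      (MvPolynomial.X (cy k) : Poly ℓ) • (MvPolynomial.pderiv (cy j) : Vec ℓ) -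
        (MvPolynomial.X (cx j) : Poly ℓ) • (MvPolynomial.pderiv (cx k) : Vec ℓ) := by
    apply chi_eq
    · intro i
      simp only [Derivation.leibniz, tanB_y, tanB_x, Derivation.sub_apply,
        Derivation.smul_apply, pd_X, cx_eq, cx_cy]
      simp [eq_comm]
    · intro i
      simp only [Derivation.leibniz, tanA_y, tanA_x, Derivation.sub_apply,
        Derivation.smul_apply, pd_X, cy_cx, cy_eq]
      simp [eq_comm]
    · rw [cf_sub, contactForm_smul, contactForm_smul, pd_cf_x, pd_cf_y]
      linear_combination (MvPolynomial.X (cx j) * MvPolynomial.X (cy k)) * Xhalf (ℓ := ℓ)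
  exact this ▸ sub_mem (X_pd_mem _ _) (X_pd_mem _ _)

lemma chi_zx (k : Fin ℓ) : chi ℓ (MvPolynomial.X cz * MvPolynomial.X (cx k)) ∈ projAlg ℓ := by
  classical
  have : chi ℓ (MvPolynomial.X cz * MvPolynomial.X (cx k)) =
      (MvPolynomial.C (1 / 2) : Poly ℓ) • (MvPolynomial.X (cx k) : Poly ℓ) • euler ℓ +
        (MvPolynomial.X cz : Poly ℓ) • (MvPolynomial.pderiv (cy k) : Vec ℓ) := by
    apply chi_eq
    · intro i
      simp only [Derivation.leibniz, tanB_z, tanB_x, Derivation.add_apply,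
        Derivation.smul_apply, pd_X, euler_X, cx_cy, smul_eq_mul, if_false]
      ring
    · intro i
      simp only [Derivation.leibniz, tanA_z, tanA_x, Derivation.add_apply,
        Derivation.smul_apply, pd_X, euler_X, cy_eq, smul_eq_mul, eq_comm (a := i)]
      ring
    · rw [contactForm_add, contactForm_smul, contactForm_smul, contactForm_smul, pd_cf_y, euler_cf]
      linear_combination (MvPolynomial.X cz * MvPolynomial.X (cx k)) * Xhalf (ℓ := ℓ)
  exact this ▸ add_mem (half_mem (X_euler_mem _)) (X_pd_mem _ _)

lemma chi_zy (k : Fin ℓ) : chi ℓ (MvPolynomial.X cz * MvPolynomial.X (cy k)) ∈ projAlg ℓ := by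
  classical
  have : chi ℓ (MvPolynomial.X cz * MvPolynomial.X (cy k)) =
      (MvPolynomial.C (1 / 2) : Poly ℓ) • (MvPolynomial.X (cy k) : Poly ℓ) • euler ℓ -
        (MvPolynomial.X cz : Poly ℓ) • (MvPolynomial.pderiv (cx k) : Vec ℓ) := by
    apply chi_eq
    · intro i
      simp only [Derivation.leibniz, tanB_z, tanB_y, Derivation.sub_apply,
        Derivation.smul_apply, pd_X, euler_X, cx_eq, smul_eq_mul, eq_comm (a := i)]
      ring
    · intro i
      simp only [Derivation.leibniz, tanA_z, tanA_y, Derivation.sub_apply,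
        Derivation.smul_apply, pd_X, euler_X, cy_cx, smul_eq_mul, if_false]
      ring
    · rw [cf_sub, contactForm_smul, contactForm_smul, contactForm_smul, pd_cf_x, euler_cf]
      linear_combination (MvPolynomial.X cz * MvPolynomial.X (cy k)) * Xhalf (ℓ := ℓ)
  exact this ▸ sub_mem (half_mem (X_euler_mem _)) (X_pd_mem _ _)

lemma chi_zz : chi ℓ (MvPolynomial.X cz * MvPolynomial.X cz) ∈ projAlg ℓ := by
  have : chi ℓ (MvPolynomial.X cz * MvPolynomial.X cz) =
      (MvPolynomial.X cz : Poly ℓ) • euler ℓ := by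
    apply chi_eq
    · intro i
      simp only [Derivation.leibniz, tanB_z, Derivation.smul_apply, euler_X, smul_eq_mul]
      linear_combination (MvPolynomial.X cz * MvPolynomial.X (cx i)) * Xhalf (ℓ := ℓ)
    · intro i
      simp only [Derivation.leibniz, tanA_z, Derivation.smul_apply, euler_X, smul_eq_mul]
      linear_combination (MvPolynomial.X cz * MvPolynomial.X (cy i)) * Xhalf (ℓ := ℓ)
    · rw [contactForm_smul, euler_cf]
  exact this ▸ X_euler_mem _

lemma chi_quad (a b : Coord ℓ) : chi ℓ (MvPolynomial.X a * MvPolynomial.X b) ∈ projAlg ℓ := by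
  rcases a with j | j | j <;> rcases b with k | k | k
  · exact chi_xx j k
  · exact chi_xy j k
  · rw [mul_comm]; exact chi_zx j
  · rw [mul_comm]; exact chi_xy k j
  · exact chi_yy j k
  · rw [mul_comm]; exact chi_zy j
  · exact chi_zx k
  · exact chi_zy k
  · exact chi_zz

lemma chi_deg_two {f : Poly ℓ} (hf : f.totalDegree ≤ 2) : chi ℓ f ∈ projAlg ℓ := by
  classical
  rw [MvPolynomial.as_sum f, map_sum]
  refine Submodule.sum_mem (projAlg ℓ).toSubmodule fun s hs => ?_
  have h1 : MvPolynomial.monomial s (f.coeff s) = f.coeff s • MvPolynomial.monomial s (1 : ℂ) := by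
    rw [MvPolynomial.smul_monomial, smul_eq_mul, mul_one]
  rw [h1, map_smul]
  refine (projAlg ℓ).smul_mem _ ?_
  have h2 : Multiset.card s.toMultiset ≤ 2 := by
    rw [Finsupp.card_toMultiset]
    exact (MvPolynomial.le_totalDegree hs).trans hf
  obtain ⟨t, rfl⟩ : ∃ t : Multiset (Coord ℓ), s = Multiset.toFinsupp t :=
    ⟨s.toMultiset, by simp⟩
  rw [Multiset.toFinsupp_toMultiset] at h2
  interval_cases hc : Multiset.card t
  · rw [Multiset.card_eq_zero] at hc
    subst hc
    have : MvPolynomial.monomial (Multiset.toFinsupp (0 : Multiset (Coord ℓ))) (1 : ℂ) = 1 := by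
      simp
    rw [this, chi_one]
    exact pd_mem _
  · obtain ⟨a, rfl⟩ := Multiset.card_eq_one.mp hc
    rw [Multiset.toFinsupp_singleton]
    exact chi_X a
  · obtain ⟨a, b, rfl⟩ := Multiset.card_eq_two.mp hc
    have : MvPolynomial.monomial (Multiset.toFinsupp ({a, b} : Multiset (Coord ℓ))) (1 : ℂ)
        = MvPolynomial.X a * MvPolynomial.X b := by
      rw [show ({a, b} : Multiset (Coord ℓ)) = {a} + {b} from rfl, Multiset.toFinsupp_add,
        Multiset.toFinsupp_singleton, Multiset.toFinsupp_singleton]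
      simp [MvPolynomial.X, MvPolynomial.monomial_mul]
    rw [this]
    exact chi_quad a b

lemma totalDegree_contactForm_projGen {X : Vec ℓ} (hX : X ∈ projGen ℓ) :
    (contactForm X).totalDegree ≤ 2 := by
  have hpd : ∀ i, (contactForm (MvPolynomial.pderiv i : Vec ℓ)).totalDegree ≤ 1 := by
    have hC : ∀ i : Coord ℓ,
        (MvPolynomial.C (1 / 2) * MvPolynomial.X i : Poly ℓ).totalDegree ≤ 1 := fun i =>
      (MvPolynomial.totalDegree_mul _ _).trans (by simp)
    rintro (i | i | i)
    · refine le_trans (le_of_eq ?_) (hC (cy i))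
      exact (congrArg _ (pd_cf_x i)).trans (MvPolynomial.totalDegree_neg _)
    · refine le_trans (le_of_eq ?_) (hC (cx i))
      rw [← pd_cf_y]; rfl
    · refine le_trans (le_of_eq (congrArg _ (pd_cf_z (ℓ := ℓ)))) ?_
      simp
  rcases hX with ⟨i, rfl⟩ | ⟨i, j, rfl⟩ | ⟨j, rfl⟩
  · exact (hpd i).trans (by norm_num)
  · rw [contactForm_smul]
    refine (MvPolynomial.totalDegree_mul _ _).trans ?_
    have := hpd i
    rw [MvPolynomial.totalDegree_X]
    omega
  · rw [contactForm_smul, euler_cf]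
    refine (MvPolynomial.totalDegree_mul _ _).trans ?_
    simp

lemma totalDegree_contactForm {X : Vec ℓ} (hX : X ∈ projAlg ℓ) :
    (contactForm X).totalDegree ≤ 2 := by
  change X ∈ Submodule.span ℂ (projGen ℓ) at hX
  induction hX using Submodule.span_induction with
  | mem X hX => exact totalDegree_contactForm_projGen hX
  | zero => simp [contactForm]
  | add X Y _ _ h1 h2 =>
    rw [contactForm_add]
    exact (MvPolynomial.totalDegree_add _ _).trans (max_le h1 h2)
  | smul c X _ h =>
    rw [contactForm_csmul]
    exact (MvPolynomial.totalDegree_smul_le _ _).trans h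

/-- A contact field has a Hamiltonian of degree `≤ 2` iff it lies in the projective algebra. -/
lemma con_deg_two_iff {X : Vec ℓ} (hX : X ∈ Con ℓ) :
    (contactForm X).totalDegree ≤ 2 ↔ X ∈ projAlg ℓ :=
  ⟨fun h => chi_contactForm hX ▸ chi_deg_two h, totalDegree_contactForm⟩

/-- The conformal algebra `𝔰_m ≅ 𝔰𝔭_{m+1}`: the contact fields `χ(f)` whose contact Hamiltonian
`f = ⟨ω, χ(f)⟩` is a polynomial of degree `≤ 2`. -/
def conformalAlg (ℓ : ℕ) : LieSubalgebra ℂ (Con ℓ) where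
  carrier := {X | (contactForm (X : Vec ℓ)).totalDegree ≤ 2}
  add_mem' {X Y} hX hY := by
    have h : contactForm ((X + Y : Con ℓ) : Vec ℓ) = contactForm X.1 + contactForm Y.1 :=
      contactForm_add X.1 Y.1
    exact (congrArg _ h).trans_le ((MvPolynomial.totalDegree_add _ _).trans (max_le hX hY))
  zero_mem' := by
    have h : contactForm ((0 : Con ℓ) : Vec ℓ) = 0 := (Tan ℓ).zero_mem
    exact (congrArg MvPolynomial.totalDegree h).trans_le (by simp)
  smul_mem' c X hX := by
    have h : contactForm ((c • X : Con ℓ) : Vec ℓ) = c • contactForm X.1 :=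
      contactForm_csmul c X.1
    exact (congrArg _ h).trans_le ((MvPolynomial.totalDegree_smul_le _ _).trans hX)
  lie_mem' {X Y} hX hY := by
    have h : ⁅X.1, Y.1⁆ ∈ projAlg ℓ := (projAlg ℓ).lie_mem
      ((con_deg_two_iff X.2).mp hX) ((con_deg_two_iff Y.2).mp hY)
    exact totalDegree_contactForm h

/-! ### Tensor density modules -/

lemma div_add (X Y : Vec ℓ) : div (X + Y) = div X + div Y := by
  simp only [div, Derivation.add_apply, map_add, Finset.sum_add_distrib]

lemma div_smul (c : ℂ) (X : Vec ℓ) : div (c • X) = c • div X := by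
  simp only [div, Derivation.smul_apply, Derivation.map_smul, Finset.smul_sum]

/-- A polynomial vector field is `∑_i X(x_i) D_i`. -/
lemma vec_apply (X : Vec ℓ) (f : Poly ℓ) :
    X f = ∑ i, X (MvPolynomial.X i) * MvPolynomial.pderiv i f := by
  classical
  have h : X = ∑ i, X (MvPolynomial.X i) • (MvPolynomial.pderiv i : Vec ℓ) := by
    apply MvPolynomial.derivation_ext
    intro k
    rw [sum_apply, Finset.sum_eq_single k]
    · simp
    · intro b _ hb
      simp [MvPolynomial.pderiv_X_of_ne hb.symm]
    · simp
  conv_lhs => rw [h, sum_apply]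
  rfl

lemma pd_comm (i j : Coord ℓ) (f : Poly ℓ) :
    MvPolynomial.pderiv i (MvPolynomial.pderiv j f)
      = MvPolynomial.pderiv j (MvPolynomial.pderiv i f) := by
  have h := congrArg (fun D : Vec ℓ => D f) (pderiv_lie_pderiv i j)
  simp only [Derivation.commutator_apply, Derivation.zero_apply] at h
  exact sub_eq_zero.mp h

lemma div_lie (X Y : Vec ℓ) : div ⁅X, Y⁆ = X (div Y) - Y (div X) := by
  simp only [div, Derivation.commutator_apply, map_sub, map_sum, Finset.sum_sub_distrib]
  have key : ∀ Z W : Vec ℓ,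
      ∑ i, MvPolynomial.pderiv i (Z (W (MvPolynomial.X i)))
        = ∑ i, ∑ j, MvPolynomial.pderiv i (Z (MvPolynomial.X j)) *
            MvPolynomial.pderiv j (W (MvPolynomial.X i))
          + ∑ i, Z (MvPolynomial.pderiv i (W (MvPolynomial.X i))) := by
    intro Z W
    rw [← Finset.sum_add_distrib]
    refine Finset.sum_congr rfl fun i _ => ?_
    rw [vec_apply Z (W (MvPolynomial.X i)), vec_apply Z (MvPolynomial.pderiv i _), map_sum,
      ← Finset.sum_add_distrib]
    refine Finset.sum_congr rfl fun j _ => ?_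
    rw [Derivation.leibniz, pd_comm i j, smul_eq_mul, smul_eq_mul]
    ring
  rw [key X Y, key Y X]
  have hsw : ∑ i, ∑ j, MvPolynomial.pderiv i (X (MvPolynomial.X j)) *
        MvPolynomial.pderiv j (Y (MvPolynomial.X i))
      = ∑ i, ∑ j, MvPolynomial.pderiv i (Y (MvPolynomial.X j)) *
        MvPolynomial.pderiv j (X (MvPolynomial.X i)) := by
    rw [Finset.sum_comm]
    exact Finset.sum_congr rfl fun i _ => Finset.sum_congr rfl fun j _ => mul_comm _ _
  rw [hsw]
  ring

/-- The tensor density module `F(λ) = dx^λ ℂ[x_1,…,y_1,…,z]`. -/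
def Density (ℓ : ℕ) (_lam : ℂ) : Type := Poly ℓ

instance (lam : ℂ) : AddCommGroup (Density ℓ lam) := inferInstanceAs (AddCommGroup (Poly ℓ))
instance (lam : ℂ) : Module ℂ (Density ℓ lam) := inferInstanceAs (Module ℂ (Poly ℓ))

/-- The identification `f ↦ dx^λ f`. -/
def dens (ℓ : ℕ) (lam : ℂ) : Poly ℓ ≃ₗ[ℂ] Density ℓ lam := LinearEquiv.refl ℂ (Poly ℓ)

/-- The action `π_λ(X)(dx^λ f) = dx^λ (X(f) + λ f ∇·X)` of `Vec ℝ^m` on `F(λ)`. -/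
instance (lam : ℂ) : LieRingModule (Vec ℓ) (Density ℓ lam) where
  bracket X f := dens ℓ lam (X ((dens ℓ lam).symm f) + lam • ((dens ℓ lam).symm f * div X))
  add_lie X Y f := by
    rw [← map_add]
    congr 1
    rw [div_add, Derivation.add_apply, mul_add, smul_add]
    abel
  lie_add X f g := by
    rw [← map_add]
    congr 1
    rw [map_add, map_add, add_mul, smul_add]
    abel
  leibniz_lie X Y f := by
    rw [← map_add]
    congr 1
    simp only [LinearEquiv.symm_apply_apply, div_lie, Derivation.commutator_apply, map_add,
      Derivation.map_smul, Derivation.leibniz, smul_eq_mul]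
    simp only [MvPolynomial.smul_eq_C_mul]
    ring

lemma density_lie (lam : ℂ) (X : Vec ℓ) (f : Poly ℓ) :
    ⁅X, dens ℓ lam f⁆ = dens ℓ lam (X f + lam • (f * div X)) := rfl

instance (lam : ℂ) : LieModule ℂ (Vec ℓ) (Density ℓ lam) where
  smul_lie c X f := by
    obtain ⟨f, rfl⟩ := (dens ℓ lam).surjective f
    rw [density_lie, density_lie, ← map_smul]
    congr 1
    rw [div_smul, Derivation.smul_apply, smul_add, mul_smul_comm, smul_comm c lam]
  lie_smul c X f := by
    obtain ⟨f, rfl⟩ := (dens ℓ lam).surjective f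
    rw [← map_smul, density_lie, density_lie, ← map_smul]
    congr 1
    rw [Derivation.map_smul, smul_add, smul_mul_assoc, smul_comm c lam]

/-! ### Differential operators on polynomials: order and non-tangential order -/

/-- Multiplication by a polynomial. -/
def mulOp (f : Poly ℓ) : Module.End ℂ (Poly ℓ) := LinearMap.mulLeft ℂ f

/-- A vector field as a first order differential operator. -/
def vecOp (X : Vec ℓ) : Module.End ℂ (Poly ℓ) := X.toLinearMap

/-- The operator `D_{i_1} ∘ ⋯ ∘ D_{i_r}`. -/
def word (L : List (Coord ℓ)) : Module.End ℂ (Poly ℓ) :=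
  (L.map fun i => vecOp (MvPolynomial.pderiv i : Vec ℓ)).prod

/-- Polynomial differential operators of order `< n`: the span of the `f D_{i_1} ⋯ D_{i_r}` with
`f` a polynomial and `r < n`. -/
def opLT (ℓ n : ℕ) : Submodule ℂ (Module.End ℂ (Poly ℓ)) :=
  Submodule.span ℂ {T | ∃ (f : Poly ℓ) (L : List (Coord ℓ)), L.length < n ∧ T = mulOp f * word L}

/-- `Tan ℝ^m` as a space of first order differential operators. -/
def tanOps (ℓ : ℕ) : Submodule ℂ (Module.End ℂ (Poly ℓ)) :=
  Submodule.span ℂ (vecOp '' (Tan ℓ : Set (Vec ℓ)))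

/-- The operators of order `≤ k` and non-tangential order `< n`, modulo operators of order `< k`:
the span of the operators of order `< k` and of the products of an operator of order `≤ i` with
`k - i` tangent fields, `i < n`. -/
def fineOpLT (ℓ k n : ℕ) : Submodule ℂ (Module.End ℂ (Poly ℓ)) :=
  opLT ℓ k ⊔ ⨆ i ∈ Finset.range n, opLT ℓ (i + 1) * tanOps ℓ ^ (k - i)

lemma mulOp_apply (f g : Poly ℓ) : mulOp f g = f * g := rfl
lemma vecOp_apply (X : Vec ℓ) (g : Poly ℓ) : vecOp X g = X g := rfl

lemma mulOp_mul (f g : Poly ℓ) : mulOp (f * g) = mulOp f * mulOp g := by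
  exact LinearMap.ext fun h => mul_assoc f g h

lemma mulOp_one : (mulOp 1 : Module.End ℂ (Poly ℓ)) = 1 := by
  exact LinearMap.ext fun h => one_mul h

lemma vecOp_mulOp (X : Vec ℓ) (f : Poly ℓ) :
    vecOp X * mulOp f = mulOp f * vecOp X + mulOp (X f) := by
  apply LinearMap.ext
  intro h
  change X (f * h) = f * X h + X f * h
  rw [Derivation.leibniz, smul_eq_mul, smul_eq_mul, mul_comm h]

lemma vecOp_lie (X Y : Vec ℓ) : vecOp X * vecOp Y - vecOp Y * vecOp X = vecOp ⁅X, Y⁆ := by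
  apply LinearMap.ext
  intro h
  exact (Derivation.commutator_apply (D1 := X) (D2 := Y) h).symm

lemma mem_opLT {n : ℕ} (f : Poly ℓ) (L : List (Coord ℓ)) (h : L.length < n) :
    mulOp f * word L ∈ opLT ℓ n := Submodule.subset_span ⟨f, L, h, rfl⟩

lemma word_mem {n : ℕ} (L : List (Coord ℓ)) (h : L.length < n) : word L ∈ opLT ℓ n := by
  have := mem_opLT 1 L h
  rwa [mulOp_one, one_mul] at this

lemma mulOp_mem {n : ℕ} (hn : 0 < n) (f : Poly ℓ) : mulOp f ∈ opLT ℓ n := by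
  have := mem_opLT f [] hn
  rwa [word, List.map_nil, List.prod_nil, mul_one] at this

lemma opLT_mono {a b : ℕ} (h : a ≤ b) : opLT ℓ a ≤ opLT ℓ b :=
  Submodule.span_mono fun _ ⟨f, L, hL, hT⟩ => ⟨f, L, hL.trans_le h, hT⟩

lemma vecOp_mem {n : ℕ} (hn : 1 < n) (X : Vec ℓ) : vecOp X ∈ opLT ℓ n := by
  have h : vecOp X = ∑ i, mulOp (X (MvPolynomial.X i)) * word [i] := by
    apply LinearMap.ext
    intro f
    rw [vecOp_apply, vec_apply, LinearMap.sum_apply]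
    refine Finset.sum_congr rfl fun i _ => ?_
    rw [word, List.map_singleton, List.prod_singleton]
    rfl
  rw [h]
  exact Submodule.sum_mem _ fun i _ => mem_opLT _ _ (by simpa using hn)

lemma mulOp_mul_mem {n : ℕ} (g : Poly ℓ) {T : Module.End ℂ (Poly ℓ)} (hT : T ∈ opLT ℓ n) :
    mulOp g * T ∈ opLT ℓ n := by
  induction hT using Submodule.span_induction with
  | mem T hT =>
    obtain ⟨f, L, hL, rfl⟩ := hT
    rw [← mul_assoc, ← mulOp_mul]
    exact mem_opLT _ _ hL
  | zero => rw [mul_zero]; exact zero_mem _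
  | add T S _ _ h1 h2 => rw [mul_add]; exact add_mem h1 h2
  | smul c T _ h => rw [mul_smul_comm]; exact Submodule.smul_mem _ _ h

lemma pd_mul_mem {n : ℕ} (i : Coord ℓ) {T : Module.End ℂ (Poly ℓ)} (hT : T ∈ opLT ℓ n) :
    vecOp (MvPolynomial.pderiv i) * T ∈ opLT ℓ (n + 1) := by
  induction hT using Submodule.span_induction with
  | mem T hT =>
    obtain ⟨f, L, hL, rfl⟩ := hT
    rw [← mul_assoc, vecOp_mulOp, add_mul, mul_assoc]
    refine add_mem ?_ (mem_opLT _ _ (by omega))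
    exact mem_opLT f (i :: L) (by simpa using hL)
  | zero => rw [mul_zero]; exact zero_mem _
  | add T S _ _ h1 h2 => rw [mul_add]; exact add_mem h1 h2
  | smul c T _ h => rw [mul_smul_comm]; exact Submodule.smul_mem _ _ h

lemma word_mul_mem {n : ℕ} (L : List (Coord ℓ)) {T : Module.End ℂ (Poly ℓ)} (hT : T ∈ opLT ℓ n) :
    word L * T ∈ opLT ℓ (L.length + n) := by
  induction L with
  | nil => simpa [word] using hT
  | cons i L ih =>
    have := pd_mul_mem i ih
    rw [List.length_cons]
    rw [show word (i :: L) = vecOp (MvPolynomial.pderiv i) * word L from rfl, mul_assoc]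
    exact opLT_mono (by omega) this

lemma opLT_mul {a b c : ℕ} (h : a + b ≤ c + 1) {S T : Module.End ℂ (Poly ℓ)}
    (hS : S ∈ opLT ℓ a) (hT : T ∈ opLT ℓ b) : S * T ∈ opLT ℓ c := by
  induction hS using Submodule.span_induction with
  | mem S hS =>
    obtain ⟨f, L, hL, rfl⟩ := hS
    rw [mul_assoc]
    exact mulOp_mul_mem _ (opLT_mono (by omega) (word_mul_mem L hT))
  | zero => rw [zero_mul]; exact zero_mem _
  | add T S _ _ h1 h2 => rw [add_mul]; exact add_mem h1 h2
  | smul c T _ h => rw [smul_mul_assoc]; exact Submodule.smul_mem _ _ h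

/-- Bracketing with a function lowers the order. -/
lemma comm_mulOp_mem {n : ℕ} (g : Poly ℓ) {T : Module.End ℂ (Poly ℓ)}
    (hT : T ∈ opLT ℓ (n + 1)) : T * mulOp g - mulOp g * T ∈ opLT ℓ n := by
  have hw : ∀ L : List (Coord ℓ), word L * mulOp g - mulOp g * word L ∈ opLT ℓ L.length := by
    intro L
    induction L with
    | nil => simp [word]
    | cons i L ih =>
      rw [show word (i :: L) = vecOp (MvPolynomial.pderiv i) * word L from rfl]
      have e : vecOp (MvPolynomial.pderiv i) * word L * mulOp g
            - mulOp g * (vecOp (MvPolynomial.pderiv i) * word L)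
          = vecOp (MvPolynomial.pderiv i) * (word L * mulOp g - mulOp g * word L)
            + mulOp (MvPolynomial.pderiv i g) * word L := by
        have := vecOp_mulOp (MvPolynomial.pderiv i : Vec ℓ) g
        rw [mul_sub, ← mul_assoc, ← mul_assoc, ← mul_assoc, this, add_mul]
        abel
      rw [e]
      exact add_mem (pd_mul_mem i ih) (mem_opLT _ _ (by simp))
  induction hT using Submodule.span_induction with
  | mem S hS =>
    obtain ⟨f, L, hL, rfl⟩ := hS
    have e : mulOp f * word L * mulOp g - mulOp g * (mulOp f * word L)
        = mulOp f * (word L * mulOp g - mulOp g * word L) := by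
      rw [mul_sub, ← mul_assoc, ← mul_assoc, ← mul_assoc, ← mulOp_mul, ← mulOp_mul, mul_comm f g]
    rw [e]
    exact mulOp_mul_mem _ (opLT_mono (by omega) (hw L))
  | zero => simp
  | add T S _ _ h1 h2 =>
    have e : (T + S) * mulOp g - mulOp g * (T + S)
        = (T * mulOp g - mulOp g * T) + (S * mulOp g - mulOp g * S) := by
      rw [add_mul, mul_add]; abel
    rw [e]; exact add_mem h1 h2
  | smul c T _ h =>
    rw [smul_mul_assoc, mul_smul_comm, ← smul_sub]; exact Submodule.smul_mem _ _ h

/-- Bracketing with a vector field preserves the order. -/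
lemma comm_vecOp_mem {n : ℕ} (X : Vec ℓ) {T : Module.End ℂ (Poly ℓ)}
    (hT : T ∈ opLT ℓ n) : vecOp X * T - T * vecOp X ∈ opLT ℓ n := by
  have hw : ∀ L : List (Coord ℓ), vecOp X * word L - word L * vecOp X ∈ opLT ℓ (L.length + 1) := by
    intro L
    induction L with
    | nil => simp [word]
    | cons i L ih =>
      rw [show word (i :: L) = vecOp (MvPolynomial.pderiv i) * word L from rfl]
      have e : vecOp X * (vecOp (MvPolynomial.pderiv i) * word L)
            - vecOp (MvPolynomial.pderiv i) * word L * vecOp X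
          = vecOp ⁅X, (MvPolynomial.pderiv i : Vec ℓ)⁆ * word L
            + vecOp (MvPolynomial.pderiv i) * (vecOp X * word L - word L * vecOp X) := by
        rw [← vecOp_lie, mul_sub, sub_mul]
        simp only [mul_assoc]
        abel
      rw [e]
      refine add_mem (opLT_mul ?_ (vecOp_mem (n := 2) (by omega) _)
        (word_mem (n := L.length + 1) L (by omega))) (pd_mul_mem i ih)
      rw [List.length_cons]; omega
  induction hT using Submodule.span_induction with
  | mem S hS =>
    obtain ⟨f, L, hL, rfl⟩ := hS
    have e : vecOp X * (mulOp f * word L) - mulOp f * word L * vecOp X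
        = mulOp f * (vecOp X * word L - word L * vecOp X) + mulOp (X f) * word L := by
      rw [mul_sub, ← mul_assoc, vecOp_mulOp, add_mul]
      simp only [mul_assoc]
      abel
    rw [e]
    exact add_mem (mulOp_mul_mem _ (opLT_mono (by omega) (hw L))) (mem_opLT _ _ hL)
  | zero => simp
  | add T S _ _ h1 h2 =>
    have e : vecOp X * (T + S) - (T + S) * vecOp X
        = (vecOp X * T - T * vecOp X) + (vecOp X * S - S * vecOp X) := by
      rw [add_mul, mul_add]; abel
    rw [e]; exact add_mem h1 h2
  | smul c T _ h =>
    rw [smul_mul_assoc, mul_smul_comm, ← smul_sub]; exact Submodule.smul_mem _ _ h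

lemma tanOps_le : tanOps ℓ ≤ opLT ℓ 2 := by
  rw [tanOps, Submodule.span_le]
  rintro _ ⟨T, _, rfl⟩
  exact vecOp_mem (by omega) T

lemma tanOps_pow_le (r : ℕ) : tanOps ℓ ^ r ≤ opLT ℓ (r + 1) := by
  induction r with
  | zero =>
    rw [Submodule.pow_zero, Submodule.one_le, ← mulOp_one]
    exact mulOp_mem (by omega) 1
  | succ r ih =>
    rw [Submodule.pow_succ, Submodule.mul_le]
    exact fun S hS T hT => opLT_mul (by omega) (ih hS) (tanOps_le hT)

lemma comm_tanOps_mem {X : Vec ℓ} (hX : X ∈ Con ℓ) {T : Module.End ℂ (Poly ℓ)}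
    (hT : T ∈ tanOps ℓ) : vecOp X * T - T * vecOp X ∈ tanOps ℓ := by
  induction hT using Submodule.span_induction with
  | mem S hS =>
    obtain ⟨Y, hY, rfl⟩ := hS
    rw [vecOp_lie]
    exact Submodule.subset_span ⟨_, hX Y hY, rfl⟩
  | zero => simp
  | add T S _ _ h1 h2 =>
    have e : vecOp X * (T + S) - (T + S) * vecOp X
        = (vecOp X * T - T * vecOp X) + (vecOp X * S - S * vecOp X) := by
      rw [add_mul, mul_add]; abel
    rw [e]; exact add_mem h1 h2
  | smul c T _ h =>
    rw [smul_mul_assoc, mul_smul_comm, ← smul_sub]; exact Submodule.smul_mem _ _ h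

/-- If bracketing with an operator preserves two spaces, it preserves their product. -/
lemma comm_mul_mem (V : Module.End ℂ (Poly ℓ)) {P Q : Submodule ℂ (Module.End ℂ (Poly ℓ))}
    (hP : ∀ T ∈ P, V * T - T * V ∈ P) (hQ : ∀ T ∈ Q, V * T - T * V ∈ Q) :
    ∀ T ∈ P * Q, V * T - T * V ∈ P * Q := by
  intro T hT
  induction hT using Submodule.mul_induction_on' with
  | mem_mul_mem A hA B hB =>
    have e : V * (A * B) - A * B * V = (V * A - A * V) * B + A * (V * B - B * V) := by
      rw [sub_mul, mul_sub, mul_assoc, mul_assoc, mul_assoc]; abel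
    rw [e]
    exact add_mem (Submodule.mul_mem_mul (hP A hA) hB) (Submodule.mul_mem_mul hA (hQ B hB))
  | add A _ B _ h1 h2 =>
    have e : V * (A + B) - (A + B) * V = (V * A - A * V) + (V * B - B * V) := by noncomm_ring
    rw [e]; exact add_mem h1 h2

lemma comm_tanOps_pow_mem {X : Vec ℓ} (hX : X ∈ Con ℓ) (r : ℕ) :
    ∀ T ∈ tanOps ℓ ^ r, vecOp X * T - T * vecOp X ∈ tanOps ℓ ^ r := by
  induction r with
  | zero =>
    intro T hT
    rw [Submodule.pow_zero] at hT ⊢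
    obtain ⟨c, rfl⟩ := Submodule.mem_one.mp hT
    rw [(Algebra.commutes c (vecOp X)).symm, sub_self]
    exact zero_mem _
  | succ r ih =>
    rw [Submodule.pow_succ]
    exact comm_mul_mem _ ih fun T hT => comm_tanOps_mem hX hT

lemma fineOpLT_le {k n : ℕ} (hn : n ≤ k + 1) : fineOpLT ℓ k n ≤ opLT ℓ (k + 1) := by
  refine sup_le (opLT_mono (by omega)) (iSup₂_le fun i hi => ?_)
  rw [Finset.mem_range] at hi
  rw [Submodule.mul_le]
  exact fun S hS T hT => opLT_mul (by omega) hS (tanOps_pow_le _ hT)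

/-- The two-sided action of a vector field on differential operators from `F(λ)` to `F(λ+p)`,
written on polynomials. -/
lemma action_mem {P : Submodule ℂ (Module.End ℂ (Poly ℓ))} (X : Vec ℓ) (a b : Poly ℓ)
    (hV : ∀ T ∈ P, vecOp X * T - T * vecOp X ∈ P) (hl : ∀ T ∈ P, mulOp a * T ∈ P)
    (hr : ∀ T ∈ P, T * mulOp b ∈ P) :
    ∀ T ∈ P, (vecOp X + mulOp a) * T - T * (vecOp X + mulOp b) ∈ P := by
  intro T hT
  have e : (vecOp X + mulOp a) * T - T * (vecOp X + mulOp b)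
      = (vecOp X * T - T * vecOp X) + mulOp a * T - T * mulOp b := by noncomm_ring
  rw [e]
  exact sub_mem (add_mem (hV T hT) (hl T hT)) (hr T hT)

lemma mul_mulOp_mem {n : ℕ} (g : Poly ℓ) {T : Module.End ℂ (Poly ℓ)} (hT : T ∈ opLT ℓ n) :
    T * mulOp g ∈ opLT ℓ n :=
  opLT_mul (b := 1) le_rfl hT (mulOp_mem (by omega) g)

lemma mulOp_mul_mem_fine {k n : ℕ} (g : Poly ℓ) :
    ∀ T ∈ fineOpLT ℓ k n, mulOp g * T ∈ fineOpLT ℓ k n := by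
  have h : fineOpLT ℓ k n ≤ (fineOpLT ℓ k n).comap (LinearMap.mulLeft ℂ (mulOp g)) := by
    refine sup_le (fun T hT => ?_) (iSup₂_le fun i hi => ?_)
    · exact Submodule.mem_sup_left (mulOp_mul_mem g hT)
    · rw [Submodule.mul_le]
      intro S hS T hT
      change mulOp g * (S * T) ∈ fineOpLT ℓ k n
      rw [← mul_assoc]
      exact Submodule.mem_sup_right (Submodule.mem_iSup_of_mem i (Submodule.mem_iSup_of_mem hi
        (Submodule.mul_mem_mul (mulOp_mul_mem g hS) hT)))
  exact h

lemma mul_mulOp_mem_fine {k n : ℕ} (hn : n ≤ k + 1) (g : Poly ℓ) :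
    ∀ T ∈ fineOpLT ℓ k n, T * mulOp g ∈ fineOpLT ℓ k n := by
  intro T hT
  have e : T * mulOp g = (T * mulOp g - mulOp g * T) + mulOp g * T := by abel
  rw [e]
  exact add_mem (Submodule.mem_sup_left (comm_mulOp_mem g (fineOpLT_le hn hT)))
    (mulOp_mul_mem_fine g T hT)

lemma comm_vecOp_mem_fine {X : Vec ℓ} (hX : X ∈ Con ℓ) {k n : ℕ} :
    ∀ T ∈ fineOpLT ℓ k n, vecOp X * T - T * vecOp X ∈ fineOpLT ℓ k n := by
  have h : fineOpLT ℓ k n ≤ (fineOpLT ℓ k n).comap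
      (LinearMap.mulLeft ℂ (vecOp X) - LinearMap.mulRight ℂ (vecOp X)) := by
    refine sup_le (fun T hT => ?_) (iSup₂_le fun i hi T hT => ?_)
    · exact Submodule.mem_sup_left (comm_vecOp_mem X hT)
    · exact Submodule.mem_sup_right (Submodule.mem_iSup_of_mem i (Submodule.mem_iSup_of_mem hi
        (comm_mul_mem _ (fun T hT => comm_vecOp_mem X hT) (comm_tanOps_pow_mem hX _) T hT)))
  exact h

/-! ### The modules `Diff(λ,p)`, their filtrations and their symbols -/

/-- All linear maps `F(λ) → F(λ+p)`, a `Vec ℝ^m`-module under the two-sided action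
`X · T = π_{λ+p}(X) ∘ T - T ∘ π_λ(X)`. -/
abbrev HomDens (ℓ : ℕ) (lam p : ℂ) : Type := Density ℓ lam →ₗ[ℂ] Density ℓ (lam + p)

/-- `T ↦ (dx^λ f ↦ dx^{λ+p} T(f))`. -/
def toHom (ℓ : ℕ) (lam p : ℂ) : Module.End ℂ (Poly ℓ) ≃ₗ[ℂ] HomDens ℓ lam p :=
  LinearEquiv.arrowCongr (dens ℓ lam) (dens ℓ (lam + p))

lemma lie_toHom (lam p : ℂ) (X : Vec ℓ) (T : Module.End ℂ (Poly ℓ)) :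
    ⁅X, toHom ℓ lam p T⁆ = toHom ℓ lam p ((vecOp X + mulOp ((lam + p) • div X)) * T
      - T * (vecOp X + mulOp (lam • div X))) := by
  have h : ∀ (c : ℂ) (f : Poly ℓ),
      X f + c • (f * div X) = (vecOp X + mulOp (c • div X)) f := by
    intro c f
    change _ = X f + (c • div X) * f
    rw [smul_mul_assoc, mul_comm f]
  apply LinearMap.ext
  intro f
  obtain ⟨f, rfl⟩ := (dens ℓ lam).surjective f
  rw [LieHom.lie_apply]
  rw [density_lie, h]
  change ⁅X, dens ℓ (lam + p) (T f)⁆ - dens ℓ (lam + p) (T _) = _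
  rw [density_lie, h]
  rfl

/-- The operators of order `< n` in `Diff(λ,p)`, i.e. `Diff^{n-1}(λ,p)`, as a
`Vec ℝ^m`-module. -/
def diffLT (ℓ : ℕ) (lam p : ℂ) (n : ℕ) : LieSubmodule ℂ (Vec ℓ) (HomDens ℓ lam p) where
  toSubmodule := (opLT ℓ n).map (toHom ℓ lam p).toLinearMap
  lie_mem {X m} hm := by
    obtain ⟨T, hT, rfl⟩ := hm
    exact ⟨_, action_mem X _ _ (fun T hT => comm_vecOp_mem X hT) (fun T hT => mulOp_mul_mem _ hT)
      (fun T hT => mul_mulOp_mem _ hT) T hT, (lie_toHom lam p X T).symm⟩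

/-- `Diff(λ,p)`: the polynomial differential operators from `F(λ)` to `F(λ+p)`. -/
def Diff (ℓ : ℕ) (lam p : ℂ) : LieSubmodule ℂ (Vec ℓ) (HomDens ℓ lam p) :=
  ⨆ n, diffLT ℓ lam p n

/-- `Diff^k(λ,p)`: operators of order `≤ k`. -/
abbrev diffOrd (ℓ : ℕ) (lam p : ℂ) (k : ℕ) : LieSubmodule ℂ (Vec ℓ) (HomDens ℓ lam p) :=
  diffLT ℓ lam p (k + 1)

/-- Operators of order `≤ k` and non-tangential order `< n` in `Diff(λ,p)`, plus `Diff^{k-1}`: for `n = l + 1` this is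
`Diff^{k,l}(λ,p) = Diff^{k-1}(λ,p) + ∑_{i=0}^l Diff^i(λ,p) (Tan ℝ^m)^{k-i}`, as a
`Con ℝ^m`-module; for `n = 0` it is `Diff^{k-1}(λ,p)`. -/
def fineLT (ℓ : ℕ) (lam p : ℂ) (k n : ℕ) (hn : n ≤ k + 1) :
    LieSubmodule ℂ (Con ℓ) (HomDens ℓ lam p) where
  toSubmodule := (fineOpLT ℓ k n).map (toHom ℓ lam p).toLinearMap
  lie_mem {X m} hm := by
    obtain ⟨T, hT, rfl⟩ := hm
    exact ⟨_, action_mem X.1 _ _ (comm_vecOp_mem_fine X.2) (mulOp_mul_mem_fine _)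
      (mul_mulOp_mem_fine hn _) T hT, (lie_toHom lam p X.1 T).symm⟩

/-- The pairs `(k, l)` with `0 ≤ l ≤ k`. -/
abbrev FineIdx : Type := Σ k : ℕ, Fin (k + 1)

/-- `Diff^{k,l}(λ,p)`. -/
abbrev diffFine (ℓ : ℕ) (lam p : ℂ) (i : FineIdx) : LieSubmodule ℂ (Con ℓ) (HomDens ℓ lam p) :=
  fineLT ℓ lam p i.1 (i.2 + 1) (Nat.succ_le_succ (Nat.le_of_lt_succ i.2.isLt))

/-- `Diff^{k,l-1}(λ,p)`, where `Diff^{k,-1} = Diff^{k-1}`. -/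
abbrev diffFinePred (ℓ : ℕ) (lam p : ℂ) (i : FineIdx) :
    LieSubmodule ℂ (Con ℓ) (HomDens ℓ lam p) :=
  fineLT ℓ lam p i.1 i.2 i.2.isLt.le

/-- The symbol module `Symb^k(p) = Diff^k(λ,p) / Diff^{k-1}(λ,p)`. Up to canonical isomorphism it
does not depend on `λ`; here it is the literal quotient. -/
abbrev Symb (ℓ : ℕ) (lam p : ℂ) (k : ℕ) : Type :=
  ↥(diffOrd ℓ lam p k) ⧸ (diffLT ℓ lam p k).comap (diffOrd ℓ lam p k).incl

/-- The symbol of an operator of order `≤ k`. -/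
abbrev symb (ℓ : ℕ) (lam p : ℂ) (k : ℕ) : ↥(diffOrd ℓ lam p k) → Symb ℓ lam p k :=
  LieSubmodule.Quotient.mk

/-- The fine symbol module `Symb_fine^{k,l}(p) = Diff^{k,l}(λ,p) / Diff^{k,l-1}(λ,p)`. -/
abbrev FineSymb (ℓ : ℕ) (lam p : ℂ) (i : FineIdx) : Type :=
  ↥(diffFine ℓ lam p i) ⧸ (diffFinePred ℓ lam p i).comap (diffFine ℓ lam p i).incl

/-- The fine symbol of an element of `Diff^{k,l}(λ,p)`. -/
abbrev fineSymb (ℓ : ℕ) (lam p : ℂ) (i : FineIdx) : ↥(diffFine ℓ lam p i) → FineSymb ℓ lam p i :=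
  LieSubmodule.Quotient.mk

/-- `Symb(p) = ⨁_k Symb^k(p)`. -/
abbrev SymbTot (ℓ : ℕ) (lam p : ℂ) : Type := ⨁ k : ℕ, Symb ℓ lam p k

/-- `Symb_fine(p) = ⨁_{k,l} Symb_fine^{k,l}(p)`. -/
abbrev FineSymbTot (ℓ : ℕ) (lam p : ℂ) : Type := ⨁ i : FineIdx, FineSymb ℓ lam p i

/-! ### Quantizations -/

/-- The projective quantization property of an `𝔞_m`-equivalence `P : Symb(p) → Diff(λ,p)`:
for `S ∈ Symb^k(p)`, `P(S)` lies in `Diff^k(λ,p)` and has symbol `S`. -/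
def IsProjectiveQuantization {lam p : ℂ}
    (P : SymbTot ℓ lam p ≃ₗ⁅ℂ, projAlg ℓ⁆ ↥(Diff ℓ lam p)) : Prop :=
  ∀ (k : ℕ) (S : Symb ℓ lam p k), ∃ T : ↥(diffOrd ℓ lam p k),
    (T : HomDens ℓ lam p) = (P (DirectSum.of (Symb ℓ lam p) k S) : HomDens ℓ lam p) ∧
      symb ℓ lam p k T = S

/-- A splitting under `𝔰_m` of the fine filtrations of the `Symb^k(p)`: an `𝔰_m`-equivalence
`Symb_fine(p) → Symb(p)` that sends `S ∈ Symb_fine^{k,l}(p)` to the symbol in `Symb^k(p)` of an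
element of `Diff^{k,l}(λ,p)` with fine symbol `S`. -/
def IsFineSplitting {lam p : ℂ}
    (Φ : FineSymbTot ℓ lam p ≃ₗ⁅ℂ, conformalAlg ℓ⁆ SymbTot ℓ lam p) : Prop :=
  ∀ (i : FineIdx) (S : FineSymb ℓ lam p i), ∃ (T : ↥(diffFine ℓ lam p i))
    (T' : ↥(diffOrd ℓ lam p i.1)), (T : HomDens ℓ lam p) = (T' : HomDens ℓ lam p) ∧
      Φ (DirectSum.of (FineSymb ℓ lam p) i S)
        = DirectSum.of (Symb ℓ lam p) i.1 (symb ℓ lam p i.1 T') ∧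
      fineSymb ℓ lam p i T = S

/-- The conformal quantization property of an `𝔰_m`-equivalence
`Q : Symb_fine(p) → Diff(λ,p)`: it is symbol-preserving, i.e. for `S ∈ Symb_fine^{k,l}(p)`,
`Q(S)` lies in `Diff^{k,l}(λ,p)` and has fine symbol `S`. -/
def IsConformalQuantization {lam p : ℂ}
    (Q : FineSymbTot ℓ lam p ≃ₗ⁅ℂ, conformalAlg ℓ⁆ ↥(Diff ℓ lam p)) : Prop :=
  ∀ (i : FineIdx) (S : FineSymb ℓ lam p i), ∃ T : ↥(diffFine ℓ lam p i),
    (T : HomDens ℓ lam p) = (Q (DirectSum.of (FineSymb ℓ lam p) i S) : HomDens ℓ lam p) ∧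
      fineSymb ℓ lam p i T = S

end ContactQuant

end

/-!
The conformal quantization is written down explicitly, and Schur's lemma for the fine symbols gives
its uniqueness.

**Coordinates.** Normal ordering (`normalOrder`, coordinates to the left of derivatives) identifies
the differential operators with the polynomials in the base coordinates `u_i` and the fibre
coordinates of the cotangent bundle, the algebra `Phase ℓ`, and the order with the fibre degree
`fdeg`. The symbol modules become the same space, on which a vector field acts by its Hamiltonian
lift plus `p` times its divergence (`symAct`). The fibre coordinates may be replaced by the symbols
of the contact frame `B_i`, `-A_i`, `∂_z` (`frame`); the degree `zdeg` in the last of them, `ζ`, is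
then the non-tangential order, and the fine symbols are again all of `Phase ℓ`, on which the contact
field `χ(f)` with Hamiltonian `f` acts by `fineAct p f`.

**Existence.** On normally ordered operators the fields `D_i` and `u_j D_i` act as on symbols, while
`u_j E` acquires an extra term that lowers the order by one. The divergence operator
`divOp = ∑ ∂_{u_i} ∂_{ξ_i}` commutes with the former, and its commutator with the latter is, on each
degree, a multiple of the essential part of the extra term. A series in the powers of `divOp`
therefore intertwines the two actions as soon as a recursion for its coefficients can be solved
(`triang_intertwines`), and the denominators vanish only if `(m + 1) p` is an integer. This gives `P`
(`projQ`, `lie_projQ`). The same lemma gives `Φ`: in the contact frame the action of `χ(f)` on symbols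
is the action on fine symbols plus a term that lowers `zdeg` by one (`symAct_frame`), and the series
is in the powers of `gradZ`, the contact gradient composed with `∂_ζ` (`fineQ`,
`fineQ_intertwines`). The bound on the degree of `f` enters through the differential identities
`IsQuadHam`. Finally `Q = P ∘ Φ`.

**Uniqueness.** Two conformal quantizations differ by an endomorphism of the fine symbols that
commutes with all `fineAct p f`. It suffices that it preserves the summands of the fine symbols, as
its components there are then determined by the symbols. So let `τ` be an intertwining operator from
the symbols of degree `r` in the horizontal fibre variables and degree `l` in `ζ` to those of degrees
`(r', l') ≠ (r, l)`; the claim is `τ = 0` (`FineIntertwiner.eq_zero`).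

* The action of `χ(z)` is a grading, so `τ` lowers the weight `bdeg + 2 zexp` of the base coordinates
  by `n = r + 2 l - r' - 2 l'`. The translations `χ(1)`, `χ(x_k)`, `χ(y_k)` show that `τ` vanishes if
  it does on the symbols of weight `n`, which it maps to symbols with constant coefficients
  (`eq_zero_of_lowest`).
* The action of `χ(z²)` expresses `τ` on the multiples of `z` through its values on the symbols that
  do not involve `z` (`eq_zero_of_lowest_of_base`).
* On these acts the symplectic algebra spanned by the `χ(x_j x_k)`, `χ(x_j y_k)`, `χ(y_j y_k)`. By
  polarization they are generated by `x_o^n υ_o^r ζ^l`, where `υ_o` is the fibre variable of `y_o`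
  (`eq_zero_of_cyclic`). If the image of this generator is not zero, it is a multiple of a monomial
  `ξ_o^a υ_o^b ζ^l'` (`isHighest`).
* The action of `χ(z x_o)` and `χ(z y_o)` then yields two equations between `n`, `r`, `l`, `a`, `b` and
  `p` (`first_relation`, `second_relation`). Together they show that a translate of `2 (ℓ + 1) p` by
  an integer is rational and a root of a monic quadratic polynomial with integer coefficients. Hence
  `(m + 1) p` is an integer, contrary to the assumption (`gen_eq_zero`).
-/

set_option linter.unusedSimpArgs false

open scoped DirectSum

noncomputable section

namespace ContactQuant

variable {ℓ : ℕ}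

/-! ### Polynomials with prescribed exponents -/

section Monomials

variable {σ : Type*}

open MvPolynomial

/-- A linear map sends the polynomials with exponents in `A` into a submodule as soon as it does
so for the monomials. -/
lemma restrictSupport_le_comap {M : Type*} [AddCommGroup M] [Module ℂ M] {A : Set (σ →₀ ℕ)}
    {F : MvPolynomial σ ℂ →ₗ[ℂ] M} {S : Submodule ℂ M}
    (h : ∀ t ∈ A, F (monomial t 1) ∈ S) {s : MvPolynomial σ ℂ} (hs : s ∈ restrictSupport ℂ A) :
    F s ∈ S := by
  have : restrictSupport ℂ A ≤ S.comap F := by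
    rw [restrictSupport_eq_span, Submodule.span_le]
    rintro _ ⟨t, ht, rfl⟩
    exact h t ht
  exact this hs

/-- The projection that keeps the monomials with exponents in `A`. -/
def monoProj (A : Set (σ →₀ ℕ)) : MvPolynomial σ ℂ →ₗ[ℂ] MvPolynomial σ ℂ :=
  open Classical in
  (basisMonomials σ ℂ).constr ℂ fun t => if t ∈ A then monomial t 1 else 0

lemma monoProj_monomial (A : Set (σ →₀ ℕ)) [DecidablePred (· ∈ A)] (t : σ →₀ ℕ) :
    monoProj A (monomial t 1) = if t ∈ A then monomial t 1 else 0 := by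
  have := (basisMonomials σ ℂ).constr_basis ℂ
    (fun t => @ite _ (t ∈ A) (Classical.propDecidable _) (monomial t (1 : ℂ)) 0) t
  rw [coe_basisMonomials] at this
  refine this.trans ?_
  congr

lemma coeff_monoProj (A : Set (σ →₀ ℕ)) [DecidablePred (· ∈ A)] (t : σ →₀ ℕ)
    (s : MvPolynomial σ ℂ) : coeff t (monoProj A s) = if t ∈ A then coeff t s else 0 := by
  classical
  induction s using MvPolynomial.induction_on' with
  | monomial u a =>
    have e : monomial u a = a • monomial u (1 : ℂ) := by simp [smul_monomial]
    rw [e, map_smul, coeff_smul, monoProj_monomial, coeff_smul, coeff_monomial]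
    by_cases h : u = t
    · subst h; by_cases h : u ∈ A <;> simp [h]
    · split_ifs <;> simp [coeff_monomial, h]
  | add s u hs hu =>
    rw [map_add, coeff_add, hs, hu, coeff_add]
    split_ifs <;> simp

lemma mem_restrictSupport' {A : Set (σ →₀ ℕ)} {s : MvPolynomial σ ℂ} :
    s ∈ restrictSupport ℂ A ↔ ∀ t, coeff t s ≠ 0 → t ∈ A := by
  rw [mem_restrictSupport_iff]
  exact ⟨fun h t ht => h (by simpa using ht), fun h t ht => h t (by simpa using ht)⟩

lemma monomial_mem_of {A : Set (σ →₀ ℕ)} {t : σ →₀ ℕ} (ht : t ∈ A) (a : ℂ) :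
    monomial t a ∈ restrictSupport ℂ A := by
  classical
  rw [mem_restrictSupport']
  intro u hu
  rw [coeff_monomial] at hu
  split_ifs at hu with h
  · exact h ▸ ht
  · exact (hu rfl).elim

lemma monoProj_mem (A : Set (σ →₀ ℕ)) (s : MvPolynomial σ ℂ) :
    monoProj A s ∈ restrictSupport ℂ A := by
  classical
  rw [mem_restrictSupport']
  intro t ht
  rw [coeff_monoProj] at ht
  by_contra h
  exact ht (if_neg h)

lemma sub_monoProj_mem (A B : Set (σ →₀ ℕ)) {s : MvPolynomial σ ℂ}
    (hs : s ∈ restrictSupport ℂ B) : s - monoProj A s ∈ restrictSupport ℂ (B \ A) := by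
  classical
  rw [mem_restrictSupport'] at hs ⊢
  intro t ht
  rw [coeff_sub, coeff_monoProj] at ht
  by_cases h : t ∈ A
  · simp [h] at ht
  · exact ⟨hs t (by simpa [h] using ht), h⟩

lemma monoProj_of_mem {A : Set (σ →₀ ℕ)} {s : MvPolynomial σ ℂ} (hs : s ∈ restrictSupport ℂ A) :
    monoProj A s = s := by
  have := sub_monoProj_mem A A hs
  rw [Set.sdiff_self, mem_restrictSupport'] at this
  ext t
  by_contra h
  exact this t (by rw [coeff_sub]; exact sub_ne_zero.mpr (Ne.symm h))

lemma monoProj_eq_zero {A B : Set (σ →₀ ℕ)} {s : MvPolynomial σ ℂ}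
    (hs : s ∈ restrictSupport ℂ B) (hAB : Disjoint A B) : monoProj A s = 0 := by
  classical
  rw [mem_restrictSupport'] at hs
  ext t
  rw [coeff_monoProj, coeff_zero]
  split_ifs with h
  · by_contra h'
    exact Set.disjoint_left.mp hAB h (hs t h')
  · rfl

/-- The polynomials whose exponents `t` all have `g t = i`. -/
abbrev piece {ι : Type*} (g : (σ →₀ ℕ) → ι) (i : ι) : Submodule ℂ (MvPolynomial σ ℂ) :=
  restrictSupport ℂ {t | g t = i}

/-- Sorting the monomials by the value of `g` decomposes the polynomial ring. -/
lemma piece_isInternal {ι : Type*} [DecidableEq ι] (g : (σ →₀ ℕ) → ι) :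
    DirectSum.IsInternal (piece g) := by
  rw [DirectSum.isInternal_submodule_iff_iSupIndep_and_iSup_eq_top]
  constructor
  · rw [iSupIndep_def]
    intro i
    rw [Submodule.disjoint_def]
    intro s hs hs'
    have h1 : (⨆ j, ⨆ (_ : j ≠ i), piece g j) ≤ restrictSupport ℂ {t | g t ≠ i} :=
      iSup₂_le fun j hj => restrictSupport_mono _ fun t (ht : g t = j) => by
        simpa [ht] using hj
    rw [← monoProj_of_mem hs]
    exact monoProj_eq_zero (h1 hs') (Set.disjoint_left.mpr fun t h h' => h' h)
  · rw [eq_top_iff]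
    intro s _
    rw [as_sum s]
    exact Submodule.sum_mem _ fun t _ => Submodule.mem_iSup_of_mem (g t)
      (monomial_mem_of (A := {u | g u = g t}) rfl _)

/-- The identification of the polynomial ring with the direct sum of its pieces. -/
def pieceEquiv {ι : Type*} [DecidableEq ι] (g : (σ →₀ ℕ) → ι) :
    (⨁ i, piece g i) ≃ₗ[ℂ] MvPolynomial σ ℂ :=
  LinearEquiv.ofBijective (DirectSum.coeLinearMap (piece g)) (piece_isInternal g)

lemma pieceEquiv_symm_of_mem {ι : Type*} [DecidableEq ι] (g : (σ →₀ ℕ) → ι) {i : ι}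
    {s : MvPolynomial σ ℂ} (hs : s ∈ piece g i) :
    (pieceEquiv g).symm s = DirectSum.lof ℂ ι (fun i => piece g i) i ⟨s, hs⟩ := by
  rw [LinearEquiv.symm_apply_eq]
  exact (DirectSum.coeLinearMap_lof (piece g) i ⟨s, hs⟩).symm

/-- Linear maps agree as soon as they agree on every piece. -/
lemma ext_piece {ι M : Type*} [AddCommGroup M] [Module ℂ M] (g : (σ →₀ ℕ) → ι)
    {F G : MvPolynomial σ ℂ →ₗ[ℂ] M} (h : ∀ i, ∀ s ∈ piece g i, F s = G s) : F = G := by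
  apply (basisMonomials σ ℂ).ext
  intro t
  exact h (g t) _ (by
    rw [coe_basisMonomials]; exact monomial_mem_of (A := {u | g u = g t}) rfl _)

/-- The derivation that multiplies a monomial of exponent `t` by `∑ i, c i * t i`. -/
def eulerD (c : σ → ℂ) : Derivation ℂ (MvPolynomial σ ℂ) (MvPolynomial σ ℂ) :=
  mkDerivation ℂ fun i => c i • X i

lemma eulerD_X (c : σ → ℂ) (i : σ) : eulerD c (X i : MvPolynomial σ ℂ) = c i • X i :=
  mkDerivation_X ..

lemma eulerD_monomial [Fintype σ] (c : σ → ℂ) (t : σ →₀ ℕ) (a : ℂ) :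
    eulerD c (monomial t a) = (∑ i, c i * t i) • monomial t a := by
  rw [eulerD, mkDerivation_monomial, Finsupp.sum_fintype _ _ (by simp), Finset.sum_smul, Finset.smul_sum]
  refine Finset.sum_congr rfl fun i _ => ?_
  by_cases h : t i = 0
  · simp [h]
  · rw [smul_eq_mul, mul_smul_comm, X, monomial_mul, tsub_add_cancel_of_le
      (Finsupp.single_le_iff.mpr (Nat.one_le_iff_ne_zero.mpr h)), smul_monomial, smul_monomial,
      smul_monomial]
    congr 1
    simp only [smul_eq_mul, mul_one]
    ring

lemma coeff_eulerD [Fintype σ] (c : σ → ℂ) (t : σ →₀ ℕ) (s : MvPolynomial σ ℂ) :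
    coeff t (eulerD c s) = (∑ i, c i * t i) * coeff t s := by
  classical
  induction s using MvPolynomial.induction_on' with
  | monomial u a =>
    rw [eulerD_monomial, coeff_smul, coeff_monomial]
    split_ifs with h
    · subst h; rfl
    · simp
  | add s u hs hu => rw [map_add, coeff_add, hs, hu, coeff_add, mul_add]

/-- A polynomial is an eigenvector of `eulerD c` iff all its exponents have the eigenvalue as
their weight. -/
lemma eulerD_eq_iff [Fintype σ] (c : σ → ℂ) (κ : ℂ) (s : MvPolynomial σ ℂ) :
    eulerD c s = κ • s ↔ ∀ t, coeff t s ≠ 0 → ∑ i, c i * t i = κ := by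
  constructor
  · intro h t ht
    have := congrArg (coeff t) h
    rw [coeff_eulerD, coeff_smul, smul_eq_mul] at this
    exact mul_right_cancel₀ ht this
  · intro h
    ext t
    rw [coeff_eulerD, coeff_smul, smul_eq_mul]
    by_cases ht : coeff t s = 0
    · rw [ht, mul_zero, mul_zero]
    · rw [h t ht]

end Monomials

/-! ### Normal ordering -/

/-- Polynomials in the coordinates of `ℝ^m` (`Sum.inl`) and in one fibre variable for each of them
(`Sum.inr`), i.e. polynomial functions on the cotangent bundle. -/
abbrev Phase (ℓ : ℕ) : Type := MvPolynomial (Coord ℓ ⊕ Coord ℓ) ℂ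

/-- The base coordinates. -/
def bu (i : Coord ℓ) : Phase ℓ := MvPolynomial.X (Sum.inl i)
/-- The fibre coordinates. -/
def fv (i : Coord ℓ) : Phase ℓ := MvPolynomial.X (Sum.inr i)
/-- Partial derivatives in the base directions. -/
def du (i : Coord ℓ) : Derivation ℂ (Phase ℓ) (Phase ℓ) := MvPolynomial.pderiv (Sum.inl i)
/-- Partial derivatives in the fibre directions. -/
def dv (i : Coord ℓ) : Derivation ℂ (Phase ℓ) (Phase ℓ) := MvPolynomial.pderiv (Sum.inr i)

/-- Polynomials in the base coordinates as functions on the cotangent bundle. -/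
def base : Poly ℓ →ₐ[ℂ] Phase ℓ := MvPolynomial.rename Sum.inl

lemma base_X (i : Coord ℓ) : base (MvPolynomial.X i : Poly ℓ) = bu i := MvPolynomial.rename_X ..

section
variable (i j : Coord ℓ)
lemma du_bu [DecidableEq (Coord ℓ)] : du i (bu j) = if i = j then 1 else 0 := by
  simp only [du, bu, MvPolynomial.pderiv_X, Pi.single_apply, Sum.inl.injEq, eq_comm]
lemma dv_fv [DecidableEq (Coord ℓ)] : dv i (fv j) = if i = j then 1 else 0 := by
  simp only [dv, fv, MvPolynomial.pderiv_X, Pi.single_apply, Sum.inr.injEq, eq_comm]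
lemma du_fv : du i (fv j) = 0 := MvPolynomial.pderiv_X_of_ne (by simp)
lemma dv_bu : dv i (bu j) = 0 := MvPolynomial.pderiv_X_of_ne (by simp)
end

lemma phase_derivation_ext {D E : Derivation ℂ (Phase ℓ) (Phase ℓ)}
    (hu : ∀ i, D (bu i) = E (bu i)) (hv : ∀ i, D (fv i) = E (fv i)) : D = E := by
  apply MvPolynomial.derivation_ext
  rintro (i | i)
  exacts [hu i, hv i]

/-- The equality of two derivations of the phase space algebra, checked on the generators. -/
lemma phase_derivation_ext' {D E : Derivation ℂ (Phase ℓ) (Phase ℓ)}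
    (hx : ∀ i, D (bu (cx i)) = E (bu (cx i))) (hy : ∀ i, D (bu (cy i)) = E (bu (cy i)))
    (hz : D (bu cz) = E (bu cz)) (hfx : ∀ i, D (fv (cx i)) = E (fv (cx i)))
    (hfy : ∀ i, D (fv (cy i)) = E (fv (cy i))) (hfz : D (fv cz) = E (fv cz)) : D = E := by
  apply phase_derivation_ext
  · rintro (i | i | i)
    exacts [hx i, hy i, hz]
  · rintro (i | i | i)
    exacts [hfx i, hfy i, hfz]

/-- Induction over the generators of `Phase`. -/
lemma phase_induction {p : Phase ℓ → Prop} (s : Phase ℓ) (hC : ∀ a, p (MvPolynomial.C a))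
    (hadd : ∀ s t, p s → p t → p (s + t)) (hu : ∀ i s, p s → p (bu i * s))
    (hv : ∀ i s, p s → p (fv i * s)) : p s := by
  induction s using MvPolynomial.induction_on with
  | C a => exact hC a
  | add s t hs ht => exact hadd s t hs ht
  | mul_X s n hs =>
    rw [mul_comm]
    rcases n with n | n
    exacts [hu n s hs, hv n s hs]

lemma pd_commute (i j : Coord ℓ) : Commute (vecOp (MvPolynomial.pderiv i : Vec ℓ))
    (vecOp (MvPolynomial.pderiv j : Vec ℓ)) :=
  LinearMap.ext fun f => pd_comm i j f

lemma word_perm {L L' : List (Coord ℓ)} (h : L.Perm L') : word L = word L' := by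
  refine (h.map _).prod_eq' ?_
  exact List.pairwise_map.mpr (List.pairwise_of_forall fun a b => pd_commute a b)

/-- The word `D_{i_1} ⋯ D_{i_r}` of a multiset of indices. -/
def mword (m : Multiset (Coord ℓ)) : Module.End ℂ (Poly ℓ) := word m.toList

lemma word_append (L L' : List (Coord ℓ)) : word (L ++ L') = word L * word L' := by
  simp [word]

lemma mword_cons (i : Coord ℓ) (m : Multiset (Coord ℓ)) :
    mword (i ::ₘ m) = mword m * vecOp (MvPolynomial.pderiv i : Vec ℓ) := by
  have h : ((i ::ₘ m).toList).Perm (m.toList ++ [i]) := by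
    rw [← Multiset.coe_eq_coe, ← Multiset.coe_add, Multiset.coe_toList, Multiset.coe_toList, Multiset.coe_singleton, add_comm,
      Multiset.singleton_add]
  rw [mword, word_perm h, word_append, mword]
  simp [word]

lemma mulOp_add (f g : Poly ℓ) : mulOp (f + g) = mulOp f + mulOp g :=
  LinearMap.ext fun h => add_mul f g h

lemma mulOp_smul (c : ℂ) (f : Poly ℓ) : mulOp (c • f) = c • mulOp f :=
  LinearMap.ext fun h => smul_mul_assoc c f h

lemma vecOp_fsmul (f : Poly ℓ) (X : Vec ℓ) : vecOp (f • X) = mulOp f * vecOp X := rfl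

/-- Normal ordering: `f ξ_{i_1} ⋯ ξ_{i_r} ↦ f D_{i_1} ⋯ D_{i_r}`. -/
def normalOrder : Phase ℓ →ₗ[ℂ] Module.End ℂ (Poly ℓ) :=
  (MvPolynomial.basisMonomials _ ℂ).constr ℂ fun t =>
    mulOp (MvPolynomial.monomial (Finsupp.sumFinsuppAddEquivProdFinsupp t).1 1) *
      mword (Finsupp.toMultiset (Finsupp.sumFinsuppAddEquivProdFinsupp t).2)

lemma normalOrder_monomial (t : Coord ℓ ⊕ Coord ℓ →₀ ℕ) :
    normalOrder (MvPolynomial.monomial t 1) =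
      mulOp (MvPolynomial.monomial (Finsupp.sumFinsuppAddEquivProdFinsupp t).1 1) *
      mword (Finsupp.toMultiset (Finsupp.sumFinsuppAddEquivProdFinsupp t).2) := by
  have := (MvPolynomial.basisMonomials (Coord ℓ ⊕ Coord ℓ) ℂ).constr_basis ℂ (fun t =>
    mulOp (MvPolynomial.monomial (Finsupp.sumFinsuppAddEquivProdFinsupp t).1 1) *
      mword (Finsupp.toMultiset (Finsupp.sumFinsuppAddEquivProdFinsupp t).2)) t
  rwa [MvPolynomial.coe_basisMonomials] at this

lemma normalOrder_one : normalOrder (1 : Phase ℓ) = 1 := by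
  have : (1 : Phase ℓ) = MvPolynomial.monomial 0 1 := rfl
  rw [this, normalOrder_monomial, map_zero]
  simp [mword, word, mulOp_one]

lemma normalOrder_bu_mul (i : Coord ℓ) (s : Phase ℓ) :
    normalOrder (bu i * s) = mulOp (MvPolynomial.X i) * normalOrder s := by
  have : normalOrder ∘ₗ LinearMap.mulLeft ℂ (bu i)
      = LinearMap.mulLeft ℂ (mulOp (MvPolynomial.X i)) ∘ₗ normalOrder (ℓ := ℓ) := by
    apply (MvPolynomial.basisMonomials _ ℂ).ext
    intro t
    simp only [MvPolynomial.coe_basisMonomials, LinearMap.comp_apply, LinearMap.mulLeft_apply]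
    rw [bu, MvPolynomial.X, MvPolynomial.monomial_mul, one_mul, normalOrder_monomial, normalOrder_monomial, map_add,
      ← mul_assoc, ← mulOp_mul]
    have e : Finsupp.sumFinsuppAddEquivProdFinsupp (Finsupp.single (Sum.inl i : Coord ℓ ⊕ Coord ℓ) 1)
        = (Finsupp.single i 1, 0) := by
      ext j <;> simp [Finsupp.single_apply]
    rw [e, Prod.fst_add, Prod.snd_add, zero_add, MvPolynomial.X, MvPolynomial.monomial_mul, one_mul]
  exact LinearMap.congr_fun this s

lemma normalOrder_fv_mul (i : Coord ℓ) (s : Phase ℓ) :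
    normalOrder (fv i * s) = normalOrder s * vecOp (MvPolynomial.pderiv i : Vec ℓ) := by
  have : normalOrder ∘ₗ LinearMap.mulLeft ℂ (fv i)
      = LinearMap.mulRight ℂ (vecOp (MvPolynomial.pderiv i : Vec ℓ)) ∘ₗ normalOrder (ℓ := ℓ) := by
    apply (MvPolynomial.basisMonomials _ ℂ).ext
    intro t
    simp only [MvPolynomial.coe_basisMonomials, LinearMap.comp_apply, LinearMap.mulLeft_apply,
      LinearMap.mulRight_apply]
    rw [fv, MvPolynomial.X, MvPolynomial.monomial_mul, one_mul, normalOrder_monomial, normalOrder_monomial, map_add]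
    have e : Finsupp.sumFinsuppAddEquivProdFinsupp (Finsupp.single (Sum.inr i : Coord ℓ ⊕ Coord ℓ) 1)
        = (0, Finsupp.single i 1) := by
      ext j <;> simp [Finsupp.single_apply]
    rw [e, Prod.fst_add, Prod.snd_add, zero_add, map_add, Finsupp.toMultiset_single, one_smul,
      Multiset.singleton_add, mword_cons, mul_assoc]
  exact LinearMap.congr_fun this s

lemma normalOrder_base_mul (f : Poly ℓ) (s : Phase ℓ) :
    normalOrder (base f * s) = mulOp f * normalOrder s := by
  induction f using MvPolynomial.induction_on generalizing s with
  | C a =>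
    have h1 : mulOp (MvPolynomial.C a : Poly ℓ) = a • 1 := by
      rw [← mulOp_one, ← mulOp_smul, MvPolynomial.smul_eq_C_mul, mul_one]
    have h2 : base (MvPolynomial.C a : Poly ℓ) = MvPolynomial.C a := MvPolynomial.rename_C ..
    rw [h1, h2, ← MvPolynomial.smul_eq_C_mul, map_smul, smul_mul_assoc, one_mul]
  | add f g hf hg => rw [map_add, add_mul, map_add, hf, hg, mulOp_add, add_mul]
  | mul_X f i hf => rw [map_mul base, base_X, mul_assoc, hf, normalOrder_bu_mul, mulOp_mul, mul_assoc]

lemma normalOrder_base (f : Poly ℓ) : normalOrder (base f) = mulOp f := by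
  have := normalOrder_base_mul f 1
  rwa [normalOrder_one, mul_one, mul_one] at this

lemma du_leib (i : Coord ℓ) (s t : Phase ℓ) : du i (s * t) = s * du i t + t * du i s := by
  rw [Derivation.leibniz, smul_eq_mul, smul_eq_mul]
lemma dv_leib (i : Coord ℓ) (s t : Phase ℓ) : dv i (s * t) = s * dv i t + t * dv i s := by
  rw [Derivation.leibniz, smul_eq_mul, smul_eq_mul]

lemma pd_normalOrder (i : Coord ℓ) (s : Phase ℓ) :
    vecOp (MvPolynomial.pderiv i : Vec ℓ) * normalOrder s = normalOrder (fv i * s + du i s) := by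
  classical
  induction s using phase_induction with
  | hC a =>
    have : du i (MvPolynomial.C a) = 0 := Derivation.map_algebraMap _ _
    rw [this, add_zero, ← mul_one (MvPolynomial.C a), ← MvPolynomial.smul_eq_C_mul, mul_smul_comm, map_smul, map_smul,
      mul_smul_comm, normalOrder_fv_mul, normalOrder_one, mul_one, one_mul]
  | hadd s t hs ht =>
    rw [map_add, mul_add, hs, ht, ← map_add]
    congr 1
    rw [map_add]; ring
  | hu j s hs =>
    rw [normalOrder_bu_mul, ← mul_assoc, vecOp_mulOp, add_mul, mul_assoc, hs, du_leib, du_bu, pd_X,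
      mul_left_comm, map_add, map_add, normalOrder_bu_mul, mul_add, map_add, normalOrder_bu_mul]
    rw [add_assoc]
    simp only [eq_comm (a := j)]
    split_ifs
    · simp [mulOp_one]
    · have : mulOp (0 : Poly ℓ) = 0 := LinearMap.ext fun h => zero_mul h
      simp [this]
  | hv j s hs =>
    rw [normalOrder_fv_mul, ← mul_assoc, hs, du_leib, du_fv, mul_zero, add_zero, mul_left_comm, ← mul_add,
      normalOrder_fv_mul]

lemma normalOrder_mul_X (i : Coord ℓ) (s : Phase ℓ) :
    normalOrder s * mulOp (MvPolynomial.X i) = normalOrder (bu i * s + dv i s) := by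
  classical
  induction s using phase_induction with
  | hC a =>
    have : dv i (MvPolynomial.C a) = 0 := Derivation.map_algebraMap _ _
    rw [this, add_zero, ← mul_one (MvPolynomial.C a), ← MvPolynomial.smul_eq_C_mul, mul_smul_comm, map_smul, map_smul,
      smul_mul_assoc, normalOrder_bu_mul, normalOrder_one, mul_one, one_mul]
  | hadd s t hs ht =>
    rw [map_add, add_mul, hs, ht, ← map_add]
    congr 1
    rw [map_add]; ring
  | hu j s hs =>
    rw [normalOrder_bu_mul, mul_assoc, hs, dv_leib, dv_bu, mul_zero, add_zero, mul_left_comm, ← mul_add,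
      normalOrder_bu_mul]
  | hv j s hs =>
    rw [normalOrder_fv_mul, mul_assoc, vecOp_mulOp, mul_add, ← mul_assoc, hs, dv_leib, dv_fv, pd_X,
      mul_left_comm, map_add, map_add, normalOrder_fv_mul, add_mul, map_add, normalOrder_fv_mul]
    rw [add_assoc]
    split_ifs
    · simp [mulOp_one]
    · have : mulOp (0 : Poly ℓ) = 0 := LinearMap.ext fun h => zero_mul h
      simp [this]

/-! ### The order filtration on symbols -/

section Monomials

variable {σ : Type*}

open MvPolynomial

lemma X_mul_mem {A B : Set (σ →₀ ℕ)} (a : σ) (h : ∀ t ∈ A, t + Finsupp.single a 1 ∈ B)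
    {s : MvPolynomial σ ℂ} (hs : s ∈ restrictSupport ℂ A) : X a * s ∈ restrictSupport ℂ B := by
  refine restrictSupport_le_comap (F := LinearMap.mulLeft ℂ (X a)) (fun t ht => ?_) hs
  rw [LinearMap.mulLeft_apply, X, monomial_mul, add_comm]
  exact monomial_mem_of (h t ht) _

lemma pderiv_mem {A B : Set (σ →₀ ℕ)} (a : σ) (h : ∀ t, t + Finsupp.single a 1 ∈ A → t ∈ B)
    {s : MvPolynomial σ ℂ} (hs : s ∈ restrictSupport ℂ A) : pderiv a s ∈ restrictSupport ℂ B := by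
  refine restrictSupport_le_comap (F := (pderiv a).toLinearMap) (fun t ht => ?_) hs
  change pderiv a (monomial t 1) ∈ _
  rw [pderiv_monomial]
  by_cases h0 : t a = 0
  · simp [h0]
  · refine monomial_mem_of (h _ ?_) _
    rwa [tsub_add_cancel_of_le (Finsupp.single_le_iff.mpr (Nat.one_le_iff_ne_zero.mpr h0))]

lemma derivation_sum_apply {ι : Type*} (u : Finset ι)
    (D : ι → Derivation ℂ (MvPolynomial σ ℂ) (MvPolynomial σ ℂ)) (s : MvPolynomial σ ℂ) :
    (∑ i ∈ u, D i) s = ∑ i ∈ u, D i s := by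
  classical
  induction u using Finset.induction_on with
  | empty => simp
  | insert a u ha ih => simp [Finset.sum_insert ha, ih]

lemma eulerD_eq_sum [Fintype σ] (c : σ → ℂ) (s : MvPolynomial σ ℂ) :
    eulerD c s = ∑ i, c i • (X i * pderiv i s) := by
  classical
  have : eulerD c = ∑ i, (c i • X i : MvPolynomial σ ℂ) • pderiv (R := ℂ) i := by
    apply derivation_ext
    intro j
    rw [eulerD_X, derivation_sum_apply, Finset.sum_eq_single j]
    · simp
    · intro i _ hi
      simp [pderiv_X_of_ne hi.symm]
    · simp
  rw [this, derivation_sum_apply]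
  simp [Derivation.smul_apply]

end Monomials

/-- The degree of an exponent in the fibre variables. -/
def fdeg (t : Coord ℓ ⊕ Coord ℓ →₀ ℕ) : ℕ := ∑ i, t (Sum.inr i)

lemma fdeg_add (t u : Coord ℓ ⊕ Coord ℓ →₀ ℕ) : fdeg (t + u) = fdeg t + fdeg u := by
  simp [fdeg, Finset.sum_add_distrib]

lemma fdeg_inl (i : Coord ℓ) : fdeg (Finsupp.single (Sum.inl i) 1) = 0 := by
  simp [fdeg]

lemma fdeg_inr (i : Coord ℓ) : fdeg (Finsupp.single (Sum.inr i) 1) = 1 := by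
  classical
  simp only [fdeg, Finsupp.single_apply, Sum.inr.injEq]
  simp

/-- Symbols of fibre degree `< n`. -/
abbrev degLT (ℓ n : ℕ) : Submodule ℂ (Phase ℓ) :=
  MvPolynomial.restrictSupport ℂ {t | fdeg t < n}

lemma degLT_mono {a b : ℕ} (h : a ≤ b) : degLT ℓ a ≤ degLT ℓ b :=
  MvPolynomial.restrictSupport_mono _ fun _ ht => lt_of_lt_of_le ht h

lemma piece_le_degLT {k n : ℕ} (h : k < n) : piece (fdeg (ℓ := ℓ)) k ≤ degLT ℓ n :=
  MvPolynomial.restrictSupport_mono _ fun _ ht => lt_of_eq_of_lt ht h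

lemma bu_mul_mem {n : ℕ} (i : Coord ℓ) {s : Phase ℓ} (hs : s ∈ degLT ℓ n) :
    bu i * s ∈ degLT ℓ n :=
  X_mul_mem _ (fun t ht => by simpa [fdeg_add, fdeg_inl] using ht) hs

lemma fv_mul_mem {n : ℕ} (i : Coord ℓ) {s : Phase ℓ} (hs : s ∈ degLT ℓ n) :
    fv i * s ∈ degLT ℓ (n + 1) :=
  X_mul_mem _ (fun t ht => by simpa [fdeg_add, fdeg_inr] using ht) hs

lemma dv_mem {n : ℕ} (i : Coord ℓ) {s : Phase ℓ} (hs : s ∈ degLT ℓ (n + 1)) :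
    dv i s ∈ degLT ℓ n :=
  pderiv_mem _ (fun t ht => by simpa [fdeg_add, fdeg_inr] using ht) hs

lemma base_mul_mem {n : ℕ} (f : Poly ℓ) {s : Phase ℓ} (hs : s ∈ degLT ℓ n) :
    base f * s ∈ degLT ℓ n := by
  induction f using MvPolynomial.induction_on generalizing s with
  | C a =>
    have h2 : base (MvPolynomial.C a : Poly ℓ) = MvPolynomial.C a := MvPolynomial.rename_C ..
    rw [h2, ← MvPolynomial.smul_eq_C_mul]
    exact Submodule.smul_mem _ _ hs
  | add f g hf hg => rw [map_add, add_mul]; exact add_mem (hf hs) (hg hs)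
  | mul_X f i hf => rw [map_mul base, base_X, mul_assoc]; exact hf (bu_mul_mem i hs)

/-! ### Normal ordering is an isomorphism onto the differential operators -/

/-- Restriction to the zero section. -/
def zeroSec : Phase ℓ →ₐ[ℂ] Poly ℓ := MvPolynomial.aeval (Sum.elim MvPolynomial.X 0)

lemma normalOrder_apply_one (s : Phase ℓ) : normalOrder s 1 = zeroSec s := by
  induction s using phase_induction with
  | hC a =>
    rw [← mul_one (MvPolynomial.C a), ← MvPolynomial.smul_eq_C_mul, map_smul, map_smul,
      LinearMap.smul_apply, normalOrder_one, map_one zeroSec]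
    rfl
  | hadd s t hs ht => rw [map_add, map_add, LinearMap.add_apply, hs, ht]
  | hu i s hs =>
    rw [normalOrder_bu_mul, map_mul, ← hs, zeroSec, bu, MvPolynomial.aeval_X]
    rfl
  | hv i s hs =>
    rw [normalOrder_fv_mul, map_mul, zeroSec, fv, MvPolynomial.aeval_X, Sum.elim_inr,
      Pi.zero_apply, zero_mul]
    change normalOrder s (MvPolynomial.pderiv i 1) = 0
    rw [MvPolynomial.pderiv_one, map_zero]

lemma base_zeroSec {s : Phase ℓ} (hs : s ∈ piece fdeg 0) : base (zeroSec s) = s := by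
  have h : base (zeroSec s) - s ∈ (⊥ : Submodule ℂ (Phase ℓ)) := by
    refine restrictSupport_le_comap (F := (base.comp zeroSec).toLinearMap - LinearMap.id)
      (fun t ht => ?_) hs
    have h0 : ∀ i, t (Sum.inr i) = 0 := by
      have : ∑ i, t (Sum.inr i) = 0 := ht
      exact fun i => Finset.sum_eq_zero_iff.mp this i (Finset.mem_univ i)
    have e : MvPolynomial.monomial t (1 : ℂ) = ∏ i, bu i ^ t (Sum.inl i) := by
      rw [MvPolynomial.monomial_eq, Finsupp.prod_fintype _ _ (by simp), map_one, one_mul, Fintype.prod_sum_type]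
      simp [h0, bu]
    simp only [LinearMap.sub_apply, AlgHom.toLinearMap_apply, AlgHom.comp_apply, LinearMap.id_apply,
      Submodule.mem_bot, sub_eq_zero]
    rw [e, map_prod, map_prod]
    refine Finset.prod_congr rfl fun i _ => ?_
    rw [map_pow, map_pow, zeroSec, bu, MvPolynomial.aeval_X, Sum.elim_inl, base_X]
    rfl
  rwa [Submodule.mem_bot, sub_eq_zero] at h

lemma mem_degLT_zero {s : Phase ℓ} (hs : s ∈ degLT ℓ 0) : s = 0 := by
  rw [mem_restrictSupport'] at hs
  ext t
  by_contra h
  exact absurd (hs t (by simpa using h)) (Nat.not_lt_zero _)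

lemma mem_degLT_some (s : Phase ℓ) : ∃ n, s ∈ degLT ℓ n := by
  refine ⟨s.support.sup fdeg + 1, ?_⟩
  rw [mem_restrictSupport']
  intro t ht
  exact Nat.lt_succ_of_le (Finset.le_sup (by simpa using ht))

/-- The degree operator in the fibre variables. -/
def Ef : Derivation ℂ (Phase ℓ) (Phase ℓ) := eulerD (Sum.elim 0 1)

lemma Ef_eq_sum (s : Phase ℓ) : Ef s = ∑ i, fv i * dv i s := by
  rw [Ef, eulerD_eq_sum, Fintype.sum_sum_type]
  simp [fv, dv]

lemma mem_piece_fdeg {k : ℕ} {s : Phase ℓ} : s ∈ piece fdeg k ↔ Ef s = (k : ℂ) • s := by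
  rw [Ef, eulerD_eq_iff, mem_restrictSupport']
  refine forall₂_congr fun t _ => ?_
  rw [Fintype.sum_sum_type]
  simp only [Sum.elim_inl, Sum.elim_inr, Pi.zero_apply, Pi.one_apply, zero_mul,
    one_mul, Finset.sum_const_zero, zero_add]
  rw [Set.mem_ofPred_eq, fdeg, ← Nat.cast_sum, Nat.cast_inj]

lemma normalOrder_eq_zero {s : Phase ℓ} (h : normalOrder s = 0) : s = 0 := by
  obtain ⟨n, hn⟩ := mem_degLT_some s
  induction n generalizing s with
  | zero => exact mem_degLT_zero hn
  | succ n ih =>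
    have h1 : ∀ i, dv i s = 0 := fun i => ih (by
      have := normalOrder_mul_X i s
      rw [map_add, normalOrder_bu_mul, h, mul_zero, zero_mul, zero_add] at this
      exact this.symm) (dv_mem i hn)
    have h2 : s ∈ piece fdeg 0 := by
      rw [mem_piece_fdeg, Ef_eq_sum]
      simp [h1]
    rw [← base_zeroSec h2, ← normalOrder_apply_one, h]
    simp

lemma normalOrder_injective : Function.Injective (normalOrder (ℓ := ℓ)) :=
  (injective_iff_map_eq_zero _).mpr fun _ => normalOrder_eq_zero

lemma normalOrder_prod_fv (L : List (Coord ℓ)) (f : Poly ℓ) :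
    normalOrder ((L.map fv).prod * base f) = mulOp f * word L := by
  suffices h : ∀ s : Phase ℓ, normalOrder ((L.map fv).prod * s) = normalOrder s * word L by
    rw [h, normalOrder_base]
  intro s
  induction L generalizing s with
  | nil => simp [word]
  | cons i L ih =>
    have h1 : word (i :: L) = vecOp (MvPolynomial.pderiv i : Vec ℓ) * word L := rfl
    rw [h1, List.map_cons, List.prod_cons, mul_right_comm, mul_comm (fv i * s), ih,
      normalOrder_fv_mul, mul_assoc]

/-- Operators of order `< n` are the normal orderings of the symbols of degree `< n`. -/
lemma map_normalOrder_degLT (n : ℕ) : (degLT ℓ n).map normalOrder = opLT ℓ n := by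
  apply le_antisymm
  · rw [Submodule.map_le_iff_le_comap]
    intro s hs
    change normalOrder s ∈ opLT ℓ n
    refine restrictSupport_le_comap (F := normalOrder) (fun t ht => ?_) hs
    rw [normalOrder_monomial]
    refine mem_opLT _ _ ?_
    rw [Multiset.length_toList, Finsupp.card_toMultiset, Finsupp.sum_fintype _ _ (by simp)]
    exact ht
  · rw [opLT, Submodule.span_le]
    rintro _ ⟨f, L, hL, rfl⟩
    refine ⟨_, ?_, normalOrder_prod_fv L f⟩
    have : ∀ L : List (Coord ℓ), (L.map fv).prod * base f ∈ degLT ℓ (L.length + 1) := by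
      intro L
      induction L with
      | nil =>
        rw [List.map_nil, List.prod_nil, mul_comm]
        exact base_mul_mem f (monomial_mem_of (A := {t | fdeg t < 1}) (t := 0) (by simp [fdeg]) 1)
      | cons i L ih =>
        rw [List.map_cons, List.prod_cons, mul_assoc]
        exact fv_mul_mem i ih
    exact degLT_mono hL (this L)

lemma normalOrder_mem_opLT {n : ℕ} {s : Phase ℓ} : normalOrder s ∈ opLT ℓ n ↔ s ∈ degLT ℓ n := by
  rw [← map_normalOrder_degLT]
  constructor
  · rintro ⟨s', hs', h⟩
    rwa [← normalOrder_injective h]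
  · exact fun h => ⟨s, h, rfl⟩

/-! ### The action of vector fields on symbols -/

/-- The Hamiltonian lift of a vector field to the cotangent bundle. -/
def hamDer (X : Vec ℓ) : Derivation ℂ (Phase ℓ) (Phase ℓ) :=
  MvPolynomial.mkDerivation ℂ (Sum.elim (fun i => base (X (MvPolynomial.X i)))
    fun j => -∑ i, base (MvPolynomial.pderiv j (X (MvPolynomial.X i))) * fv i)

lemma hamDer_bu (X : Vec ℓ) (i : Coord ℓ) : hamDer X (bu i) = base (X (MvPolynomial.X i)) :=
  MvPolynomial.mkDerivation_X ..

lemma hamDer_fv (X : Vec ℓ) (j : Coord ℓ) :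
    hamDer X (fv j) = -∑ i, base (MvPolynomial.pderiv j (X (MvPolynomial.X i))) * fv i :=
  MvPolynomial.mkDerivation_X ..

lemma hamDer_add (X Y : Vec ℓ) : hamDer (X + Y) = hamDer X + hamDer Y := by
  apply phase_derivation_ext
  · intro i
    simp only [hamDer_bu, Derivation.add_apply, map_add]
  · intro i
    simp only [hamDer_fv, Derivation.add_apply, map_add, add_mul, Finset.sum_add_distrib, neg_add]

lemma hamDer_smul (c : ℂ) (X : Vec ℓ) : hamDer (c • X) = c • hamDer X := by
  apply phase_derivation_ext
  · intro i
    simp only [hamDer_bu, Derivation.smul_apply, map_smul]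
  · intro i
    simp only [hamDer_fv, Derivation.smul_apply, map_smul, smul_neg, Finset.smul_sum, smul_mul_assoc,
      Derivation.map_smul]

/-- The action of a vector field on symbols of operators that shift the density weight by `p`. -/
def symAct (p : ℂ) : Vec ℓ →ₗ[ℂ] Module.End ℂ (Phase ℓ) where
  toFun X := (hamDer X).toLinearMap + LinearMap.mulLeft ℂ (p • base (div X))
  map_add' X Y := LinearMap.ext fun s => by
    change hamDer (X + Y) s + p • base (div (X + Y)) * s
      = (hamDer X s + p • base (div X) * s) + (hamDer Y s + p • base (div Y) * s)
    rw [hamDer_add, div_add, map_add, smul_add, Derivation.add_apply, add_mul]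
    ring
  map_smul' c X := LinearMap.ext fun s => by
    change hamDer (c • X) s + p • base (div (c • X)) * s
      = c • (hamDer X s + p • base (div X) * s)
    rw [hamDer_smul, div_smul, map_smul, smul_add, Derivation.smul_apply, smul_comm p c,
      smul_mul_assoc]

lemma symAct_apply (p : ℂ) (X : Vec ℓ) (s : Phase ℓ) :
    symAct p X s = hamDer X s + p • (base (div X) * s) := by
  rw [← smul_mul_assoc]; rfl

lemma div_pd (i : Coord ℓ) : div (MvPolynomial.pderiv i : Vec ℓ) = 0 := by
  classical
  refine Finset.sum_eq_zero fun j _ => ?_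
  rw [pd_X]
  split_ifs <;> simp

lemma div_fsmul (f : Poly ℓ) (X : Vec ℓ) : div (f • X) = f * div X + X f := by
  rw [vec_apply X f]
  simp only [div, Derivation.smul_apply, smul_eq_mul, Derivation.leibniz, Finset.sum_add_distrib,
    Finset.mul_sum]

lemma div_euler : div (euler ℓ) = ((2 * ℓ + 1 : ℕ) : Poly ℓ) := by
  simp only [div, euler_X, MvPolynomial.pderiv_X_self]
  simp
  ring

lemma div_X_euler (j : Coord ℓ) : div ((MvPolynomial.X j : Poly ℓ) • euler ℓ)
    = ((2 * ℓ + 2 : ℕ) : ℂ) • MvPolynomial.X j := by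
  rw [div_fsmul, div_euler, euler_X, MvPolynomial.smul_eq_C_mul]
  simp only [map_natCast]
  push_cast
  ring

/-- The Euler field in the base directions. -/
def Eu : Derivation ℂ (Phase ℓ) (Phase ℓ) := eulerD (Sum.elim 1 0)

lemma Eu_eq_sum (s : Phase ℓ) : Eu s = ∑ i, bu i * du i s := by
  rw [Eu, eulerD_eq_sum, Fintype.sum_sum_type]
  simp [bu, du]

lemma Eu_bu (i : Coord ℓ) : Eu (bu i) = bu i := by simp [Eu, bu, eulerD_X]
lemma Eu_fv (i : Coord ℓ) : Eu (fv i) = 0 := by simp [Eu, fv, eulerD_X]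
lemma Ef_bu (i : Coord ℓ) : Ef (bu i) = 0 := by simp [Ef, bu, eulerD_X]
lemma Ef_fv (i : Coord ℓ) : Ef (fv i) = fv i := by simp [Ef, fv, eulerD_X]

lemma symAct_pd (p : ℂ) (i : Coord ℓ) (s : Phase ℓ) :
    symAct p (MvPolynomial.pderiv i) s = du i s := by
  classical
  have : hamDer (MvPolynomial.pderiv i : Vec ℓ) = du i := by
    apply phase_derivation_ext
    · intro j
      rw [hamDer_bu, du_bu, pd_X]
      simp only [eq_comm (a := j)]
      split_ifs <;> simp
    · intro j
      rw [hamDer_fv, du_fv, neg_eq_zero]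
      refine Finset.sum_eq_zero fun k _ => ?_
      rw [pd_X]
      split_ifs <;> simp
  rw [symAct_apply, this, div_pd, map_zero, zero_mul, smul_zero, add_zero]

lemma symAct_X_pd (p : ℂ) (i j : Coord ℓ) (s : Phase ℓ) [Decidable (j = i)] :
    symAct p ((MvPolynomial.X j : Poly ℓ) • (MvPolynomial.pderiv i : Vec ℓ)) s
      = bu j * du i s - fv i * dv j s + (if j = i then p else 0) • s := by
  classical
  have : hamDer ((MvPolynomial.X j : Poly ℓ) • (MvPolynomial.pderiv i : Vec ℓ))
      = bu j • du i - fv i • dv j := by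
    apply phase_derivation_ext
    · intro k
      simp only [hamDer_bu, Derivation.sub_apply, Derivation.smul_apply, du_bu, dv_bu, pd_X, map_mul,
        smul_eq_mul, base_X, mul_zero, sub_zero, eq_comm (a := k)]
      split_ifs <;> simp
    · intro k
      simp only [hamDer_fv, Derivation.sub_apply, Derivation.smul_apply, du_fv, dv_fv, pd_X,
        smul_eq_mul, mul_zero, zero_sub]
      rw [Finset.sum_eq_single i]
      · simp only [if_true, mul_one, pd_X]
        split_ifs <;> simp
      · intro b _ hb
        simp [hb]
      · simp
  rw [symAct_apply, this, div_fsmul, div_pd, mul_zero, zero_add, pd_X]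
  simp only [Derivation.sub_apply, Derivation.smul_apply, smul_eq_mul]
  split_ifs <;> simp

lemma symAct_X_euler (p : ℂ) (j : Coord ℓ) (s : Phase ℓ) :
    symAct p ((MvPolynomial.X j : Poly ℓ) • euler ℓ) s
      = bu j * Eu s - (∑ i, bu i * fv i) * dv j s - bu j * Ef s
        + (p * (2 * ℓ + 2 : ℕ)) • (bu j * s) := by
  classical
  have : hamDer ((MvPolynomial.X j : Poly ℓ) • euler ℓ)
      = (bu j : Phase ℓ) • Eu - (∑ i, bu i * fv i : Phase ℓ) • dv j - (bu j : Phase ℓ) • Ef := by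
    apply phase_derivation_ext
    · intro k
      simp only [hamDer_bu, Derivation.sub_apply, Derivation.smul_apply, dv_bu, euler_X, map_mul,
        smul_eq_mul, base_X, mul_zero, sub_zero, Eu_bu, Ef_bu]
    · intro k
      simp only [hamDer_fv, Derivation.sub_apply, Derivation.smul_apply, Eu_fv, Ef_fv, dv_fv, euler_X,
        smul_eq_mul, mul_zero, zero_sub, Derivation.leibniz, pd_X]
      have h1 : ∀ i, base (MvPolynomial.X j * (if i = k then 1 else 0)
          + MvPolynomial.X i * (if j = k then 1 else 0)) * fv i
          = (if i = k then bu j * fv k else 0) + (bu i * fv i) * if j = k then 1 else 0 := by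
        intro i
        rw [map_add, map_mul, map_mul, base_X, base_X]
        by_cases hi : i = k <;> by_cases hj : j = k <;> simp [hi, hj] <;> try ring
      rw [Finset.sum_congr rfl fun i _ => h1 i, Finset.sum_add_distrib, ← Finset.sum_mul,
        Finset.sum_ite_eq' Finset.univ k]
      simp
      ring
  rw [symAct_apply, this, div_X_euler]
  simp only [Derivation.sub_apply, Derivation.smul_apply, smul_eq_mul, map_smul, base_X, smul_smul,
    smul_mul_assoc]

/-! ### The projective algebra acting on normally ordered operators -/

lemma lie_normalOrder (lam p : ℂ) (X : Vec ℓ) (s : Phase ℓ) :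
    ⁅X, toHom ℓ lam p (normalOrder s)⁆ = toHom ℓ lam p (vecOp X * normalOrder s
      - normalOrder s * vecOp X + normalOrder (((lam + p) • base (div X)) * s)
      - lam • (normalOrder s * mulOp (div X))) := by
  rw [lie_toHom]
  refine congrArg (toHom ℓ lam p) ?_
  rw [← map_smul, normalOrder_base_mul, add_mul, mul_add, mulOp_smul lam, mul_smul_comm]
  abel

lemma lie_pd_normalOrder (lam p : ℂ) (i : Coord ℓ) (s : Phase ℓ) :
    ⁅(MvPolynomial.pderiv i : Vec ℓ), toHom ℓ lam p (normalOrder s)⁆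
      = toHom ℓ lam p (normalOrder (symAct p (MvPolynomial.pderiv i) s)) := by
  have h0 : mulOp (0 : Poly ℓ) = 0 := LinearMap.ext fun h => zero_mul h
  rw [lie_normalOrder, symAct_pd, div_pd, map_zero, smul_zero, zero_mul, map_zero, h0, mul_zero,
    smul_zero, pd_normalOrder, ← normalOrder_fv_mul, ← map_sub, add_sub_cancel_left, add_zero,
    sub_zero]

lemma lie_X_pd_normalOrder (lam p : ℂ) (i j : Coord ℓ) (s : Phase ℓ) :
    ⁅((MvPolynomial.X j : Poly ℓ) • MvPolynomial.pderiv i : Vec ℓ),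
        toHom ℓ lam p (normalOrder s)⁆
      = toHom ℓ lam p (normalOrder
          (symAct p ((MvPolynomial.X j : Poly ℓ) • MvPolynomial.pderiv i) s)) := by
  classical
  have h0 : mulOp (0 : Poly ℓ) = 0 := LinearMap.ext fun h => zero_mul h
  rw [lie_normalOrder, symAct_X_pd, vecOp_fsmul, mul_assoc, pd_normalOrder, ← normalOrder_bu_mul,
    ← mul_assoc, normalOrder_mul_X, ← normalOrder_fv_mul, div_fsmul, div_pd, mul_zero, zero_add, pd_X]
  refine congrArg (toHom ℓ lam p) ?_
  split_ifs
  · rw [mulOp_one, mul_one, map_one, ← map_smul, ← map_sub, ← map_add, ← map_sub]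
    refine congrArg normalOrder ?_
    simp only [MvPolynomial.smul_eq_C_mul, map_add]
    ring
  · rw [h0, mul_zero, map_zero, smul_zero, smul_zero, zero_mul, map_zero, zero_smul, add_zero,
      add_zero, sub_zero, ← map_sub]
    refine congrArg normalOrder ?_
    ring

lemma vecOp_euler : vecOp (euler ℓ)
    = ∑ i, mulOp (MvPolynomial.X i) * vecOp (MvPolynomial.pderiv i : Vec ℓ) := by
  apply LinearMap.ext
  intro f
  rw [vecOp_apply, euler, sum_apply, LinearMap.sum_apply]
  rfl

lemma lie_X_euler_normalOrder (lam p : ℂ) (j : Coord ℓ) (s : Phase ℓ) :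
    ⁅((MvPolynomial.X j : Poly ℓ) • euler ℓ : Vec ℓ), toHom ℓ lam p (normalOrder s)⁆
      = toHom ℓ lam p (normalOrder (symAct p ((MvPolynomial.X j : Poly ℓ) • euler ℓ) s
          - (Ef (dv j s) + (lam * (2 * ℓ + 2 : ℕ)) • dv j s))) := by
  classical
  have h : ∀ (i : Coord ℓ) (t : Phase ℓ), normalOrder t * (mulOp (MvPolynomial.X i)
      * vecOp (MvPolynomial.pderiv i : Vec ℓ)) = normalOrder (fv i * (bu i * t + dv i t)) := by
    intro i t
    rw [← mul_assoc, normalOrder_mul_X, ← normalOrder_fv_mul]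
  rw [lie_normalOrder, symAct_X_euler, vecOp_fsmul, vecOp_euler, div_X_euler, mul_assoc,
    Finset.sum_mul, ← mul_assoc (normalOrder s), normalOrder_mul_X, Finset.mul_sum, Finset.mul_sum,
    mulOp_smul, mul_smul_comm, normalOrder_mul_X, map_smul, base_X]
  simp only [mul_assoc (mulOp _), pd_normalOrder, h, ← normalOrder_bu_mul]
  refine congrArg (toHom ℓ lam p) ?_
  simp only [← map_sum, ← map_sub, ← map_add, ← map_smul]
  refine congrArg normalOrder ?_
  simp only [Eu_eq_sum, Ef_eq_sum, dv_leib, dv_bu, map_add, mul_add, Finset.sum_add_distrib,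
    MvPolynomial.smul_eq_C_mul, map_mul, Finset.mul_sum, Finset.sum_mul, mul_zero, add_zero]
  have h1 : ∀ i, bu j * (bu i * (fv i * s)) = fv i * (bu i * (bu j * s)) := fun i => by ring
  have h2 : ∀ i, fv i * (bu i * dv j s) = bu i * fv i * dv j s := fun i => by ring
  have h3 : ∀ i, bu j * (fv i * dv i s) = fv i * (bu j * dv i s) := fun i => by ring
  simp only [h1, h2, h3]
  ring

/-! ### Unipotent intertwiners built from a lowering operator -/

section Triangular

variable {σ : Type*}

open MvPolynomial

/-- `G` lowers the degree `g` by one. -/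
structure Lowers (g : (σ →₀ ℕ) → ℕ) (G : Module.End ℂ (MvPolynomial σ ℂ)) : Prop where
  zero : ∀ s ∈ piece g 0, G s = 0
  succ : ∀ d, ∀ s ∈ piece g (d + 1), G s ∈ piece g d

variable {g : (σ →₀ ℕ) → ℕ} {G : Module.End ℂ (MvPolynomial σ ℂ)}

lemma Lowers.pow_mem (hG : Lowers g G) (j : ℕ) {d : ℕ} {s : MvPolynomial σ ℂ}
    (hs : s ∈ piece g (d + j)) : (G ^ j) s ∈ piece g d := by
  induction j generalizing s d with
  | zero => exact hs
  | succ j ih =>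
    rw [pow_succ, Module.End.mul_apply]
    exact ih (hG.succ _ _ hs)

/-- The operator that is `∑ j ≤ d, c d j • G ^ j` on the elements of degree `d`. -/
def triang (g : (σ →₀ ℕ) → ℕ) (G : Module.End ℂ (MvPolynomial σ ℂ)) (c : ℕ → ℕ → ℂ) :
    Module.End ℂ (MvPolynomial σ ℂ) :=
  DirectSum.toModule ℂ ℕ (MvPolynomial σ ℂ)
    (fun d => (∑ j ∈ Finset.range (d + 1), c d j • G ^ j) ∘ₗ (piece g d).subtype)
    ∘ₗ (pieceEquiv g).symm.toLinearMap

lemma triang_apply (G : Module.End ℂ (MvPolynomial σ ℂ)) (c : ℕ → ℕ → ℂ) {d : ℕ}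
    {s : MvPolynomial σ ℂ} (hs : s ∈ piece g d) :
    triang g G c s = ∑ j ∈ Finset.range (d + 1), c d j • (G ^ j) s := by
  rw [triang, LinearMap.comp_apply, LinearEquiv.coe_coe, pieceEquiv_symm_of_mem g hs,
    DirectSum.toModule_lof]
  simp [LinearMap.sum_apply]

lemma triang_sub_mem (hG : Lowers g G) {c : ℕ → ℕ → ℂ} (hc : ∀ d, c d 0 = 1)
    {M : Submodule ℂ (MvPolynomial σ ℂ)} (hM : ∀ s ∈ M, G s ∈ M) {d : ℕ}
    {s : MvPolynomial σ ℂ} (hs : s ∈ piece g d) (hsM : s ∈ M) :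
    triang g G c s - s ∈ restrictSupport ℂ {t | g t < d} ⊓ M := by
  rw [triang_apply G c hs, Finset.sum_range_succ', hc, pow_zero, one_smul, Module.End.one_apply,
    add_sub_cancel_right]
  refine Submodule.sum_mem _ fun j hj => Submodule.smul_mem _ _ ⟨?_, ?_⟩
  · have h1 : j + 1 ≤ d := Nat.succ_le_of_lt (Finset.mem_range.mp hj)
    have h2 : (G ^ (j + 1)) s ∈ piece g (d - (j + 1)) :=
      hG.pow_mem (j + 1) (by rwa [Nat.sub_add_cancel h1])
    exact restrictSupport_mono _ (fun t (ht : g t = _) => by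
      change g t < d
      omega) h2
  · clear hj
    have : ∀ j, (G ^ j) s ∈ M := by
      intro j
      induction j with
      | zero => exact hsM
      | succ j ih => rw [pow_succ', Module.End.mul_apply]; exact hM _ ih
    exact this _

lemma triang_sub_mem_lt (hG : Lowers g G) {c : ℕ → ℕ → ℂ} (hc : ∀ d, c d 0 = 1) {n : ℕ}
    {s : MvPolynomial σ ℂ} (hs : s ∈ restrictSupport ℂ {t | g t < n + 1}) :
    triang g G c s - s ∈ restrictSupport ℂ {t | g t < n} := by
  refine restrictSupport_le_comap (F := triang g G c - LinearMap.id) (fun t ht => ?_) hs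
  have h := (triang_sub_mem hG hc (M := ⊤) (fun _ _ => trivial)
    (monomial_mem_of (A := {u | g u = g t}) rfl 1) trivial).1
  exact restrictSupport_mono _ (fun u (hu : g u < g t) =>
    lt_of_lt_of_le hu (Nat.lt_succ_iff.mp ht)) h

lemma mem_lt_some (g : (σ →₀ ℕ) → ℕ) (s : MvPolynomial σ ℂ) :
    ∃ n, s ∈ restrictSupport ℂ {t | g t < n} := by
  refine ⟨s.support.sup g + 1, ?_⟩
  rw [mem_restrictSupport']
  intro t ht
  exact Nat.lt_succ_of_le (Finset.le_sup (by simpa using ht))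

lemma mem_lt_zero {s : MvPolynomial σ ℂ} (hs : s ∈ restrictSupport ℂ {t | g t < 0}) : s = 0 := by
  rw [mem_restrictSupport'] at hs
  ext t
  by_contra h
  exact absurd (hs t (by simpa using h)) (Nat.not_lt_zero _)

lemma triang_bijective (hG : Lowers g G) {c : ℕ → ℕ → ℂ} (hc : ∀ d, c d 0 = 1) :
    Function.Bijective (triang g G c) := by
  constructor
  · rw [injective_iff_map_eq_zero]
    intro s h
    obtain ⟨n, hn⟩ := mem_lt_some g s
    induction n with
    | zero => exact mem_lt_zero hn
    | succ n ih =>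
      have := triang_sub_mem_lt hG hc hn
      rw [h, zero_sub, Submodule.neg_mem_iff] at this
      exact ih this
  · intro s
    obtain ⟨n, hn⟩ := mem_lt_some g s
    induction n generalizing s with
    | zero => exact ⟨0, by rw [mem_lt_zero hn, map_zero]⟩
    | succ n ih =>
      obtain ⟨u, hu⟩ := ih _ (triang_sub_mem_lt hG hc hn)
      exact ⟨s - u, by rw [map_sub, hu, sub_sub_cancel]⟩

/-- The coefficients of the intertwiner in `triang_intertwines`. -/
def triCoef (γ ν : ℕ → ℂ) (d j : ℕ) : ℂ :=
  ∏ i ∈ Finset.range j, ν (d - i) / ∑ a ∈ Finset.range (i + 1), γ (d - a)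

/-- Suppose that `L` preserves the degree, that `K` lowers it and commutes with `G`, and that
`[G, L] = γ(d) K` on the elements of degree `d`. Then `triang` intertwines `L` with the
perturbation `L + ν(d) K`: comparing the coefficients of `K G ^ j` gives a recursion for the
coefficients of `triang`, solvable as the sums `γ(d) + γ(d-1) + ⋯` do not vanish. -/
lemma triang_intertwines (hG : Lowers g G) {γ ν : ℕ → ℂ} {L K L' : Module.End ℂ (MvPolynomial σ ℂ)}
    (hγ : ∀ d j, j < d → ∑ a ∈ Finset.range (j + 1), γ (d - a) ≠ 0)
    (hL : ∀ d, ∀ s ∈ piece g d, L s ∈ piece g d) (hK : ∀ s ∈ piece g 0, K s = 0)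
    (hKG : ∀ s, G (K s) = K (G s))
    (hGL : ∀ d, ∀ s ∈ piece g d, G (L s) = L (G s) + γ d • K s)
    (hL' : ∀ d, ∀ s ∈ piece g d, L' s = L s + ν d • K s) (s : MvPolynomial σ ℂ) :
    L' (triang g G (triCoef γ ν) s) = triang g G (triCoef γ ν) (L s) := by
  suffices h : L' ∘ₗ triang g G (triCoef γ ν) = triang g G (triCoef γ ν) ∘ₗ L from
    LinearMap.congr_fun h s
  refine ext_piece g fun d s hs => ?_
  have hpow : ∀ j, j ≤ d → (G ^ j) s ∈ piece g (d - j) := fun j hj =>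
    hG.pow_mem j (by rwa [Nat.sub_add_cancel hj])
  have hKpow : ∀ j s, (G ^ j) (K s) = K ((G ^ j) s) := by
    intro j s
    induction j generalizing s with
    | zero => rfl
    | succ j ih => rw [pow_succ, Module.End.mul_apply, hKG, ih, Module.End.mul_apply]
  have key : ∀ j, j < d → (G ^ (j + 1)) (L s) = L ((G ^ (j + 1)) s)
      + (∑ a ∈ Finset.range (j + 1), γ (d - a)) • K ((G ^ j) s) := by
    intro j hj
    induction j with
    | zero => simpa using hGL d s hs
    | succ j ih =>
      have h1 : ∀ i u, (G ^ (i + 1)) u = G ((G ^ i) u) := fun i u => by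
        rw [pow_succ', Module.End.mul_apply]
      rw [h1 (j + 1), ih (by omega), map_add, map_smul, hGL _ _ (hpow (j + 1) hj.le), hKG, ← h1,
        ← h1, Finset.sum_range_succ _ (j + 1), add_smul]
      abel
  simp only [LinearMap.comp_apply]
  rw [triang_apply _ _ hs, triang_apply _ _ (hL d s hs), map_sum]
  have e1 : ∀ j ∈ Finset.range (d + 1), L' (triCoef γ ν d j • (G ^ j) s)
      = triCoef γ ν d j • L ((G ^ j) s) + (triCoef γ ν d j * ν (d - j)) • K ((G ^ j) s) := by
    intro j hj
    rw [map_smul, hL' _ _ (hpow j (Nat.lt_succ_iff.mp (Finset.mem_range.mp hj))), smul_add,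
      smul_smul]
  rw [Finset.sum_congr rfl e1, Finset.sum_add_distrib, Finset.sum_range_succ (fun j =>
    (triCoef γ ν d j * ν (d - j)) • K ((G ^ j) s)),
    hK _ (by simpa using hpow d le_rfl), smul_zero, add_zero,
    Finset.sum_range_succ' (fun j => triCoef γ ν d j • L ((G ^ j) s)),
    Finset.sum_range_succ' (fun j => triCoef γ ν d j • (G ^ j) (L s))]
  rw [add_right_comm, ← Finset.sum_add_distrib]
  congr 1
  refine Finset.sum_congr rfl fun j hj => ?_
  have hj' := Finset.mem_range.mp hj
  rw [key j hj', smul_add, smul_smul]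
  congr 2
  rw [triCoef, triCoef, Finset.prod_range_succ, mul_assoc, div_mul_cancel₀ _ (hγ d j hj')]

end Triangular

/-! ### The projective quantization on symbols -/

/-- The divergence operator `∑ ∂_{u_i} ∂_{ξ_i}` on symbols. -/
def divOp (ℓ : ℕ) : Module.End ℂ (Phase ℓ) := ∑ i, (du i).toLinearMap * (dv i).toLinearMap

lemma divOp_apply (s : Phase ℓ) : divOp ℓ s = ∑ i, du i (dv i s) := by
  rw [divOp, LinearMap.sum_apply]; rfl

section
variable {σ : Type*}
lemma pderiv_comm' (i j : σ) (s : MvPolynomial σ ℂ) :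
    MvPolynomial.pderiv i (MvPolynomial.pderiv j s)
      = MvPolynomial.pderiv j (MvPolynomial.pderiv i s) := by
  classical
  have : ⁅(MvPolynomial.pderiv i : Derivation ℂ (MvPolynomial σ ℂ) (MvPolynomial σ ℂ)),
      (MvPolynomial.pderiv j : Derivation ℂ (MvPolynomial σ ℂ) (MvPolynomial σ ℂ))⁆ = 0 := by
    apply MvPolynomial.derivation_ext
    intro k
    simp only [Derivation.commutator_apply, MvPolynomial.pderiv_X, Derivation.zero_apply]
    rw [Pi.single_apply, Pi.single_apply]
    split_ifs <;> simp
  have h := congrArg (fun D : Derivation ℂ (MvPolynomial σ ℂ) (MvPolynomial σ ℂ) => D s) this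
  simp only [Derivation.commutator_apply, Derivation.zero_apply] at h
  exact sub_eq_zero.mp h
end

lemma du_du (i j : Coord ℓ) (s : Phase ℓ) : du i (du j s) = du j (du i s) := pderiv_comm' ..
lemma du_dv (i j : Coord ℓ) (s : Phase ℓ) : du i (dv j s) = dv j (du i s) := pderiv_comm' ..
lemma dv_dv (i j : Coord ℓ) (s : Phase ℓ) : dv i (dv j s) = dv j (dv i s) := pderiv_comm' ..

lemma dv_piece_zero (i : Coord ℓ) {s : Phase ℓ} (hs : s ∈ piece fdeg 0) : dv i s = 0 :=
  mem_degLT_zero (pderiv_mem _ (fun t ht => by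
    have : fdeg (t + Finsupp.single (Sum.inr i) 1) = 0 := ht
    rw [fdeg_add, fdeg_inr] at this
    omega) hs)

lemma dv_piece_succ (i : Coord ℓ) {d : ℕ} {s : Phase ℓ} (hs : s ∈ piece fdeg (d + 1)) :
    dv i s ∈ piece fdeg d :=
  pderiv_mem _ (fun t ht => by simpa [fdeg_add, fdeg_inr] using ht) hs

lemma du_piece (i : Coord ℓ) {d : ℕ} {s : Phase ℓ} (hs : s ∈ piece fdeg d) :
    du i s ∈ piece fdeg d :=
  pderiv_mem _ (fun t ht => by simpa [fdeg_add, fdeg_inl] using ht) hs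

lemma bu_piece (i : Coord ℓ) {d : ℕ} {s : Phase ℓ} (hs : s ∈ piece fdeg d) :
    bu i * s ∈ piece fdeg d :=
  X_mul_mem _ (fun t ht => by simpa [fdeg_add, fdeg_inl] using ht) hs

lemma fv_piece (i : Coord ℓ) {d : ℕ} {s : Phase ℓ} (hs : s ∈ piece fdeg d) :
    fv i * s ∈ piece fdeg (d + 1) :=
  X_mul_mem _ (fun t ht => by simpa [fdeg_add, fdeg_inr] using ht) hs

lemma fv_dv_piece (i j : Coord ℓ) {d : ℕ} {s : Phase ℓ} (hs : s ∈ piece fdeg d) :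
    fv i * dv j s ∈ piece fdeg d := by
  cases d with
  | zero => rw [dv_piece_zero j hs, mul_zero]; exact zero_mem _
  | succ d => exact fv_piece i (dv_piece_succ j hs)

lemma lowers_divOp : Lowers fdeg (divOp ℓ) where
  zero s hs := by
    rw [divOp_apply]
    exact Finset.sum_eq_zero fun i _ => by rw [dv_piece_zero i hs, map_zero]
  succ d s hs := by
    rw [divOp_apply]
    exact Submodule.sum_mem _ fun i _ => du_piece i (dv_piece_succ i hs)

lemma symAct_piece_gen (p : ℂ) {X : Vec ℓ} (hX : X ∈ projGen ℓ) {d : ℕ} {s : Phase ℓ}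
    (hs : s ∈ piece fdeg d) : symAct p X s ∈ piece fdeg d := by
  classical
  rcases hX with ⟨i, rfl⟩ | ⟨i, j, rfl⟩ | ⟨j, rfl⟩
  · rw [symAct_pd]
    exact du_piece i hs
  · rw [symAct_X_pd]
    exact add_mem (sub_mem (bu_piece j (du_piece i hs)) (fv_dv_piece i j hs))
      (Submodule.smul_mem _ _ hs)
  · rw [symAct_X_euler, Eu_eq_sum, Ef_eq_sum]
    refine add_mem (sub_mem (sub_mem (bu_piece j (Submodule.sum_mem _ fun i _ =>
      bu_piece i (du_piece i hs))) ?_) (bu_piece j (Submodule.sum_mem _ fun i _ => fv_dv_piece i i hs)))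
      (Submodule.smul_mem _ _ (bu_piece j hs))
    rw [Finset.sum_mul]
    exact Submodule.sum_mem _ fun i _ => by rw [mul_assoc]; exact bu_piece i (fv_dv_piece i j hs)

lemma divOp_symAct_pd (p : ℂ) (i : Coord ℓ) (s : Phase ℓ) :
    divOp ℓ (symAct p (MvPolynomial.pderiv i) s) = symAct p (MvPolynomial.pderiv i) (divOp ℓ s) := by
  simp only [symAct_pd, divOp_apply, map_sum]
  exact Finset.sum_congr rfl fun j _ => by rw [← du_dv, du_du]

lemma divOp_bu_mul (j : Coord ℓ) (s : Phase ℓ) :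
    divOp ℓ (bu j * s) = bu j * divOp ℓ s + dv j s := by
  classical
  have : ∀ i, du i (dv i (bu j * s)) = bu j * du i (dv i s) + if i = j then dv j s else 0 := by
    intro i
    rw [dv_leib, dv_bu, mul_zero, add_zero, du_leib, du_bu]
    split_ifs with h
    · subst h; ring
    · ring
  rw [divOp_apply, Finset.sum_congr rfl fun i _ => this i, Finset.sum_add_distrib, ← Finset.mul_sum,
    divOp_apply]
  simp

lemma divOp_fv_mul (j : Coord ℓ) (s : Phase ℓ) :
    divOp ℓ (fv j * s) = fv j * divOp ℓ s + du j s := by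
  classical
  have : ∀ i, du i (dv i (fv j * s)) = fv j * du i (dv i s) + if i = j then du j s else 0 := by
    intro i
    rw [du_dv, du_leib, du_fv, mul_zero, add_zero, dv_leib, dv_fv, ← du_dv]
    split_ifs with h
    · subst h; ring
    · ring
  rw [divOp_apply, Finset.sum_congr rfl fun i _ => this i, Finset.sum_add_distrib, ← Finset.mul_sum,
    divOp_apply]
  simp

lemma divOp_du (j : Coord ℓ) (s : Phase ℓ) : divOp ℓ (du j s) = du j (divOp ℓ s) := by
  simp only [divOp_apply, map_sum]
  exact Finset.sum_congr rfl fun i _ => by rw [← du_dv, du_du]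

lemma divOp_dv (j : Coord ℓ) (s : Phase ℓ) : divOp ℓ (dv j s) = dv j (divOp ℓ s) := by
  simp only [divOp_apply, map_sum]
  exact Finset.sum_congr rfl fun i _ => by rw [dv_dv, du_dv]

lemma divOp_symAct_X_pd (p : ℂ) (i j : Coord ℓ) (s : Phase ℓ) :
    divOp ℓ (symAct p ((MvPolynomial.X j : Poly ℓ) • (MvPolynomial.pderiv i : Vec ℓ)) s)
      = symAct p ((MvPolynomial.X j : Poly ℓ) • (MvPolynomial.pderiv i : Vec ℓ)) (divOp ℓ s) := by
  classical
  rw [symAct_X_pd, symAct_X_pd, map_add, map_sub, map_smul, divOp_bu_mul, divOp_fv_mul, divOp_du,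
    divOp_dv, du_dv]
  ring

lemma card_coord : Fintype.card (Coord ℓ) = 2 * ℓ + 1 := by
  simp [Coord]; ring

lemma divOp_symAct_X_euler (p : ℂ) (j : Coord ℓ) {d : ℕ} {s : Phase ℓ} (hs : s ∈ piece fdeg d) :
    divOp ℓ (symAct p ((MvPolynomial.X j : Poly ℓ) • euler ℓ) s)
      = symAct p ((MvPolynomial.X j : Poly ℓ) • euler ℓ) (divOp ℓ s)
        + (p * (2 * ℓ + 2 : ℕ) - 2 * d - 2 * ℓ) • dv j s := by
  have e1 : ∀ s, divOp ℓ (Eu s) = Eu (divOp ℓ s) + divOp ℓ s := by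
    intro s
    simp only [Eu_eq_sum, map_sum, divOp_bu_mul, divOp_du, Finset.sum_add_distrib]
    congr 1
    rw [divOp_apply]
    exact Finset.sum_congr rfl fun i _ => (du_dv i i s).symm
  have e2 : ∀ s, divOp ℓ (Ef s) = Ef (divOp ℓ s) + divOp ℓ s := by
    intro s
    simp only [Ef_eq_sum, map_sum, divOp_fv_mul, divOp_dv, Finset.sum_add_distrib]
    congr 1
    rw [divOp_apply]
  have e3 : ∀ s, divOp ℓ ((∑ i, bu i * fv i) * s)
      = (∑ i, bu i * fv i) * divOp ℓ s + Eu s + Ef s + (2 * ℓ + 1 : ℕ) • s := by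
    classical
    intro s
    have : ∀ i, divOp ℓ (bu i * fv i * s) = bu i * fv i * divOp ℓ s + bu i * du i s
        + fv i * dv i s + s := by
      intro i
      rw [mul_assoc, divOp_bu_mul, divOp_fv_mul, dv_leib, dv_fv, if_pos rfl]
      ring
    rw [Finset.sum_mul, map_sum, Finset.sum_congr rfl fun i _ => this i]
    simp only [Finset.sum_add_distrib, Finset.sum_mul, Finset.sum_const, Finset.card_univ, card_coord,
      Eu_eq_sum, Ef_eq_sum]
  have e4 : ∀ s, dv j (Eu s) = Eu (dv j s) := by
    intro s
    simp only [Eu_eq_sum, map_sum, dv_leib, dv_bu, mul_zero, add_zero, du_dv]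
  have e5 : Ef (dv j s) = ((d : ℂ) - 1) • dv j s := by
    cases d with
    | zero => rw [dv_piece_zero j hs, map_zero, smul_zero]
    | succ d =>
      rw [mem_piece_fdeg.mp (dv_piece_succ j hs)]
      congr 1
      push_cast; ring
  have e6 : dv j (Ef s) = (d : ℂ) • dv j s := by
    rw [mem_piece_fdeg.mp hs, Derivation.map_smul]
  rw [symAct_X_euler, symAct_X_euler, map_add, map_sub, map_sub, map_smul, divOp_bu_mul, divOp_bu_mul,
    divOp_bu_mul, e1, e2, e3, divOp_dv, e4, e5, e6]
  simp only [MvPolynomial.smul_eq_C_mul, nsmul_eq_mul, map_sub, map_mul, map_add, map_natCast, map_ofNat, map_one]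
  push_cast
  ring

/-- The projective quantization written on symbols. -/
def projQ (ℓ : ℕ) (lam p : ℂ) : Module.End ℂ (Phase ℓ) :=
  triang fdeg (divOp ℓ) (triCoef (fun d => p * (2 * ℓ + 2 : ℕ) - 2 * d - 2 * ℓ)
    fun d => -((d : ℂ) - 1 + lam * (2 * ℓ + 2 : ℕ)))

/-- `p` is not a resonance. -/
def Generic (ℓ : ℕ) (p : ℂ) : Prop := ∀ n : ℤ, p * (2 * ℓ + 2 : ℕ) ≠ n

lemma sum_arith (c e : ℂ) (d j : ℕ) (hj : j < d) :
    ∑ a ∈ Finset.range (j + 1), (c - e * (d - a : ℕ)) = (j + 1) * (c - e * d + e * j / 2) := by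
  induction j with
  | zero => simp
  | succ j ih =>
    rw [Finset.sum_range_succ, ih (by omega), Nat.cast_sub (by omega)]
    push_cast
    ring

/-- On symbols, the projective quantization intertwines the symbol action with the action on
normally ordered operators. -/
lemma lie_projQ {lam p : ℂ} (hp : Generic ℓ p) {X : Vec ℓ} (hX : X ∈ projGen ℓ) (s : Phase ℓ) :
    ⁅X, toHom ℓ lam p (normalOrder (projQ ℓ lam p s))⁆
      = toHom ℓ lam p (normalOrder (projQ ℓ lam p (symAct p X s))) := by
  have hγ : ∀ d j, j < d → ∑ a ∈ Finset.range (j + 1),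
      (p * (2 * ℓ + 2 : ℕ) - 2 * (d - a : ℕ) - 2 * ℓ) ≠ 0 := by
    intro d j hj
    have := sum_arith (p * (2 * ℓ + 2 : ℕ) - 2 * ℓ) 2 d j hj
    simp only [sub_right_comm _ (2 * (ℓ : ℂ))] at this
    rw [this]
    refine mul_ne_zero (by exact_mod_cast Nat.succ_ne_zero j) fun h => ?_
    refine hp (2 * d - j + 2 * ℓ) ?_
    push_cast at h ⊢
    linear_combination h
  have h0 : ∀ L : Module.End ℂ (Phase ℓ), (∀ d, ∀ s ∈ piece fdeg d, L s ∈ piece fdeg d) →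
      (∀ s, divOp ℓ (L s) = L (divOp ℓ s)) → ∀ s, L (projQ ℓ lam p s) = projQ ℓ lam p (L s) := by
    intro L hL hLG s
    exact triang_intertwines lowers_divOp (K := 0) hγ hL (fun _ _ => rfl) (fun _ => by simp)
      (fun d s _ => by simp [hLG]) (fun d s _ => by simp) s
  have hX' := hX
  rcases hX with ⟨i, rfl⟩ | ⟨i, j, rfl⟩ | ⟨j, rfl⟩
  · rw [lie_pd_normalOrder, h0 (symAct p _) (fun d s hs => symAct_piece_gen p hX' hs)
      (divOp_symAct_pd p i)]
  · rw [lie_X_pd_normalOrder, h0 (symAct p _) (fun d s hs => symAct_piece_gen p hX' hs)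
      (divOp_symAct_X_pd p i j)]
  · rw [lie_X_euler_normalOrder]
    congr 2
    refine triang_intertwines (L' := symAct p ((MvPolynomial.X j : Poly ℓ) • euler ℓ)
      - (Ef.toLinearMap * (dv j).toLinearMap + (lam * (2 * ℓ + 2 : ℕ)) • (dv j).toLinearMap))
      (K := (dv j).toLinearMap) lowers_divOp hγ (fun d s hs => symAct_piece_gen p hX' hs)
      (fun s hs => dv_piece_zero j hs) (divOp_dv j) (fun d s hs => divOp_symAct_X_euler p j hs)
      (fun d s hs => ?_) s
    change symAct p ((MvPolynomial.X j : Poly ℓ) • euler ℓ) s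
      - (Ef (dv j s) + (lam * (2 * ℓ + 2 : ℕ)) • dv j s) = _ + _ • dv j s
    have e5 : Ef (dv j s) = ((d : ℂ) - 1) • dv j s := by
      cases d with
      | zero => rw [dv_piece_zero j hs, map_zero, smul_zero]
      | succ d =>
        rw [mem_piece_fdeg.mp (dv_piece_succ j hs)]
        congr 1
        push_cast; ring
    rw [e5, ← add_smul, neg_smul, sub_eq_add_neg]

/-! ### The contact frame -/

lemma vec_C (X : Vec ℓ) (c : ℂ) : X (MvPolynomial.C c) = 0 := X.map_algebraMap c

lemma tanA_tanA (i j : Fin ℓ) (f : Poly ℓ) : tanA i (tanA j f) = tanA j (tanA i f) := by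
  have : ⁅(tanA i : Vec ℓ), (tanA j : Vec ℓ)⁆ = 0 := by
    apply vec_ext
    · intro k
      simp only [Derivation.commutator_apply, tanA_x]
      split_ifs <;> simp
    · intro k; simp only [Derivation.commutator_apply, tanA_y, map_zero, sub_zero]; rfl
    · simp only [Derivation.commutator_apply, tanA_z, Derivation.leibniz, tanA_y, vec_C, smul_zero,
        add_zero, sub_zero]; rfl
  have h := congrArg (fun D : Vec ℓ => D f) this
  exact sub_eq_zero.mp ((Derivation.commutator_apply ..).symm.trans h)

lemma tanB_tanB (i j : Fin ℓ) (f : Poly ℓ) : tanB i (tanB j f) = tanB j (tanB i f) := by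
  have : ⁅(tanB i : Vec ℓ), (tanB j : Vec ℓ)⁆ = 0 := by
    apply vec_ext
    · intro k; simp only [Derivation.commutator_apply, tanB_x, map_zero, sub_zero]; rfl
    · intro k
      simp only [Derivation.commutator_apply, tanB_y]
      split_ifs <;> simp
    · simp only [Derivation.commutator_apply, tanB_z, Derivation.leibniz, tanB_x, vec_C, smul_zero,
        add_zero, sub_zero, map_neg, neg_zero]; rfl
  have h := congrArg (fun D : Vec ℓ => D f) this
  exact sub_eq_zero.mp ((Derivation.commutator_apply ..).symm.trans h)

lemma tanB_tanA (i j : Fin ℓ) (f : Poly ℓ) [Decidable (i = j)] :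
    tanB i (tanA j f) = tanA j (tanB i f) + if i = j then MvPolynomial.pderiv cz f else 0 := by
  have : ⁅(tanB i : Vec ℓ), (tanA j : Vec ℓ)⁆
      = (if i = j then (1 : Poly ℓ) else 0) • (MvPolynomial.pderiv cz : Vec ℓ) := by
    classical
    apply vec_ext
    · intro k
      simp only [Derivation.commutator_apply, tanA_x, tanB_x, map_zero, sub_zero,
        Derivation.smul_apply, pd_X, cx_cz, if_false, smul_zero]
      split_ifs <;> simp
    · intro k
      simp only [Derivation.commutator_apply, tanA_y, tanB_y, map_zero, zero_sub,
        Derivation.smul_apply, pd_X, cy_cz, if_false, smul_zero]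
      split_ifs <;> simp
    · simp only [Derivation.commutator_apply, tanA_z, tanB_z, Derivation.leibniz, tanB_y, tanA_x,
        vec_C, smul_zero, add_zero, map_neg, Derivation.smul_apply, pd_X, if_true, smul_eq_mul,
        mul_one, sub_neg_eq_add, eq_comm (a := j)]
      rw [mul_zero, mul_zero, add_zero, add_zero]
      have := Xhalf (ℓ := ℓ)
      split_ifs
      · simpa only [mul_one] using this
      · simp only [mul_zero, add_zero]
  have h := congrArg (fun D : Vec ℓ => D f) this
  rw [← sub_eq_iff_eq_add']
  refine ((Derivation.commutator_apply ..).symm.trans h).trans ?_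
  simp only [Derivation.smul_apply]
  split_ifs <;> simp

lemma pz_tanA (i : Fin ℓ) (f : Poly ℓ) :
    MvPolynomial.pderiv cz (tanA i f) = tanA i (MvPolynomial.pderiv cz f) := by
  classical
  have : ⁅(MvPolynomial.pderiv cz : Vec ℓ), (tanA i : Vec ℓ)⁆ = 0 := by
    apply vec_ext
    · intro k
      simp only [Derivation.commutator_apply, tanA_x, pd_X, cx_cz, if_false, map_zero, sub_zero]
      split_ifs <;> simp
    · intro k
      simp only [Derivation.commutator_apply, tanA_y, pd_X, cy_cz, if_false, map_zero, sub_zero]; rfl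
    · simp only [Derivation.commutator_apply, tanA_z, pd_X, if_true, Derivation.leibniz, vec_C,
        cy_cz, if_false, smul_zero, add_zero, zero_sub]
      simp
  have h := congrArg (fun D : Vec ℓ => D f) this
  exact sub_eq_zero.mp ((Derivation.commutator_apply ..).symm.trans h)

lemma pz_tanB (i : Fin ℓ) (f : Poly ℓ) :
    MvPolynomial.pderiv cz (tanB i f) = tanB i (MvPolynomial.pderiv cz f) := by
  classical
  have : ⁅(MvPolynomial.pderiv cz : Vec ℓ), (tanB i : Vec ℓ)⁆ = 0 := by
    apply vec_ext
    · intro k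
      simp only [Derivation.commutator_apply, tanB_x, pd_X, cx_cz, if_false, map_zero, sub_zero]; rfl
    · intro k
      simp only [Derivation.commutator_apply, tanB_y, pd_X, cy_cz, if_false, map_zero, sub_zero]
      split_ifs <;> simp
    · simp only [Derivation.commutator_apply, tanB_z, pd_X, if_true, Derivation.leibniz, vec_C,
        cx_cz, if_false, smul_zero, add_zero, zero_sub, map_neg]
      simp
  have h := congrArg (fun D : Vec ℓ => D f) this
  exact sub_eq_zero.mp ((Derivation.commutator_apply ..).symm.trans h)

lemma chi_lie_tanA (f : Poly ℓ) (j : Fin ℓ) : ⁅chi ℓ f, tanA j⁆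
    = ∑ i, (tanA j (tanB i f) • (tanA i : Vec ℓ) - tanA j (tanA i f) • (tanB i : Vec ℓ)) := by
  classical
  apply vec_ext
  · intro k
    rw [sum_apply]
    simp only [Derivation.commutator_apply, chi_x, Derivation.sub_apply, Derivation.smul_apply,
      tanA_x, tanB_x, smul_zero, sub_zero, smul_eq_mul, mul_ite, mul_one, mul_zero, map_neg]
    simp only [Finset.sum_ite_eq, Finset.mem_univ, if_true]
    split_ifs <;> simp
  · intro k
    rw [sum_apply]
    simp only [Derivation.commutator_apply, chi_y, Derivation.sub_apply, Derivation.smul_apply,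
      tanA_y, tanB_y, smul_zero, zero_sub, smul_eq_mul, mul_ite, mul_one, mul_zero, map_zero,
      Finset.sum_neg_distrib]
    simp only [Finset.sum_ite_eq, Finset.mem_univ, if_true]
  · rw [sum_apply]
    simp only [Derivation.commutator_apply, chi_z, tanA_z, tanB_z, Derivation.sub_apply,
      Derivation.smul_apply, Derivation.leibniz, vec_C, smul_zero, add_zero, chi_y, map_sub, map_sum,
      map_add, tanA_x, tanA_y, smul_eq_mul, mul_ite, mul_one, mul_zero, Finset.sum_add_distrib,
      Finset.mul_sum, mul_neg, sub_neg_eq_add]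
    simp only [Finset.sum_ite_eq, Finset.mem_univ, if_true, Finset.sum_ite_eq']
    have h2 : ∀ i, tanA j (tanB i f) * (MvPolynomial.C (1 / 2) * MvPolynomial.X (cy i))
        = MvPolynomial.C (1 / 2) * (MvPolynomial.X (cy i) * tanA j (tanB i f)) := fun i => by ring
    have h3 : ∀ i, tanA j (tanA i f) * (MvPolynomial.C (1 / 2) * MvPolynomial.X (cx i))
        = MvPolynomial.C (1 / 2) * (MvPolynomial.X (cx i) * tanA j (tanA i f)) := fun i => by ring
    simp only [h2, h3, ← Finset.mul_sum]
    linear_combination (tanA j f) * Xhalf (ℓ := ℓ)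

lemma chi_lie_tanB (f : Poly ℓ) (j : Fin ℓ) : ⁅chi ℓ f, tanB j⁆
    = ∑ i, (tanB j (tanB i f) • (tanA i : Vec ℓ) - tanB j (tanA i f) • (tanB i : Vec ℓ)) := by
  classical
  apply vec_ext
  · intro k
    rw [sum_apply]
    simp only [Derivation.commutator_apply, chi_x, Derivation.sub_apply, Derivation.smul_apply,
      tanA_x, tanB_x, smul_zero, sub_zero, smul_eq_mul, mul_ite, mul_one, mul_zero, map_neg, map_zero,
      zero_sub, neg_neg]
    simp only [Finset.sum_ite_eq, Finset.mem_univ, if_true]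
  · intro k
    rw [sum_apply]
    simp only [Derivation.commutator_apply, chi_y, Derivation.sub_apply, Derivation.smul_apply,
      tanA_y, tanB_y, smul_zero, zero_sub, smul_eq_mul, mul_ite, mul_one, mul_zero, map_zero,
      Finset.sum_neg_distrib]
    simp only [Finset.sum_ite_eq, Finset.mem_univ, if_true]
    split_ifs <;> simp
  · rw [sum_apply]
    simp only [Derivation.commutator_apply, chi_z, tanA_z, tanB_z, Derivation.sub_apply,
      Derivation.smul_apply, Derivation.leibniz, vec_C, smul_zero, add_zero, chi_x, map_sub, map_sum,
      map_add, tanB_x, tanB_y, smul_eq_mul, mul_ite, mul_one, mul_zero, Finset.sum_add_distrib,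
      Finset.mul_sum, mul_neg, sub_neg_eq_add, map_neg]
    simp only [Finset.sum_ite_eq, Finset.mem_univ, if_true, Finset.sum_ite_eq']
    have h2 : ∀ i, tanB j (tanB i f) * (MvPolynomial.C (1 / 2) * MvPolynomial.X (cy i))
        = MvPolynomial.C (1 / 2) * (MvPolynomial.X (cy i) * tanB j (tanB i f)) := fun i => by ring
    have h3 : ∀ i, tanB j (tanA i f) * (MvPolynomial.C (1 / 2) * MvPolynomial.X (cx i))
        = MvPolynomial.C (1 / 2) * (MvPolynomial.X (cx i) * tanB j (tanA i f)) := fun i => by ring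
    simp only [h2, h3, ← Finset.mul_sum]
    linear_combination (tanB j f) * Xhalf (ℓ := ℓ)

lemma chi_lie_pz (f : Poly ℓ) : ⁅chi ℓ f, (MvPolynomial.pderiv cz : Vec ℓ)⁆
    = ∑ i, (tanB i (MvPolynomial.pderiv cz f) • (tanA i : Vec ℓ)
      - tanA i (MvPolynomial.pderiv cz f) • (tanB i : Vec ℓ))
      - MvPolynomial.pderiv cz f • (MvPolynomial.pderiv cz : Vec ℓ) := by
  classical
  apply vec_ext
  · intro k
    rw [Derivation.sub_apply, sum_apply]
    simp only [Derivation.commutator_apply, chi_x, Derivation.sub_apply, Derivation.smul_apply,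
      tanA_x, tanB_x, smul_zero, sub_zero, smul_eq_mul, mul_ite, mul_one, mul_zero, map_neg, map_zero,
      zero_sub, neg_neg, pd_X, cx_cz, if_false]
    simp only [Finset.sum_ite_eq, Finset.mem_univ, if_true, pz_tanB]
  · intro k
    rw [Derivation.sub_apply, sum_apply]
    simp only [Derivation.commutator_apply, chi_y, Derivation.sub_apply, Derivation.smul_apply,
      tanA_y, tanB_y, smul_zero, zero_sub, smul_eq_mul, mul_ite, mul_one, mul_zero, map_zero,
      Finset.sum_neg_distrib, pd_X, cy_cz, if_false, sub_zero]
    simp only [Finset.sum_ite_eq, Finset.mem_univ, if_true, pz_tanA]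
  · rw [Derivation.sub_apply, sum_apply]
    simp only [Derivation.commutator_apply, chi_z, tanA_z, tanB_z, Derivation.sub_apply,
      Derivation.smul_apply, Derivation.leibniz, vec_C, smul_zero, add_zero, map_sub, map_sum,
      map_add, smul_eq_mul, mul_one, mul_zero, Finset.sum_add_distrib,
      Finset.mul_sum, mul_neg, sub_neg_eq_add, pd_X, if_true, cx_cz, cy_cz, if_false, pz_tanA, pz_tanB, Derivation.map_one_eq_zero, zero_sub]
    have h2 : ∀ i, tanB i (MvPolynomial.pderiv cz f) * (MvPolynomial.C (1 / 2) * MvPolynomial.X (cy i))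
        = MvPolynomial.C (1 / 2) * (MvPolynomial.X (cy i) * tanB i (MvPolynomial.pderiv cz f)) := fun i => by ring
    have h3 : ∀ i, tanA i (MvPolynomial.pderiv cz f) * (MvPolynomial.C (1 / 2) * MvPolynomial.X (cx i))
        = MvPolynomial.C (1 / 2) * (MvPolynomial.X (cx i) * tanA i (MvPolynomial.pderiv cz f)) := fun i => by ring
    simp only [h2, h3, ← Finset.mul_sum]
    ring

lemma div_chi (f : Poly ℓ) : div (chi ℓ f) = ((ℓ : ℂ) + 1) • MvPolynomial.pderiv cz f := by
  classical
  have hA : ∀ (i : Fin ℓ) (g : Poly ℓ), MvPolynomial.pderiv (cx i) g = tanA i g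
      - MvPolynomial.C (1 / 2) * MvPolynomial.X (cy i) * MvPolynomial.pderiv cz g := by
    intro i g
    simp [tanA]
  have hB : ∀ (i : Fin ℓ) (g : Poly ℓ), MvPolynomial.pderiv (cy i) g = tanB i g
      + MvPolynomial.C (1 / 2) * MvPolynomial.X (cx i) * MvPolynomial.pderiv cz g := by
    intro i g
    simp [tanB]
  have e : div (chi ℓ f) = ∑ i, MvPolynomial.pderiv (cx i) (chi ℓ f (MvPolynomial.X (cx i)))
      + (∑ i, MvPolynomial.pderiv (cy i) (chi ℓ f (MvPolynomial.X (cy i)))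
      + MvPolynomial.pderiv cz (chi ℓ f (MvPolynomial.X cz))) := by
    simp only [div, Fintype.sum_sum_type]
    congr 2
    exact Fintype.sum_unique _
  rw [e]
  simp only [chi_x, chi_y, chi_z, hA, hB, map_neg, map_sub, Derivation.leibniz, map_sum, map_add,
    vec_C, pd_X, cx_cz, cy_cz, if_false, smul_zero, add_zero, smul_eq_mul, pz_tanA, pz_tanB,
    tanB_tanA, if_true, Finset.sum_add_distrib, Finset.sum_sub_distrib, Finset.sum_neg_distrib,
    mul_neg, mul_add, Finset.mul_sum, mul_zero]
  simp only [Finset.sum_const, Finset.card_univ, Fintype.card_fin, nsmul_eq_mul, MvPolynomial.smul_eq_C_mul, map_add,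
    map_natCast, map_one, mul_assoc]
  ring

/-- `χ(f)` is a contact field with Hamiltonian `f`. -/
lemma contactForm_chi (f : Poly ℓ) : contactForm (chi ℓ f) = f := by
  simp only [contactForm, chi_x, chi_y, chi_z, Finset.mul_sum, Finset.sum_sub_distrib,
    Finset.sum_add_distrib, mul_add, mul_sub, mul_neg, sub_neg_eq_add]
  ring

lemma tan_eq {T : Vec ℓ} (hT : T ∈ Tan ℓ) : T = ∑ i, (T (MvPolynomial.X (cx i)) • (tanA i : Vec ℓ)
    + T (MvPolynomial.X (cy i)) • (tanB i : Vec ℓ)) := by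
  classical
  have hT' : contactForm T = 0 := hT
  apply vec_ext
  · intro k
    rw [sum_apply]
    simp only [Derivation.add_apply, Derivation.smul_apply, tanA_x, tanB_x, smul_zero, add_zero,
      smul_eq_mul, mul_ite, mul_one, mul_zero]
    simp
  · intro k
    rw [sum_apply]
    simp only [Derivation.add_apply, Derivation.smul_apply, tanA_y, tanB_y, smul_zero, zero_add,
      smul_eq_mul, mul_ite, mul_one, mul_zero]
    simp
  · rw [sum_apply]
    simp only [Derivation.add_apply, Derivation.smul_apply, tanA_z, tanB_z, smul_eq_mul]
    rw [contactForm, Finset.mul_sum] at hT'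
    rw [eq_neg_of_add_eq_zero_left hT', ← Finset.sum_neg_distrib]
    exact Finset.sum_congr rfl fun i _ => by ring

lemma chi_mem_con (f : Poly ℓ) : chi ℓ f ∈ Con ℓ := by
  intro T hT
  change contactForm ⁅chi ℓ f, T⁆ = 0
  rw [contactForm_lie, contactForm_chi, show contactForm T = 0 from hT, map_zero]
  simp only [chi_x, chi_y]
  have := congrArg (fun D : Vec ℓ => D f) (tan_eq hT)
  simp only [sum_apply, Derivation.add_apply, Derivation.smul_apply, smul_eq_mul] at this
  rw [this, zero_sub, ← Finset.sum_neg_distrib, ← Finset.sum_sub_distrib]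
  exact Finset.sum_eq_zero fun i _ => by ring

/-- The symbol of a vector field. -/
def symV (X : Vec ℓ) : Phase ℓ := ∑ i, base (X (MvPolynomial.X i)) * fv i

lemma symV_add (X Y : Vec ℓ) : symV (X + Y) = symV X + symV Y := by
  simp [symV, add_mul, Finset.sum_add_distrib]
lemma symV_sub (X Y : Vec ℓ) : symV (X - Y) = symV X - symV Y := by
  simp [symV, sub_mul, Finset.sum_sub_distrib]
lemma symV_sum {ι : Type*} (s : Finset ι) (X : ι → Vec ℓ) : symV (∑ i ∈ s, X i) = ∑ i ∈ s, symV (X i) := by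
  classical
  induction s using Finset.induction_on with
  | empty => simp [symV]
  | insert a s ha ih => rw [Finset.sum_insert ha, Finset.sum_insert ha, symV_add, ih]
lemma symV_fsmul (f : Poly ℓ) (X : Vec ℓ) : symV (f • X) = base f * symV X := by
  simp only [symV, Derivation.smul_apply, smul_eq_mul, map_mul base, Finset.mul_sum, mul_assoc]
lemma symV_pd (i : Coord ℓ) : symV (MvPolynomial.pderiv i : Vec ℓ) = fv i := by
  classical
  simp only [symV, pd_X]
  rw [Finset.sum_eq_single i]
  · simp
  · intro b _ hb; simp [hb]
  · simp

lemma base_C (c : ℂ) : base (MvPolynomial.C c : Poly ℓ) = MvPolynomial.C c :=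
  MvPolynomial.rename_C ..

lemma hamDer_base (X : Vec ℓ) (f : Poly ℓ) : hamDer X (base f) = base (X f) := by
  induction f using MvPolynomial.induction_on with
  | C a => rw [base_C, vec_C, map_zero]; exact Derivation.map_algebraMap _ _
  | add f g hf hg => simp only [map_add, hf, hg]
  | mul_X f i hf =>
    rw [map_mul base, Derivation.leibniz, Derivation.leibniz, hf, base_X, hamDer_bu, map_add base]
    simp only [smul_eq_mul, map_mul base, base_X]

lemma hamDer_symV (X Y : Vec ℓ) : hamDer X (symV Y) = symV ⁅X, Y⁆ := by
  simp only [symV, map_sum, Derivation.leibniz, hamDer_base, hamDer_fv, smul_eq_mul,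
    Derivation.commutator_apply, map_sub, sub_mul, Finset.sum_add_distrib, Finset.sum_sub_distrib,
    mul_neg, Finset.sum_neg_distrib, Finset.mul_sum]
  rw [Finset.sum_comm, neg_add_eq_sub]
  refine congrArg₂ (· - ·) ?_ ?_
  · exact Finset.sum_congr rfl fun i _ => mul_comm _ _
  · refine Finset.sum_congr rfl fun i _ => ?_
    rw [vec_apply Y, map_sum base, Finset.sum_mul]
    exact Finset.sum_congr rfl fun j _ => by rw [map_mul base, mul_assoc]

/-- The change of fibre coordinates to the contact frame: the fibre variables of `x_i`, `y_i`, `z`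
become the symbols of `B_i`, `-A_i`, `∂_z`. With these signs the fibre variables transform under
the linear symplectic fields exactly as the base coordinates do. -/
def frame (ℓ : ℕ) : Phase ℓ →ₐ[ℂ] Phase ℓ :=
  MvPolynomial.aeval (Sum.elim bu (Sum.elim (fun i => symV (tanB i))
    (Sum.elim (fun i => -symV (tanA i)) fun _ => fv cz)))

lemma frame_bu (i : Coord ℓ) : frame ℓ (bu i) = bu i := MvPolynomial.aeval_X ..
lemma frame_x (i : Fin ℓ) : frame ℓ (fv (cx i)) = symV (tanB i) := MvPolynomial.aeval_X ..
lemma frame_y (i : Fin ℓ) : frame ℓ (fv (cy i)) = -symV (tanA i) := MvPolynomial.aeval_X ..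
lemma frame_z : frame ℓ (fv cz) = fv cz := MvPolynomial.aeval_X ..

lemma symV_tanA (i : Fin ℓ) : symV (tanA i)
    = fv (cx i) + MvPolynomial.C (1 / 2) * bu (cy i) * fv cz := by
  rw [tanA, symV_add, symV_fsmul, symV_pd, symV_pd, map_mul base, base_C, base_X]
lemma symV_tanB (i : Fin ℓ) : symV (tanB i)
    = fv (cy i) - MvPolynomial.C (1 / 2) * bu (cx i) * fv cz := by
  rw [tanB, symV_sub, symV_fsmul, symV_pd, symV_pd, map_mul base, base_C, base_X]

/-- The inverse of `frame`. -/
def frameInv (ℓ : ℕ) : Phase ℓ →ₐ[ℂ] Phase ℓ :=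
  MvPolynomial.aeval (Sum.elim bu (Sum.elim
    (fun i => -fv (cy i) - MvPolynomial.C (1 / 2) * bu (cy i) * fv cz)
    (Sum.elim (fun i => fv (cx i) + MvPolynomial.C (1 / 2) * bu (cx i) * fv cz) fun _ => fv cz)))

lemma frameInv_bu (i : Coord ℓ) : frameInv ℓ (bu i) = bu i := MvPolynomial.aeval_X ..
lemma frameInv_x (i : Fin ℓ) : frameInv ℓ (fv (cx i))
    = -fv (cy i) - MvPolynomial.C (1 / 2) * bu (cy i) * fv cz := MvPolynomial.aeval_X ..
lemma frameInv_y (i : Fin ℓ) : frameInv ℓ (fv (cy i))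
    = fv (cx i) + MvPolynomial.C (1 / 2) * bu (cx i) * fv cz := MvPolynomial.aeval_X ..
lemma frameInv_z : frameInv ℓ (fv cz) = fv cz := MvPolynomial.aeval_X ..

lemma algHom_C (φ : Phase ℓ →ₐ[ℂ] Phase ℓ) (c : ℂ) :
    φ (MvPolynomial.C c) = MvPolynomial.C c := φ.commutes c

/-- The contact frame as an automorphism. -/
def frameEquiv (ℓ : ℕ) : Phase ℓ ≃ₐ[ℂ] Phase ℓ :=
  AlgEquiv.ofAlgHom (frame ℓ) (frameInv ℓ)
    (by
      apply MvPolynomial.algHom_ext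
      rintro (i | i | i | i)
      · change frame ℓ (frameInv ℓ (bu i)) = bu i
        rw [frameInv_bu, frame_bu]
      · change frame ℓ (frameInv ℓ (fv (cx i))) = fv (cx i)
        simp only [frameInv_x, map_sub, map_neg, map_mul, frame_y, frame_bu, frame_z, algHom_C,
          symV_tanA]
        ring
      · change frame ℓ (frameInv ℓ (fv (cy i))) = fv (cy i)
        simp only [frameInv_y, map_add, map_mul, frame_x, frame_bu, frame_z, algHom_C, symV_tanB]
        ring
      · change frame ℓ (frameInv ℓ (fv cz)) = fv cz
        rw [frameInv_z, frame_z])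
    (by
      apply MvPolynomial.algHom_ext
      rintro (i | i | i | i)
      · change frameInv ℓ (frame ℓ (bu i)) = bu i
        rw [frame_bu, frameInv_bu]
      · change frameInv ℓ (frame ℓ (fv (cx i))) = fv (cx i)
        simp only [frame_x, symV_tanB, map_sub, map_mul, frameInv_y, frameInv_bu, frameInv_z,
          algHom_C]
        ring
      · change frameInv ℓ (frame ℓ (fv (cy i))) = fv (cy i)
        simp only [frame_y, symV_tanA, map_neg, map_add, map_mul, frameInv_x, frameInv_bu,
          frameInv_z, algHom_C]
        ring
      · change frameInv ℓ (frame ℓ (fv cz)) = fv cz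
        rw [frame_z, frameInv_z])

lemma frame_base (f : Poly ℓ) : frame ℓ (base f) = base f := by
  induction f using MvPolynomial.induction_on with
  | C a => rw [base_C, algHom_C]
  | add f g hf hg => simp only [map_add, hf, hg]
  | mul_X f i hf => rw [map_mul base, map_mul (frame ℓ), hf, base_X, frame_bu]

/-! ### Contact fields in the contact frame -/

/-- The lift of `A_i` to functions of the base and (inert) fibre variables. -/
def hA (i : Fin ℓ) : Derivation ℂ (Phase ℓ) (Phase ℓ) :=
  du (cx i) + ((1 / 2 : ℂ) • bu (cy i) : Phase ℓ) • du cz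
/-- The lift of `B_i` to functions of the base and (inert) fibre variables. -/
def hB (i : Fin ℓ) : Derivation ℂ (Phase ℓ) (Phase ℓ) :=
  du (cy i) - ((1 / 2 : ℂ) • bu (cx i) : Phase ℓ) • du cz

/-- The symplectic gradient `∑_i (η_{x_i} A_i + η_{y_i} B_i)` along the fibre variables `η`. -/
def grad (ℓ : ℕ) : Derivation ℂ (Phase ℓ) (Phase ℓ) :=
  ∑ i : Fin ℓ, ((fv (cx i) : Phase ℓ) • hA i + (fv (cy i) : Phase ℓ) • hB i)

lemma grad_apply (s : Phase ℓ) :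
    grad ℓ s = ∑ i : Fin ℓ, (fv (cx i) * hA i s + fv (cy i) * hB i s) := by
  rw [grad, derivation_sum_apply]
  rfl

lemma der_C (D : Derivation ℂ (Phase ℓ) (Phase ℓ)) (c : ℂ) : D (MvPolynomial.C c) = 0 :=
  D.map_algebraMap c

lemma du_base (i : Coord ℓ) (f : Poly ℓ) : du i (base f) = base (MvPolynomial.pderiv i f) := by
  classical
  induction f using MvPolynomial.induction_on with
  | C a => rw [base_C, der_C, vec_C, map_zero]
  | add f g hf hg => simp only [map_add, hf, hg]
  | mul_X f j hf =>
    rw [map_mul base, Derivation.leibniz, Derivation.leibniz, hf, base_X, du_bu, pd_X, map_add base]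
    simp only [smul_eq_mul, map_mul base, base_X, eq_comm (a := j)]
    split_ifs <;> simp

lemma smul_half (f : Phase ℓ) : (1 / 2 : ℂ) • f = MvPolynomial.C (1 / 2) * f :=
  MvPolynomial.smul_eq_C_mul ..

lemma hA_base (i : Fin ℓ) (f : Poly ℓ) : hA i (base f) = base (tanA i f) := by
  simp only [hA, tanA, Derivation.add_apply, Derivation.smul_apply, du_base, smul_eq_mul, map_add base,
    map_mul base, base_X, base_C, smul_half]
lemma hB_base (i : Fin ℓ) (f : Poly ℓ) : hB i (base f) = base (tanB i f) := by
  simp only [hB, tanB, Derivation.sub_apply, Derivation.smul_apply, du_base, smul_eq_mul, map_sub base,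
    map_mul base, base_X, base_C, smul_half]
lemma hA_fv (i : Fin ℓ) (j : Coord ℓ) : hA i (fv j) = 0 := by
  simp [hA, du_fv]
lemma hB_fv (i : Fin ℓ) (j : Coord ℓ) : hB i (fv j) = 0 := by
  simp [hB, du_fv]

lemma grad_fv (j : Coord ℓ) : grad ℓ (fv j) = 0 := by
  simp [grad_apply, hA_fv, hB_fv]

lemma grad_base (f : Poly ℓ) : grad ℓ (base f)
    = ∑ i : Fin ℓ, (fv (cx i) * base (tanA i f) + fv (cy i) * base (tanB i f)) := by
  simp only [grad_apply, hA_base, hB_base]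

lemma grad_x (k : Fin ℓ) : grad ℓ (bu (cx k)) = fv (cx k) := by
  classical
  rw [← base_X, grad_base]
  simp only [tanA_x, tanB_x, map_zero, mul_zero, add_zero]
  rw [Finset.sum_eq_single k]
  · simp
  · intro b _ hb; simp [hb.symm]
  · simp

lemma grad_y (k : Fin ℓ) : grad ℓ (bu (cy k)) = fv (cy k) := by
  classical
  rw [← base_X, grad_base]
  simp only [tanA_y, tanB_y, map_zero, mul_zero, zero_add]
  rw [Finset.sum_eq_single k]
  · simp
  · intro b _ hb; simp [hb.symm]
  · simp

lemma grad_z : grad ℓ (bu cz) = MvPolynomial.C (1 / 2) * ∑ i : Fin ℓ,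
    (fv (cx i) * bu (cy i) - fv (cy i) * bu (cx i)) := by
  rw [← base_X, grad_base, Finset.mul_sum]
  refine Finset.sum_congr rfl fun i _ => ?_
  rw [tanA_z, tanB_z, map_neg base, map_mul base, map_mul base, base_C, base_X, base_X]
  ring

/-- The derivation part of the action of `χ(f)` on fine symbols, in the contact frame. -/
def fineDer (f : Poly ℓ) : Derivation ℂ (Phase ℓ) (Phase ℓ) :=
  MvPolynomial.mkDerivation ℂ (Sum.elim (fun i => base (chi ℓ f (MvPolynomial.X i)))
    (Sum.elim (fun i => -grad ℓ (base (tanB i f)) - base (MvPolynomial.pderiv cz f) * fv (cx i))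
    (Sum.elim (fun i => grad ℓ (base (tanA i f)) - base (MvPolynomial.pderiv cz f) * fv (cy i))
      fun _ => -(base (MvPolynomial.pderiv cz f) * fv cz))))

lemma fineDer_bu (f : Poly ℓ) (i : Coord ℓ) :
    fineDer f (bu i) = base (chi ℓ f (MvPolynomial.X i)) := MvPolynomial.mkDerivation_X ..
lemma fineDer_x (f : Poly ℓ) (i : Fin ℓ) : fineDer f (fv (cx i))
    = -grad ℓ (base (tanB i f)) - base (MvPolynomial.pderiv cz f) * fv (cx i) :=
  MvPolynomial.mkDerivation_X ..
lemma fineDer_y (f : Poly ℓ) (i : Fin ℓ) : fineDer f (fv (cy i))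
    = grad ℓ (base (tanA i f)) - base (MvPolynomial.pderiv cz f) * fv (cy i) :=
  MvPolynomial.mkDerivation_X ..
lemma fineDer_z (f : Poly ℓ) : fineDer f (fv cz) = -(base (MvPolynomial.pderiv cz f) * fv cz) :=
  MvPolynomial.mkDerivation_X ..

/-- The part of the action of `χ(f)` on symbols that lowers the non-tangential order. -/
def lowDer (f : Poly ℓ) : Derivation ℂ (Phase ℓ) (Phase ℓ) :=
  -(grad ℓ (base (MvPolynomial.pderiv cz f)) • dv cz)

lemma lowDer_apply (f : Poly ℓ) (s : Phase ℓ) :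
    lowDer f s = -(grad ℓ (base (MvPolynomial.pderiv cz f)) * dv cz s) := rfl

/-- The action of `χ(f)` on fine symbols, in the contact frame. -/
def fineAct (p : ℂ) (f : Poly ℓ) : Module.End ℂ (Phase ℓ) :=
  (fineDer f).toLinearMap
    + LinearMap.mulLeft ℂ ((p * (ℓ + 1)) • base (MvPolynomial.pderiv cz f))

lemma fineAct_apply (p : ℂ) (f : Poly ℓ) (s : Phase ℓ) : fineAct p f s
    = fineDer f s + (p * (ℓ + 1)) • (base (MvPolynomial.pderiv cz f) * s) := by
  rw [← smul_mul_assoc]; rfl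

lemma derivation_intertwines {φ : Phase ℓ →ₐ[ℂ] Phase ℓ} {D E : Derivation ℂ (Phase ℓ) (Phase ℓ)}
    (hu : ∀ i, D (φ (bu i)) = φ (E (bu i))) (hv : ∀ i, D (φ (fv i)) = φ (E (fv i)))
    (s : Phase ℓ) : D (φ s) = φ (E s) := by
  induction s using phase_induction with
  | hC a => rw [algHom_C, der_C, der_C, map_zero]
  | hadd s t hs ht => simp only [map_add, hs, ht]
  | hu i s hs => simp only [map_mul φ, Derivation.leibniz, smul_eq_mul, map_add φ, hs, hu]
  | hv i s hs => simp only [map_mul φ, Derivation.leibniz, smul_eq_mul, map_add φ, hs, hv]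

lemma frame_grad_base (f : Poly ℓ) : frame ℓ (grad ℓ (base f)) = ∑ i : Fin ℓ,
    (base (tanA i f) * symV (tanB i) - base (tanB i f) * symV (tanA i)) := by
  rw [grad_base, map_sum]
  refine Finset.sum_congr rfl fun i _ => ?_
  rw [map_add, map_mul, map_mul, frame_x, frame_y, frame_base, frame_base]
  ring

/-- The symbol action of a contact field, read in the contact frame. -/
lemma symAct_frame (p : ℂ) (f : Poly ℓ) (s : Phase ℓ) :
    symAct p (chi ℓ f) (frame ℓ s) = frame ℓ (fineAct p f s + lowDer f s) := by
  classical
  have h : hamDer (chi ℓ f) (frame ℓ s) = frame ℓ ((fineDer f + lowDer f) s) := by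
    refine derivation_intertwines (fun i => ?_) ?_ s
    · rw [frame_bu, hamDer_bu, Derivation.add_apply, fineDer_bu, lowDer_apply, dv_bu, mul_zero,
        neg_zero, add_zero, frame_base]
    · rintro (i | i | i)
      · change hamDer (chi ℓ f) (frame ℓ (fv (cx i))) = frame ℓ ((fineDer f + lowDer f) (fv (cx i)))
        rw [frame_x, hamDer_symV, Derivation.add_apply, fineDer_x, lowDer_apply, dv_fv]
        simp only [cz_cx, if_false, mul_zero, neg_zero, add_zero]
        rw [map_sub, map_neg, frame_grad_base, chi_lie_tanB, symV_sum, map_mul, frame_base, frame_x]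
        simp only [symV_sub, symV_fsmul, tanB_tanA, tanB_tanB i]
        simp only [map_add base, add_mul, Finset.sum_sub_distrib, Finset.sum_add_distrib, apply_ite base,
          map_zero, ite_mul, zero_mul]
        simp only [Finset.sum_ite_eq, Finset.mem_univ, if_true]
        ring
      · change hamDer (chi ℓ f) (frame ℓ (fv (cy i))) = frame ℓ ((fineDer f + lowDer f) (fv (cy i)))
        rw [frame_y, map_neg, hamDer_symV, Derivation.add_apply, fineDer_y, lowDer_apply, dv_fv]
        simp only [cz_cy, if_false, mul_zero, neg_zero, add_zero]
        rw [map_sub, frame_grad_base, chi_lie_tanA, symV_sum, map_mul, frame_base, frame_y]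
        simp only [symV_sub, symV_fsmul, tanB_tanA, tanA_tanA i]
        simp only [map_add base, add_mul, Finset.sum_sub_distrib, Finset.sum_add_distrib, apply_ite base,
          map_zero, ite_mul, zero_mul]
        simp only [Finset.sum_ite_eq', Finset.mem_univ, if_true]
        ring
      · change hamDer (chi ℓ f) (frame ℓ (fv cz)) = frame ℓ ((fineDer f + lowDer f) (fv cz))
        rw [frame_z, ← symV_pd, hamDer_symV, Derivation.add_apply, symV_pd, fineDer_z, lowDer_apply,
          dv_fv, if_pos rfl, mul_one, map_add, map_neg, map_neg, map_mul, frame_base, frame_z,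
          frame_grad_base, chi_lie_pz, symV_sub, symV_sum, symV_fsmul, symV_pd]
        simp only [symV_sub, symV_fsmul, Finset.sum_sub_distrib]
        ring
  rw [symAct_apply, h, div_chi, fineAct_apply, map_smul, Derivation.add_apply, smul_mul_assoc, smul_smul,
    add_right_comm, map_add (frame ℓ) (fineDer f s + lowDer f s), map_smul (frame ℓ), map_mul,
    frame_base]

/-! ### The splitting of the fine filtration on symbols -/

/-- The exponent of the fibre variable of `z`. -/
def zdeg (t : Coord ℓ ⊕ Coord ℓ →₀ ℕ) : ℕ := t (Sum.inr cz)

/-- The degree operator in the fibre variable of `z`. -/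
def Ez : Derivation ℂ (Phase ℓ) (Phase ℓ) := (fv cz : Phase ℓ) • dv cz

lemma Ez_apply (s : Phase ℓ) : Ez s = fv cz * dv cz s := rfl

lemma mem_piece_zdeg {l : ℕ} {s : Phase ℓ} : s ∈ piece zdeg l ↔ Ez s = (l : ℂ) • s := by
  classical
  have h : (Ez : Derivation ℂ (Phase ℓ) (Phase ℓ)) = eulerD (Pi.single (Sum.inr cz) 1) := by
    refine MvPolynomial.derivation_ext fun i => ?_
    rw [eulerD_X, Ez, Derivation.smul_apply, dv, MvPolynomial.pderiv_X, Pi.single_apply,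
      Pi.single_apply]
    split_ifs with h
    · subst h; simp [fv]
    · simp
  rw [h, eulerD_eq_iff, mem_restrictSupport']
  refine forall₂_congr fun t _ => ?_
  rw [Finset.sum_eq_single (Sum.inr cz) (fun b _ hb => by simp [Pi.single_apply, hb]) (by simp)]
  rw [Pi.single_eq_same, one_mul, Set.mem_ofPred_eq, zdeg, Nat.cast_inj]

lemma dv_base (i : Coord ℓ) (f : Poly ℓ) : dv i (base f) = 0 := by
  induction f using MvPolynomial.induction_on with
  | C a => rw [base_C, der_C]
  | add f g hf hg => simp only [map_add, hf, hg, add_zero]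
  | mul_X f j hf =>
    rw [map_mul base, Derivation.leibniz, hf, base_X, dv_bu, smul_zero, smul_zero, add_zero]

lemma dv_hA (j : Coord ℓ) (i : Fin ℓ) (s : Phase ℓ) : dv j (hA i s) = hA i (dv j s) := by
  simp only [hA, Derivation.add_apply, Derivation.smul_apply, map_add, smul_eq_mul, smul_mul_assoc,
    Derivation.map_smul, Derivation.leibniz, dv_bu, mul_zero, add_zero, du_dv]

lemma dv_hB (j : Coord ℓ) (i : Fin ℓ) (s : Phase ℓ) : dv j (hB i s) = hB i (dv j s) := by
  simp only [hB, Derivation.sub_apply, Derivation.smul_apply, map_sub, smul_eq_mul, smul_mul_assoc,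
    Derivation.map_smul, Derivation.leibniz, dv_bu, mul_zero, add_zero, du_dv]

lemma dv_grad (s : Phase ℓ) : dv cz (grad ℓ s) = grad ℓ (dv cz s) := by
  classical
  simp only [grad_apply, map_sum, map_add, Derivation.leibniz, dv_fv, cz_cx, cz_cy, if_false,
    smul_zero, mul_zero, add_zero, dv_hA, dv_hB, smul_eq_mul]

lemma grad_piece_zdeg {l : ℕ} {s : Phase ℓ} (hs : s ∈ piece zdeg l) : grad ℓ s ∈ piece zdeg l := by
  rw [mem_piece_zdeg, Ez_apply] at hs ⊢
  have := congrArg (grad ℓ) hs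
  rwa [Derivation.leibniz, grad_fv, smul_zero, add_zero, smul_eq_mul, Derivation.map_smul,
    ← dv_grad] at this

lemma hA_piece (i : Fin ℓ) {k : ℕ} {s : Phase ℓ} (hs : s ∈ piece fdeg k) : hA i s ∈ piece fdeg k := by
  rw [hA, Derivation.add_apply, Derivation.smul_apply, smul_eq_mul, smul_mul_assoc]
  exact add_mem (du_piece _ hs) (Submodule.smul_mem _ _ (bu_piece _ (du_piece _ hs)))

lemma hB_piece (i : Fin ℓ) {k : ℕ} {s : Phase ℓ} (hs : s ∈ piece fdeg k) : hB i s ∈ piece fdeg k := by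
  rw [hB, Derivation.sub_apply, Derivation.smul_apply, smul_eq_mul, smul_mul_assoc]
  exact sub_mem (du_piece _ hs) (Submodule.smul_mem _ _ (bu_piece _ (du_piece _ hs)))

lemma grad_piece_fdeg {k : ℕ} {s : Phase ℓ} (hs : s ∈ piece fdeg k) :
    grad ℓ s ∈ piece fdeg (k + 1) := by
  rw [grad_apply]
  exact Submodule.sum_mem _ fun i _ =>
    add_mem (fv_piece _ (hA_piece i hs)) (fv_piece _ (hB_piece i hs))

/-- The invariant operator along which the splitting of the fine filtration is expanded. -/
def gradZ (ℓ : ℕ) : Module.End ℂ (Phase ℓ) := (grad ℓ).toLinearMap * (dv cz).toLinearMap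

lemma gradZ_apply (s : Phase ℓ) : gradZ ℓ s = grad ℓ (dv cz s) := rfl

lemma dv_zdeg_zero {s : Phase ℓ} (hs : s ∈ piece zdeg 0) : dv cz s = 0 := by
  rw [mem_piece_zdeg, Ez_apply, Nat.cast_zero, zero_smul, mul_eq_zero] at hs
  exact hs.resolve_left (MvPolynomial.X_ne_zero _)

lemma dv_zdeg_succ {d : ℕ} {s : Phase ℓ} (hs : s ∈ piece zdeg (d + 1)) :
    dv cz s ∈ piece zdeg d :=
  pderiv_mem _ (fun t ht => by simpa [zdeg] using ht) hs

lemma lowers_gradZ : Lowers zdeg (gradZ ℓ) where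
  zero s hs := by rw [gradZ_apply, dv_zdeg_zero hs, map_zero]
  succ d s hs := grad_piece_zdeg (dv_zdeg_succ hs)

lemma gradZ_piece_fdeg {k : ℕ} {s : Phase ℓ} (hs : s ∈ piece fdeg k) :
    gradZ ℓ s ∈ piece fdeg k := by
  rw [gradZ_apply]
  cases k with
  | zero => rw [dv_piece_zero _ hs, map_zero]; exact zero_mem _
  | succ k => exact grad_piece_fdeg (dv_piece_succ _ hs)

/-- A submodule of polynomials that contains `1`, the coordinates and their products contains the
polynomials of degree at most two. -/
lemma mem_of_totalDegree_le_two {S : Submodule ℂ (Poly ℓ)} (h0 : 1 ∈ S)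
    (h1 : ∀ a, MvPolynomial.X a ∈ S) (h2 : ∀ a b, MvPolynomial.X a * MvPolynomial.X b ∈ S)
    {f : Poly ℓ} (hf : f.totalDegree ≤ 2) : f ∈ S := by
  classical
  rw [MvPolynomial.as_sum f]
  refine Submodule.sum_mem _ fun s hs => ?_
  have e : MvPolynomial.monomial s (f.coeff s) = f.coeff s • MvPolynomial.monomial s (1 : ℂ) := by
    rw [MvPolynomial.smul_monomial, smul_eq_mul, mul_one]
  rw [e]
  refine S.smul_mem _ ?_
  have hc : Multiset.card s.toMultiset ≤ 2 := by
    rw [Finsupp.card_toMultiset]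
    exact (MvPolynomial.le_totalDegree hs).trans hf
  obtain ⟨t, rfl⟩ : ∃ t : Multiset (Coord ℓ), s = Multiset.toFinsupp t :=
    ⟨s.toMultiset, by simp⟩
  rw [Multiset.toFinsupp_toMultiset] at hc
  interval_cases hcard : Multiset.card t
  · rw [Multiset.card_eq_zero] at hcard
    subst hcard
    simpa using h0
  · obtain ⟨a, rfl⟩ := Multiset.card_eq_one.mp hcard
    rw [Multiset.toFinsupp_singleton]
    exact h1 a
  · obtain ⟨a, b, rfl⟩ := Multiset.card_eq_two.mp hcard
    have : MvPolynomial.monomial (Multiset.toFinsupp ({a, b} : Multiset (Coord ℓ))) (1 : ℂ)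
        = MvPolynomial.X a * MvPolynomial.X b := by
      rw [show ({a, b} : Multiset (Coord ℓ)) = {a} + {b} from rfl, Multiset.toFinsupp_add,
        Multiset.toFinsupp_singleton, Multiset.toFinsupp_singleton]
      simp [MvPolynomial.X, MvPolynomial.monomial_mul]
    rw [this]
    exact h2 a b

/-- The differential identities satisfied by `1` and the coordinates. -/
structure IsAffineHam (g : Poly ℓ) : Prop where
  sq : grad ℓ (grad ℓ (base g)) = 0
  tanA (k : Fin ℓ) : grad ℓ (base (ContactQuant.tanA k g))
    = MvPolynomial.C (1 / 2) * (fv (cy k) * base (MvPolynomial.pderiv cz g))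
  tanB (k : Fin ℓ) : grad ℓ (base (ContactQuant.tanB k g))
    = -(MvPolynomial.C (1 / 2) * (fv (cx k) * base (MvPolynomial.pderiv cz g)))
  z : grad ℓ (base (MvPolynomial.pderiv cz g)) = 0

lemma isAffineHam_one : IsAffineHam (1 : Poly ℓ) := by
  constructor <;> simp

lemma isAffineHam_X (a : Coord ℓ) : IsAffineHam (MvPolynomial.X a : Poly ℓ) := by
  classical
  rcases a with j | j | j
  · change IsAffineHam (MvPolynomial.X (cx j))
    constructor
    · rw [base_X, grad_x, grad_fv]
    · intro k
      rw [tanA_x, pd_X]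
      simp only [cx_cz, if_false]
      split_ifs <;> simp
    · intro k
      rw [tanB_x, pd_X]
      simp only [cx_cz, if_false]
      simp
    · rw [pd_X]
      simp only [cx_cz, if_false]
      simp
  · change IsAffineHam (MvPolynomial.X (cy j))
    constructor
    · rw [base_X, grad_y, grad_fv]
    · intro k
      rw [tanA_y, pd_X]
      simp only [cy_cz, if_false]
      simp
    · intro k
      rw [tanB_y, pd_X]
      simp only [cy_cz, if_false]
      split_ifs <;> simp
    · rw [pd_X]
      simp only [cy_cz, if_false]
      simp
  · change IsAffineHam (MvPolynomial.X cz)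
    have hC : ∀ (c : ℂ) (s : Phase ℓ), grad ℓ (MvPolynomial.C c * s) = MvPolynomial.C c * grad ℓ s := by
      intro c s
      rw [Derivation.leibniz, der_C, smul_zero, add_zero, smul_eq_mul]
    constructor
    · rw [base_X, grad_z, hC, map_sum]
      refine mul_eq_zero_of_right _ (Finset.sum_eq_zero fun i _ => ?_)
      simp only [map_sub, Derivation.leibniz, grad_fv, grad_x, grad_y, smul_zero, add_zero,
        smul_eq_mul]
      ring
    · intro k
      rw [tanA_z, map_mul base, base_C, hC, base_X, grad_y, pd_X, if_pos rfl, map_one, mul_one]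
    · intro k
      rw [tanB_z, map_neg base, map_mul base, base_C, map_neg, hC, base_X, grad_x, pd_X, if_pos rfl,
        map_one, mul_one]
    · simp

/-- The differential identities satisfied by the polynomials of degree at most two. -/
structure IsQuadHam (f : Poly ℓ) : Prop where
  tanA (k : Fin ℓ) : grad ℓ (grad ℓ (base (ContactQuant.tanA k f)))
    = grad ℓ (base (MvPolynomial.pderiv cz f)) * fv (cy k)
  tanB (k : Fin ℓ) : grad ℓ (grad ℓ (base (ContactQuant.tanB k f)))
    = -(grad ℓ (base (MvPolynomial.pderiv cz f)) * fv (cx k))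
  z : grad ℓ (grad ℓ (base (MvPolynomial.pderiv cz f))) = 0

lemma IsAffineHam.mul {g h : Poly ℓ} (hg : IsAffineHam g) (hh : IsAffineHam h) :
    IsQuadHam (g * h) := by
  have e2 : (MvPolynomial.C (1 / 2) : Phase ℓ) + MvPolynomial.C (1 / 2) = 1 := by
    rw [← map_add]; norm_num
  constructor
  · intro k
    simp only [Derivation.leibniz, smul_eq_mul, map_add, map_mul base, hg.sq, hh.sq, hg.tanA,
      hh.tanA, hg.z, hh.z, grad_fv, der_C, mul_zero, add_zero, zero_add]
    linear_combination (fv (cy k) * (grad ℓ (base g) * base (MvPolynomial.pderiv cz h)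
      + grad ℓ (base h) * base (MvPolynomial.pderiv cz g))) * e2
  · intro k
    simp only [Derivation.leibniz, smul_eq_mul, map_add, map_neg, map_mul base, hg.sq, hh.sq, hg.tanB,
      hh.tanB, hg.z, hh.z, grad_fv, der_C, mul_zero, add_zero, zero_add, neg_zero]
    linear_combination -(fv (cx k) * (grad ℓ (base g) * base (MvPolynomial.pderiv cz h)
      + grad ℓ (base h) * base (MvPolynomial.pderiv cz g))) * e2
  · simp only [Derivation.leibniz, smul_eq_mul, map_add, map_mul base, hg.sq, hh.sq,
      hg.z, hh.z, mul_zero, add_zero, zero_add]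

lemma isQuadHam {f : Poly ℓ} (hf : f.totalDegree ≤ 2) : IsQuadHam f := by
  let S : Submodule ℂ (Poly ℓ) :=
    { carrier := {f | IsQuadHam f}
      add_mem' := fun {f g} hf hg => by
        refine ⟨fun k => ?_, fun k => ?_, ?_⟩
        · simp only [map_add, hf.tanA, hg.tanA, add_mul]
        · simp only [map_add, hf.tanB, hg.tanB, add_mul, neg_add]
        · simp only [map_add, hf.z, hg.z, add_zero]
      zero_mem' := by constructor <;> simp
      smul_mem' := fun c f hf => by
        refine ⟨fun k => ?_, fun k => ?_, ?_⟩
        · simp only [Derivation.map_smul, map_smul, hf.tanA, smul_mul_assoc]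
        · simp only [Derivation.map_smul, map_smul, hf.tanB, smul_mul_assoc, smul_neg]
        · simp only [Derivation.map_smul, map_smul, hf.z, smul_zero] }
  refine mem_of_totalDegree_le_two (S := S) ?_ (fun a => ?_) (fun a b => ?_) hf
  · have := isAffineHam_one.mul (isAffineHam_one (ℓ := ℓ))
    rwa [one_mul] at this
  · have := isAffineHam_one.mul (isAffineHam_X a)
    rwa [one_mul] at this
  · exact (isAffineHam_X a).mul (isAffineHam_X b)

lemma grad_fineDer {f : Poly ℓ} (hf : IsQuadHam f) (s : Phase ℓ) :
    grad ℓ (fineDer f s) = fineDer f (grad ℓ s) + base (MvPolynomial.pderiv cz f) * grad ℓ s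
      - grad ℓ (base (MvPolynomial.pderiv cz f)) * Ez s := by
  classical
  have h : ⁅grad ℓ, fineDer f⁆ = (base (MvPolynomial.pderiv cz f) : Phase ℓ) • grad ℓ
      - (grad ℓ (base (MvPolynomial.pderiv cz f)) : Phase ℓ) • Ez := by
    have hE : ∀ t, ((base (MvPolynomial.pderiv cz f) : Phase ℓ) • grad ℓ
        - (grad ℓ (base (MvPolynomial.pderiv cz f)) : Phase ℓ) • Ez :
          Derivation ℂ (Phase ℓ) (Phase ℓ)) t
          = base (MvPolynomial.pderiv cz f) * grad ℓ t
            - grad ℓ (base (MvPolynomial.pderiv cz f)) * (fv cz * dv cz t) := by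
      intro t
      rw [Derivation.sub_apply, Derivation.smul_apply, Derivation.smul_apply, Ez_apply, smul_eq_mul,
        smul_eq_mul]
    apply phase_derivation_ext'
    · intro k
      rw [hE]
      rw [Derivation.commutator_apply, fineDer_bu, chi_x, grad_x, fineDer_x, dv_bu, map_neg, map_neg]
      ring
    · intro k
      rw [hE]
      rw [Derivation.commutator_apply, fineDer_bu, chi_y, grad_y, fineDer_y, dv_bu]
      ring
    · rw [hE]
      have e2 : (MvPolynomial.C (1 / 2) : Phase ℓ) + MvPolynomial.C (1 / 2) = 1 := by
        rw [← map_add]; norm_num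
      rw [Derivation.commutator_apply, fineDer_bu, chi_z, grad_z, dv_bu]
      simp only [Derivation.leibniz, map_sum, map_sub, map_add, map_mul base, base_C, der_C, base_X,
        smul_zero, add_zero, fineDer_x, fineDer_y, fineDer_bu, smul_eq_mul, chi_x, chi_y, map_neg,
        grad_x, grad_y, Finset.sum_add_distrib, Finset.sum_sub_distrib, mul_add, mul_sub,
        Finset.mul_sum]
      have e3 := grad_base f
      rw [Finset.sum_add_distrib] at e3
      have h1 : ∀ (g : Poly ℓ) (j : Coord ℓ), base g * fv j = fv j * base g :=
        fun g j => mul_comm _ _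
      have h3 : ∀ (g : Poly ℓ) (i j : Coord ℓ), bu i * (fv j * base g) = base g * (fv j * bu i) :=
        fun g i j => by ring
      simp only [h1, h3, mul_zero, mul_neg, Finset.sum_neg_distrib, Finset.sum_const_zero,
        ← Finset.mul_sum]
      linear_combination e3 - (∑ i : Fin ℓ, fv (cx i) * base (tanA i f)
        + ∑ i : Fin ℓ, fv (cy i) * base (tanB i f)) * e2
    · intro k
      rw [hE]
      rw [Derivation.commutator_apply, fineDer_x, grad_fv, map_sub, map_neg, hf.tanB,
        Derivation.leibniz, grad_fv, dv_fv]
      simp only [cz_cx, if_false, map_zero, smul_eq_mul]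
      ring
    · intro k
      rw [hE]
      rw [Derivation.commutator_apply, fineDer_y, grad_fv, map_sub, hf.tanA,
        Derivation.leibniz, grad_fv, dv_fv]
      simp only [cz_cy, if_false, map_zero, smul_eq_mul]
      ring
    · rw [hE]
      rw [Derivation.commutator_apply, fineDer_z, grad_fv, map_neg,
        Derivation.leibniz, grad_fv, dv_fv, if_pos rfl]
      simp only [map_zero, smul_eq_mul]
      ring
  have h' := congrArg (fun D : Derivation ℂ (Phase ℓ) (Phase ℓ) => D s) h
  rw [add_sub_assoc]
  exact eq_add_of_sub_eq' ((Derivation.commutator_apply ..).symm.trans h')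

lemma dv_fineDer (f : Poly ℓ) (s : Phase ℓ) :
    dv cz (fineDer f s) = fineDer f (dv cz s) - base (MvPolynomial.pderiv cz f) * dv cz s := by
  classical
  have h : ⁅(dv cz : Derivation ℂ (Phase ℓ) (Phase ℓ)), fineDer f⁆
      = -((base (MvPolynomial.pderiv cz f) : Phase ℓ) • dv cz) := by
    have hE : ∀ t, (-((base (MvPolynomial.pderiv cz f) : Phase ℓ) • dv cz)
        : Derivation ℂ (Phase ℓ) (Phase ℓ)) t = -(base (MvPolynomial.pderiv cz f) * dv cz t) := by
      intro t
      rw [Derivation.neg_apply, Derivation.smul_apply, smul_eq_mul]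
    apply phase_derivation_ext
    · intro i
      rw [Derivation.commutator_apply, fineDer_bu, dv_base, dv_bu, Derivation.neg_apply,
        Derivation.smul_apply, dv_bu, map_zero, smul_zero, sub_zero, neg_zero]
    · rintro (k | k | k)
      · change ⁅(dv cz : Derivation ℂ (Phase ℓ) (Phase ℓ)), fineDer f⁆ (fv (cx k))
          = -(base (MvPolynomial.pderiv cz f) * dv cz (fv (cx k)))
        rw [Derivation.commutator_apply, fineDer_x, map_sub, map_neg, dv_grad, dv_base,
          Derivation.leibniz, dv_base, dv_fv]
        simp only [cz_cx, if_false, map_zero]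
        simp
      · change ⁅(dv cz : Derivation ℂ (Phase ℓ) (Phase ℓ)), fineDer f⁆ (fv (cy k))
          = -(base (MvPolynomial.pderiv cz f) * dv cz (fv (cy k)))
        rw [Derivation.commutator_apply, fineDer_y, map_sub, dv_grad, dv_base,
          Derivation.leibniz, dv_base, dv_fv]
        simp only [cz_cy, if_false, map_zero]
        simp
      · change ⁅(dv cz : Derivation ℂ (Phase ℓ) (Phase ℓ)), fineDer f⁆ (fv cz)
          = -(base (MvPolynomial.pderiv cz f) * dv cz (fv cz))
        rw [Derivation.commutator_apply, fineDer_z, map_neg,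
          Derivation.leibniz, dv_base, dv_fv, if_pos rfl]
        simp
  have h' := congrArg (fun D : Derivation ℂ (Phase ℓ) (Phase ℓ) => D s) h
  rw [sub_eq_add_neg]
  exact eq_add_of_sub_eq' ((Derivation.commutator_apply ..).symm.trans h')

lemma gradZ_fineAct (p : ℂ) {f : Poly ℓ} (hf : IsQuadHam f) {l : ℕ} {s : Phase ℓ}
    (hs : s ∈ piece zdeg l) : gradZ ℓ (fineAct p f s)
      = fineAct p f (gradZ ℓ s) + ((l : ℂ) - p * (ℓ + 1)) • lowDer f s := by
  have hz : Ez (dv cz s) = ((l : ℂ) - 1) • dv cz s := by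
    cases l with
    | zero => rw [dv_zdeg_zero hs, map_zero, smul_zero]
    | succ l =>
      rw [mem_piece_zdeg.mp (dv_zdeg_succ hs)]
      congr 1
      push_cast; ring
  simp only [gradZ_apply, fineAct_apply, lowDer_apply, map_add, Derivation.map_smul, Derivation.leibniz,
    dv_base, smul_zero, map_zero, mul_zero, add_zero, dv_fineDer, map_sub, grad_fineDer hf, hz, smul_eq_mul]
  simp only [MvPolynomial.smul_eq_C_mul, map_sub, map_mul, map_one]
  ring

lemma gradZ_lowDer {f : Poly ℓ} (hf : IsQuadHam f) (s : Phase ℓ) :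
    gradZ ℓ (lowDer f s) = lowDer f (gradZ ℓ s) := by
  simp only [gradZ_apply, lowDer_apply, map_neg, Derivation.leibniz, dv_grad, dv_base, hf.z, map_zero,
    smul_zero, add_zero, smul_eq_mul, mul_zero]

lemma base_mul_piece_zdeg (f : Poly ℓ) {l : ℕ} {s : Phase ℓ} (hs : s ∈ piece zdeg l) :
    base f * s ∈ piece zdeg l := by
  rw [mem_piece_zdeg, Ez_apply] at hs ⊢
  rw [Derivation.leibniz, dv_base, smul_zero, add_zero, smul_eq_mul, mul_left_comm, hs,
    mul_smul_comm]

lemma base_piece_fdeg (f : Poly ℓ) : base f ∈ piece fdeg 0 := by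
  rw [mem_piece_fdeg, Ef_eq_sum]
  simp [dv_base]

lemma mul_piece_fdeg {a b : ℕ} {s t : Phase ℓ} (hs : s ∈ piece fdeg a) (ht : t ∈ piece fdeg b) :
    s * t ∈ piece fdeg (a + b) := by
  rw [mem_piece_fdeg] at hs ht ⊢
  rw [Derivation.leibniz, hs, ht, smul_eq_mul, smul_eq_mul, mul_smul_comm, mul_smul_comm, mul_comm t,
    ← add_smul, add_comm, Nat.cast_add]

lemma fv_mem_piece (i : Coord ℓ) : (fv i : Phase ℓ) ∈ piece fdeg 1 := by
  rw [mem_piece_fdeg, Ef_fv, Nat.cast_one, one_smul]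

lemma fineDer_piece_fdeg (f : Poly ℓ) {k : ℕ} {s : Phase ℓ} (hs : s ∈ piece fdeg k) :
    fineDer f s ∈ piece fdeg k := by
  have h : ⁅(Ef : Derivation ℂ (Phase ℓ) (Phase ℓ)), fineDer f⁆ = 0 := by
    have hbf : ∀ g j, (base g * fv j : Phase ℓ) ∈ piece fdeg 1 := fun g j =>
      mul_piece_fdeg (base_piece_fdeg g) (fv_mem_piece j)
    have hfix : ∀ j, fineDer f (fv j) ∈ piece fdeg 1 := by
      rintro (j | j | j)
      · exact (fineDer_x f j) ▸ sub_mem (neg_mem (grad_piece_fdeg (base_piece_fdeg _))) (hbf _ _)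
      · exact (fineDer_y f j) ▸ sub_mem (grad_piece_fdeg (base_piece_fdeg _)) (hbf _ _)
      · exact (fineDer_z f) ▸ neg_mem (hbf _ _)
    apply phase_derivation_ext
    · intro i
      rw [Derivation.commutator_apply, Ef_bu, fineDer_bu, mem_piece_fdeg.mp (base_piece_fdeg _)]
      simp
    · intro i
      rw [Derivation.commutator_apply, Ef_fv, mem_piece_fdeg.mp (hfix i)]
      simp
  have h' := congrArg (fun D : Derivation ℂ (Phase ℓ) (Phase ℓ) => D s) h
  have h2 := sub_eq_zero.mp ((Derivation.commutator_apply ..).symm.trans h')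
  rw [mem_piece_fdeg] at hs ⊢
  rw [h2, hs, Derivation.map_smul]

lemma fineDer_piece_zdeg (f : Poly ℓ) {l : ℕ} {s : Phase ℓ} (hs : s ∈ piece zdeg l) :
    fineDer f s ∈ piece zdeg l := by
  rw [mem_piece_zdeg, Ez_apply] at hs ⊢
  have := congrArg (fineDer f) hs
  rw [Derivation.leibniz, fineDer_z, Derivation.map_smul, smul_eq_mul, smul_eq_mul] at this
  rw [← this, dv_fineDer]
  ring

lemma fineAct_piece_fdeg (p : ℂ) (f : Poly ℓ) {k : ℕ} {s : Phase ℓ} (hs : s ∈ piece fdeg k) :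
    fineAct p f s ∈ piece fdeg k := by
  rw [fineAct_apply]
  refine add_mem (fineDer_piece_fdeg f hs) (Submodule.smul_mem _ _ ?_)
  have := mul_piece_fdeg (base_piece_fdeg (MvPolynomial.pderiv cz f)) hs
  rwa [zero_add] at this

lemma fineAct_piece_zdeg (p : ℂ) (f : Poly ℓ) {l : ℕ} {s : Phase ℓ} (hs : s ∈ piece zdeg l) :
    fineAct p f s ∈ piece zdeg l := by
  rw [fineAct_apply]
  exact add_mem (fineDer_piece_zdeg f hs) (Submodule.smul_mem _ _ (base_mul_piece_zdeg _ hs))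

lemma lowDer_piece_fdeg (f : Poly ℓ) {k : ℕ} {s : Phase ℓ} (hs : s ∈ piece fdeg k) :
    lowDer f s ∈ piece fdeg k := by
  rw [lowDer_apply]
  cases k with
  | zero => rw [dv_piece_zero _ hs, mul_zero, neg_zero]; exact zero_mem _
  | succ k =>
    have := mul_piece_fdeg (grad_piece_fdeg (base_piece_fdeg (MvPolynomial.pderiv cz f)))
      (dv_piece_succ cz hs)
    rw [zero_add, add_comm] at this
    exact neg_mem this

lemma lowDer_zdeg_lt (f : Poly ℓ) {l : ℕ} {s : Phase ℓ} (hs : s ∈ piece zdeg l) :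
    lowDer f s ∈ MvPolynomial.restrictSupport ℂ {t | zdeg t < l} := by
  rw [lowDer_apply]
  cases l with
  | zero => rw [dv_zdeg_zero hs, mul_zero, neg_zero]; exact zero_mem _
  | succ l =>
    have h := dv_zdeg_succ hs
    have h2 : grad ℓ (base (MvPolynomial.pderiv cz f)) * dv cz s ∈ piece zdeg l := by
      rw [mem_piece_zdeg, Ez_apply] at h ⊢
      rw [Derivation.leibniz, dv_grad, dv_base, map_zero, smul_zero, add_zero, smul_eq_mul,
        mul_left_comm, h, mul_smul_comm]
    have h3 : {t : Coord ℓ ⊕ Coord ℓ →₀ ℕ | zdeg t = l} ⊆ {t | zdeg t < l + 1} :=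
      fun t (ht : zdeg t = l) => ht.trans_lt (Nat.lt_succ_self l)
    exact neg_mem (MvPolynomial.restrictSupport_mono ℂ h3 h2)

/-- The splitting of the fine filtration, written on symbols in the contact frame. -/
def fineQ (ℓ : ℕ) (p : ℂ) : Module.End ℂ (Phase ℓ) :=
  triang zdeg (gradZ ℓ) (triCoef (fun l => (l : ℂ) - p * (ℓ + 1)) fun _ => 1)

/-- `fineQ` intertwines the action on fine symbols with the action on symbols. -/
lemma fineQ_intertwines {p : ℂ} (hp : Generic ℓ p) {f : Poly ℓ} (hf : f.totalDegree ≤ 2)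
    (s : Phase ℓ) : fineAct p f (fineQ ℓ p s) + lowDer f (fineQ ℓ p s)
      = fineQ ℓ p (fineAct p f s) := by
  have hq := isQuadHam hf
  refine triang_intertwines (L' := fineAct p f + (lowDer f).toLinearMap)
    (K := (lowDer f).toLinearMap) lowers_gradZ (fun d j hj => ?_)
    (fun d s hs => fineAct_piece_zdeg p f hs) (fun s hs => ?_) (gradZ_lowDer hq)
    (fun d s hs => gradZ_fineAct p hq hs) (fun d s _ => ?_) s
  · have := sum_arith (-(p * (ℓ + 1))) (-1) d j hj
    have e : ∀ a, -(p * (ℓ + 1)) - -1 * ((d - a : ℕ) : ℂ) = ((d - a : ℕ) : ℂ) - p * (ℓ + 1) := by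
      intro a; ring
    simp only [e] at this
    rw [this]
    refine mul_ne_zero (by exact_mod_cast Nat.succ_ne_zero j) fun h => ?_
    refine hp (2 * d - j) ?_
    push_cast at h ⊢
    linear_combination -2 * h
  · have h := lowDer_apply f s
    rwa [dv_zdeg_zero hs, mul_zero, neg_zero] at h
  · rw [one_smul]; rfl

/-! ### The fine filtration in the contact frame -/

lemma symV_piece (X : Vec ℓ) : symV X ∈ piece fdeg 1 :=
  Submodule.sum_mem _ fun i _ => mul_piece_fdeg (base_piece_fdeg _) (fv_mem_piece i)

lemma algHom_piece_fdeg {φ : Phase ℓ →ₐ[ℂ] Phase ℓ} (hu : ∀ i, φ (bu i) = bu i)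
    (hv : ∀ i, φ (fv i) ∈ piece fdeg 1) {k : ℕ} {s : Phase ℓ} (hs : s ∈ piece fdeg k) :
    φ s ∈ piece fdeg k := by
  rw [mem_piece_fdeg] at hs ⊢
  rw [derivation_intertwines (D := Ef) (E := Ef) (φ := φ) (fun i => ?_) (fun i => ?_), hs, map_smul]
  · rw [hu, Ef_bu, map_zero]
  · rw [mem_piece_fdeg.mp (hv i), Ef_fv, Nat.cast_one, one_smul]

lemma frame_piece {k : ℕ} {s : Phase ℓ} (hs : s ∈ piece fdeg k) : frame ℓ s ∈ piece fdeg k := by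
  refine algHom_piece_fdeg frame_bu ?_ hs
  rintro (i | i | i)
  · exact (frame_x i) ▸ symV_piece _
  · exact (frame_y i) ▸ neg_mem (symV_piece _)
  · change frame ℓ (fv cz) ∈ _
    rw [frame_z]
    exact fv_mem_piece cz

lemma frameInv_piece {k : ℕ} {s : Phase ℓ} (hs : s ∈ piece fdeg k) :
    frameInv ℓ s ∈ piece fdeg k := by
  have h : ∀ i j : Coord ℓ, MvPolynomial.C (1 / 2) * bu i * fv j ∈ piece fdeg 1 := by
    intro i j
    have := mul_piece_fdeg (base_piece_fdeg (MvPolynomial.C (1 / 2) * MvPolynomial.X i)) (fv_mem_piece j)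
    rwa [map_mul base, base_C, base_X] at this
  refine algHom_piece_fdeg frameInv_bu ?_ hs
  rintro (i | i | i)
  · exact (frameInv_x i) ▸ sub_mem (neg_mem (fv_mem_piece _)) (h _ _)
  · exact (frameInv_y i) ▸ add_mem (fv_mem_piece _) (h _ _)
  · change frameInv ℓ (fv cz) ∈ _
    rw [frameInv_z]
    exact fv_mem_piece cz

lemma map_mem_degLT {F : Module.End ℂ (Phase ℓ)} (hF : ∀ k, ∀ s ∈ piece fdeg k, F s ∈ piece fdeg k)
    {n : ℕ} {s : Phase ℓ} (hs : s ∈ degLT ℓ n) : F s ∈ degLT ℓ n :=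
  restrictSupport_le_comap (F := F) (fun t ht => piece_le_degLT ht
    (hF _ _ (monomial_mem_of (A := {u | fdeg u = fdeg t}) rfl 1))) hs

lemma frame_mem_degLT {n : ℕ} {s : Phase ℓ} : frame ℓ s ∈ degLT ℓ n ↔ s ∈ degLT ℓ n := by
  constructor
  · intro h
    have := map_mem_degLT (F := (frameInv ℓ).toLinearMap) (fun k s hs => frameInv_piece hs) h
    change (frameEquiv ℓ).symm (frameEquiv ℓ s) ∈ _ at this
    rwa [AlgEquiv.symm_apply_apply] at this
  · exact map_mem_degLT (F := (frame ℓ).toLinearMap) fun k s hs => frame_piece hs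

lemma zdeg_le_fdeg (t : Coord ℓ ⊕ Coord ℓ →₀ ℕ) : zdeg t ≤ fdeg t :=
  Finset.single_le_sum (f := fun i => t (Sum.inr i)) (fun _ _ => Nat.zero_le _) (Finset.mem_univ cz)

/-- The exponents of the fine symbols of the operators of order `≤ k` and non-tangential order
`< n`, and of all symbols of degree `< k`. -/
def fineSet (ℓ k n : ℕ) : Set (Coord ℓ ⊕ Coord ℓ →₀ ℕ) :=
  {t | fdeg t < k ∨ fdeg t = k ∧ zdeg t < n}

lemma fineSet_le {k n : ℕ} : fineSet ℓ k n ⊆ {t | fdeg t < k + 1} := by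
  rintro t (h | ⟨h, -⟩)
  · exact Nat.lt_succ_of_lt h
  · exact h.trans_lt (Nat.lt_succ_self k)

lemma fineOpLT_mono {k n n' : ℕ} (h : n ≤ n') : fineOpLT ℓ k n ≤ fineOpLT ℓ k n' := by
  refine sup_le le_sup_left (iSup₂_le fun i hi T hT => ?_)
  exact Submodule.mem_sup_right (Submodule.mem_iSup_of_mem i (Submodule.mem_iSup_of_mem
    (Finset.mem_range.mpr ((Finset.mem_range.mp hi).trans_le h)) hT))

lemma mul_tan_mem_fineOpLT {k n : ℕ} (hn : n ≤ k + 1) {T : Vec ℓ} (hT : T ∈ Tan ℓ)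
    {S : Module.End ℂ (Poly ℓ)} (hS : S ∈ fineOpLT ℓ k n) :
    S * vecOp T ∈ fineOpLT ℓ (k + 1) n := by
  have h : fineOpLT ℓ k n ≤ (fineOpLT ℓ (k + 1) n).comap (LinearMap.mulRight ℂ (vecOp T)) := by
    refine sup_le (fun S hS => ?_) (iSup₂_le fun i hi => ?_)
    · exact Submodule.mem_sup_left (opLT_mul (b := 2) (by omega) hS (vecOp_mem (by omega) T))
    · rw [Submodule.mul_le]
      intro A hA B hB
      change A * B * vecOp T ∈ fineOpLT ℓ (k + 1) n
      have hi' := Finset.mem_range.mp hi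
      refine Submodule.mem_sup_right (Submodule.mem_iSup_of_mem i (Submodule.mem_iSup_of_mem hi ?_))
      rw [mul_assoc, show k + 1 - i = (k - i) + 1 by omega, Submodule.pow_succ]
      exact Submodule.mul_mem_mul hA (Submodule.mul_mem_mul hB (Submodule.subset_span ⟨T, hT, rfl⟩))
  exact h hS

lemma mul_pz_mem_fineOpLT {k n : ℕ} (hn : n ≤ k + 1) {S : Module.End ℂ (Poly ℓ)}
    (hS : S ∈ fineOpLT ℓ k n) :
    S * vecOp (MvPolynomial.pderiv cz : Vec ℓ) ∈ fineOpLT ℓ (k + 1) (n + 1) := by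
  have hz : (MvPolynomial.pderiv cz : Vec ℓ) ∈ Con ℓ := chi_one (ℓ := ℓ) ▸ chi_mem_con 1
  have h : fineOpLT ℓ k n ≤ (fineOpLT ℓ (k + 1) (n + 1)).comap
      (LinearMap.mulRight ℂ (vecOp (MvPolynomial.pderiv cz : Vec ℓ))) := by
    refine sup_le (fun S hS => ?_) (iSup₂_le fun i hi => ?_)
    · exact Submodule.mem_sup_left (opLT_mul (b := 2) (by omega) hS (vecOp_mem (by omega) _))
    · rw [Submodule.mul_le]
      intro A hA B hB
      have hi' := Finset.mem_range.mp hi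
      have e : A * B * vecOp (MvPolynomial.pderiv cz : Vec ℓ)
          = A * vecOp (MvPolynomial.pderiv cz : Vec ℓ) * B
            - A * (vecOp (MvPolynomial.pderiv cz : Vec ℓ) * B
              - B * vecOp (MvPolynomial.pderiv cz : Vec ℓ)) := by
        rw [mul_sub, ← mul_assoc A _ B, ← mul_assoc A B, sub_sub_cancel]
      change A * B * vecOp (MvPolynomial.pderiv cz : Vec ℓ) ∈ fineOpLT ℓ (k + 1) (n + 1)
      rw [e]
      refine sub_mem (Submodule.mem_sup_right (Submodule.mem_iSup_of_mem (i + 1)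
        (Submodule.mem_iSup_of_mem (Finset.mem_range.mpr (by omega)) ?_))) (Submodule.mem_sup_left ?_)
      · rw [show k + 1 - (i + 1) = k - i by omega]
        exact Submodule.mul_mem_mul (opLT_mul (b := 2) (by omega) hA (vecOp_mem (by omega) _)) hB
      · exact opLT_mul (by omega) hA (tanOps_pow_le _ (comm_tanOps_pow_mem hz _ B hB))
  exact h hS

/-- Composition with a vector field is multiplication by its symbol up to lower order. -/
lemma normalOrder_symV_mul {d : ℕ} (T : Vec ℓ) {s : Phase ℓ} (hs : s ∈ degLT ℓ (d + 1)) :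
    normalOrder (symV T * s) - normalOrder s * vecOp T ∈ opLT ℓ (d + 1) := by
  have e1 : vecOp T = ∑ i, mulOp (T (MvPolynomial.X i)) * vecOp (MvPolynomial.pderiv i : Vec ℓ) := by
    refine LinearMap.ext fun f => ?_
    rw [vecOp_apply, vec_apply, LinearMap.sum_apply]
    rfl
  have e2 : normalOrder (symV T * s) = ∑ i, mulOp (T (MvPolynomial.X i)) * normalOrder s
      * vecOp (MvPolynomial.pderiv i : Vec ℓ) := by
    rw [symV, Finset.sum_mul, map_sum]
    refine Finset.sum_congr rfl fun i _ => ?_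
    rw [mul_assoc, normalOrder_base_mul, normalOrder_fv_mul, mul_assoc]
  rw [e1, e2, Finset.mul_sum, ← Finset.sum_sub_distrib]
  refine Submodule.sum_mem _ fun i _ => ?_
  have h := neg_mem (comm_mulOp_mem (T (MvPolynomial.X i)) (normalOrder_mem_opLT.mpr hs))
  rw [neg_sub] at h
  rw [← mul_assoc, ← sub_mul]
  exact opLT_mul (b := 2) (by omega) h (vecOp_mem (by omega) _)

lemma normalOrder_frame_monomial (t : Coord ℓ ⊕ Coord ℓ →₀ ℕ) :
    normalOrder (frame ℓ (MvPolynomial.monomial t 1)) ∈ fineOpLT ℓ (fdeg t) (zdeg t + 1) := by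
  classical
  obtain ⟨m, rfl⟩ : ∃ m : Multiset (Coord ℓ ⊕ Coord ℓ), t = Multiset.toFinsupp m :=
    ⟨t.toMultiset, by simp⟩
  induction m using Multiset.induction_on with
  | empty =>
    rw [Multiset.toFinsupp_zero]
    have : MvPolynomial.monomial (0 : Coord ℓ ⊕ Coord ℓ →₀ ℕ) (1 : ℂ) = 1 := rfl
    rw [this, map_one, normalOrder_one, ← mulOp_one]
    refine Submodule.mem_sup_right (Submodule.mem_iSup_of_mem 0 (Submodule.mem_iSup_of_mem
      (by simp) ?_))
    rw [show fdeg (0 : Coord ℓ ⊕ Coord ℓ →₀ ℕ) = 0 by simp [fdeg], Nat.sub_zero, Submodule.pow_zero, Submodule.mul_one]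
    exact mulOp_mem (by omega) 1
  | cons a m ih =>
    have e : Multiset.toFinsupp (a ::ₘ m) = Finsupp.single a 1 + Multiset.toFinsupp m := by
      rw [← Multiset.singleton_add, Multiset.toFinsupp_add, Multiset.toFinsupp_singleton]
    have e' : MvPolynomial.monomial (Multiset.toFinsupp (a ::ₘ m)) (1 : ℂ)
        = MvPolynomial.X a * MvPolynomial.monomial (Multiset.toFinsupp m) 1 := by
      rw [e, MvPolynomial.X, MvPolynomial.monomial_mul, one_mul]
    have hle := zdeg_le_fdeg (Multiset.toFinsupp m)
    have hmem : frame ℓ (MvPolynomial.monomial (Multiset.toFinsupp m) 1)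
        ∈ degLT ℓ (fdeg (Multiset.toFinsupp m) + 1) :=
      frame_mem_degLT.mpr (monomial_mem_of
        (A := {u | fdeg u < fdeg (Multiset.toFinsupp m) + 1}) (Nat.lt_succ_self _) 1)
    set s := frame ℓ (MvPolynomial.monomial (Multiset.toFinsupp m) 1) with hsdef
    have htan : ∀ T ∈ Tan ℓ, normalOrder (symV T * s) ∈ fineOpLT ℓ
        (1 + fdeg (Multiset.toFinsupp m)) (zdeg (Multiset.toFinsupp m) + 1) := by
      intro T hT
      rw [add_comm 1, ← sub_add_cancel (normalOrder (symV T * s)) (normalOrder s * vecOp T)]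
      exact add_mem (Submodule.mem_sup_left (normalOrder_symV_mul T hmem))
        (mul_tan_mem_fineOpLT (by omega) hT ih)
    have hf : fdeg (Multiset.toFinsupp (a ::ₘ m)) = fdeg (Finsupp.single a 1)
      + fdeg (Multiset.toFinsupp m) := by rw [e, fdeg_add]
    have hz : zdeg (Multiset.toFinsupp (a ::ₘ m)) = zdeg (Finsupp.single a 1)
      + zdeg (Multiset.toFinsupp m) := by rw [e]; rfl
    rw [hf, hz, e', map_mul, ← hsdef]
    rcases a with a | a | a | a
    · change normalOrder (frame ℓ (bu a) * s) ∈ _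
      rw [frame_bu, normalOrder_bu_mul, fdeg_inl, zero_add, show zdeg (Finsupp.single (Sum.inl a) 1) = 0 by
        simp [zdeg], zero_add]
      exact mulOp_mul_mem_fine _ _ ih
    · change normalOrder (frame ℓ (fv (cx a)) * s) ∈ _
      rw [frame_x, fdeg_inr, show zdeg (Finsupp.single (Sum.inr (Sum.inl a)) 1) = 0 by
        simp [zdeg, cz], zero_add]
      exact htan _ (tanB_mem a)
    · change normalOrder (frame ℓ (fv (cy a)) * s) ∈ _
      rw [frame_y, fdeg_inr, show zdeg (Finsupp.single (Sum.inr (Sum.inr (Sum.inl a))) 1) = 0 by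
        simp [zdeg, cz], zero_add, neg_mul, map_neg]
      exact neg_mem (htan _ (tanA_mem a))
    · change normalOrder (frame ℓ (fv cz) * s) ∈ _
      rw [frame_z, fdeg_inr, show zdeg (Finsupp.single (Sum.inr (Sum.inr (Sum.inr a))) 1) = 1 by
        simp [zdeg, cz], normalOrder_fv_mul, add_comm 1, add_comm 1]
      exact mul_pz_mem_fineOpLT (by omega) ih

lemma symV_tan {T : Vec ℓ} (hT : T ∈ Tan ℓ) : symV T = frame ℓ (∑ i : Fin ℓ,
    (base (T (MvPolynomial.X (cy i))) * fv (cx i) - base (T (MvPolynomial.X (cx i))) * fv (cy i))) := by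
  conv_lhs => rw [tan_eq hT, symV_sum]
  rw [map_sum]
  refine Finset.sum_congr rfl fun i _ => ?_
  rw [symV_add, symV_fsmul, symV_fsmul, map_sub, map_mul, map_mul, frame_base, frame_base, frame_x,
    frame_y]
  ring

lemma base_mul_mem_fineSet {k n : ℕ} (f : Poly ℓ) {s : Phase ℓ}
    (hs : s ∈ MvPolynomial.restrictSupport ℂ (fineSet ℓ k n)) :
    base f * s ∈ MvPolynomial.restrictSupport ℂ (fineSet ℓ k n) := by
  induction f using MvPolynomial.induction_on generalizing s with
  | C a =>
    rw [base_C, ← MvPolynomial.smul_eq_C_mul]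
    exact Submodule.smul_mem _ _ hs
  | add f g hf hg => rw [map_add, add_mul]; exact add_mem (hf hs) (hg hs)
  | mul_X f i hf =>
    rw [map_mul base, base_X, mul_assoc]
    refine hf (X_mul_mem _ (fun t ht => ?_) hs)
    have h1 : zdeg (t + Finsupp.single (Sum.inl i) 1) = zdeg t := by simp [zdeg]
    change fdeg _ < k ∨ fdeg _ = k ∧ zdeg _ < n
    rwa [fdeg_add, fdeg_inl, h1]

lemma fv_mul_mem_fineSet {k n : ℕ} {i : Coord ℓ} (hi : i ≠ cz) {s : Phase ℓ}
    (hs : s ∈ MvPolynomial.restrictSupport ℂ (fineSet ℓ k n)) :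
    fv i * s ∈ MvPolynomial.restrictSupport ℂ (fineSet ℓ (k + 1) n) := by
  refine X_mul_mem _ (fun t ht => ?_) hs
  have h1 : zdeg (t + Finsupp.single (Sum.inr i) 1) = zdeg t := by simp [zdeg, Finsupp.single_apply, hi]
  change fdeg _ < k + 1 ∨ fdeg _ = k + 1 ∧ zdeg _ < n
  rwa [fdeg_add, fdeg_inr, h1, Nat.add_lt_add_iff_right, Nat.add_right_cancel_iff]

lemma opLT_mul_tanOps_pow_le (i r : ℕ) : opLT ℓ (i + 1) * tanOps ℓ ^ r ≤
    (MvPolynomial.restrictSupport ℂ (fineSet ℓ (i + r) (i + 1))).map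
      (normalOrder ∘ₗ (frame ℓ).toLinearMap) := by
  have hdeg : ∀ {n : ℕ} {T : Module.End ℂ (Poly ℓ)}, T ∈ opLT ℓ n →
      ∃ s ∈ degLT ℓ n, normalOrder (frame ℓ s) = T := by
    intro n T hT
    rw [← map_normalOrder_degLT] at hT
    obtain ⟨s, hs, rfl⟩ := hT
    obtain ⟨s, rfl⟩ := (frameEquiv ℓ).surjective s
    exact ⟨s, frame_mem_degLT.mp hs, rfl⟩
  induction r with
  | zero =>
    rw [Submodule.pow_zero, Submodule.mul_one]
    intro T hT
    obtain ⟨s, hs, rfl⟩ := hdeg hT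
    refine ⟨s, MvPolynomial.restrictSupport_mono _ (fun t (ht : fdeg t < i + 1) => ?_) hs, rfl⟩
    have := zdeg_le_fdeg t
    change fdeg t < i + 0 ∨ fdeg t = i + 0 ∧ zdeg t < i + 1
    omega
  | succ r ih =>
    rw [Submodule.pow_succ, ← mul_assoc, Submodule.mul_le]
    intro A hA B hB
    obtain ⟨s, hs, rfl⟩ := ih hA
    induction hB using Submodule.span_induction with
    | mem B hB =>
      obtain ⟨T, hT, rfl⟩ := hB
      change normalOrder (frame ℓ s) * vecOp T ∈ _
      have h1 : frame ℓ s ∈ degLT ℓ (i + r + 1) :=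
        frame_mem_degLT.mpr (MvPolynomial.restrictSupport_mono _ fineSet_le hs)
      obtain ⟨u, hu, hu'⟩ := hdeg (normalOrder_symV_mul T h1)
      have e : normalOrder (frame ℓ s) * vecOp T = normalOrder (symV T * frame ℓ s)
          - normalOrder (frame ℓ u) := by rw [hu']; abel
      rw [e, symV_tan hT, ← map_mul, ← map_sub, ← map_sub]
      refine ⟨_, sub_mem ?_ (MvPolynomial.restrictSupport_mono _ (fun t ht => Or.inl ht) hu), rfl⟩
      rw [Finset.sum_mul]
      refine Submodule.sum_mem _ fun j _ => ?_
      rw [sub_mul, mul_assoc, mul_assoc]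
      exact sub_mem (base_mul_mem_fineSet _ (fv_mul_mem_fineSet (by simp [cx, cz]) hs))
        (base_mul_mem_fineSet _ (fv_mul_mem_fineSet (by simp [cy, cz]) hs))
    | zero => rw [mul_zero]; exact zero_mem _
    | add T S _ _ h1 h2 => rw [mul_add]; exact add_mem h1 h2
    | smul c T _ h => rw [mul_smul_comm]; exact Submodule.smul_mem _ _ h

/-- In the contact frame the fine filtration is given by the degree and by the degree in the
fibre variable of `z`. -/
lemma map_normalOrder_fineSet {k n : ℕ} (hn : n ≤ k + 1) :
    (MvPolynomial.restrictSupport ℂ (fineSet ℓ k n)).map (normalOrder ∘ₗ (frame ℓ).toLinearMap)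
      = fineOpLT ℓ k n := by
  apply le_antisymm
  · rw [Submodule.map_le_iff_le_comap]
    intro s hs
    rw [Submodule.mem_comap]
    refine restrictSupport_le_comap (F := normalOrder ∘ₗ (frame ℓ).toLinearMap) (fun t ht => ?_) hs
    rcases ht with ht | ⟨rfl, ht⟩
    · refine Submodule.mem_sup_left (normalOrder_mem_opLT.mpr ?_)
      exact frame_mem_degLT.mpr (monomial_mem_of (A := {t | fdeg t < k}) ht 1)
    · exact fineOpLT_mono ht (normalOrder_frame_monomial t)
  · refine sup_le (fun T hT => ?_) (iSup₂_le fun i hi => ?_)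
    · rw [← map_normalOrder_degLT] at hT
      obtain ⟨s, hs, rfl⟩ := hT
      obtain ⟨s, rfl⟩ := (frameEquiv ℓ).surjective s
      exact ⟨s, MvPolynomial.restrictSupport_mono _ (fun t ht => Or.inl ht) (frame_mem_degLT.mp hs), rfl⟩
    · have hi' := Finset.mem_range.mp hi
      refine (opLT_mul_tanOps_pow_le i (k - i)).trans (Submodule.map_mono
        (MvPolynomial.restrictSupport_mono _ ?_))
      rintro t (h | ⟨h, h'⟩)
      · exact Or.inl (by omega)
      · exact Or.inr ⟨by omega, by omega⟩

lemma normalOrder_frame_mem {k n : ℕ} (hn : n ≤ k + 1) {s : Phase ℓ} :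
    normalOrder (frame ℓ s) ∈ fineOpLT ℓ k n ↔ s ∈ MvPolynomial.restrictSupport ℂ (fineSet ℓ k n) := by
  rw [← map_normalOrder_fineSet hn]
  constructor
  · rintro ⟨s', hs', h⟩
    have := (frameEquiv ℓ).injective (normalOrder_injective h)
    rwa [← this]
  · exact fun h => ⟨s, h, rfl⟩

/-! ### Symbol modules as spaces of polynomials -/

section Quotient

open MvPolynomial

variable {σ L M : Type*} [LieRing L] [AddCommGroup M] [Module ℂ M] [LieRingModule L M]

/-- The class in a quotient `N / N'` of the image of a polynomial with exponents in `D`. -/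
def toQuot (F : MvPolynomial σ ℂ →ₗ[ℂ] M) (N N' : LieSubmodule ℂ L M) (D : Set (σ →₀ ℕ))
    (hD : ∀ s ∈ restrictSupport ℂ D, F s ∈ N) :
    restrictSupport ℂ D →ₗ[ℂ] (↥N ⧸ N'.comap N.incl) :=
  (N'.comap N.incl).toSubmodule.mkQ ∘ₗ (F.restrict (q := N.toSubmodule) hD)

lemma toQuot_apply {F : MvPolynomial σ ℂ →ₗ[ℂ] M} {N N' : LieSubmodule ℂ L M} {D : Set (σ →₀ ℕ)}
    (hD : ∀ s ∈ restrictSupport ℂ D, F s ∈ N) (s : restrictSupport ℂ D) :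
    toQuot F N N' D hD s = LieSubmodule.Quotient.mk (N := N'.comap N.incl) ⟨F s.1, hD s.1 s.2⟩ := rfl

lemma mk_eq_mk_iff {N N' : LieSubmodule ℂ L M} {a b : ↥N} :
    LieSubmodule.Quotient.mk (N := N'.comap N.incl) a = LieSubmodule.Quotient.mk b
      ↔ (a : M) - b ∈ N' :=
  Submodule.Quotient.eq (N'.comap N.incl).toSubmodule

lemma toQuot_bijective {F : MvPolynomial σ ℂ →ₗ[ℂ] M} {N N' : LieSubmodule ℂ L M}
    {A B D : Set (σ →₀ ℕ)} (hN : ∀ x ∈ N, ∃ s ∈ restrictSupport ℂ A, F s = x)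
    (hB : ∀ s, F s ∈ N' ↔ s ∈ restrictSupport ℂ B) (hAB : A \ D ⊆ B) (hDB : Disjoint D B)
    (hD : ∀ s ∈ restrictSupport ℂ D, F s ∈ N) : Function.Bijective (toQuot F N N' D hD) := by
  constructor
  · rw [injective_iff_map_eq_zero]
    intro s hs
    have h : F s.1 ∈ N' := (LieSubmodule.Quotient.mk_eq_zero' (N := N'.comap N.incl)).mp hs
    refine Subtype.ext ?_
    rw [← monoProj_of_mem s.2]
    exact monoProj_eq_zero ((hB _).mp h) hDB
  · intro q
    obtain ⟨x, rfl⟩ := Submodule.mkQ_surjective (N'.comap N.incl).toSubmodule q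
    obtain ⟨s, hs, hx⟩ := hN x.1 x.2
    refine ⟨⟨monoProj D s, monoProj_mem D s⟩, ?_⟩
    rw [toQuot_apply]
    refine mk_eq_mk_iff.mpr ?_
    have h := (hB _).mpr (restrictSupport_mono _ hAB (sub_monoProj_mem D A hs))
    rw [← neg_sub, ← hx, ← map_sub]
    exact neg_mem h

end Quotient

variable {lam p : ℂ}

/-- The differential operator with a given normally ordered symbol. -/
def toOp (ℓ : ℕ) (lam p : ℂ) : Phase ℓ →ₗ[ℂ] HomDens ℓ lam p :=
  (toHom ℓ lam p).toLinearMap ∘ₗ normalOrder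

lemma toOp_apply (s : Phase ℓ) : toOp ℓ lam p s = toHom ℓ lam p (normalOrder s) := rfl

lemma toOp_injective : Function.Injective (toOp ℓ lam p) :=
  (toHom ℓ lam p).injective.comp normalOrder_injective

lemma toOp_mem_diffLT {n : ℕ} {s : Phase ℓ} : toOp ℓ lam p s ∈ diffLT ℓ lam p n ↔ s ∈ degLT ℓ n := by
  rw [← normalOrder_mem_opLT]
  constructor
  · rintro ⟨T, hT, h⟩
    rwa [← (toHom ℓ lam p).injective h]
  · exact fun h => ⟨_, h, rfl⟩

lemma exists_toOp_diffLT {n : ℕ} {T : HomDens ℓ lam p} (hT : T ∈ diffLT ℓ lam p n) :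
    ∃ s ∈ degLT ℓ n, toOp ℓ lam p s = T := by
  obtain ⟨T, hT, rfl⟩ := hT
  change T ∈ opLT ℓ n at hT
  rw [← map_normalOrder_degLT] at hT
  obtain ⟨s, hs, rfl⟩ := hT
  exact ⟨s, hs, rfl⟩

lemma toOp_frame_mem_fineLT {k n : ℕ} (hn : n ≤ k + 1) {s : Phase ℓ} :
    toOp ℓ lam p (frame ℓ s) ∈ fineLT ℓ lam p k n hn
      ↔ s ∈ MvPolynomial.restrictSupport ℂ (fineSet ℓ k n) := by
  rw [← normalOrder_frame_mem hn]
  constructor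
  · rintro ⟨T, hT, h⟩
    rwa [← (toHom ℓ lam p).injective h]
  · exact fun h => ⟨_, h, rfl⟩

lemma exists_toOp_fineLT {k n : ℕ} (hn : n ≤ k + 1) {T : HomDens ℓ lam p}
    (hT : T ∈ fineLT ℓ lam p k n hn) :
    ∃ s ∈ MvPolynomial.restrictSupport ℂ (fineSet ℓ k n), toOp ℓ lam p (frame ℓ s) = T := by
  obtain ⟨T, hT, rfl⟩ := hT
  change T ∈ fineOpLT ℓ k n at hT
  rw [← map_normalOrder_fineSet hn] at hT
  obtain ⟨s, hs, rfl⟩ := hT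
  exact ⟨s, hs, rfl⟩

lemma toOp_mem_Diff (s : Phase ℓ) : toOp ℓ lam p s ∈ Diff ℓ lam p := by
  obtain ⟨n, hn⟩ := mem_degLT_some s
  exact le_iSup (diffLT ℓ lam p) n (toOp_mem_diffLT.mpr hn)

/-- Polynomial differential operators are parametrized by their normally ordered symbols. -/
def opEquiv (ℓ : ℕ) (lam p : ℂ) : Phase ℓ ≃ₗ[ℂ] ↥(Diff ℓ lam p) :=
  LinearEquiv.ofBijective ((toOp ℓ lam p).codRestrict (Diff ℓ lam p).toSubmodule toOp_mem_Diff) (by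
    constructor
    · exact fun a b h => toOp_injective (congrArg Subtype.val h)
    · rintro ⟨T, hT⟩
      have h : (Diff ℓ lam p).toSubmodule ≤ LinearMap.range (toOp ℓ lam p) := by
        rw [Diff, LieSubmodule.iSup_toSubmodule]
        refine iSup_le fun n T hT => ?_
        obtain ⟨s, -, hs⟩ := exists_toOp_diffLT hT
        exact ⟨s, hs⟩
      obtain ⟨s, hs⟩ := h hT
      exact ⟨s, Subtype.ext hs⟩)

lemma toOp_piece_mem {k : ℕ} {s : Phase ℓ} (hs : s ∈ piece fdeg k) :
    toOp ℓ lam p s ∈ diffOrd ℓ lam p k :=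
  toOp_mem_diffLT.mpr (piece_le_degLT (Nat.lt_succ_self k) hs)

/-- `Symb^k(p)` consists of the polynomials of fibre degree `k`. -/
def symbEquiv (ℓ : ℕ) (lam p : ℂ) (k : ℕ) : piece (fdeg (ℓ := ℓ)) k ≃ₗ[ℂ] Symb ℓ lam p k :=
  LinearEquiv.ofBijective
    (toQuot (toOp ℓ lam p) (diffOrd ℓ lam p k) (diffLT ℓ lam p k) {t | fdeg t = k}
      fun _ hs => toOp_piece_mem hs)
    (toQuot_bijective (fun _ hT => exists_toOp_diffLT hT) (fun _ => toOp_mem_diffLT)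
      (fun _ ht => lt_of_le_of_ne (Nat.lt_succ_iff.mp ht.1) ht.2)
      (Set.disjoint_left.mpr fun _ h h' => (ne_of_lt h') h) _)

/-- The bidegree that corresponds to a component of the fine symbol module. -/
def fidx (t : Coord ℓ ⊕ Coord ℓ →₀ ℕ) : FineIdx :=
  ⟨fdeg t, ⟨zdeg t, Nat.lt_succ_of_le (zdeg_le_fdeg t)⟩⟩

lemma fidx_eq {t : Coord ℓ ⊕ Coord ℓ →₀ ℕ} {i : FineIdx} :
    fidx t = i ↔ fdeg t = i.1 ∧ zdeg t = i.2 := by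
  obtain ⟨k, l, hl⟩ := i
  constructor
  · intro h
    obtain ⟨rfl, h⟩ := Sigma.mk.inj h
    exact ⟨rfl, congrArg Fin.val (eq_of_heq h)⟩
  · rintro ⟨h1, h2⟩
    change fdeg t = k at h1
    change zdeg t = l at h2
    subst h1
    subst h2
    rfl

lemma mem_piece_fidx {i : FineIdx} {s : Phase ℓ} :
    s ∈ piece fidx i ↔ s ∈ piece fdeg i.1 ∧ s ∈ piece zdeg i.2 := by
  simp only [mem_restrictSupport', ← forall_and, ← imp_and, Set.mem_ofPred_eq, fidx_eq]

lemma piece_fidx_le (i : FineIdx) : piece (fidx (ℓ := ℓ)) i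
    ≤ MvPolynomial.restrictSupport ℂ (fineSet ℓ i.1 (i.2 + 1)) :=
  MvPolynomial.restrictSupport_mono _ fun t (ht : fidx t = i) =>
    Or.inr ⟨(fidx_eq.mp ht).1, (fidx_eq.mp ht).2 ▸ Nat.lt_succ_self _⟩

lemma toOp_frame_piece_mem {i : FineIdx} {s : Phase ℓ} (hs : s ∈ piece fidx i) :
    toOp ℓ lam p (frame ℓ s) ∈ diffFine ℓ lam p i :=
  (toOp_frame_mem_fineLT _).mpr (piece_fidx_le i hs)

/-- `Symb_fine^{k,l}(p)` consists of the polynomials of bidegree `(k, l)` in the contact frame. -/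
def fineSymbEquiv (ℓ : ℕ) (lam p : ℂ) (i : FineIdx) :
    piece (fidx (ℓ := ℓ)) i ≃ₗ[ℂ] FineSymb ℓ lam p i :=
  LinearEquiv.ofBijective
    (toQuot (toOp ℓ lam p ∘ₗ (frame ℓ).toLinearMap) (diffFine ℓ lam p i) (diffFinePred ℓ lam p i)
      {t | fidx t = i} fun _ hs => toOp_frame_piece_mem hs)
    (toQuot_bijective (fun _ hT => exists_toOp_fineLT _ hT) (fun _ => toOp_frame_mem_fineLT _)
      (by
        rintro t ⟨h | ⟨h, h'⟩, ht⟩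
        · exact Or.inl h
        · refine Or.inr ⟨h, lt_of_le_of_ne (Nat.lt_succ_iff.mp h') fun h2 => ht (fidx_eq.mpr ⟨h, h2⟩)⟩)
      (Set.disjoint_left.mpr fun t (ht : fidx t = i) h => by
        obtain ⟨h1, h2⟩ := fidx_eq.mp ht
        rcases h with h | ⟨-, h⟩ <;> omega) _)

/-- `Symb(p)` as the space of all polynomials. -/
def symbTotEquiv (ℓ : ℕ) (lam p : ℂ) : Phase ℓ ≃ₗ[ℂ] SymbTot ℓ lam p :=
  (pieceEquiv fdeg).symm ≪≫ₗ DirectSum.congrLinearEquiv (symbEquiv ℓ lam p)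

/-- `Symb_fine(p)` as the space of all polynomials. -/
def fineSymbTotEquiv (ℓ : ℕ) (lam p : ℂ) : Phase ℓ ≃ₗ[ℂ] FineSymbTot ℓ lam p :=
  (pieceEquiv fidx).symm ≪≫ₗ DirectSum.congrLinearEquiv (fineSymbEquiv ℓ lam p)

lemma symbTotEquiv_of_mem {k : ℕ} {s : Phase ℓ} (hs : s ∈ piece fdeg k) :
    symbTotEquiv ℓ lam p s = DirectSum.of (Symb ℓ lam p) k (symbEquiv ℓ lam p k ⟨s, hs⟩) := by
  rw [symbTotEquiv, LinearEquiv.trans_apply, pieceEquiv_symm_of_mem fdeg hs,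
    DirectSum.coe_congrLinearEquiv, DirectSum.lmap_lof]
  rfl

lemma fineSymbTotEquiv_of_mem {i : FineIdx} {s : Phase ℓ} (hs : s ∈ piece fidx i) :
    fineSymbTotEquiv ℓ lam p s
      = DirectSum.of (FineSymb ℓ lam p) i (fineSymbEquiv ℓ lam p i ⟨s, hs⟩) := by
  rw [fineSymbTotEquiv, LinearEquiv.trans_apply, pieceEquiv_symm_of_mem fidx hs,
    DirectSum.coe_congrLinearEquiv, DirectSum.lmap_lof]
  rfl

/-- The total symbol of the action on an operator, up to lower order. -/
lemma lie_toOp_sub_mem {X : Vec ℓ} (hX : X ∈ projAlg ℓ) {k : ℕ} {s : Phase ℓ} (hs : s ∈ piece fdeg k) :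
    symAct p X s ∈ piece fdeg k ∧
      ⁅X, toOp ℓ lam p s⁆ - toOp ℓ lam p (symAct p X s) ∈ diffLT ℓ lam p k := by
  change X ∈ Submodule.span ℂ (projGen ℓ) at hX
  induction hX using Submodule.span_induction with
  | mem X hX =>
    refine ⟨symAct_piece_gen p hX hs, ?_⟩
    rcases hX with ⟨i, rfl⟩ | ⟨i, j, rfl⟩ | ⟨j, rfl⟩
    · rw [toOp_apply, lie_pd_normalOrder, ← toOp_apply, sub_self]
      exact zero_mem _
    · rw [toOp_apply, lie_X_pd_normalOrder, ← toOp_apply, sub_self]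
      exact zero_mem _
    · rw [toOp_apply, lie_X_euler_normalOrder, ← toOp_apply, ← map_sub, sub_sub_cancel_left,
        toOp_mem_diffLT]
      refine neg_mem ?_
      cases k with
      | zero => rw [dv_piece_zero _ hs, map_zero, smul_zero, add_zero]; exact zero_mem _
      | succ k =>
        have h := dv_piece_succ j hs
        rw [mem_piece_fdeg.mp h]
        have h' := piece_le_degLT (Nat.lt_succ_self k) h
        exact add_mem (Submodule.smul_mem _ _ h') (Submodule.smul_mem _ _ h')
  | zero =>
    rw [map_zero, LinearMap.zero_apply, map_zero, sub_zero]
    exact ⟨zero_mem _, by rw [zero_lie]; exact zero_mem _⟩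
  | add X Y _ _ h1 h2 =>
    rw [map_add, LinearMap.add_apply, map_add, add_lie, add_sub_add_comm]
    exact ⟨add_mem h1.1 h2.1, add_mem h1.2 h2.2⟩
  | smul c X _ h =>
    rw [map_smul, LinearMap.smul_apply, map_smul, smul_lie, ← smul_sub]
    exact ⟨Submodule.smul_mem _ _ h.1, (diffLT ℓ lam p k).smul_mem _ h.2⟩

lemma lie_of {ι L : Type*} [DecidableEq ι] [LieRing L] [LieAlgebra ℂ L] {M : ι → Type*}
    [∀ i, AddCommGroup (M i)] [∀ i, Module ℂ (M i)] [∀ i, LieRingModule L (M i)]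
    [∀ i, LieModule ℂ L (M i)] (x : L) (i : ι) (m : M i) :
    ⁅x, DirectSum.of M i m⁆ = DirectSum.of M i ⁅x, m⁆ :=
  ((DirectSum.lieModuleOf ℂ ι L M i).map_lie x m).symm

lemma symbTotEquiv_symAct {X : Vec ℓ} (hX : X ∈ projAlg ℓ) (s : Phase ℓ) :
    symbTotEquiv ℓ lam p (symAct p X s) = ⁅X, symbTotEquiv ℓ lam p s⁆ := by
  have h : (symbTotEquiv ℓ lam p).toLinearMap ∘ₗ symAct p X
      = (LieModule.toEnd ℂ (Vec ℓ) (SymbTot ℓ lam p) X) ∘ₗ (symbTotEquiv ℓ lam p).toLinearMap := by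
    refine ext_piece fdeg fun k s hs => ?_
    obtain ⟨h1, h2⟩ := lie_toOp_sub_mem (lam := lam) hX hs
    change symbTotEquiv ℓ lam p (symAct p X s) = ⁅X, symbTotEquiv ℓ lam p s⁆
    rw [symbTotEquiv_of_mem hs, symbTotEquiv_of_mem h1, lie_of]
    congr 1
    refine Eq.symm (mk_eq_mk_iff.mpr ?_)
    exact h2
  exact LinearMap.congr_fun h s

lemma fineAct_piece_fidx (f : Poly ℓ) {i : FineIdx} {s : Phase ℓ} (hs : s ∈ piece fidx i) :
    fineAct p f s ∈ piece fidx i := by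
  rw [mem_piece_fidx] at hs ⊢
  exact ⟨fineAct_piece_fdeg p f hs.1, fineAct_piece_zdeg p f hs.2⟩

lemma mem_fineSet_of {k n : ℕ} {s : Phase ℓ} (h1 : s ∈ piece fdeg k)
    (h2 : s ∈ MvPolynomial.restrictSupport ℂ {t | zdeg t < n}) :
    s ∈ MvPolynomial.restrictSupport ℂ (fineSet ℓ k n) := by
  rw [mem_restrictSupport'] at *
  exact fun t ht => Or.inr ⟨h1 t ht, h2 t ht⟩

lemma degLT_le_fineSet {k n : ℕ} {s : Phase ℓ} (h1 : s ∈ degLT ℓ k) :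
    s ∈ MvPolynomial.restrictSupport ℂ (fineSet ℓ k n) :=
  MvPolynomial.restrictSupport_mono _ (fun _ ht => Or.inl ht) h1

lemma toOp_mem_fineLT_of_degLT {k n : ℕ} (hn : n ≤ k + 1) {s : Phase ℓ} (hs : s ∈ degLT ℓ k) :
    toOp ℓ lam p s ∈ fineLT ℓ lam p k n hn := by
  obtain ⟨s, rfl⟩ := (frameEquiv ℓ).surjective s
  exact (toOp_frame_mem_fineLT hn).mpr (degLT_le_fineSet (frame_mem_degLT.mp hs))

/-- The fine symbol of the action of a contact field, up to lower terms. -/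
lemma lie_toOp_frame_sub_mem (X : conformalAlg ℓ) {i : FineIdx} {s : Phase ℓ}
    (hs : s ∈ piece fidx i) : ⁅X.1.1, toOp ℓ lam p (frame ℓ s)⁆
      - toOp ℓ lam p (frame ℓ (fineAct p (contactForm X.1.1) s)) ∈ diffFinePred ℓ lam p i := by
  have hX : X.1.1 ∈ projAlg ℓ := (con_deg_two_iff X.1.2).mp X.2
  have hs' := mem_piece_fidx.mp hs
  obtain ⟨-, h2⟩ := lie_toOp_sub_mem (lam := lam) (p := p) hX (frame_piece hs'.1)
  have e : symAct p X.1.1 (frame ℓ s) = frame ℓ (fineAct p (contactForm X.1.1) s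
      + lowDer (contactForm X.1.1) s) := by
    have := symAct_frame p (contactForm X.1.1) s
    rwa [chi_contactForm X.1.2] at this
  rw [e, map_add, map_add] at h2
  have h3 : toOp ℓ lam p (frame ℓ (lowDer (contactForm X.1.1) s)) ∈ diffFinePred ℓ lam p i :=
    (toOp_frame_mem_fineLT _).mpr
      (mem_fineSet_of (lowDer_piece_fdeg _ hs'.1) (lowDer_zdeg_lt _ hs'.2))
  obtain ⟨u, hu, hu'⟩ := exists_toOp_diffLT h2
  have h4 := toOp_mem_fineLT_of_degLT (lam := lam) (p := p) i.2.isLt.le hu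
  rw [hu'] at h4
  have := add_mem h4 h3
  rwa [sub_add_eq_sub_sub, sub_add_cancel] at this

lemma fineSymbTotEquiv_fineAct (X : conformalAlg ℓ) (s : Phase ℓ) :
    fineSymbTotEquiv ℓ lam p (fineAct p (contactForm X.1.1) s)
      = ⁅X, fineSymbTotEquiv ℓ lam p s⁆ := by
  have h : (fineSymbTotEquiv ℓ lam p).toLinearMap ∘ₗ fineAct p (contactForm X.1.1)
      = (LieModule.toEnd ℂ (Con ℓ) (FineSymbTot ℓ lam p) X.1)
        ∘ₗ (fineSymbTotEquiv ℓ lam p).toLinearMap := by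
    refine ext_piece fidx fun i s hs => ?_
    have h1 := fineAct_piece_fidx (p := p) (contactForm X.1.1) hs
    have h2 := lie_toOp_frame_sub_mem (lam := lam) (p := p) X hs
    change fineSymbTotEquiv ℓ lam p (fineAct p (contactForm X.1.1) s)
      = ⁅X.1, fineSymbTotEquiv ℓ lam p s⁆
    rw [fineSymbTotEquiv_of_mem hs, fineSymbTotEquiv_of_mem h1, lie_of]
    congr 1
    exact Eq.symm (mk_eq_mk_iff.mpr h2)
  exact LinearMap.congr_fun h s

/-! ### The quantizations -/

/-- A linear equivalence that commutes with the action is an equivalence of Lie modules. -/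
def lieModuleEquivOf {L M N : Type*} [LieRing L] [LieAlgebra ℂ L] [AddCommGroup M] [Module ℂ M]
    [LieRingModule L M] [LieModule ℂ L M] [AddCommGroup N] [Module ℂ N] [LieRingModule L N]
    [LieModule ℂ L N] (e : M ≃ₗ[ℂ] N) (h : ∀ (x : L) m, e ⁅x, m⁆ = ⁅x, e m⁆) : M ≃ₗ⁅ℂ, L⁆ N :=
  { e with map_lie' := fun {x m} => h x m }

lemma lieModuleEquivOf_apply {L M N : Type*} [LieRing L] [LieAlgebra ℂ L] [AddCommGroup M]
    [Module ℂ M] [LieRingModule L M] [LieModule ℂ L M] [AddCommGroup N] [Module ℂ N]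
    [LieRingModule L N] [LieModule ℂ L N] (e : M ≃ₗ[ℂ] N) (h : ∀ (x : L) m, e ⁅x, m⁆ = ⁅x, e m⁆)
    (m : M) : lieModuleEquivOf e h m = e m := rfl

/-- `projQ` as an equivalence. -/
def projQEquiv (ℓ : ℕ) (lam p : ℂ) : Phase ℓ ≃ₗ[ℂ] Phase ℓ :=
  LinearEquiv.ofBijective (projQ ℓ lam p) (triang_bijective lowers_divOp fun _ => rfl)

/-- `fineQ` as an equivalence. -/
def fineQEquiv (ℓ : ℕ) (p : ℂ) : Phase ℓ ≃ₗ[ℂ] Phase ℓ :=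
  LinearEquiv.ofBijective (fineQ ℓ p) (triang_bijective lowers_gradZ fun _ => rfl)

lemma lie_toOp_projQ (hp : Generic ℓ p) {X : Vec ℓ} (hX : X ∈ projAlg ℓ) (s : Phase ℓ) :
    ⁅X, toOp ℓ lam p (projQ ℓ lam p s)⁆ = toOp ℓ lam p (projQ ℓ lam p (symAct p X s)) := by
  change X ∈ Submodule.span ℂ (projGen ℓ) at hX
  induction hX using Submodule.span_induction with
  | mem X hX => exact lie_projQ hp hX s
  | zero => rw [map_zero, LinearMap.zero_apply, map_zero, map_zero, zero_lie]
  | add X Y _ _ h1 h2 => rw [map_add, LinearMap.add_apply, map_add, map_add, add_lie, h1, h2]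
  | smul c X _ h => rw [map_smul, LinearMap.smul_apply, map_smul, map_smul, smul_lie, h]

/-- The projective quantization. -/
def projQuant (hp : Generic ℓ p) (lam : ℂ) : SymbTot ℓ lam p ≃ₗ⁅ℂ, projAlg ℓ⁆ ↥(Diff ℓ lam p) :=
  lieModuleEquivOf ((symbTotEquiv ℓ lam p).symm ≪≫ₗ projQEquiv ℓ lam p ≪≫ₗ opEquiv ℓ lam p) (by
    intro X S
    obtain ⟨s, rfl⟩ := (symbTotEquiv ℓ lam p).surjective S
    have e : ⁅X, symbTotEquiv ℓ lam p s⁆ = symbTotEquiv ℓ lam p (symAct p X.1 s) :=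
      (symbTotEquiv_symAct X.2 s).symm
    rw [e]
    simp only [LinearEquiv.trans_apply, LinearEquiv.symm_apply_apply]
    exact Subtype.ext (lie_toOp_projQ hp X.2 s).symm)

lemma projQuant_apply (hp : Generic ℓ p) (s : Phase ℓ) :
    (projQuant hp lam (symbTotEquiv ℓ lam p s) : HomDens ℓ lam p) = toOp ℓ lam p (projQ ℓ lam p s) := by
  rw [projQuant, lieModuleEquivOf_apply]
  simp only [LinearEquiv.trans_apply, LinearEquiv.symm_apply_apply]
  rfl

lemma projQ_sub_mem {k : ℕ} {s : Phase ℓ} (hs : s ∈ piece fdeg k) :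
    projQ ℓ lam p s - s ∈ degLT ℓ k :=
  (triang_sub_mem lowers_divOp (fun _ => rfl) (M := ⊤) (fun _ _ => trivial) hs trivial).1

lemma isProjectiveQuantization_projQuant (hp : Generic ℓ p) :
    IsProjectiveQuantization (projQuant hp lam) := by
  intro k S
  obtain ⟨s, rfl⟩ := (symbEquiv ℓ lam p k).surjective S
  have h : toOp ℓ lam p (projQ ℓ lam p s.1) - toOp ℓ lam p s.1 ∈ diffLT ℓ lam p k := by
    rw [← map_sub, toOp_mem_diffLT]
    exact projQ_sub_mem s.2
  have h2 : toOp ℓ lam p (projQ ℓ lam p s.1) ∈ diffOrd ℓ lam p k := by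
    rw [toOp_mem_diffLT, ← sub_add_cancel (projQ ℓ lam p s.1) s.1]
    exact add_mem (degLT_mono (Nat.le_succ k) (projQ_sub_mem s.2))
      (piece_le_degLT (Nat.lt_succ_self k) s.2)
  refine ⟨⟨_, h2⟩, ?_, ?_⟩
  · rw [← symbTotEquiv_of_mem s.2, projQuant_apply]
  · exact mk_eq_mk_iff.mpr h

/-- The splitting of the fine filtrations. -/
def fineSplit (hp : Generic ℓ p) (lam : ℂ) :
    FineSymbTot ℓ lam p ≃ₗ⁅ℂ, conformalAlg ℓ⁆ SymbTot ℓ lam p :=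
  lieModuleEquivOf ((fineSymbTotEquiv ℓ lam p).symm ≪≫ₗ fineQEquiv ℓ p
      ≪≫ₗ (frameEquiv ℓ).toLinearEquiv ≪≫ₗ symbTotEquiv ℓ lam p) (by
    intro X S
    obtain ⟨s, rfl⟩ := (fineSymbTotEquiv ℓ lam p).surjective S
    rw [← fineSymbTotEquiv_fineAct]
    simp only [LinearEquiv.trans_apply, LinearEquiv.symm_apply_apply]
    have e : symAct p X.1.1 (frame ℓ (fineQ ℓ p s))
        = frame ℓ (fineQ ℓ p (fineAct p (contactForm X.1.1) s)) := by
      rw [← fineQ_intertwines hp X.2]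
      conv_lhs => rw [← chi_contactForm X.1.2]
      exact symAct_frame p _ _
    change symbTotEquiv ℓ lam p (frame ℓ (fineQ ℓ p (fineAct p (contactForm X.1.1) s)))
      = ⁅X.1.1, symbTotEquiv ℓ lam p (frame ℓ (fineQ ℓ p s))⁆
    rw [← symbTotEquiv_symAct ((con_deg_two_iff X.1.2).mp X.2), e])

lemma fineSplit_apply (hp : Generic ℓ p) (s : Phase ℓ) :
    fineSplit hp lam (fineSymbTotEquiv ℓ lam p s) = symbTotEquiv ℓ lam p (frame ℓ (fineQ ℓ p s)) := by
  rw [fineSplit, lieModuleEquivOf_apply]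
  simp only [LinearEquiv.trans_apply, LinearEquiv.symm_apply_apply]
  rfl

lemma fineQ_sub_mem {i : FineIdx} {s : Phase ℓ} (hs : s ∈ piece fidx i) :
    fineQ ℓ p s - s ∈ MvPolynomial.restrictSupport ℂ (fineSet ℓ i.1 i.2) ∧
      fineQ ℓ p s ∈ piece fdeg i.1 := by
  have hs' := mem_piece_fidx.mp hs
  have h := triang_sub_mem lowers_gradZ (c := triCoef (fun l => (l : ℂ) - p * (ℓ + 1)) fun _ => 1)
    (fun _ => rfl) (M := piece fdeg i.1) (fun _ hs => gradZ_piece_fdeg hs) hs'.2 hs'.1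
  refine ⟨mem_fineSet_of h.2 h.1, ?_⟩
  have := add_mem h.2 hs'.1
  rwa [sub_add_cancel] at this

lemma toOp_fineQ_mem {i : FineIdx} {s : Phase ℓ} (hs : s ∈ piece fidx i) :
    toOp ℓ lam p (frame ℓ (fineQ ℓ p s)) ∈ diffFine ℓ lam p i := by
  rw [toOp_frame_mem_fineLT, ← sub_add_cancel (fineQ ℓ p s) s]
  refine add_mem (MvPolynomial.restrictSupport_mono _ ?_ (fineQ_sub_mem hs).1) (piece_fidx_le i hs)
  rintro t (h | ⟨h, h'⟩)
  · exact Or.inl h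
  · exact Or.inr ⟨h, h'.trans (Nat.lt_succ_self _)⟩

lemma isFineSplitting_fineSplit (hp : Generic ℓ p) : IsFineSplitting (fineSplit hp lam) := by
  intro i S
  obtain ⟨s, rfl⟩ := (fineSymbEquiv ℓ lam p i).surjective S
  have h := fineQ_sub_mem (p := p) s.2
  have h1 := frame_piece h.2
  refine ⟨⟨_, toOp_fineQ_mem s.2⟩, ⟨_, toOp_piece_mem h1⟩, rfl, ?_, ?_⟩
  · rw [← fineSymbTotEquiv_of_mem s.2, fineSplit_apply, symbTotEquiv_of_mem h1]
    rfl
  · refine mk_eq_mk_iff.mpr ?_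
    change toOp ℓ lam p (frame ℓ (fineQ ℓ p s)) - toOp ℓ lam p (frame ℓ s) ∈ _
    rw [← map_sub, ← map_sub]
    exact (toOp_frame_mem_fineLT _).mpr h.1

/-- The conformal quantization. -/
def confQuant (hp : Generic ℓ p) (lam : ℂ) :
    FineSymbTot ℓ lam p ≃ₗ⁅ℂ, conformalAlg ℓ⁆ ↥(Diff ℓ lam p) :=
  lieModuleEquivOf ((LieModuleEquiv.toLinearEquiv (fineSplit hp lam))
      ≪≫ₗ (LieModuleEquiv.toLinearEquiv (projQuant hp lam))) (by
    intro X S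
    change projQuant hp lam (fineSplit hp lam ⁅X, S⁆) = ⁅X, projQuant hp lam (fineSplit hp lam S)⁆
    have h1 : fineSplit hp lam ⁅X, S⁆ = ⁅X, fineSplit hp lam S⁆ :=
      (fineSplit hp lam).toLieModuleHom.map_lie X S
    rw [h1]
    exact (projQuant hp lam).toLieModuleHom.map_lie
      (⟨X.1.1, (con_deg_two_iff X.1.2).mp X.2⟩ : projAlg ℓ) _)

lemma confQuant_apply (hp : Generic ℓ p) (S : FineSymbTot ℓ lam p) :
    confQuant hp lam S = projQuant hp lam (fineSplit hp lam S) := rfl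

lemma isConformalQuantization_confQuant (hp : Generic ℓ p) :
    IsConformalQuantization (confQuant hp lam) := by
  intro i S
  obtain ⟨s, rfl⟩ := (fineSymbEquiv ℓ lam p i).surjective S
  have h := fineQ_sub_mem (p := p) s.2
  have h1 := frame_piece h.2
  have h2 : ∀ n hn, toOp ℓ lam p (projQ ℓ lam p (frame ℓ (fineQ ℓ p s)))
      - toOp ℓ lam p (frame ℓ (fineQ ℓ p s)) ∈ fineLT ℓ lam p i.1 n hn := by
    intro n hn
    rw [← map_sub]
    exact toOp_mem_fineLT_of_degLT hn (projQ_sub_mem h1)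
  have h3 : toOp ℓ lam p (projQ ℓ lam p (frame ℓ (fineQ ℓ p s))) ∈ diffFine ℓ lam p i := by
    have := add_mem (h2 (i.2 + 1) (Nat.succ_le_succ (Nat.le_of_lt_succ i.2.isLt))) (toOp_fineQ_mem s.2)
    rwa [sub_add_cancel] at this
  refine ⟨⟨_, h3⟩, ?_, ?_⟩
  · rw [← fineSymbTotEquiv_of_mem s.2, confQuant_apply, fineSplit_apply, projQuant_apply]
  · refine mk_eq_mk_iff.mpr ?_
    change toOp ℓ lam p (projQ ℓ lam p (frame ℓ (fineQ ℓ p s))) - toOp ℓ lam p (frame ℓ s) ∈ _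
    have h4 : toOp ℓ lam p (frame ℓ (fineQ ℓ p s)) - toOp ℓ lam p (frame ℓ s)
        ∈ diffFinePred ℓ lam p i := by
      rw [← map_sub, ← map_sub]
      exact (toOp_frame_mem_fineLT _).mpr h.1
    have := add_mem (h2 i.2 i.2.isLt.le) h4
    rwa [sub_add_sub_cancel] at this

/-! ### The grading of the fine symbols -/

/-- The exponent of `z`. -/
def zexp (t : Coord ℓ ⊕ Coord ℓ →₀ ℕ) : ℕ := t (Sum.inl cz)
/-- The degree in the coordinates `x_k`, `y_k`. -/
def bdeg (t : Coord ℓ ⊕ Coord ℓ →₀ ℕ) : ℕ :=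
  ∑ k : Fin ℓ, (t (Sum.inl (cx k)) + t (Sum.inl (cy k)))
/-- The degree in the fibre variables of the `x_k`, `y_k`. -/
def edeg (t : Coord ℓ ⊕ Coord ℓ →₀ ℕ) : ℕ :=
  ∑ k : Fin ℓ, (t (Sum.inr (cx k)) + t (Sum.inr (cy k)))

/-- The degrees in `z`, in the `x_k` and `y_k`, in their fibre variables, and in the fibre
variable of `z`. -/
def grade (t : Coord ℓ ⊕ Coord ℓ →₀ ℕ) : ℕ × ℕ × ℕ × ℕ := (zexp t, bdeg t, edeg t, zdeg t)

lemma grade_add (t u : Coord ℓ ⊕ Coord ℓ →₀ ℕ) : grade (t + u) = grade t + grade u := by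
  simp only [grade, zexp, bdeg, edeg, zdeg, Finsupp.add_apply, Prod.mk_add_mk, Prod.mk.injEq,
    true_and, and_true]
  constructor <;> rw [← Finset.sum_add_distrib] <;> exact Finset.sum_congr rfl fun _ _ => by omega

section
variable (k : Fin ℓ)
lemma grade_x : grade (Finsupp.single (Sum.inl (cx k)) 1) = (0, 1, 0, 0) := by
  simp [grade, zexp, bdeg, edeg, zdeg, Finsupp.single_apply, cx, cy, cz, Finset.sum_add_distrib]
lemma grade_y : grade (Finsupp.single (Sum.inl (cy k)) 1) = (0, 1, 0, 0) := by
  simp [grade, zexp, bdeg, edeg, zdeg, Finsupp.single_apply, cx, cy, cz, Finset.sum_add_distrib]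
lemma grade_z : grade (Finsupp.single (Sum.inl (cz (ℓ := ℓ))) 1) = (1, 0, 0, 0) := by
  simp [grade, zexp, bdeg, edeg, zdeg, Finsupp.single_apply, cx, cy, cz, Finset.sum_add_distrib]
lemma grade_fx : grade (Finsupp.single (Sum.inr (cx k)) 1) = (0, 0, 1, 0) := by
  simp [grade, zexp, bdeg, edeg, zdeg, Finsupp.single_apply, cx, cy, cz, Finset.sum_add_distrib]
lemma grade_fy : grade (Finsupp.single (Sum.inr (cy k)) 1) = (0, 0, 1, 0) := by
  simp [grade, zexp, bdeg, edeg, zdeg, Finsupp.single_apply, cx, cy, cz, Finset.sum_add_distrib]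
lemma grade_fz : grade (Finsupp.single (Sum.inr (cz (ℓ := ℓ))) 1) = (0, 0, 0, 1) := by
  simp [grade, zexp, bdeg, edeg, zdeg, Finsupp.single_apply, cx, cy, cz, Finset.sum_add_distrib]
end

lemma X_mul_grade {q v w : ℕ × ℕ × ℕ × ℕ} {a : Coord ℓ ⊕ Coord ℓ} (ha : grade (Finsupp.single a 1) = v)
    {s : Phase ℓ} (hs : s ∈ piece grade q) (hw : q + v = w) :
    MvPolynomial.X a * s ∈ piece grade w :=
  X_mul_mem a (fun t (ht : grade t = q) => by
    change grade (t + Finsupp.single a 1) = w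
    rw [grade_add, ht, ha, hw]) hs

lemma pderiv_grade {q v w : ℕ × ℕ × ℕ × ℕ} {a : Coord ℓ ⊕ Coord ℓ}
    (ha : grade (Finsupp.single a 1) = v) {s : Phase ℓ} (hs : s ∈ piece grade q) (hw : w + v = q) :
    MvPolynomial.pderiv a s ∈ piece grade w :=
  pderiv_mem a (fun t (ht : grade (t + Finsupp.single a 1) = q) => by
    change grade t = w
    rw [grade_add, ha, ← hw] at ht
    exact add_right_cancel ht) hs

lemma pderiv_grade_eq_zero {q v : ℕ × ℕ × ℕ × ℕ} {a : Coord ℓ ⊕ Coord ℓ}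
    (ha : grade (Finsupp.single a 1) = v) {s : Phase ℓ} (hs : s ∈ piece grade q)
    (hw : ∀ w, w + v ≠ q) : MvPolynomial.pderiv a s = 0 := by
  have h : MvPolynomial.pderiv a s ∈ MvPolynomial.restrictSupport ℂ (∅ : Set (Coord ℓ ⊕ Coord ℓ →₀ ℕ)) :=
    pderiv_mem a (fun t (ht : grade (t + Finsupp.single a 1) = q) => by
      rw [grade_add, ha] at ht
      exact (hw _ ht).elim) hs
  rw [mem_restrictSupport'] at h
  ext t
  by_contra h'
  exact h t (by simpa using h')

/-- Weights that are `a` on the first coordinates and `b` on `z`. -/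
def coordW (a b : ℂ) : Coord ℓ → ℂ := Sum.elim (fun _ => a) (Sum.elim (fun _ => a) fun _ => b)

/-- The derivation with the weights `a`, `b` on the base coordinates `(x, y)`, `z` and `c`, `d` on
their fibre variables. -/
def gradeD (ℓ : ℕ) (a b c d : ℂ) : Derivation ℂ (Phase ℓ) (Phase ℓ) :=
  eulerD (Sum.elim (coordW a b) (coordW c d))

section
variable (a b c d : ℂ) (k : Fin ℓ)
lemma gradeD_x : gradeD ℓ a b c d (bu (cx k)) = a • bu (cx k) := eulerD_X ..
lemma gradeD_y : gradeD ℓ a b c d (bu (cy k)) = a • bu (cy k) := eulerD_X ..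
lemma gradeD_z : gradeD ℓ a b c d (bu cz) = b • bu cz := eulerD_X ..
lemma gradeD_fx : gradeD ℓ a b c d (fv (cx k)) = c • fv (cx k) := eulerD_X ..
lemma gradeD_fy : gradeD ℓ a b c d (fv (cy k)) = c • fv (cy k) := eulerD_X ..
lemma gradeD_fz : gradeD ℓ a b c d (fv cz) = d • fv cz := eulerD_X ..
end

lemma gradeW_sum (a b c d : ℂ) (t : Coord ℓ ⊕ Coord ℓ →₀ ℕ) :
    ∑ i, (Sum.elim (coordW a b) (coordW c d) : Coord ℓ ⊕ Coord ℓ → ℂ) i * t i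
      = a * bdeg t + b * zexp t + c * edeg t + d * zdeg t := by
  have h : ∀ (a b : ℂ) (f : Coord ℓ → ℕ), ∑ i, coordW a b i * (f i : ℂ)
      = a * ((∑ k : Fin ℓ, (f (cx k) + f (cy k)) : ℕ) : ℂ) + b * f cz := by
    intro a b f
    rw [Fintype.sum_sum_type, Fintype.sum_sum_type, Finset.sum_add_distrib]
    simp only [coordW, Sum.elim_inl, Sum.elim_inr, Fintype.sum_unique, ← Finset.mul_sum]
    push_cast
    rw [mul_add, add_assoc]
    rfl
  rw [Fintype.sum_sum_type]
  simp only [Sum.elim_inl, Sum.elim_inr]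
  rw [h a b fun i => t (Sum.inl i), h c d fun i => t (Sum.inr i)]
  rw [bdeg, edeg, zexp, zdeg]
  ring

lemma gradeD_eq_iff (a b c d κ : ℂ) (s : Phase ℓ) : gradeD ℓ a b c d s = κ • s ↔
    ∀ t, MvPolynomial.coeff t s ≠ 0 → a * bdeg t + b * zexp t + c * edeg t + d * zdeg t = κ := by
  rw [gradeD, eulerD_eq_iff]
  simp only [gradeW_sum]

lemma gradeD_of_mem (a b c d : ℂ) {z n r l : ℕ} {s : Phase ℓ} (hs : s ∈ piece grade (z, n, r, l)) :
    gradeD ℓ a b c d s = (a * n + b * z + c * r + d * l) • s := by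
  rw [gradeD_eq_iff]
  intro t ht
  obtain ⟨rfl, rfl, rfl, rfl⟩ : zexp t = z ∧ bdeg t = n ∧ edeg t = r ∧ zdeg t = l := by
    have := mem_restrictSupport'.mp hs t ht
    simpa only [grade, Set.mem_ofPred_eq, Prod.mk.injEq] using this
  rfl

/-! ### The conformal algebra acting on fine symbols -/

lemma deg_X_X (a b : Coord ℓ) :
    (MvPolynomial.X a * MvPolynomial.X b : Poly ℓ).totalDegree ≤ 2 :=
  (MvPolynomial.totalDegree_mul _ _).trans (by simp)

/-- The derivation `∑ (x_i A_i + y_i B_i) = ∑ (x_i ∂_{x_i} + y_i ∂_{y_i})`. -/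
def horEuler (ℓ : ℕ) : Vec ℓ :=
  ∑ i : Fin ℓ, ((MvPolynomial.X (cx i) : Poly ℓ) • tanA i + (MvPolynomial.X (cy i) : Poly ℓ) • tanB i)

lemma chi_z' (f : Poly ℓ) :
    chi ℓ f (MvPolynomial.X cz) = f - (1 / 2 : ℂ) • horEuler ℓ f := by
  rw [chi_z, horEuler, sum_apply, MvPolynomial.smul_eq_C_mul]
  rfl

lemma horEuler_x (k : Fin ℓ) : horEuler ℓ (MvPolynomial.X (cx k)) = MvPolynomial.X (cx k) := by
  rw [horEuler, sum_apply]
  simp only [Derivation.add_apply, Derivation.smul_apply, smul_eq_mul, tanA_x, tanB_x]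
  rw [Finset.sum_eq_single k]
  · simp
  · intro b _ hb; simp [hb.symm]
  · simp

lemma horEuler_y (k : Fin ℓ) : horEuler ℓ (MvPolynomial.X (cy k)) = MvPolynomial.X (cy k) := by
  rw [horEuler, sum_apply]
  simp only [Derivation.add_apply, Derivation.smul_apply, smul_eq_mul, tanA_y, tanB_y]
  rw [Finset.sum_eq_single k]
  · simp
  · intro b _ hb; simp [hb.symm]
  · simp

lemma horEuler_z : horEuler ℓ (MvPolynomial.X cz) = 0 := by
  rw [horEuler, sum_apply]
  refine Finset.sum_eq_zero fun i _ => ?_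
  simp only [Derivation.add_apply, Derivation.smul_apply, smul_eq_mul, tanA_z, tanB_z]
  ring

section
variable (p : ℂ) (j k : Fin ℓ) (s : Phase ℓ)

attribute [local simp] fineDer_bu fineDer_x fineDer_y fineDer_z chi_x chi_y chi_z' horEuler_x
  horEuler_y horEuler_z tanA_x tanA_y tanA_z tanB_x tanB_y tanB_z base_X base_C du_bu du_fv dv_bu
  dv_fv pd_X cx_eq cy_eq cx_cy cy_cx cx_cz cz_cx cy_cz cz_cy grad_x grad_y grad_z
  MvPolynomial.C_mul'
  gradeD_x gradeD_y gradeD_z gradeD_fx gradeD_fy gradeD_fz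

lemma fineDer_one : fineDer (1 : Poly ℓ) = du cz := by
  classical
  apply phase_derivation_ext' <;> intros <;> simp

lemma fineDer_X_x : fineDer (MvPolynomial.X (cx k) : Poly ℓ)
      = du (cy k) + ((1 / 2 : ℂ) • bu (cx k) : Phase ℓ) • du cz := by
  classical
  apply phase_derivation_ext' <;> intros <;>
    simp [apply_ite (base (ℓ := ℓ)), apply_ite (grad ℓ), mul_comm]
  module

lemma fineDer_X_y : fineDer (MvPolynomial.X (cy k) : Poly ℓ)
      = -du (cx k) + ((1 / 2 : ℂ) • bu (cy k) : Phase ℓ) • du cz := by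
  classical
  apply phase_derivation_ext' <;> intros <;>
    simp [apply_ite (base (ℓ := ℓ)), apply_ite (grad ℓ), mul_comm]
  module

lemma fineDer_X_z : fineDer (MvPolynomial.X cz : Poly ℓ) = gradeD ℓ (1 / 2) 1 (-(1 / 2)) (-1) := by
  classical
  apply phase_derivation_ext' <;> intros <;> simp
  all_goals module

lemma fineDer_xx : fineDer (MvPolynomial.X (cx j) * MvPolynomial.X (cx k) : Poly ℓ)
    = (bu (cx k) : Phase ℓ) • du (cy j) + (bu (cx j) : Phase ℓ) • du (cy k)
      + (fv (cx k) : Phase ℓ) • dv (cy j) + (fv (cx j) : Phase ℓ) • dv (cy k) := by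
  classical
  apply phase_derivation_ext' <;> intros <;>
    simp [apply_ite (base (ℓ := ℓ)), apply_ite (grad ℓ), mul_comm]
  all_goals try split_ifs
  all_goals try simp
  all_goals module

lemma fineDer_xy : fineDer (MvPolynomial.X (cx j) * MvPolynomial.X (cy k) : Poly ℓ)
    = (bu (cy k) : Phase ℓ) • du (cy j) - (bu (cx j) : Phase ℓ) • du (cx k)
      + (fv (cy k) : Phase ℓ) • dv (cy j) - (fv (cx j) : Phase ℓ) • dv (cx k) := by
  classical
  apply phase_derivation_ext' <;> intros <;>
    simp [apply_ite (base (ℓ := ℓ)), apply_ite (grad ℓ), mul_comm]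
  module

lemma fineDer_yy : fineDer (MvPolynomial.X (cy j) * MvPolynomial.X (cy k) : Poly ℓ)
    = -((bu (cy k) : Phase ℓ) • du (cx j) + (bu (cy j) : Phase ℓ) • du (cx k)
      + (fv (cy k) : Phase ℓ) • dv (cx j) + (fv (cy j) : Phase ℓ) • dv (cx k)) := by
  classical
  apply phase_derivation_ext' <;> intros <;>
    simp [apply_ite (base (ℓ := ℓ)), apply_ite (grad ℓ), mul_comm]
  all_goals try split_ifs
  all_goals try simp
  all_goals module

/-- The pairing of the coordinates `x`, `y` with their fibre variables. -/
def omega (ℓ : ℕ) : Phase ℓ := ∑ i : Fin ℓ, (bu (cx i) * fv (cy i) - bu (cy i) * fv (cx i))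

lemma grad_z_eq : grad ℓ (bu cz) = -((1 / 2 : ℂ) • omega ℓ) := by
  rw [grad_z, omega, MvPolynomial.C_mul', ← smul_neg, ← Finset.sum_neg_distrib]
  congr 1
  exact Finset.sum_congr rfl fun i _ => by ring

/-- The derivation that replaces the fibre variables of the `x`, `y` by these coordinates. -/
def toBase (ℓ : ℕ) : Derivation ℂ (Phase ℓ) (Phase ℓ) :=
  ∑ i : Fin ℓ, ((bu (cx i) : Phase ℓ) • dv (cx i) + (bu (cy i) : Phase ℓ) • dv (cy i))

lemma toBase_bu (i : Coord ℓ) : toBase ℓ (bu i) = 0 := by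
  simp [toBase, derivation_sum_apply]
lemma toBase_fx : toBase ℓ (fv (cx k)) = bu (cx k) := by
  classical
  simp [toBase, derivation_sum_apply, Finset.sum_add_distrib]
lemma toBase_fy : toBase ℓ (fv (cy k)) = bu (cy k) := by
  classical
  simp [toBase, derivation_sum_apply, Finset.sum_add_distrib]
lemma toBase_fz : toBase ℓ (fv cz) = 0 := by
  classical
  simp [toBase, derivation_sum_apply, Finset.sum_add_distrib]

attribute [local simp] toBase_bu toBase_fx toBase_fy toBase_fz
attribute [-simp] grad_z
attribute [local simp] grad_z_eq

lemma fineDer_zz : fineDer (MvPolynomial.X cz * MvPolynomial.X cz : Poly ℓ)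
    = (bu cz : Phase ℓ) • gradeD ℓ 1 1 (-1) (-2) - ((1 / 2 : ℂ) • omega ℓ : Phase ℓ) • toBase ℓ := by
  classical
  apply phase_derivation_ext' <;> intros <;> simp
  all_goals
    try simp only [mul_comm (omega ℓ), add_mul]
    module

lemma fineDer_zx_x : fineDer (MvPolynomial.X cz * MvPolynomial.X (cx k) : Poly ℓ) (bu (cx k))
    = (1 / 2 : ℂ) • bu (cx k) ^ 2 := by
  classical
  simp
  rw [sq]
lemma fineDer_zx_fy : fineDer (MvPolynomial.X cz * MvPolynomial.X (cx k) : Poly ℓ) (fv (cy k))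
    = (1 / 2 : ℂ) • (bu (cy k) * fv (cx k) - bu (cx k) * fv (cy k)) - (1 / 2 : ℂ) • omega ℓ := by
  classical
  simp
  module
lemma fineDer_zx_fz : fineDer (MvPolynomial.X cz * MvPolynomial.X (cx k) : Poly ℓ) (fv cz)
    = -(bu (cx k) * fv cz) := by
  classical
  simp
lemma fineDer_zy_x : fineDer (MvPolynomial.X cz * MvPolynomial.X (cy k) : Poly ℓ) (bu (cx k))
    = (1 / 2 : ℂ) • (bu (cx k) * bu (cy k)) - bu cz := by
  classical
  simp
  rw [mul_comm]
  module
lemma fineDer_zy_fy : fineDer (MvPolynomial.X cz * MvPolynomial.X (cy k) : Poly ℓ) (fv (cy k))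
    = 0 := by
  classical
  simp
  module
lemma fineDer_zy_fz : fineDer (MvPolynomial.X cz * MvPolynomial.X (cy k) : Poly ℓ) (fv cz)
    = -(bu (cy k) * fv cz) := by
  classical
  simp

lemma fineAct_one : fineAct p 1 s = du cz s := by
  rw [fineAct_apply, fineDer_one]
  simp

lemma fineAct_X_x : fineAct p (MvPolynomial.X (cx k)) s
    = du (cy k) s + (1 / 2 : ℂ) • (bu (cx k) * du cz s) := by
  classical
  rw [fineAct_apply, fineDer_X_x]
  simp

lemma fineAct_X_y : fineAct p (MvPolynomial.X (cy k)) s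
    = -du (cx k) s + (1 / 2 : ℂ) • (bu (cy k) * du cz s) := by
  classical
  rw [fineAct_apply, fineDer_X_y]
  simp

lemma fineAct_X_z : fineAct p (MvPolynomial.X cz) s
    = gradeD ℓ (1 / 2) 1 (-(1 / 2)) (-1) s + (p * (ℓ + 1)) • s := by
  rw [fineAct_apply, fineDer_X_z]
  simp

lemma fineAct_xx : fineAct p (MvPolynomial.X (cx j) * MvPolynomial.X (cx k)) s
    = bu (cx k) * du (cy j) s + bu (cx j) * du (cy k) s
      + fv (cx k) * dv (cy j) s + fv (cx j) * dv (cy k) s := by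
  classical
  rw [fineAct_apply, fineDer_xx]
  simp

lemma fineAct_xy : fineAct p (MvPolynomial.X (cx j) * MvPolynomial.X (cy k)) s
    = bu (cy k) * du (cy j) s - bu (cx j) * du (cx k) s
      + fv (cy k) * dv (cy j) s - fv (cx j) * dv (cx k) s := by
  classical
  rw [fineAct_apply, fineDer_xy]
  simp

lemma fineAct_yy : fineAct p (MvPolynomial.X (cy j) * MvPolynomial.X (cy k)) s
    = -(bu (cy k) * du (cx j) s + bu (cy j) * du (cx k) s
      + fv (cy k) * dv (cx j) s + fv (cy j) * dv (cx k) s) := by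
  classical
  rw [fineAct_apply, fineDer_yy]
  simp

lemma fineAct_zz : fineAct p (MvPolynomial.X cz * MvPolynomial.X cz) s
    = bu cz * (gradeD ℓ 1 1 (-1) (-2) s + (2 * (p * (ℓ + 1))) • s)
      - (1 / 2 : ℂ) • (omega ℓ * toBase ℓ s) := by
  classical
  have h : base (MvPolynomial.pderiv cz (MvPolynomial.X cz * MvPolynomial.X cz : Poly ℓ))
      = bu cz + bu cz := by simp
  rw [fineAct_apply, fineDer_zz, h]
  simp only [Derivation.sub_apply, Derivation.smul_apply, smul_eq_mul, add_mul, mul_add,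
    mul_smul_comm, smul_mul_assoc]
  module

lemma fineAct_zx : fineAct p (MvPolynomial.X cz * MvPolynomial.X (cx k)) s
    = fineDer (MvPolynomial.X cz * MvPolynomial.X (cx k)) s + (p * (ℓ + 1)) • (bu (cx k) * s) := by
  classical
  rw [fineAct_apply]
  simp

lemma fineAct_zy : fineAct p (MvPolynomial.X cz * MvPolynomial.X (cy k)) s
    = fineDer (MvPolynomial.X cz * MvPolynomial.X (cy k)) s + (p * (ℓ + 1)) • (bu (cy k) * s) := by
  classical
  rw [fineAct_apply]
  simp

end

/-! ### Intertwining operators between fine symbols of different orders -/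

/-- `τ` commutes with the action of the conformal algebra on fine symbols, and its values have
degree `r'` in the fibre variables of the `x_k`, `y_k` and degree `l'` in that of `z`. -/
structure FineIntertwiner (p : ℂ) (r' l' : ℕ) (τ : Module.End ℂ (Phase ℓ)) : Prop where
  comm : ∀ f : Poly ℓ, f.totalDegree ≤ 2 → ∀ s, τ (fineAct p f s) = fineAct p f (τ s)
  target : ∀ s t, MvPolynomial.coeff t (τ s) ≠ 0 → edeg t = r' ∧ zdeg t = l'

lemma gradeD_z_eq : gradeD ℓ 0 1 0 0 = (bu cz : Phase ℓ) • du cz := by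
  classical
  apply phase_derivation_ext' <;> intros <;>
    simp [gradeD_x, gradeD_y, gradeD_z, gradeD_fx, gradeD_fy, gradeD_fz, du_bu, du_fv, cz_cx, cz_cy]

lemma exists_eq_bu_cz_mul {c m r l : ℕ} {s : Phase ℓ} (hs : s ∈ piece grade (c + 1, m, r, l)) :
    ∃ s' ∈ piece grade (c, m, r, l), s = bu cz * s' := by
  have h1 : ((c + 1 : ℕ) : ℂ) ≠ 0 := Nat.cast_ne_zero.mpr (by omega)
  refine ⟨((c + 1 : ℕ) : ℂ)⁻¹ • du cz s, Submodule.smul_mem _ _ (pderiv_grade grade_z hs ?_), ?_⟩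
  · simp
  · have h := gradeD_of_mem 0 1 0 0 hs
    rw [gradeD_z_eq] at h
    have h' : bu cz * du cz s = ((c + 1 : ℕ) : ℂ) • s := by simpa using h
    rw [mul_smul_comm, h', inv_smul_smul₀ h1]

lemma coeff_X_mul_pderiv (a : Coord ℓ ⊕ Coord ℓ) (s : Phase ℓ) (t : Coord ℓ ⊕ Coord ℓ →₀ ℕ) :
    MvPolynomial.coeff t (MvPolynomial.X a * MvPolynomial.pderiv a s)
      = t a * MvPolynomial.coeff t s := by
  classical
  have e : eulerD (Pi.single a 1)
      = (MvPolynomial.X a : Phase ℓ) • (MvPolynomial.pderiv a : Derivation ℂ (Phase ℓ) (Phase ℓ)) := by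
    apply MvPolynomial.derivation_ext
    intro j
    rw [eulerD_X, Derivation.smul_apply, MvPolynomial.pderiv_X, Pi.single_apply, Pi.single_apply]
    split_ifs with h
    · subst h; simp
    · simp
  rw [← smul_eq_mul, ← Derivation.smul_apply, ← e, coeff_eulerD]
  rw [Finset.sum_eq_single a (fun b _ hb => by simp [Pi.single_apply, hb]) (by simp),
    Pi.single_eq_same, one_mul]

lemma X_mul_pderiv_eq_iff (a : Coord ℓ ⊕ Coord ℓ) (κ : ℂ) (s : Phase ℓ) :
    MvPolynomial.X a * MvPolynomial.pderiv a s = κ • s ↔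
      ∀ t, MvPolynomial.coeff t s ≠ 0 → (t a : ℂ) = κ := by
  rw [MvPolynomial.ext_iff]
  refine forall_congr' fun t => ?_
  rw [coeff_X_mul_pderiv, MvPolynomial.coeff_smul, smul_eq_mul, mul_eq_mul_right_iff]
  tauto

lemma coeff_eq_zero_of_pderiv {a : Coord ℓ ⊕ Coord ℓ} {s : Phase ℓ}
    (h : MvPolynomial.pderiv a s = 0) {t : Coord ℓ ⊕ Coord ℓ →₀ ℕ}
    (ht : MvPolynomial.coeff t s ≠ 0) : t a = 0 := by
  have := (X_mul_pderiv_eq_iff a 0 s).mp (by rw [h, mul_zero, zero_smul]) t ht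
  exact_mod_cast this

lemma deg_X (a : Coord ℓ) : (MvPolynomial.X a : Poly ℓ).totalDegree ≤ 2 := by simp

namespace FineIntertwiner

variable {p : ℂ} {r l r' l' : ℕ} {τ : Module.End ℂ (Phase ℓ)}

/-- The values of an intertwining operator are of the weight prescribed by the action of the
grading element `z` of the conformal algebra. -/
lemma weight (hτ : FineIntertwiner p r' l' τ) {c m : ℕ} {s : Phase ℓ}
    (hs : s ∈ piece grade (c, m, r, l)) {t : Coord ℓ ⊕ Coord ℓ →₀ ℕ}
    (ht : MvPolynomial.coeff t (τ s) ≠ 0) :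
    bdeg t + 2 * zexp t + (r + 2 * l) = m + 2 * c + (r' + 2 * l') := by
  have h := hτ.comm _ (deg_X cz) s
  rw [fineAct_X_z, fineAct_X_z, map_add, map_smul, add_left_inj, gradeD_of_mem _ _ _ _ hs,
    map_smul] at h
  have h1 := (gradeD_eq_iff _ _ _ _ _ _).mp h.symm t ht
  obtain ⟨h2, h3⟩ := hτ.target s t ht
  rw [h2, h3] at h1
  have h4 : ((bdeg t + 2 * zexp t + (r + 2 * l) : ℕ) : ℂ) = (m + 2 * c + (r' + 2 * l') : ℕ) := by
    push_cast
    linear_combination 2 * h1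
  exact_mod_cast h4

lemma eq_zero_of_weight_lt (hτ : FineIntertwiner p r' l' τ) {c m : ℕ} {s : Phase ℓ}
    (hs : s ∈ piece grade (c, m, r, l)) (h : m + 2 * c + (r' + 2 * l') < r + 2 * l) : τ s = 0 := by
  ext t
  by_contra ht
  have := hτ.weight hs (t := t) (by simpa using ht)
  omega

lemma du_mem {c m : ℕ} {s : Phase ℓ} (hs : s ∈ piece grade (c, m, r, l)) :
    du cz s = 0 ∨ ∃ c', c = c' + 1 ∧ du cz s ∈ piece grade (c', m, r, l) := by
  rcases c with _ | c
  · exact Or.inl (pderiv_grade_eq_zero grade_z hs (by simp [Prod.ext_iff]))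
  · exact Or.inr ⟨c, rfl, pderiv_grade grade_z hs (by simp)⟩

lemma du_mem' {a : Coord ℓ} (ha : grade (Finsupp.single (Sum.inl a) 1) = (0, 1, 0, 0))
    {c m : ℕ} {s : Phase ℓ} (hs : s ∈ piece grade (c, m, r, l)) :
    du a s = 0 ∨ ∃ m', m = m' + 1 ∧ du a s ∈ piece grade (c, m', r, l) := by
  rcases m with _ | m
  · exact Or.inl (pderiv_grade_eq_zero ha hs (by simp [Prod.ext_iff]))
  · exact Or.inr ⟨m, rfl, pderiv_grade ha hs (by simp)⟩

/-- An intertwining operator is determined by its values in the lowest weight: everywhere else the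
translations and the `χ(x_k)`, `χ(y_k)` show by induction that a value has constant coefficients. -/
lemma eq_zero_of_lowest (hτ : FineIntertwiner p r' l' τ)
    (h0 : ∀ c m s, s ∈ piece grade (c, m, r, l) → m + 2 * c + (r' + 2 * l') = r + 2 * l → τ s = 0) :
    ∀ w c m s, m + 2 * c = w → s ∈ piece grade (c, m, r, l) → τ s = 0 := by
  intro w
  induction w using Nat.strong_induction_on with
  | _ w ih =>
    intro c m s hw hs
    have hz : τ (du cz s) = 0 := by
      rcases du_mem hs with h | ⟨c', rfl, h⟩
      · rw [h, map_zero]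
      · exact ih (m + 2 * c') (by omega) _ _ _ rfl h
    have hz' : ∀ a, grade (Finsupp.single (Sum.inl a) 1) = (0, 1, 0, 0) →
        τ (bu a * du cz s) = 0 := by
      intro a ha
      rcases du_mem hs with h | ⟨c', rfl, h⟩
      · rw [h, mul_zero, map_zero]
      · exact ih (m + 1 + 2 * c') (by omega) _ _ _ rfl (X_mul_grade ha h (by simp))
    have hd : ∀ a, grade (Finsupp.single (Sum.inl a) 1) = (0, 1, 0, 0) → τ (du a s) = 0 := by
      intro a ha
      rcases du_mem' ha hs with h | ⟨m', rfl, h⟩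
      · rw [h, map_zero]
      · exact ih (m' + 2 * c) (by omega) _ _ _ rfl h
    have ez : du cz (τ s) = 0 := by
      have := hτ.comm 1 (by simp) s
      rwa [fineAct_one, fineAct_one, hz, eq_comm] at this
    have ey : ∀ k, du (cy k) (τ s) = 0 := by
      intro k
      have := hτ.comm _ (deg_X (cx k)) s
      rw [fineAct_X_x, fineAct_X_x, map_add, map_smul, hd _ (grade_y k), hz' _ (grade_x k), ez] at this
      simpa using this.symm
    have ex : ∀ k, du (cx k) (τ s) = 0 := by
      intro k
      have := hτ.comm _ (deg_X (cy k)) s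
      rw [fineAct_X_y, fineAct_X_y, map_add, map_neg, map_smul, hd _ (grade_x k), hz' _ (grade_y k),
        ez] at this
      simpa using this.symm
    ext t
    by_contra ht
    have ht : MvPolynomial.coeff t (τ s) ≠ 0 := by simpa using ht
    have e1 : zexp t = 0 := coeff_eq_zero_of_pderiv ez ht
    have e2 : bdeg t = 0 := Finset.sum_eq_zero fun k _ => by
      rw [coeff_eq_zero_of_pderiv (ex k) ht, coeff_eq_zero_of_pderiv (ey k) ht, add_zero]
    have := hτ.weight hs ht
    rw [h0 c m s hs (by omega)] at ht
    simp at ht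

lemma toBase_mem {c m : ℕ} {s : Phase ℓ} (hs : s ∈ piece grade (c, m, r + 1, l)) :
    toBase ℓ s ∈ piece grade (c, m + 1, r, l) := by
  rw [toBase, derivation_sum_apply]
  refine Submodule.sum_mem _ fun k _ => add_mem ?_ ?_
  · exact X_mul_grade (grade_x k) (pderiv_grade (w := (c, m, r, l)) (grade_fx k) hs (by simp)) (by simp)
  · exact X_mul_grade (grade_y k) (pderiv_grade (w := (c, m, r, l)) (grade_fy k) hs (by simp)) (by simp)

lemma toBase_eq_zero {c m : ℕ} {s : Phase ℓ} (hs : s ∈ piece grade (c, m, 0, l)) :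
    toBase ℓ s = 0 := by
  rw [toBase, derivation_sum_apply]
  refine Finset.sum_eq_zero fun k _ => ?_
  change bu (cx k) * dv (cx k) s + bu (cy k) * dv (cy k) s = 0
  rw [show dv (cx k) s = 0 from pderiv_grade_eq_zero (grade_fx k) hs (by simp [Prod.ext_iff]),
    show dv (cy k) s = 0 from pderiv_grade_eq_zero (grade_fy k) hs (by simp [Prod.ext_iff])]
  simp

lemma omega_mul_mem {c m : ℕ} {s : Phase ℓ} (hs : s ∈ piece grade (c, m, r, l)) :
    omega ℓ * s ∈ piece grade (c, m + 1, r + 1, l) := by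
  rw [omega, Finset.sum_mul]
  refine Submodule.sum_mem _ fun k _ => ?_
  rw [sub_mul, mul_assoc, mul_assoc]
  refine sub_mem ?_ ?_
  · exact X_mul_grade (grade_x k) (X_mul_grade (w := (c, m, r + 1, l)) (grade_fy k) hs (by simp))
      (by simp)
  · exact X_mul_grade (grade_y k) (X_mul_grade (w := (c, m, r + 1, l)) (grade_fx k) hs (by simp))
      (by simp)

lemma omega_toBase_mem {c m : ℕ} {s : Phase ℓ} (hs : s ∈ piece grade (c, m, r, l)) :
    omega ℓ * toBase ℓ s ∈ piece grade (c, m + 2, r, l) := by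
  rcases r with _ | r
  · rw [toBase_eq_zero hs, mul_zero]; exact zero_mem _
  · exact omega_mul_mem (toBase_mem hs)

lemma generic_ne {p : ℂ} (hp : Generic ℓ p) (n : ℤ) : 2 * (p * (ℓ + 1)) - n ≠ 0 := by
  intro h
  apply hp n
  push_cast
  linear_combination h

/-- The relation imposed by `χ(z²)` on multiples of `z` in the lowest weight. -/
lemma map_bu_cz_mul (hτ : FineIntertwiner p r' l' τ) {c m : ℕ} {s : Phase ℓ}
    (hs : s ∈ piece grade (c, m, r, l)) (h : m + 2 * (c + 1) + (r' + 2 * l') ≤ r + 2 * l) :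
    (m + c - r - 2 * l + 2 * (p * (ℓ + 1)) : ℂ) • τ (bu cz * s)
      = (1 / 2 : ℂ) • τ (omega ℓ * toBase ℓ s) := by
  have := hτ.comm _ (deg_X_X cz cz) s
  rw [hτ.eq_zero_of_weight_lt hs (by omega), map_zero, fineAct_zz, gradeD_of_mem _ _ _ _ hs, map_sub,
    map_smul, sub_eq_zero, ← add_smul, mul_smul_comm, map_smul] at this
  rw [← this]
  congr 1
  ring

lemma eq_zero_of_lowest_of_base (hp : Generic ℓ p) (hτ : FineIntertwiner p r' l' τ)
    (h0 : ∀ m s, s ∈ piece grade (0, m, r, l) → m + (r' + 2 * l') = r + 2 * l → τ s = 0) :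
    ∀ c m s, s ∈ piece grade (c, m, r, l) → m + 2 * c + (r' + 2 * l') = r + 2 * l → τ s = 0 := by
  intro c
  induction c with
  | zero => exact fun m s hs h => h0 m s hs (by omega)
  | succ c ih =>
    intro m s hs h
    obtain ⟨s', hs', rfl⟩ := exists_eq_bu_cz_mul hs
    have := hτ.map_bu_cz_mul hs' (by omega)
    rw [ih _ _ (omega_toBase_mem hs') (by omega), smul_zero] at this
    refine (smul_eq_zero.mp this).resolve_left fun h' => ?_
    refine generic_ne hp ((r + 2 * l : ℤ) - m - c) ?_
    push_cast
    linear_combination h'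

end FineIntertwiner

/-! ### Polarization -/

section
variable {A : Type*} [CommRing A] [Algebra ℂ A]

lemma derivation_mul_mem (D : Derivation ℂ A A) {M N : Submodule ℂ A} (hM : ∀ a ∈ M, D a ∈ M)
    (hN : ∀ a ∈ N, D a ∈ N) : ∀ a ∈ M * N, D a ∈ M * N := by
  intro a ha
  induction ha using Submodule.mul_induction_on' with
  | mem_mul_mem x hx y hy =>
    rw [Derivation.leibniz, smul_eq_mul, smul_eq_mul, mul_comm y]
    exact add_mem (Submodule.mul_mem_mul hx (hN y hy)) (Submodule.mul_mem_mul (hM x hx) hy)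
  | add x _ y _ h1 h2 => rw [map_add]; exact add_mem h1 h2

lemma derivation_pow_mem (D : Derivation ℂ A A) {V : Submodule ℂ A} (hV : ∀ a ∈ V, D a ∈ V)
    (n : ℕ) : ∀ a ∈ V ^ n, D a ∈ V ^ n := by
  induction n with
  | zero =>
    intro a ha
    rw [Submodule.pow_zero] at ha ⊢
    obtain ⟨c, rfl⟩ := Submodule.mem_one.mp ha
    rw [D.map_algebraMap]
    exact zero_mem _
  | succ n ih => rw [Submodule.pow_succ]; exact derivation_mul_mem D ih hV

/-- Polarization: if derivations preserving `K`, `M` and the span of `S` move `v` to every element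
of `S`, then `K` contains `M · S^n` as soon as it contains `M · v^n`. -/
lemma polarization {K M : Submodule ℂ A} {S : Set A} {v : A}
    (hD : ∀ w ∈ S, ∃ D : Derivation ℂ A A, (∃ c : ℂ, c ≠ 0 ∧ D v = c • w) ∧ (∀ a ∈ K, D a ∈ K) ∧
      (∀ a ∈ M, D a ∈ M) ∧ ∀ a ∈ Submodule.span ℂ S, D a ∈ Submodule.span ℂ S)
    (n : ℕ) (h : ∀ m ∈ M, m * v ^ n ∈ K) : M * Submodule.span ℂ S ^ n ≤ K := by
  have key : ∀ j i, j + i = n → ∀ m ∈ M * Submodule.span ℂ S ^ j, m * v ^ i ∈ K := by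
    intro j
    induction j with
    | zero =>
      intro i hi m hm
      rw [Submodule.pow_zero, Submodule.mul_one] at hm
      obtain rfl : i = n := by omega
      exact h m hm
    | succ j ih =>
      intro i hi m hm
      rw [Submodule.pow_succ, ← mul_assoc] at hm
      induction hm using Submodule.mul_induction_on' with
      | mem_mul_mem x hx y hy =>
        induction hy using Submodule.span_induction with
        | mem w hw =>
          obtain ⟨D, ⟨c, hc, hv⟩, hK, hM, hS⟩ := hD w hw
          have h1 := hK _ (ih (i + 1) (by omega) x hx)
          have h2 := ih (i + 1) (by omega) _
            (derivation_mul_mem D hM (derivation_pow_mem D hS j) x hx)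
          rw [Derivation.leibniz, Derivation.leibniz_pow, hv, smul_eq_mul (v ^ (i + 1)),
            mul_comm (v ^ (i + 1))] at h1
          have h3 := (Submodule.add_mem_iff_left K h2).mp h1
          have h4 : x * w * v ^ i = (((i + 1 : ℕ) : ℂ) * c)⁻¹ •
              (x • (i + 1) • v ^ (i + 1 - 1) • c • w) := by
            have h0 : (((i + 1 : ℕ) : ℂ) * c) ≠ 0 := mul_ne_zero (by exact_mod_cast i.succ_ne_zero) hc
            rw [eq_inv_smul_iff₀ h0, Nat.add_sub_cancel, ← Nat.cast_smul_eq_nsmul ℂ]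
            simp only [smul_eq_mul, mul_smul_comm, smul_mul_assoc, smul_smul]
            congr 1
            ring
          rw [h4]
          exact K.smul_mem _ h3
        | zero => simp
        | add a b _ _ h1 h2 => rw [mul_add, add_mul]; exact add_mem h1 h2
        | smul a b _ h1 => rw [mul_smul_comm, smul_mul_assoc]; exact K.smul_mem _ h1
      | add x _ y _ h1 h2 => rw [add_mul]; exact add_mem h1 h2
  intro m hm
  simpa using key n 0 (by omega) m hm

lemma prod_pow_mem {ι : Type*} (s : Finset ι) {V : Submodule ℂ A} (f : ι → A) (e : ι → ℕ)
    (h : ∀ i, f i ∈ V) : ∏ i ∈ s, f i ^ e i ∈ V ^ ∑ i ∈ s, e i := by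
  classical
  induction s using Finset.induction_on with
  | empty => rw [Finset.prod_empty, Finset.sum_empty, Submodule.pow_zero]; exact Submodule.one_le.mp le_rfl
  | insert a s ha ih =>
    rw [Finset.prod_insert ha, Finset.sum_insert ha, pow_add]
    exact Submodule.mul_mem_mul (Submodule.pow_mem_pow V (h a) _) ih

end

/-- The coordinates `x_k`, `y_k`. -/
def baseSet (ℓ : ℕ) : Set (Phase ℓ) := Set.range (fun k => bu (cx k)) ∪ Set.range fun k => bu (cy k)
/-- The fibre variables of the `x_k`, `y_k`. -/
def fibreSet (ℓ : ℕ) : Set (Phase ℓ) := Set.range (fun k => fv (cx k)) ∪ Set.range fun k => fv (cy k)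

lemma piece_grade_le (m r l : ℕ) : piece grade (0, m, r, l) ≤
    (Submodule.span ℂ {(fv cz : Phase ℓ) ^ l} * Submodule.span ℂ (baseSet ℓ) ^ m) *
      Submodule.span ℂ (fibreSet ℓ) ^ r := by
  intro s hs
  rw [piece, mem_restrictSupport'] at hs
  rw [MvPolynomial.as_sum s]
  refine Submodule.sum_mem _ fun t ht => ?_
  have h := hs t (by simpa using ht)
  simp only [grade, Set.mem_ofPred_eq, Prod.mk.injEq] at h
  obtain ⟨h1, h2, h3, h4⟩ := h
  rw [MvPolynomial.monomial_eq, ← MvPolynomial.smul_eq_C_mul]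
  refine Submodule.smul_mem _ _ ?_
  rw [Finsupp.prod_fintype _ _ (fun i => pow_zero _), Fintype.prod_sum_type]
  simp only [Fintype.prod_sum_type, Fintype.prod_unique]
  have e : ∀ a b c d e f : Phase ℓ, a * (b * c) * (d * (e * f)) = c * ((f * (a * b)) * (d * e)) := by
    intros; ring
  rw [e]
  have hz : (MvPolynomial.X (Sum.inl (Sum.inr (Sum.inr default))) : Phase ℓ)
      ^ t (Sum.inl (Sum.inr (Sum.inr default))) = 1 := by
    rw [show t (Sum.inl (Sum.inr (Sum.inr default))) = 0 from h1, pow_zero]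
  rw [hz, one_mul]
  refine Submodule.mul_mem_mul (Submodule.mul_mem_mul ?_ ?_) ?_
  · rw [← h4]
    exact Submodule.subset_span rfl
  · rw [← h2, bdeg, Finset.sum_add_distrib, pow_add]
    refine Submodule.mul_mem_mul (prod_pow_mem _ _ _ fun k => ?_) (prod_pow_mem _ _ _ fun k => ?_)
    · exact Submodule.subset_span (Or.inl ⟨k, rfl⟩)
    · exact Submodule.subset_span (Or.inr ⟨k, rfl⟩)
  · rw [← h3, edeg, Finset.sum_add_distrib, pow_add]
    refine Submodule.mul_mem_mul (prod_pow_mem _ _ _ fun k => ?_) (prod_pow_mem _ _ _ fun k => ?_)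
    · exact Submodule.subset_span (Or.inl ⟨k, rfl⟩)
    · exact Submodule.subset_span (Or.inr ⟨k, rfl⟩)

/-- The action of `χ(x_j x_k)`. With `symXY` and `symYY` it spans the symplectic algebra. -/
def symXX (j k : Fin ℓ) : Derivation ℂ (Phase ℓ) (Phase ℓ) :=
  (bu (cx k) : Phase ℓ) • du (cy j) + (bu (cx j) : Phase ℓ) • du (cy k)
    + (fv (cx k) : Phase ℓ) • dv (cy j) + (fv (cx j) : Phase ℓ) • dv (cy k)
/-- The action of `χ(x_j y_k)`; see `symXX`. -/
def symXY (j k : Fin ℓ) : Derivation ℂ (Phase ℓ) (Phase ℓ) :=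
  (bu (cy k) : Phase ℓ) • du (cy j) - (bu (cx j) : Phase ℓ) • du (cx k)
    + (fv (cy k) : Phase ℓ) • dv (cy j) - (fv (cx j) : Phase ℓ) • dv (cx k)
/-- The negative of the action of `χ(y_j y_k)`; see `symXX`. -/
def symYY (j k : Fin ℓ) : Derivation ℂ (Phase ℓ) (Phase ℓ) :=
  (bu (cy k) : Phase ℓ) • du (cx j) + (bu (cy j) : Phase ℓ) • du (cx k)
    + (fv (cy k) : Phase ℓ) • dv (cx j) + (fv (cy j) : Phase ℓ) • dv (cx k)

section
variable (j k : Fin ℓ) (s : Phase ℓ)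
lemma symXX_apply : symXX j k s = bu (cx k) * du (cy j) s + bu (cx j) * du (cy k) s
      + fv (cx k) * dv (cy j) s + fv (cx j) * dv (cy k) s := rfl
lemma symXY_apply : symXY j k s = bu (cy k) * du (cy j) s - bu (cx j) * du (cx k) s
      + fv (cy k) * dv (cy j) s - fv (cx j) * dv (cx k) s := rfl
lemma symYY_apply : symYY j k s = bu (cy k) * du (cx j) s + bu (cy j) * du (cx k) s
      + fv (cy k) * dv (cx j) s + fv (cy j) * dv (cx k) s := rfl
end

namespace FineIntertwiner
variable {p : ℂ} {r' l' : ℕ} {τ : Module.End ℂ (Phase ℓ)}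

lemma comm_xx (hτ : FineIntertwiner p r' l' τ) (j k : Fin ℓ) (s : Phase ℓ) :
    τ (symXX j k s) = symXX j k (τ s) := by
  have := hτ.comm _ (deg_X_X (cx j) (cx k)) s
  rwa [fineAct_xx, fineAct_xx] at this
lemma comm_xy (hτ : FineIntertwiner p r' l' τ) (j k : Fin ℓ) (s : Phase ℓ) :
    τ (symXY j k s) = symXY j k (τ s) := by
  have := hτ.comm _ (deg_X_X (cx j) (cy k)) s
  rwa [fineAct_xy, fineAct_xy] at this
lemma comm_yy (hτ : FineIntertwiner p r' l' τ) (j k : Fin ℓ) (s : Phase ℓ) :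
    τ (symYY j k s) = symYY j k (τ s) := by
  have := hτ.comm _ (deg_X_X (cy j) (cy k)) s
  rw [fineAct_yy, fineAct_yy, map_neg, neg_inj] at this
  exact this

end FineIntertwiner

lemma mem_span_of_forall {A : Type*} [CommRing A] [Algebra ℂ A] {S : Set A} (D : Derivation ℂ A A)
    (h : ∀ a ∈ S, D a ∈ Submodule.span ℂ S) : ∀ a ∈ Submodule.span ℂ S, D a ∈ Submodule.span ℂ S := by
  intro a ha
  induction ha using Submodule.span_induction with
  | mem a ha => exact h a ha
  | zero => rw [map_zero]; exact zero_mem _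
  | add a b _ _ h1 h2 => rw [map_add]; exact add_mem h1 h2
  | smul c a _ h1 => rw [D.map_smul]; exact Submodule.smul_mem _ _ h1

section
variable (j k i : Fin ℓ)

lemma bx_mem : bu (cx i) ∈ Submodule.span ℂ (baseSet ℓ) := Submodule.subset_span (Or.inl ⟨i, rfl⟩)
lemma by_mem : bu (cy i) ∈ Submodule.span ℂ (baseSet ℓ) := Submodule.subset_span (Or.inr ⟨i, rfl⟩)
lemma fx_mem : fv (cx i) ∈ Submodule.span ℂ (fibreSet ℓ) := Submodule.subset_span (Or.inl ⟨i, rfl⟩)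
lemma fy_mem : fv (cy i) ∈ Submodule.span ℂ (fibreSet ℓ) := Submodule.subset_span (Or.inr ⟨i, rfl⟩)

lemma mul_ite_mem {V : Submodule ℂ (Phase ℓ)} {a : Phase ℓ} (h : a ∈ V) (P : Prop) [Decidable P] :
    a * (if P then 1 else 0) ∈ V := by
  split_ifs
  · rwa [mul_one]
  · rw [mul_zero]; exact zero_mem _

attribute [local simp] symXX_apply symXY_apply symYY_apply du_bu du_fv dv_bu dv_fv
  cx_eq cy_eq cx_cy cy_cx cx_cz cz_cx cy_cz cz_cy

lemma symXX_span : (∀ a ∈ Submodule.span ℂ (baseSet ℓ), symXX j k a ∈ Submodule.span ℂ (baseSet ℓ)) ∧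
    ∀ a ∈ Submodule.span ℂ (fibreSet ℓ), symXX j k a ∈ Submodule.span ℂ (fibreSet ℓ) := by
  classical
  constructor <;> refine mem_span_of_forall _ ?_ <;> rintro _ (⟨i, rfl⟩ | ⟨i, rfl⟩) <;>
    simp only [symXX_apply, du_bu, du_fv, dv_bu, dv_fv, cx_eq, cy_eq, cx_cy, cy_cx, if_false,
      mul_zero, add_zero, zero_add, zero_mem]
  · exact add_mem (mul_ite_mem (bx_mem _) _) (mul_ite_mem (bx_mem _) _)
  · exact add_mem (mul_ite_mem (fx_mem _) _) (mul_ite_mem (fx_mem _) _)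

lemma symXY_span : (∀ a ∈ Submodule.span ℂ (baseSet ℓ), symXY j k a ∈ Submodule.span ℂ (baseSet ℓ)) ∧
    ∀ a ∈ Submodule.span ℂ (fibreSet ℓ), symXY j k a ∈ Submodule.span ℂ (fibreSet ℓ) := by
  classical
  constructor <;> refine mem_span_of_forall _ ?_ <;> rintro _ (⟨i, rfl⟩ | ⟨i, rfl⟩) <;>
    simp only [symXY_apply, du_bu, du_fv, dv_bu, dv_fv, cx_eq, cy_eq, cx_cy, cy_cx, if_false,
      mul_zero, add_zero, zero_add, sub_zero, zero_sub]
  · exact neg_mem (mul_ite_mem (bx_mem _) _)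
  · exact mul_ite_mem (by_mem _) _
  · exact neg_mem (mul_ite_mem (fx_mem _) _)
  · exact mul_ite_mem (fy_mem _) _

lemma symYY_span : (∀ a ∈ Submodule.span ℂ (baseSet ℓ), symYY j k a ∈ Submodule.span ℂ (baseSet ℓ)) ∧
    ∀ a ∈ Submodule.span ℂ (fibreSet ℓ), symYY j k a ∈ Submodule.span ℂ (fibreSet ℓ) := by
  classical
  constructor <;> refine mem_span_of_forall _ ?_ <;> rintro _ (⟨i, rfl⟩ | ⟨i, rfl⟩) <;>
    simp only [symYY_apply, du_bu, du_fv, dv_bu, dv_fv, cx_eq, cy_eq, cx_cy, cy_cx, if_false,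
      mul_zero, add_zero, zero_add, zero_mem]
  · exact add_mem (mul_ite_mem (by_mem _) _) (mul_ite_mem (by_mem _) _)
  · exact add_mem (mul_ite_mem (fy_mem _) _) (mul_ite_mem (fy_mem _) _)

end

lemma span_singleton_stable {A : Type*} [CommRing A] [Algebra ℂ A] {D : Derivation ℂ A A} {a : A}
    {c : ℂ} (h : D a = c • a) : ∀ b ∈ Submodule.span ℂ {a}, D b ∈ Submodule.span ℂ {a} := by
  refine mem_span_of_forall D ?_
  rintro _ rfl
  rw [h]
  exact Submodule.smul_mem _ _ (Submodule.subset_span rfl)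

lemma derivation_pow_eq_zero {A : Type*} [CommRing A] [Algebra ℂ A] {D : Derivation ℂ A A} {a : A}
    (h : D a = 0) (n : ℕ) : D (a ^ n) = 0 := by
  rw [Derivation.leibniz_pow, h, smul_zero, smul_zero]

lemma derivation_pow_mul {A : Type*} [CommRing A] [Algebra ℂ A] {D : Derivation ℂ A A} {a b : A}
    {c : ℂ} (ha : D a = c • a) (hb : D b = 0) (n : ℕ) : D (a ^ n * b) = (n * c) • (a ^ n * b) := by
  rw [Derivation.leibniz, Derivation.leibniz_pow, ha, hb, smul_zero, zero_add]
  rcases n with _ | n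
  · simp
  · rw [Nat.add_sub_cancel, ← Nat.cast_smul_eq_nsmul ℂ, pow_succ]
    simp only [smul_eq_mul, mul_smul_comm, smul_smul]
    congr 1
    ring

section
variable (o k : Fin ℓ)

lemma symXY_bx : symXY k o (bu (cx o)) = (-1 : ℂ) • bu (cx k) := by
  classical
  simp [symXY_apply, du_bu, dv_bu, cx_eq, cy_cx]
lemma symYY_bx : ∃ c : ℂ, c ≠ 0 ∧ symYY k o (bu (cx o)) = c • bu (cy k) := by
  classical
  refine ⟨if k = o then 2 else 1, by split_ifs <;> norm_num, ?_⟩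
  by_cases h : k = o
  · subst h; simp [symYY_apply, du_bu, dv_bu, cx_eq, cy_cx, two_smul, mul_two]; try abel
  · simp [symYY_apply, du_bu, dv_bu, cx_eq, cy_cx, h]
lemma symXX_fy : ∃ c : ℂ, c ≠ 0 ∧ symXX o k (fv (cy o)) = c • fv (cx k) := by
  classical
  refine ⟨if k = o then 2 else 1, by split_ifs <;> norm_num, ?_⟩
  by_cases h : k = o
  · subst h; simp [symXX_apply, du_fv, dv_fv, cy_eq, two_smul, mul_two]; try abel
  · simp [symXX_apply, du_fv, dv_fv, cy_eq, h]
lemma symXY_fy : symXY o k (fv (cy o)) = (1 : ℂ) • fv (cy k) := by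
  classical
  simp [symXY_apply, du_fv, dv_fv, cy_eq, cx_cy]
lemma symXY_fy' : symXY k o (fv (cy o)) = (if k = o then 1 else 0 : ℂ) • fv (cy o) := by
  classical
  simp [symXY_apply, du_fv, dv_fv, cy_eq, cx_cy]
lemma symYY_fy : symYY k o (fv (cy o)) = (0 : ℂ) • fv (cy o) := by
  classical
  simp [symYY_apply, du_fv, dv_fv, cx_cy]
lemma symXX_fz : symXX o k (fv cz) = 0 := by
  classical
  simp [symXX_apply, du_fv, dv_fv, cy_cz]
lemma symXY_fz : symXY o k (fv cz) = 0 := by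
  classical
  simp [symXY_apply, du_fv, dv_fv, cy_cz, cx_cz]
lemma symYY_fz : symYY o k (fv cz) = 0 := by
  classical
  simp [symYY_apply, du_fv, dv_fv, cx_cz]

end

namespace FineIntertwiner
variable {p : ℂ} {r' l' : ℕ} {τ : Module.End ℂ (Phase ℓ)}

lemma ker_xx (hτ : FineIntertwiner p r' l' τ) (j k : Fin ℓ) :
    ∀ a ∈ LinearMap.ker τ, symXX j k a ∈ LinearMap.ker τ := fun a ha => by
  rw [LinearMap.mem_ker] at ha ⊢
  rw [hτ.comm_xx, ha, map_zero]
lemma ker_xy (hτ : FineIntertwiner p r' l' τ) (j k : Fin ℓ) :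
    ∀ a ∈ LinearMap.ker τ, symXY j k a ∈ LinearMap.ker τ := fun a ha => by
  rw [LinearMap.mem_ker] at ha ⊢
  rw [hτ.comm_xy, ha, map_zero]
lemma ker_yy (hτ : FineIntertwiner p r' l' τ) (j k : Fin ℓ) :
    ∀ a ∈ LinearMap.ker τ, symYY j k a ∈ LinearMap.ker τ := fun a ha => by
  rw [LinearMap.mem_ker] at ha ⊢
  rw [hτ.comm_yy, ha, map_zero]

lemma le_ker_base (hτ : FineIntertwiner p r' l' τ) (o : Fin ℓ) {n r l : ℕ}
    (h : τ (bu (cx o) ^ n * fv (cy o) ^ r * fv cz ^ l) = 0) :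
    Submodule.span ℂ {(fv (cy o) : Phase ℓ) ^ r * fv cz ^ l} *
      Submodule.span ℂ (baseSet ℓ) ^ n ≤ LinearMap.ker τ := by
  refine polarization (v := bu (cx o)) ?_ n ?_
  · rintro _ (⟨k, rfl⟩ | ⟨k, rfl⟩)
    · exact ⟨symXY k o, ⟨-1, by norm_num, symXY_bx o k⟩, hτ.ker_xy k o,
        span_singleton_stable (derivation_pow_mul (symXY_fy' o k)
          (derivation_pow_eq_zero (symXY_fz k o) l) r), (symXY_span k o).1⟩
    · exact ⟨symYY k o, symYY_bx o k, hτ.ker_yy k o,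
        span_singleton_stable (derivation_pow_mul (symYY_fy o k)
          (derivation_pow_eq_zero (symYY_fz k o) l) r), (symYY_span k o).1⟩
  · intro m hm
    obtain ⟨c, rfl⟩ := Submodule.mem_span_singleton.mp hm
    have e : c • ((fv (cy o) : Phase ℓ) ^ r * fv cz ^ l) * bu (cx o) ^ n
        = c • (bu (cx o) ^ n * fv (cy o) ^ r * fv cz ^ l) := by
      rw [smul_mul_assoc]
      congr 1
      ring
    rw [LinearMap.mem_ker, e, map_smul, h, smul_zero]

lemma span_fz_stable {D : Derivation ℂ (Phase ℓ) (Phase ℓ)} (h : D (fv cz) = 0) (l : ℕ) :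
    ∀ b ∈ Submodule.span ℂ {(fv cz : Phase ℓ) ^ l}, D b ∈ Submodule.span ℂ {(fv cz : Phase ℓ) ^ l} :=
  span_singleton_stable (c := 0) (by rw [derivation_pow_eq_zero h, zero_smul])

/-- Under the symplectic algebra, `x_o^n υ_o^r ζ^l` generates all fine symbols of its degrees that do
not involve `z`. -/
lemma eq_zero_of_cyclic (hτ : FineIntertwiner p r' l' τ) (o : Fin ℓ) {n r l : ℕ}
    (h : τ (bu (cx o) ^ n * fv (cy o) ^ r * fv cz ^ l) = 0) :
    ∀ s ∈ piece grade (0, n, r, l), τ s = 0 := by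
  have h1 := hτ.le_ker_base o h
  have h2 : (Submodule.span ℂ {(fv cz : Phase ℓ) ^ l} * Submodule.span ℂ (baseSet ℓ) ^ n) *
      Submodule.span ℂ (fibreSet ℓ) ^ r ≤ LinearMap.ker τ := by
    refine polarization (v := fv (cy o)) ?_ r ?_
    · rintro _ (⟨k, rfl⟩ | ⟨k, rfl⟩)
      · have hM := derivation_mul_mem _ (span_fz_stable (symXX_fz o k) l)
          (derivation_pow_mem _ (symXX_span o k).1 n)
        exact ⟨symXX o k, symXX_fy o k, hτ.ker_xx o k, hM, (symXX_span o k).2⟩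
      · have hM := derivation_mul_mem _ (span_fz_stable (symXY_fz o k) l)
          (derivation_pow_mem _ (symXY_span o k).1 n)
        exact ⟨symXY o k, ⟨1, one_ne_zero, symXY_fy o k⟩, hτ.ker_xy o k, hM, (symXY_span o k).2⟩
    · intro m hm
      induction hm using Submodule.mul_induction_on' with
      | mem_mul_mem x hx y hy =>
        obtain ⟨c, rfl⟩ := Submodule.mem_span_singleton.mp hx
        have := h1 (Submodule.mul_mem_mul (Submodule.subset_span rfl) hy)
        rw [LinearMap.mem_ker] at this
        have e : c • (fv cz : Phase ℓ) ^ l * y * fv (cy o) ^ r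
            = c • (fv (cy o) ^ r * fv cz ^ l * y) := by
          rw [smul_mul_assoc, smul_mul_assoc]
          congr 1
          ring
        rw [LinearMap.mem_ker, e, map_smul, this, smul_zero]
      | add a _ b _ h1 h2 => rw [add_mul]; exact add_mem h1 h2
  exact fun s hs => h2 (piece_grade_le n r l hs)

end FineIntertwiner

/-! ### The generating fine symbols and their images -/

lemma one_mem_piece_grade : (1 : Phase ℓ) ∈ piece grade (0, 0, 0, 0) :=
  monomial_mem_of (A := {t | grade t = (0, 0, 0, 0)}) (by simp [grade, zexp, bdeg, edeg, zdeg]) 1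

/-- The fine symbol `x_o^n υ_o^r ζ^l`. -/
def gen (o : Fin ℓ) (n r l : ℕ) : Phase ℓ := bu (cx o) ^ n * fv (cy o) ^ r * fv cz ^ l

lemma gen_mem (o : Fin ℓ) (n r l : ℕ) : gen o n r l ∈ piece grade (0, n, r, l) := by
  have h1 : ∀ l, (fv cz : Phase ℓ) ^ l ∈ piece grade (0, 0, 0, l) := by
    intro l
    induction l with
    | zero => rw [pow_zero]; exact one_mem_piece_grade
    | succ l ih => rw [pow_succ']; exact X_mul_grade grade_fz ih (by simp)
  have h2 : ∀ r, fv (cy o) ^ r * (fv cz : Phase ℓ) ^ l ∈ piece grade (0, 0, r, l) := by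
    intro r
    induction r with
    | zero => rw [pow_zero, one_mul]; exact h1 l
    | succ r ih => rw [pow_succ', mul_assoc]; exact X_mul_grade (grade_fy o) ih (by simp)
  have h3 : ∀ n, bu (cx o) ^ n * (fv (cy o) ^ r * (fv cz : Phase ℓ) ^ l) ∈ piece grade (0, n, r, l) := by
    intro n
    induction n with
    | zero => rw [pow_zero, one_mul]; exact h2 r
    | succ n ih => rw [pow_succ', mul_assoc]; exact X_mul_grade (grade_x o) ih (by simp)
  rw [gen, mul_assoc]
  exact h3 n

section
variable (o : Fin ℓ) (n r l : ℕ)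

lemma derivation_gen (D : Derivation ℂ (Phase ℓ) (Phase ℓ)) : D (gen o n r l)
    = (n : Phase ℓ) * (bu (cx o) ^ (n - 1) * fv (cy o) ^ r * fv cz ^ l) * D (bu (cx o))
      + (r : Phase ℓ) * (bu (cx o) ^ n * fv (cy o) ^ (r - 1) * fv cz ^ l) * D (fv (cy o))
      + (l : Phase ℓ) * (bu (cx o) ^ n * fv (cy o) ^ r * fv cz ^ (l - 1)) * D (fv cz) := by
  simp only [gen, Derivation.leibniz, Derivation.leibniz_pow, smul_eq_mul, nsmul_eq_mul]
  ring

lemma der_natCast (D : Derivation ℂ (Phase ℓ) (Phase ℓ)) : D (n : Phase ℓ) = 0 := D.map_natCast n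

attribute [local simp] du_bu du_fv dv_bu dv_fv cx_eq cy_eq cx_cy cy_cx cx_cz cz_cx cy_cz cz_cy

lemma du_gen {i : Coord ℓ} (h : i ≠ cx o) : du i (gen o n r l) = 0 := by
  classical
  rw [derivation_gen, du_bu, du_fv, du_fv, if_neg h]
  ring
lemma du_gen_x : du (cx o) (gen o n r l) = (n : Phase ℓ) * gen o (n - 1) r l := by
  classical
  rw [derivation_gen, du_bu, du_fv, du_fv, if_pos rfl, gen]
  ring
lemma dv_gen {i : Coord ℓ} (h : i ≠ cy o) (h' : i ≠ cz) : dv i (gen o n r l) = 0 := by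
  classical
  rw [derivation_gen, dv_bu, dv_fv, dv_fv, if_neg h, if_neg h']
  ring
lemma dv_gen_y : dv (cy o) (gen o n r l) = (r : Phase ℓ) * gen o n (r - 1) l := by
  classical
  rw [derivation_gen, dv_bu, dv_fv, dv_fv, if_pos rfl, if_neg (by simp), gen]
  ring

lemma mul_gen_x : bu (cx o) * gen o n r l = gen o (n + 1) r l := by rw [gen, gen]; ring
lemma mul_gen_fy : fv (cy o) * gen o n r l = gen o n (r + 1) l := by rw [gen, gen]; ring

lemma symYY_symXX_gen : symYY o o (symXX o o (gen o (n + 1) (r + 1) l))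
    = (4 * (r + 1) : ℂ) • ((n + 1 : ℂ) • (bu (cy o) * fv (cx o) * gen o n r l)
        + gen o (n + 1) (r + 1) l) := by
  classical
  rw [symXX_apply, du_gen o _ _ _ (by simp), dv_gen_y, ← mul_gen_fy o (n + 1) r]
  simp only [symYY_apply, du_leib, dv_leib, map_add, du_fv, dv_fv, if_true, der_natCast,
    dv_gen o _ _ _ (i := cx o) (by simp) (by simp), du_gen_x, mul_zero, add_zero, zero_add, cy_cx, if_false,
    MvPolynomial.smul_eq_C_mul, map_mul, map_natCast, map_one, map_ofNat]
  push_cast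
  ring

lemma sym_gen {k : Fin ℓ} (hk : k ≠ o) : symXY o k (symXY k o (gen o (n + 1) (r + 1) l))
      + symXX o k (symYY o k (gen o (n + 1) (r + 1) l))
    = (2 * (n + 1) : ℂ) • gen o (n + 1) (r + 1) l - ((n + 1) * (r + 1) : ℂ) •
        ((bu (cx k) * fv (cy k) - bu (cy k) * fv (cx k)) * gen o n r l) := by
  classical
  have h1 : symXY k o (gen o (n + 1) (r + 1) l)
      = -((n + 1 : ℕ) * (bu (cx k) * gen o n (r + 1) l)) := by
    rw [symXY_apply, du_gen o _ _ _ (by simp), du_gen_x, dv_gen o _ _ _ (i := cx o) (by simp) (by simp),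
      dv_gen o _ _ _ (i := cy k) (by simpa using hk) (by simp), Nat.add_sub_cancel]
    ring
  have h2 : symYY o k (gen o (n + 1) (r + 1) l)
      = (n + 1 : ℕ) * (bu (cy k) * gen o n (r + 1) l) := by
    rw [symYY_apply, du_gen o _ _ _ (i := cx k) (by simpa using hk), du_gen_x,
      dv_gen o _ _ _ (i := cx o) (by simp) (by simp),
      dv_gen o _ _ _ (i := cx k) (by simp) (by simp), Nat.add_sub_cancel]
    ring
  rw [h1, h2, symXY_apply, symXX_apply, ← mul_gen_x]
  simp only [map_neg, du_leib, dv_leib, du_bu, dv_bu, der_natCast, cx_eq, cy_eq, cx_cy, cy_cx, hk,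
    hk.symm, if_true, if_false, du_gen o _ _ _ (i := cx k) (by simpa using hk),
    du_gen o _ _ _ (i := cy o) (by simp), du_gen o _ _ _ (i := cy k) (by simp), dv_gen_y,
    dv_gen o _ _ _ (i := cy k) (by simpa using hk) (by simp),
    dv_gen o _ _ _ (i := cx k) (by simp) (by simp), mul_zero, add_zero, zero_add, neg_zero,
    MvPolynomial.smul_eq_C_mul, map_mul, map_natCast, map_one, map_ofNat, map_add]
  push_cast
  ring

lemma omega_mul_gen : ((n + 1) * (r + 1) : ℂ) • (omega ℓ * gen o n r l)
    = ((n + 1) * (r + 1) + (r + 1) : ℂ) • gen o (n + 1) (r + 1) l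
      - (1 / 4 : ℂ) • symYY o o (symXX o o (gen o (n + 1) (r + 1) l))
      + ∑ k ∈ Finset.univ.erase o, ((2 * (n + 1) : ℂ) • gen o (n + 1) (r + 1) l
          - (symXY o k (symXY k o (gen o (n + 1) (r + 1) l))
            + symXX o k (symYY o k (gen o (n + 1) (r + 1) l)))) := by
  rw [Finset.sum_congr rfl fun k hk => by
    rw [sym_gen o n r l (Finset.ne_of_mem_erase hk), sub_sub_cancel]]
  rw [omega, ← Finset.add_sum_erase _ _ (Finset.mem_univ o),
    add_mul (bu (cx o) * fv (cy o) - _), Finset.sum_mul, smul_add,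
    Finset.smul_sum, symYY_symXX_gen]
  congr 1
  have e : gen o (n + 1) (r + 1) l = bu (cx o) * fv (cy o) * gen o n r l := by
    rw [mul_assoc, mul_gen_fy, mul_gen_x]
  rw [e, sub_mul]
  module

end

/-- `E` is a fine symbol in the variables `ξ_o`, `υ_o`, `ζ` alone, homogeneous of the degrees `a` in
`ξ_o` and `b` in `υ_o`. -/
structure IsHighest (o : Fin ℓ) (a b : ℕ) (E : Phase ℓ) : Prop where
  du : ∀ i, du i E = 0
  dv_x : ∀ k, k ≠ o → dv (cx k) E = 0
  dv_y : ∀ k, k ≠ o → dv (cy k) E = 0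
  ev_x : fv (cx o) * dv (cx o) E = (a : ℂ) • E
  ev_y : fv (cy o) * dv (cy o) E = (b : ℂ) • E

namespace IsHighest
variable {o : Fin ℓ} {a b : ℕ} {E : Phase ℓ}

lemma ev_xy (h : IsHighest o a b E) :
    fv (cx o) * (fv (cy o) * dv (cx o) (dv (cy o) E)) = (a * b : ℂ) • E := by
  classical
  have := congrArg (fun s => fv (cy o) * dv (cy o) s) h.ev_x
  simp only [dv_leib, dv_fv, cy_cx, if_false, mul_zero, add_zero, Derivation.map_smul, mul_smul_comm,
    h.ev_y, smul_smul] at this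
  rw [← this, dv_dv]
  ring

lemma symYY_symXX (h : IsHighest o a b E) :
    symYY o o (symXX o o E) = (4 * (b * (a + 1)) : ℂ) • E := by
  classical
  have h1 := h.ev_xy
  have h2 := h.ev_y
  rw [MvPolynomial.smul_eq_C_mul] at h1 h2 ⊢
  simp only [symXX_apply, symYY_apply, h.du, mul_zero, zero_add, map_add, du_leib, dv_leib, du_fv,
    dv_fv, du_dv, map_zero, add_zero, if_true, map_mul, map_add, map_natCast, map_one, map_ofNat] at *
  linear_combination 4 * h1 + 4 * h2

lemma symXX_symYY (h : IsHighest o a b E) :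
    symXX o o (symYY o o E) = (4 * (a * (b + 1)) : ℂ) • E := by
  classical
  have h1 := h.ev_xy
  have h2 := h.ev_x
  rw [dv_dv] at h1
  rw [MvPolynomial.smul_eq_C_mul] at h1 h2 ⊢
  simp only [symXX_apply, symYY_apply, h.du, mul_zero, zero_add, map_add, du_leib, dv_leib, du_fv,
    dv_fv, du_dv, map_zero, add_zero, if_true, map_mul, map_add, map_natCast, map_one, map_ofNat] at *
  linear_combination 4 * h1 + 4 * h2

lemma sym (h : IsHighest o a b E) {k : Fin ℓ} (hk : k ≠ o) :
    symXY o k (symXY k o E) + symXX o k (symYY o k E) = (2 * a : ℂ) • E := by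
  classical
  have h2 := h.ev_x
  rw [MvPolynomial.smul_eq_C_mul] at h2 ⊢
  have e1 : dv (cx k) (dv (cx o) E) = 0 := by rw [dv_dv, h.dv_x k hk, map_zero]
  have e2 : dv (cy k) (dv (cx o) E) = 0 := by rw [dv_dv, h.dv_y k hk, map_zero]
  have e3 : dv (cx k) (dv (cy o) E) = 0 := by rw [dv_dv, h.dv_x k hk, map_zero]
  simp only [symXX_apply, symYY_apply, symXY_apply, h.du, h.dv_x k hk, h.dv_y k hk, mul_zero,
    zero_add, sub_zero, zero_sub, map_neg, map_add, du_leib, dv_leib, du_fv, e1, e2, e3, cx_eq, cy_eq,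
    cx_cy, cy_cx, hk, hk.symm, if_false,
    dv_fv, du_dv, map_zero, add_zero, if_true, map_mul, map_add, map_natCast, map_one, map_ofNat] at *
  rw [dv_dv (cy o) (cx o)]
  linear_combination 2 * h2

end IsHighest

namespace FineIntertwiner
variable {p : ℂ} {r' l' : ℕ} {τ : Module.End ℂ (Phase ℓ)} {o : Fin ℓ} {n r l : ℕ}

lemma symXX_gen_other {k : Fin ℓ} (hk : k ≠ o) : symXX k k (gen o n r l) = 0 := by
  rw [symXX_apply, du_gen o _ _ _ (by simp [cy_cx]), dv_gen o _ _ _ (by simpa [cy_eq] using hk)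
    (by simp [cy_cz])]
  ring

lemma symYY_gen_other {k : Fin ℓ} (hk : k ≠ o) : symYY k k (gen o n r l) = 0 := by
  rw [symYY_apply, du_gen o _ _ _ (by simpa [cx_eq] using hk), dv_gen o _ _ _ (by simp [cx_cy])
    (by simp [cx_cz])]
  ring

lemma symXY_gen : symXY o o (gen o n r l) = (r - n : ℂ) • gen o n r l := by
  rw [symXY_apply, du_gen o _ _ _ (by simp [cy_cx]), du_gen_x, dv_gen_y, dv_gen o _ _ _ (by simp [cx_cy])
    (by simp [cx_cz])]
  have h1 : ((n : ℕ) : Phase ℓ) * (bu (cx o) * gen o (n - 1) r l) = n * gen o n r l := by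
    rcases n with _ | n
    · simp
    · rw [mul_gen_x, Nat.add_sub_cancel]
  have h2 : ((r : ℕ) : Phase ℓ) * (fv (cy o) * gen o n (r - 1) l) = r * gen o n r l := by
    rcases r with _ | r
    · simp
    · rw [mul_gen_fy, Nat.add_sub_cancel]
  rw [MvPolynomial.smul_eq_C_mul, map_sub, map_natCast, map_natCast]
  linear_combination h2 - h1

/-- The image of `x_o^n υ_o^r ζ^l`, in the lowest weight, is of weight zero and of the same weight
under the torus of the symplectic algebra, and is killed with it by `χ(x_k²)`, `χ(y_k²)`, `k ≠ o`. -/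
lemma isHighest (hτ : FineIntertwiner p r' l' τ) (hn : n + (r' + 2 * l') = r + 2 * l)
    (h0 : τ (gen o n r l) ≠ 0) :
    ∃ a b : ℕ, a + b = r' ∧ b + n = r + a ∧ IsHighest o a b (τ (gen o n r l)) := by
  classical
  set E := τ (gen o n r l) with hE
  have hu : ∀ t, MvPolynomial.coeff t E ≠ 0 → bdeg t = 0 ∧ zexp t = 0 := by
    intro t ht
    have := hτ.weight (gen_mem o n r l) ht
    omega
  have hdu : ∀ i, du i E = 0 := by
    intro i
    have h : MvPolynomial.X (Sum.inl i) * MvPolynomial.pderiv (Sum.inl i) E = (0 : ℂ) • E := by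
      rw [X_mul_pderiv_eq_iff]
      intro t ht
      obtain ⟨h1, h2⟩ := hu t ht
      rw [bdeg, Finset.sum_eq_zero_iff] at h1
      rw [Nat.cast_eq_zero]
      rcases i with i | i | i
      · exact (Nat.add_eq_zero_iff.mp (h1 i (Finset.mem_univ i))).1
      · exact (Nat.add_eq_zero_iff.mp (h1 i (Finset.mem_univ i))).2
      · exact h2
    rw [zero_smul] at h
    exact (mul_eq_zero.mp h).resolve_left (MvPolynomial.X_ne_zero _)
  have hx : ∀ k, k ≠ o → dv (cx k) E = 0 := by
    intro k hk
    have h := hτ.comm_yy k k (gen o n r l)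
    rw [symYY_gen_other hk, map_zero, symYY_apply, ← hE, hdu, mul_zero, zero_add, zero_add, ← two_mul,
      eq_comm] at h
    exact (mul_eq_zero.mp ((mul_eq_zero.mp h).resolve_left two_ne_zero)).resolve_left
      (MvPolynomial.X_ne_zero _)
  have hy : ∀ k, k ≠ o → dv (cy k) E = 0 := by
    intro k hk
    have h := hτ.comm_xx k k (gen o n r l)
    rw [symXX_gen_other hk, map_zero, symXX_apply, ← hE, hdu, mul_zero, zero_add, zero_add, ← two_mul,
      eq_comm] at h
    exact (mul_eq_zero.mp ((mul_eq_zero.mp h).resolve_left two_ne_zero)).resolve_left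
      (MvPolynomial.X_ne_zero _)
  have hw : ∀ t, MvPolynomial.coeff t E ≠ 0 →
      t (Sum.inr (cx o)) + t (Sum.inr (cy o)) = r' ∧
        t (Sum.inr (cy o)) + n = r + t (Sum.inr (cx o)) := by
    intro t ht
    constructor
    · rw [← (hτ.target _ t ht).1, edeg, Finset.sum_eq_single o]
      · intro k _ hk
        rw [coeff_eq_zero_of_pderiv (hx k hk) ht, coeff_eq_zero_of_pderiv (hy k hk) ht, add_zero]
      · exact fun h => (h (Finset.mem_univ o)).elim
    · have h := hτ.comm_xy o o (gen o n r l)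
      rw [symXY_gen, map_smul, symXY_apply, ← hE, hdu, hdu, mul_zero, mul_zero, sub_zero,
        zero_add] at h
      have h1 := congrArg (MvPolynomial.coeff t) h
      rw [MvPolynomial.coeff_smul, MvPolynomial.coeff_sub, fv, fv, dv, dv, coeff_X_mul_pderiv,
        coeff_X_mul_pderiv, smul_eq_mul, ← sub_mul] at h1
      have h2 := mul_right_cancel₀ ht h1
      have h3 : ((t (Sum.inr (cy o)) + n : ℕ) : ℂ) = (r + t (Sum.inr (cx o)) : ℕ) := by
        push_cast
        linear_combination -h2
      exact_mod_cast h3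
  obtain ⟨t, ht⟩ : ∃ t, MvPolynomial.coeff t E ≠ 0 := by
    by_contra! h
    exact h0 (by ext t; simpa using h t)
  refine ⟨t (Sum.inr (cx o)), t (Sum.inr (cy o)), (hw t ht).1, (hw t ht).2, hdu, hx, hy, ?_, ?_⟩
  · refine (X_mul_pderiv_eq_iff _ _ _).mpr fun u hu => ?_
    have h1 := hw t ht
    have h2 := hw u hu
    rw [Nat.cast_inj]
    omega
  · refine (X_mul_pderiv_eq_iff _ _ _).mpr fun u hu => ?_
    have h1 := hw t ht
    have h2 := hw u hu
    rw [Nat.cast_inj]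
    omega

end FineIntertwiner

/-! ### The relations imposed by `χ(z x_o)` and `χ(z y_o)` -/

section
variable (p : ℂ) (o : Fin ℓ) (n r l : ℕ)

lemma cast_mul_pow (s : Phase ℓ) : ((n : ℕ) : Phase ℓ) * (s ^ (n - 1) * s) = n * s ^ n := by
  rcases n with _ | n
  · simp
  · rw [Nat.add_sub_cancel, ← pow_succ]

lemma fineAct_zx_gen_eq : fineAct p (MvPolynomial.X cz * MvPolynomial.X (cx o)) (gen o n r l)
    = (n / 2 + p * (ℓ + 1) - l : ℂ) • gen o (n + 1) r l + (r : Phase ℓ) * (gen o n (r - 1) l *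
      ((1 / 2 : ℂ) • (bu (cy o) * fv (cx o) - bu (cx o) * fv (cy o)) - (1 / 2 : ℂ) • omega ℓ)) := by
  have h1 := cast_mul_pow n (bu (cx o))
  have h2 := cast_mul_pow l (fv (cz (ℓ := ℓ)))
  have e : gen o (n + 1) r l = bu (cx o) ^ n * bu (cx o) * fv (cy o) ^ r * fv cz ^ l := by
    rw [gen]; ring
  rw [fineAct_zx, derivation_gen, fineDer_zx_x, fineDer_zx_fz, fineDer_zx_fy, mul_gen_x, e,
    show (n / 2 + p * (ℓ + 1) - l : ℂ) = 1 / 2 * n + p * (ℓ + 1) - l by ring, gen]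
  simp only [MvPolynomial.smul_eq_C_mul, map_sub, map_add, map_mul MvPolynomial.C, map_natCast]
  linear_combination (MvPolynomial.C (1 / 2 : ℂ) * fv (cy o) ^ r * fv cz ^ l * bu (cx o)) * h1
    - bu (cx o) ^ n * bu (cx o) * fv (cy o) ^ r * h2

lemma fineAct_zx_gen_zero : fineAct p (MvPolynomial.X cz * MvPolynomial.X (cx o)) (gen o n 0 l)
    = (1 / 2 : ℂ) • ((n + 2 * (p * (ℓ + 1)) - 2 * l : ℂ) • gen o (n + 1) 0 l) := by
  rw [fineAct_zx_gen_eq, Nat.cast_zero, zero_mul, add_zero, smul_smul]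
  congr 1
  ring

lemma fineAct_zx_gen : (2 * (n + 1) : ℂ) •
      fineAct p (MvPolynomial.X cz * MvPolynomial.X (cx o)) (gen o n (r + 1) l)
    = ((n + 1) * (n + 2 * (p * (ℓ + 1)) - (r + 1) - 2 * l) - (r + 1) : ℂ) • gen o (n + 1) (r + 1) l
      + (1 / 4 : ℂ) • symYY o o (symXX o o (gen o (n + 1) (r + 1) l))
      - ((n + 1) * (r + 1) : ℂ) • (omega ℓ * gen o n r l) := by
  have e : gen o (n + 1) (r + 1) l = bu (cx o) * fv (cy o) * gen o n r l := by
    rw [mul_assoc, mul_gen_fy, mul_gen_x]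
  have e' : (((r + 1 : ℕ) : Phase ℓ)) * (gen o n (r + 1 - 1) l * ((1 / 2 : ℂ) •
      (bu (cy o) * fv (cx o) - bu (cx o) * fv (cy o)) - (1 / 2 : ℂ) • omega ℓ))
      = ((r + 1) / 2 : ℂ) • (bu (cy o) * fv (cx o) * gen o n r l
        - bu (cx o) * fv (cy o) * gen o n r l - omega ℓ * gen o n r l) := by
    rw [Nat.add_sub_cancel, show ((r + 1) / 2 : ℂ) = (1 / 2) * (r + 1) by ring]
    simp only [MvPolynomial.smul_eq_C_mul, map_add, map_mul MvPolynomial.C, map_natCast, map_one]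
    push_cast
    ring
  rw [fineAct_zx_gen_eq, symYY_symXX_gen, e', e]
  module

lemma fineAct_zy_gen : (2 : ℂ) •
      fineAct p (MvPolynomial.X cz * MvPolynomial.X (cy o)) (gen o n r l)
    = (n + 2 * (p * (ℓ + 1)) - 2 * l : ℂ) • (bu (cy o) * gen o n r l)
      - (2 * n : ℂ) • (bu cz * gen o (n - 1) r l) := by
  have h1 := cast_mul_pow n (bu (cx o))
  have h2 := cast_mul_pow l (fv (cz (ℓ := ℓ)))
  have h3 : MvPolynomial.C (σ := Coord ℓ ⊕ Coord ℓ) (1 / 2 : ℂ) * 2 = 1 := by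
    rw [← map_ofNat MvPolynomial.C, ← map_mul]; norm_num
  rw [fineAct_zy, derivation_gen, fineDer_zy_x, fineDer_zy_fz, fineDer_zy_fy, gen, gen]
  simp only [MvPolynomial.smul_eq_C_mul, map_sub, map_add, map_mul MvPolynomial.C, map_natCast,
    map_ofNat]
  linear_combination (fv (cy o) ^ r * fv cz ^ l * bu (cy o)) * h1
    - 2 * bu (cx o) ^ n * bu (cy o) * fv (cy o) ^ r * h2
    + n * bu (cx o) ^ (n - 1) * fv (cy o) ^ r * fv cz ^ l * bu (cx o) * bu (cy o) * h3

lemma toBase_gen : toBase ℓ (gen o n (r + 1) l) = (r + 1 : ℂ) • (bu (cy o) * gen o n r l) := by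
  rw [derivation_gen, toBase_bu, toBase_fy, toBase_fz, Nat.add_sub_cancel, gen]
  simp only [MvPolynomial.smul_eq_C_mul, map_add, map_natCast, map_one]
  push_cast
  ring

lemma symYY_gen : symYY o o (gen o (n + 1) r l) = (2 * (n + 1) : ℂ) • (bu (cy o) * gen o n r l) := by
  rw [symYY_apply, du_gen_x, dv_gen o _ _ _ (by simp [cx_cy]) (by simp [cx_cz]), Nat.add_sub_cancel]
  simp only [MvPolynomial.smul_eq_C_mul, map_add, map_natCast, map_one, map_ofNat, map_mul]
  push_cast
  ring

lemma symYY_omega : symYY o o (omega ℓ) = 0 := by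
  classical
  have h1 : du (cx o) (omega ℓ) = fv (cy o) := by
    simp only [omega, map_sum, map_sub, du_leib, du_bu, du_fv, cx_eq, cx_cy, if_false, mul_zero,
      zero_add, sub_zero]
    simp
  have h2 : dv (cx o) (omega ℓ) = -bu (cy o) := by
    simp only [omega, map_sum, map_sub, dv_leib, dv_bu, dv_fv, cx_eq, cx_cy, if_false, mul_zero,
      add_zero, zero_sub]
    simp
  rw [symYY_apply, h1, h2]
  ring

lemma symYY_omega_gen : symYY o o (omega ℓ * gen o n r l)
    = (2 * n : ℂ) • (omega ℓ * (bu (cy o) * gen o (n - 1) r l)) := by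
  rw [Derivation.leibniz, symYY_omega, smul_zero, add_zero, smul_eq_mul]
  rcases n with _ | n
  · rw [symYY_apply, du_gen_x, dv_gen o _ _ _ (by simp [cx_cy]) (by simp [cx_cz])]
    simp
  · rw [symYY_gen, mul_smul_comm, Nat.add_sub_cancel]
    push_cast
    rfl

end

namespace FineIntertwiner
variable {p : ℂ} {r' l' : ℕ} {τ : Module.End ℂ (Phase ℓ)} {o : Fin ℓ} {n r l a b : ℕ}

/-- The scalar that relates the value of an intertwining operator on
`(n + 1) (r + 1) Ω x_o^n υ_o^r ζ^l` to its value on the generator `x_o^{n+1} υ_o^{r+1} ζ^l`. -/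
def omegaScalar (ℓ n r a b : ℕ) : ℤ :=
  (n + 1) * (r + 1) + (r + 1) - b * (a + 1) + (ℓ - 1) * (2 * (n + 1) - 2 * a)

lemma map_omega_mul_gen (hτ : FineIntertwiner p r' l' τ)
    (hE : IsHighest o a b (τ (gen o (n + 1) (r + 1) l))) :
    ((n + 1) * (r + 1) : ℂ) • τ (omega ℓ * gen o n r l)
      = (omegaScalar ℓ n r a b : ℂ) • τ (gen o (n + 1) (r + 1) l) := by
  have hℓ : (((Finset.univ.erase o).card : ℕ) : ℂ) = ℓ - 1 := by
    have hpos : 0 < ℓ := o.pos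
    rw [Finset.card_erase_of_mem (Finset.mem_univ o), Finset.card_univ, Fintype.card_fin,
      Nat.cast_pred hpos]
  rw [← map_smul, omega_mul_gen, map_add, map_sub, map_smul, map_smul, map_sum, hτ.comm_yy, hτ.comm_xx,
    hE.symYY_symXX, Finset.sum_congr rfl fun k hk => by
      rw [map_sub, map_add, map_smul, hτ.comm_xy, hτ.comm_xy, hτ.comm_xx, hτ.comm_yy,
        hE.sym (Finset.ne_of_mem_erase hk)],
    Finset.sum_const, ← Nat.cast_smul_eq_nsmul ℂ, hℓ, omegaScalar]
  push_cast
  module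

/-- The relation imposed by `χ(z x_o)`, which maps `x_o^n υ_o^{r+1} ζ^l`, of too low a weight for `τ`,
to a combination of the generator, its image under the symplectic algebra and a multiple of `Ω`. -/
lemma first_relation (hτ : FineIntertwiner p r' l' τ) (hn : n + 1 + (r' + 2 * l') = r + 1 + 2 * l)
    (h0 : τ (gen o (n + 1) (r + 1) l) ≠ 0) (hE : IsHighest o a b (τ (gen o (n + 1) (r + 1) l))) :
    ((n + 1) * (n + 2 * (p * (ℓ + 1)) - (r + 1) - 2 * l) : ℂ)
      = omegaScalar ℓ n r a b + (r + 1) - b * (a + 1) := by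
  have h := hτ.comm _ (deg_X_X cz (cx o)) (gen o n (r + 1) l)
  rw [hτ.eq_zero_of_weight_lt (gen_mem o n (r + 1) l) (by omega), map_zero] at h
  have h1 := congrArg τ (fineAct_zx_gen p o n r l)
  rw [map_smul, h, smul_zero, map_sub, map_add, map_smul, map_smul, map_smul, hτ.comm_yy, hτ.comm_xx,
    hE.symYY_symXX, hτ.map_omega_mul_gen hE, smul_smul, ← add_smul, ← sub_smul, eq_comm,
    smul_eq_zero] at h1
  linear_combination h1.resolve_right h0

/-- The relation imposed by `χ(z y_o)` on the same symbol as in `first_relation`. It also involves a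
multiple of `z`, which `χ(z²)` reduces to a multiple of `Ω`. -/
lemma second_relation (hτ : FineIntertwiner p r' l' τ) (hn : n + 1 + (r' + 2 * l') = r + 1 + 2 * l)
    (h0 : symYY o o (τ (gen o (n + 1) (r + 1) l)) ≠ 0)
    (hE : IsHighest o a b (τ (gen o (n + 1) (r + 1) l))) {t : ℂ}
    (ht : t = n - 1 + 2 * (p * (ℓ + 1)) - (r + 1) - 2 * l) :
    t * (t + 1 + (r + 1)) = omegaScalar ℓ n r a b := by
  have hz : (n * t : ℂ) • τ (bu cz * gen o (n - 1) (r + 1) l)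
      = (n / 2 : ℂ) • τ (omega ℓ * toBase ℓ (gen o (n - 1) (r + 1) l)) := by
    rcases n with _ | n
    · simp
    · have := hτ.map_bu_cz_mul (gen_mem o n (r + 1) l) (by omega)
      rw [Nat.add_sub_cancel, mul_smul, div_eq_mul_one_div, mul_smul, ← this, ht]
      push_cast
      congr 2
      ring
  rw [toBase_gen, mul_smul_comm, map_smul] at hz
  have hy := congrArg τ (fineAct_zy_gen p o n (r + 1) l)
  rw [map_smul, hτ.comm _ (deg_X_X cz (cy o)),
    hτ.eq_zero_of_weight_lt (gen_mem o n (r + 1) l) (by omega), map_zero, smul_zero, map_sub, map_smul,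
    map_smul] at hy
  have hΩ := congrArg (symYY o o) (hτ.map_omega_mul_gen hE)
  rw [Derivation.map_smul, Derivation.map_smul, ← hτ.comm_yy, symYY_omega_gen, map_smul] at hΩ
  have hg : symYY o o (τ (gen o (n + 1) (r + 1) l))
      = (2 * (n + 1) : ℂ) • τ (bu (cy o) * gen o n (r + 1) l) := by
    rw [← hτ.comm_yy, symYY_gen, map_smul]
  have key : (t * (t + 1 + (r + 1)) - omegaScalar ℓ n r a b : ℂ) •
      symYY o o (τ (gen o (n + 1) (r + 1) l)) = 0 := by
    have hκ : (n + 2 * (p * (ℓ + 1)) - 2 * l : ℂ) = t + 1 + (r + 1) := by rw [ht]; ring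
    rw [hκ] at hy
    rw [sub_smul, ← hΩ, hg]
    linear_combination (norm := skip) (-(2 * (n + 1) * t) : ℂ) • hy + (4 * (n + 1) : ℂ) • hz
    module
  exact sub_eq_zero.mp ((smul_eq_zero.mp key).resolve_right h0)

/-- A rational number that is a root of a monic quadratic polynomial over `ℤ` is an integer. -/
lemma int_of_quadratic {t : ℂ} {n M c N : ℤ} (hn : n ≠ 0) (h1 : n * t = M)
    (h2 : t * (t + c) = N) : ∃ k : ℤ, t = k := by
  have hn' : (n : ℂ) ≠ 0 := by exact_mod_cast hn
  have h3 : (2 * M + c * n) ^ 2 = n ^ 2 * (4 * N + c ^ 2) := by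
    have : ((2 * M + c * n : ℤ) : ℂ) ^ 2 = ((n ^ 2 * (4 * N + c ^ 2) : ℤ) : ℂ) := by
      push_cast
      rw [← h1, ← h2]
      ring
    exact_mod_cast this
  have h4 : n ∣ 2 * M + c * n := by
    rw [← Int.pow_dvd_pow_iff two_ne_zero, h3]
    exact dvd_mul_right _ _
  obtain ⟨K, hK⟩ := h4
  rw [hK, mul_pow] at h3
  have h5 := mul_left_cancel₀ (pow_ne_zero 2 hn) h3
  have h6 : Even (K - c) := by
    have : Even (K ^ 2 - c ^ 2) := ⟨2 * N, by rw [h5]; ring⟩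
    rw [Int.even_sub] at this ⊢
    simpa [Int.even_pow] using this
  obtain ⟨j, hj⟩ := h6
  refine ⟨j, mul_left_cancel₀ hn' ?_⟩
  rw [h1]
  have : M = n * j := by
    have : 2 * M = 2 * (n * j) := by
      have h7 : K = 2 * j + c := by omega
      rw [h7] at hK
      linarith
    omega
  rw [this]
  push_cast
  rfl

/-- For generic `p`, an intertwining operator between different degrees kills the generators. -/
lemma gen_eq_zero (hp : Generic ℓ p) (hτ : FineIntertwiner p r' l' τ)
    (hn : n + (r' + 2 * l') = r + 2 * l) (hne : ¬(r = r' ∧ l = l')) : τ (gen o n r l) = 0 := by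
  by_contra h0
  obtain ⟨a, b, hab, hba, hE⟩ := hτ.isHighest hn h0
  have hE' : symYY o o (τ (gen o n r l)) = 0 → a = 0 := by
    intro h
    have := hE.symXX_symYY
    rw [h, map_zero, eq_comm, smul_eq_zero] at this
    have := this.resolve_right h0
    have h' : ((4 * (a * (b + 1)) : ℕ) : ℂ) = 0 := by push_cast; exact this
    rw [Nat.cast_eq_zero] at h'
    simpa using h'
  -- In weight zero `symYY o o` kills the generator, so `a = 0` and the degrees agree.
  rcases n with _ | n
  · have := hE' (by
      rw [← hτ.comm_yy, symYY_apply, du_gen_x, dv_gen o _ _ _ (by simp [cx_cy]) (by simp [cx_cz])]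
      simp)
    omega
  have hint : ∀ k : ℤ, (n + 2 * (p * (ℓ + 1)) - r - 2 * l : ℂ) ≠ k := by
    intro k hk
    refine generic_ne hp (k - n + r + 2 * l) ?_
    push_cast
    linear_combination hk
  -- Without fibre variables `υ_o` the generator is a multiple of the image under `χ(z x_o)` of a
  -- symbol whose weight is too low for `τ`.
  rcases r with _ | r
  · have h := hτ.comm _ (deg_X_X cz (cx o)) (gen o n 0 l)
    rw [hτ.eq_zero_of_weight_lt (gen_mem o n 0 l) (by omega), map_zero, fineAct_zx_gen_zero, map_smul,
      map_smul, smul_eq_zero, smul_eq_zero] at h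
    rcases h with h | h | h
    · norm_num at h
    · refine hint 0 ?_
      push_cast
      linear_combination h
    · exact h0 h
  have h1 := hτ.first_relation hn h0 hE
  by_cases ha : a = 0
  · subst ha
    obtain rfl : b = r' := by omega
    have hn' : ((n + 1 : ℕ) : ℂ) ≠ 0 := Nat.cast_ne_zero.mpr (by omega)
    have hb : (b : ℂ) + (n + 1) = r + 1 := by exact_mod_cast hba
    refine hint (r + 1 + 2 * ℓ) (mul_left_cancel₀ hn' ?_)
    rw [omegaScalar] at h1
    push_cast at h1 ⊢
    linear_combination h1 - 2 * hb
  -- The two relations make `t = n - 1 + 2 (ℓ + 1) p - (r + 1) - 2 l` rational and a root of a monic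
  -- integral quadratic polynomial.
  · have h2 := hτ.second_relation hn (fun h => ha (hE' h)) hE rfl
    have hn' : (n + 1 : ℤ) ≠ 0 := by omega
    obtain ⟨k, hk⟩ := int_of_quadratic (t := n - 1 + 2 * (p * (ℓ + 1)) - (r + 1) - 2 * l)
      (n := n + 1) (M := omegaScalar ℓ n r a b + (r + 1) - b * (a + 1) - (n + 1)) (c := 1 + (r + 1))
      (N := omegaScalar ℓ n r a b) hn' (by push_cast; linear_combination h1)
      (by push_cast; linear_combination h2)
    refine hint (k + 1) ?_
    push_cast
    linear_combination hk

end FineIntertwiner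

/-! ### Uniqueness of the conformal quantization -/

lemma fdeg_eq_edeg_add (t : Coord ℓ ⊕ Coord ℓ →₀ ℕ) : fdeg t = edeg t + zdeg t := by
  simp only [fdeg, edeg, Fintype.sum_sum_type, Fintype.sum_unique, Finset.sum_add_distrib, add_assoc]
  rfl

/-- For generic `p` there are no intertwining operators between fine symbols of different
degrees. -/
lemma FineIntertwiner.eq_zero {p : ℂ} (hp : Generic ℓ p) {r l r' l' : ℕ} {τ : Module.End ℂ (Phase ℓ)}
    (hτ : FineIntertwiner p r' l' τ) (hne : ¬(r = r' ∧ l = l')) {c m : ℕ} {s : Phase ℓ}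
    (hs : s ∈ piece grade (c, m, r, l)) : τ s = 0 := by
  refine hτ.eq_zero_of_lowest (hτ.eq_zero_of_lowest_of_base hp fun m s hs hn => ?_) _ c m s rfl hs
  -- For `ℓ = 0` there are no horizontal variables, and the weight alone determines the degrees.
  rcases isEmpty_or_nonempty (Fin ℓ) with h | ⟨⟨o⟩⟩
  · by_contra h0
    have e : ∀ t : Coord ℓ ⊕ Coord ℓ →₀ ℕ, bdeg t = 0 ∧ edeg t = 0 := fun t =>
      ⟨Fintype.sum_empty _, Fintype.sum_empty _⟩
    obtain ⟨t, ht⟩ := MvPolynomial.ne_zero_iff.mp h0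
    obtain ⟨u, hu⟩ := MvPolynomial.ne_zero_iff.mp (show s ≠ 0 by rintro rfl; exact h0 (map_zero τ))
    have h1 := (hτ.target s t ht).1
    have h2 : grade u = (0, m, r, l) := mem_restrictSupport'.mp hs u hu
    simp only [grade, Prod.mk.injEq, (e u).1, (e u).2] at h2
    rw [(e t).2] at h1
    obtain ⟨-, rfl, rfl, -⟩ := h2
    exact hne ⟨h1, by omega⟩
  · exact hτ.eq_zero_of_cyclic o (hτ.gen_eq_zero hp hn hne) s hs

lemma monoProj_comm {ι : Type*} (g : (Coord ℓ ⊕ Coord ℓ →₀ ℕ) → ι) {F : Module.End ℂ (Phase ℓ)}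
    (hF : ∀ i, ∀ s ∈ piece g i, F s ∈ piece g i) (i : ι) (s : Phase ℓ) :
    monoProj {t | g t = i} (F s) = F (monoProj {t | g t = i} s) := by
  have h : (monoProj {t | g t = i}) ∘ₗ F = F ∘ₗ monoProj {t | g t = i} := by
    refine ext_piece g fun j s hs => ?_
    simp only [LinearMap.comp_apply]
    by_cases h : j = i
    · subst h
      rw [monoProj_of_mem hs, monoProj_of_mem (hF _ _ hs)]
    · have hd : Disjoint {t | g t = i} {t | g t = j} :=
        Set.disjoint_left.mpr fun t (h1 : g t = i) (h2 : g t = j) => h (h2.symm.trans h1)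
      rw [monoProj_eq_zero hs hd, monoProj_eq_zero (hF _ _ hs) hd, map_zero]
  exact LinearMap.congr_fun h s

/-- For generic `p`, the intertwining operators of the module of fine symbols preserve its
summands. -/
lemma intertwiner_mem_piece {p : ℂ} (hp : Generic ℓ p) {R : Module.End ℂ (Phase ℓ)}
    (hR : ∀ f : Poly ℓ, f.totalDegree ≤ 2 → ∀ s, R (fineAct p f s) = fineAct p f (R s))
    {i : FineIdx} {s : Phase ℓ} (hs : s ∈ piece fidx i) : R s ∈ piece fidx i := by
  classical
  rw [piece, mem_restrictSupport']
  intro t ht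
  by_contra hti
  have hτ : FineIntertwiner p (edeg t) (zdeg t) (monoProj {u | fidx u = fidx t} ∘ₗ R) := by
    refine ⟨fun f hf s => ?_, fun s u hu => ?_⟩
    · rw [LinearMap.comp_apply, LinearMap.comp_apply, hR f hf,
        monoProj_comm fidx (fun i s hs => fineAct_piece_fidx f hs)]
    · have h1 : fidx u = fidx t := mem_restrictSupport'.mp (monoProj_mem {u | fidx u = fidx t} (R s)) u hu
      obtain ⟨h2, h3⟩ := fidx_eq.mp h1
      obtain ⟨h4, h5⟩ := fidx_eq.mp (rfl : fidx t = fidx t)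
      rw [fdeg_eq_edeg_add] at h2 h4
      omega
  have h0 : monoProj {u | fidx u = fidx t} (R s) = 0 := by
    change (monoProj {u | fidx u = fidx t} ∘ₗ R) s = 0
    rw [MvPolynomial.as_sum s, map_sum]
    refine Finset.sum_eq_zero fun u hu => ?_
    have hu : fidx u = i := mem_restrictSupport'.mp hs u (by simpa using hu)
    refine hτ.eq_zero hp (r := edeg u) (l := zdeg u) (c := zexp u) (m := bdeg u) ?_
      (monomial_mem_of (A := {v | grade v = grade u}) rfl _)
    rintro ⟨h1, h2⟩
    refine hti ((fidx_eq.mpr ?_).trans hu)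
    obtain ⟨h4, h5⟩ := fidx_eq.mp (rfl : fidx u = fidx u)
    rw [fdeg_eq_edeg_add] at h4 ⊢
    exact ⟨by rw [← h1, ← h2, h4], by rw [← h2, h5]⟩
  apply ht
  have := congrArg (MvPolynomial.coeff t) h0
  rwa [coeff_monoProj, if_pos (show t ∈ {u | fidx u = fidx t} from rfl)] at this

variable {lam p : ℂ}

/-- For generic `p` a conformal quantization is unique. -/
lemma isConformalQuantization_unique (hp : Generic ℓ p)
    {Q Q' : FineSymbTot ℓ lam p ≃ₗ⁅ℂ, conformalAlg ℓ⁆ ↥(Diff ℓ lam p)}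
    (hQ : IsConformalQuantization Q) (hQ' : IsConformalQuantization Q') (S : FineSymbTot ℓ lam p) :
    Q' S = Q S := by
  set J := fineSymbTotEquiv ℓ lam p
  let R : Module.End ℂ (Phase ℓ) :=
    (J ≪≫ₗ LieModuleEquiv.toLinearEquiv Q' ≪≫ₗ (LieModuleEquiv.toLinearEquiv Q).symm ≪≫ₗ J.symm).toLinearMap
  have hR : ∀ s, Q (J (R s)) = Q' (J s) := by
    intro s
    change LieModuleEquiv.toLinearEquiv Q (J (J.symm ((LieModuleEquiv.toLinearEquiv Q).symm (Q' (J s))))) = _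
    rw [LinearEquiv.apply_symm_apply, LinearEquiv.apply_symm_apply]
  have hcomm : ∀ f : Poly ℓ, f.totalDegree ≤ 2 → ∀ s, R (fineAct p f s) = fineAct p f (R s) := by
    intro f hf s
    let X : conformalAlg ℓ := ⟨⟨chi ℓ f, chi_mem_con f⟩, by
      change (contactForm (chi ℓ f)).totalDegree ≤ 2
      rwa [contactForm_chi]⟩
    have hX : contactForm X.1.1 = f := contactForm_chi f
    have hJ : ∀ s, J (fineAct p f s) = ⁅X, J s⁆ := by
      intro s
      have := fineSymbTotEquiv_fineAct (lam := lam) (p := p) X s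
      rwa [hX] at this
    have h1 : Q' ⁅X, J s⁆ = ⁅X, Q' (J s)⁆ := Q'.toLieModuleHom.map_lie X (J s)
    have h2 : Q ⁅X, J (R s)⁆ = ⁅X, Q (J (R s))⁆ := Q.toLieModuleHom.map_lie X (J (R s))
    apply J.injective
    apply (LieModuleEquiv.toLinearEquiv Q).injective
    change Q (J (R (fineAct p f s))) = Q (J (fineAct p f (R s)))
    rw [hR, hJ, hJ, h1, h2, hR]
  have hRid : R = LinearMap.id := by
    refine ext_piece fidx fun i s hs => ?_
    have hs' := intertwiner_mem_piece hp hcomm hs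
    obtain ⟨T, hT, hTs⟩ := hQ i (fineSymbEquiv ℓ lam p i ⟨R s, hs'⟩)
    obtain ⟨T', hT', hTs'⟩ := hQ' i (fineSymbEquiv ℓ lam p i ⟨s, hs⟩)
    rw [← fineSymbTotEquiv_of_mem] at hT hT'
    have : T = T' := Subtype.ext (by rw [hT, hT']; exact congrArg _ (hR s))
    rw [← this, hTs] at hTs'
    exact congrArg Subtype.val ((fineSymbEquiv ℓ lam p i).injective hTs')
  obtain ⟨s, rfl⟩ := J.surjective S
  rw [← hR, hRid]
  rfl

end ContactQuant

end

theorem mainTheorem4 (ℓ : ℕ) (lam p : ℂ)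
    (hp : ∀ n : ℤ, p ≠ (n : ℂ) / (((2 * ℓ + 1 : ℕ) : ℂ) + 1)) :
    ∃ Q : ContactQuant.FineSymbTot ℓ lam p
        ≃ₗ⁅ℂ, ContactQuant.conformalAlg ℓ⁆ ↥(ContactQuant.Diff ℓ lam p),
      ContactQuant.IsConformalQuantization Q ∧
      (∀ Q' : ContactQuant.FineSymbTot ℓ lam p
          ≃ₗ⁅ℂ, ContactQuant.conformalAlg ℓ⁆ ↥(ContactQuant.Diff ℓ lam p),
        ContactQuant.IsConformalQuantization Q' → ∀ S, Q' S = Q S) ∧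
      ∃ (Φ : ContactQuant.FineSymbTot ℓ lam p
            ≃ₗ⁅ℂ, ContactQuant.conformalAlg ℓ⁆ ContactQuant.SymbTot ℓ lam p)
        (P : ContactQuant.SymbTot ℓ lam p
            ≃ₗ⁅ℂ, ContactQuant.projAlg ℓ⁆ ↥(ContactQuant.Diff ℓ lam p)),
        ContactQuant.IsFineSplitting Φ ∧ ContactQuant.IsProjectiveQuantization P ∧
          ∀ S, Q S = P (Φ S) := by
  have hg : ContactQuant.Generic ℓ p := by
    intro n hn
    refine hp n ?_
    have h : (((2 * ℓ + 1 : ℕ) : ℂ) + 1) ≠ 0 := by exact_mod_cast (2 * ℓ + 1).succ_ne_zero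
    rw [eq_div_iff h, ← hn]
    push_cast
    ring
  exact ⟨ContactQuant.confQuant hg lam, ContactQuant.isConformalQuantization_confQuant hg,
    fun _ hQ' S => ContactQuant.isConformalQuantization_unique hg
      (ContactQuant.isConformalQuantization_confQuant hg) hQ' S,
    ContactQuant.fineSplit hg lam, ContactQuant.projQuant hg lam,
    ContactQuant.isFineSplitting_fineSplit hg, ContactQuant.isProjectiveQuantization_projQuant hg,
    ContactQuant.confQuant_apply hg⟩
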